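/- Let $M$ be a compact connected oriented 3-manifold whose boundary is a torus, with a fixed basis $(\mu,\lambda)$ (meridian, longitude) of $H_1(\partial M;\mathbb Z)$. Let $\rho:\pi_1(M)\to \mathrm{PSL}(2,\mathbb C)$ be a representation, together with a fixed $\rho$-equivariant map from the ideal points of the universal cover of $M$ to $\mathbb{CP}^1$ (a developing map). An oriented ideal triangulation $\mathcal T$ of $M$ with $N$ tetrahedra $\Delta_1,\dots,\Delta_N$ (and hence $N$ edges $E_1,\dots,E_N$) is called $\rho$-regular if the developing map takes the four vertices of each tetrahedron to distinct points; its shape parameters are then the cross-ratios of these points. An enhanced Neumann–Zagier datum of a $\rho$-regular triangulation $\mathcal T$ for the meridian eigenvalue $m\in\mathbb C$ consists of the following choices. (1) A quad type: for each $\Delta_j$ one of the three pairs of opposite edges. Its shape is called $z_j$, and the shapes of the other two pairs, in the cyclic order given by the orientation, are $z_j'=1/(1-z_j)$ and $z_j''=1-1/z_j$. (2) A numbering of the edges, one of which, $E_N$, is distinguished. (3) Oriented simple closed curves on $\partial M$ that are normal with respect to the triangulation of $\partial M$ induced by $\mathcal T$ and represent the homology classes $\mu$ and $\lambda$. For $1\le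 I\le N$ let $G_{Ij},G'_{Ij},G''_{Ij}$ be the numbers of edges of $\Delta_j$ with parameter $z_j,z_j',z_j''$ that are incident to $E_I$. For the meridian curve ($I=N+1$) and the longitude curve ($I=N+2$) let them be the signed numbers of times that the curve turns around the corners with parameter $z_j,z_j',z_j''$, counterclockwise turns, as seen from the boundary, being positive. Define $N\times N$ matrices $\mathbf A=(G_{ij}-G'_{ij})$ and $\mathbf B=(G''_{ij}-G'_{ij})$, and a vector $\eta_i=2-\sum_jG'_{ij}$, where for $i=N$ the row $G_{N}$ is replaced by $G_{N+1}$ and $2$ by $0$. It is required that $z$ satisfies the deformed gluing equations $$\prod_{j} z_j^{\mathbf A_{ij}}(z_j'')^{\mathbf B_{ij}}=(-1)^{\eta_i}m^{2\delta_{iN}},\qquad i=1,\dots,N.$$ (4) A combinatorial flattening compatible with the longitude: integers $(f_j,f_j',f_j'')$ with $f_j+f_j'+f_j''=1$ for all $j$, such that $\sum_j(G_{Ij}f_j+G'_{Ij}f'_j+G''_{Ij}f''_j)$ equals $2$ for $I=1,\dots,N$ and $0$ for $I=N+1$ and $I=N+2$. The generalized torsion of such a datum is $$\tau_{\mathcal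 T}(\rho)=\pm\tfrac12\det\big(\mathbf A\Delta_{z''}+\mathbf B\Delta_z^{-1}\big)\prod_j z_j^{f_j''}(z_j'')^{-f_j}\in\mathbb C/\{\pm1\},\qquad \Delta_z=\mathrm{diag}(z_j),\ \Delta_{z''}=\mathrm{diag}(z_j'').$$ **Theorem.** (i) Any two enhanced Neumann–Zagier data of the same $\rho$-regular triangulation $\mathcal T$ for the same $m$ give the same $\tau_{\mathcal T}(\rho)$, up to sign. (ii) If $\mathcal T$ and $\widetilde{\mathcal T}$ are $\rho$-regular ideal triangulations of $M$ that are isomorphic (by an orientation-preserving relabelling of tetrahedra and vertices, up to conjugation of $\rho$ together with its developing map) or related by a 2–3 move, then any enhanced Neumann–Zagier data of $\mathcal T$ and of $\widetilde{\mathcal T}$ for the same $m$ give $\tau_{\mathcal T}(\rho)=\tau_{\widetilde{\mathcal T}}(\rho)$, up to sign. -/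

import Mathlib

open scoped LinearAlgebra.Projectivization MatrixGroups

namespace NeumannZagier

/-! ### Oriented ideal triangulations -/

/-- An oriented ideal triangulation with tetrahedra indexed by `ι`. Each tetrahedron has vertices
`0, 1, 2, 3`, in this order positively oriented. The face of the tetrahedron `i` opposite to its
vertex `u` is glued to a face of `nbr i u` by the affine map that takes a vertex `w ≠ u` of `i` to
the vertex `perm i u w` of `nbr i u`; the value `perm i u u` is the vertex of `nbr i u` opposite to
the face glued to. The gluings reverse the orientation of the faces, so `perm i u` is odd. -/
structure IdealTriangulation (ι : Type) where
  nbr : ι → Fin 4 → ι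
  perm : ι → Fin 4 → Equiv.Perm (Fin 4)
  nbr_nbr : ∀ i u, nbr (nbr i u) (perm i u u) = i
  perm_perm : ∀ i u, perm (nbr i u) (perm i u u) = (perm i u)⁻¹
  sign_perm : ∀ i u, Equiv.Perm.sign (perm i u) = -1
  not_self_glued : ∀ i u, ¬ (nbr i u = i ∧ perm i u u = u)

/-- Directed edges of the single tetrahedra: `(i, a, b)` runs from vertex `a` to vertex `b`
of the tetrahedron `i`. -/
abbrev DirEdge (ι : Type) : Type := {x : ι × Fin 4 × Fin 4 // x.2.1 ≠ x.2.2}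

/-- The same edge of a tetrahedron in the opposite direction. -/
def DirEdge.rev {ι : Type} (x : DirEdge ι) : DirEdge ι :=
  ⟨(x.1.1, x.1.2.2, x.1.2.1), x.2.symm⟩

/-- Transport of a directed edge through the face opposite to `u`. -/
def IdealTriangulation.across {ι : Type} (T : IdealTriangulation ι) (x : DirEdge ι) (u : Fin 4) :
    DirEdge ι :=
  ⟨(T.nbr x.1.1 u, T.perm x.1.1 u x.1.2.1, T.perm x.1.1 u x.1.2.2),
    fun h => x.2 ((T.perm x.1.1 u).injective h)⟩

/-- Two directed edges that a face gluing identifies. -/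
def IdealTriangulation.EdgeStep {ι : Type} (T : IdealTriangulation ι) (x y : DirEdge ι) : Prop :=
  ∃ u : Fin 4, u ≠ x.1.2.1 ∧ u ≠ x.1.2.2 ∧ y = T.across x u

/-- The (undirected) edges of the triangulation. -/
def IdealTriangulation.Edge {ι : Type} (T : IdealTriangulation ι) : Type :=
  Quot (fun x y : DirEdge ι => T.EdgeStep x y ∨ y = x.rev)

/-- The edge of the triangulation that contains a given edge of a tetrahedron. -/
def IdealTriangulation.edgeOf {ι : Type} (T : IdealTriangulation ι) (x : DirEdge ι) : T.Edge :=
  Quot.mk _ x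

/-- The boundary surface of the truncated triangulation is made of the triangles `(i, v)`, where the
triangle `(i, v)` cuts off the vertex `v` of the tetrahedron `i`. Its corners lie on the edges
`{v, w}`, its sides on the faces opposite to `u`, for `w, u ≠ v`.
This is the relation of adjacency through a side. -/
def IdealTriangulation.TriangleStep {ι : Type} (T : IdealTriangulation ι) (x y : ι × Fin 4) : Prop :=
  ∃ u : Fin 4, u ≠ x.2 ∧ y = (T.nbr x.1 u, T.perm x.1 u x.2)

/-- The triangulated space, with its ideal vertices truncated, is a compact connected oriented
3-manifold whose boundary is a single torus. No edge is glued to itself in reverse (so the space is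
a manifold), the boundary surface is connected, and its Euler characteristic
`2 * #edges - 6 * N + 4 * N` vanishes, where `N` is the number of tetrahedra. -/
structure IdealTriangulation.TorusBoundary {ι : Type} (T : IdealTriangulation ι) : Prop where
  finite : Finite ι
  nonempty : Nonempty ι
  not_reversed : ∀ x : DirEdge ι, ¬ Relation.EqvGen T.EdgeStep x x.rev
  connected : ∀ x y : ι × Fin 4, Relation.EqvGen T.TriangleStep x y
  card_edge : Nat.card T.Edge = Nat.card ι

/-- A pair `(i, π)` describes an oriented normal arc in the boundary triangle `(i, π 0)`: it enters
through the side on the face opposite to `π 1`, leaves through the side on the face opposite to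
`π 2`, and cuts off the corner on the edge `{π 0, π 3}`. The arc runs counterclockwise around that
corner, as seen from the ideal vertex, if and only if `π` is even.
The map `turn` continues the arc around the same corner into the next triangle. -/
def IdealTriangulation.turn {ι : Type} (T : IdealTriangulation ι)
    (x : ι × Equiv.Perm (Fin 4)) : ι × Equiv.Perm (Fin 4) :=
  (T.nbr x.1 (x.2 2), T.perm x.1 (x.2 2) * x.2 * Equiv.swap 1 2)

/-- The number of arcs in a full turn around the corner of `x`. -/
noncomputable def IdealTriangulation.degree {ι : Type} (T : IdealTriangulation ι)
    (x : ι × Equiv.Perm (Fin 4)) : ℕ :=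
  Function.minimalPeriod T.turn x

/-! ### Representations and developing maps -/

/-- A `PSL(2, ℂ)`-representation of the fundamental group of the triangulated manifold, given as a
flat bundle: `hol i u` is the parallel transport from the tetrahedron `nbr i u` to the tetrahedron
`i` through their common face. As the manifold retracts to the 2-complex dual to the triangulation,
flatness means that the product around every edge is trivial. Products along closed paths that start
in a base tetrahedron give the representation of the fundamental group. -/
structure Representation {ι : Type} (T : IdealTriangulation ι) where
  hol : ι → Fin 4 → PSL(2, ℂ)
  hol_inv : ∀ i u, hol (T.nbr i u) (T.perm i u u) = (hol i u)⁻¹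
  hol_edge : ∀ x : ι × Equiv.Perm (Fin 4),
    ((List.range (T.degree x)).map
      (fun k => hol (T.turn^[k] x).1 ((T.turn^[k] x).2 2))).prod = 1

/-- The complex projective line, the ideal boundary of hyperbolic 3-space. -/
abbrev CP1 : Type := ℙ ℂ (Fin 2 → ℂ)

/-- The element `h` of `PSL(2, ℂ)` takes the point `x` to the point `y`. -/
def Moves (h : PSL(2, ℂ)) (x y : CP1) : Prop :=
  ∃ g : SL(2, ℂ), (QuotientGroup.mk g : PSL(2, ℂ)) = h ∧ g • x = y

/-- A developing map: a `ρ`-equivariant assignment of points of `ℂP¹` to the ideal vertices of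
the universal cover, written in the trivialization of the flat bundle over each tetrahedron. -/
structure DevelopingMap {ι : Type} {T : IdealTriangulation ι} (ρ : Representation T) where
  pt : ι → Fin 4 → CP1
  equivariant : ∀ i u w, w ≠ u →
    Moves (ρ.hol i u) (pt (T.nbr i u) (T.perm i u w)) (pt i w)

/-- The determinant of representatives of two points of `ℂP¹`. -/
noncomputable def bracket (x y : CP1) : ℂ := x.rep 0 * y.rep 1 - x.rep 1 * y.rep 0

/-- The cross-ratio, normalized so that `(0, ∞, 1, z)` has cross-ratio `z`. -/
noncomputable def crossRatio (a b c d : CP1) : ℂ :=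
  (bracket d a * bracket c b) / (bracket c a * bracket d b)

/-- The three pairs of opposite edges of a tetrahedron, in the cyclic order given by the
orientation: `0` is `{01, 23}`, `1` is `{03, 12}` and `2` is `{02, 13}`.
The value on the diagonal is irrelevant. -/
def pairType (a b : Fin 4) : Fin 3 :=
  (![![0, 0, 2, 1], ![0, 0, 1, 2], ![2, 1, 0, 0], ![1, 2, 0, 0]] : Fin 4 → Fin 4 → Fin 3) a b

/-- The shape parameter of the tetrahedron `i` on its `p`-th pair of opposite edges. -/
noncomputable def DevelopingMap.shape {ι : Type} {T : IdealTriangulation ι} {ρ : Representation T}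
    (δ : DevelopingMap ρ) (i : ι) (p : Fin 3) : ℂ :=
  (![crossRatio (δ.pt i 0) (δ.pt i 1) (δ.pt i 2) (δ.pt i 3),
    crossRatio (δ.pt i 0) (δ.pt i 3) (δ.pt i 1) (δ.pt i 2),
    crossRatio (δ.pt i 0) (δ.pt i 2) (δ.pt i 3) (δ.pt i 1)] : Fin 3 → ℂ) p

/-! ### Peripheral curves -/

/-- A cocycle on the boundary torus with values in `ℤ²`, which records the coordinates of the homology
classes of closed curves with respect to a basis `(meridian, longitude)`: `val i v u` is the amount
picked up by a curve that leaves the triangle `(i, v)` through its side on the face opposite to `u`.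
It is an isomorphism from the first homology of the torus to `ℤ²` as soon as there are
curves of class `(1, 0)` and `(0, 1)`. -/
structure Marking {ι : Type} (T : IdealTriangulation ι) where
  val : ι → Fin 4 → Fin 4 → ℤ × ℤ
  val_neg : ∀ i v u, v ≠ u → val (T.nbr i u) (T.perm i u v) (T.perm i u u) = - val i v u
  val_corner : ∀ x : ι × Equiv.Perm (Fin 4),
    ∑ k ∈ Finset.range (T.degree x),
      val (T.turn^[k] x).1 ((T.turn^[k] x).2 0) ((T.turn^[k] x).2 2) = 0

/-- An oriented simple closed curve on the boundary torus in normal position with respect to the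
triangulation of the torus. It is a cyclic sequence of `len + 1` oriented normal arcs. The arc `k` is
realized in its triangle as the straight segment from `entry k` to `exit k`, in barycentric
coordinates (the coordinate `w` belongs to the corner on the edge `{v, w}` of the triangle `(i, v)`),
and the segments are disjoint within each triangle. -/
structure SimpleCurve {ι : Type} (T : IdealTriangulation ι) where
  len : ℕ
  arc : Fin (len + 1) → ι × Equiv.Perm (Fin 4)
  arc_tet : ∀ k, (arc (k + 1)).1 = T.nbr (arc k).1 ((arc k).2 2)
  arc_vertex : ∀ k, (arc (k + 1)).2 0 = T.perm (arc k).1 ((arc k).2 2) ((arc k).2 0)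
  arc_side : ∀ k, (arc (k + 1)).2 1 = T.perm (arc k).1 ((arc k).2 2) ((arc k).2 2)
  entry : Fin (len + 1) → Fin 4 → ℝ
  exit : Fin (len + 1) → Fin 4 → ℝ
  entry_sum : ∀ k, ∑ w, entry k w = 1
  entry_mem : ∀ k, entry k ((arc k).2 0) = 0 ∧ entry k ((arc k).2 1) = 0 ∧
    0 < entry k ((arc k).2 2) ∧ 0 < entry k ((arc k).2 3)
  exit_mem : ∀ k, exit k ((arc k).2 0) = 0 ∧ exit k ((arc k).2 2) = 0 ∧
    0 < exit k ((arc k).2 1) ∧ 0 < exit k ((arc k).2 3)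
  entry_succ : ∀ k w, entry (k + 1) (T.perm (arc k).1 ((arc k).2 2) w) = exit k w
  simple : ∀ k l, k ≠ l → (arc k).1 = (arc l).1 → (arc k).2 0 = (arc l).2 0 →
    Disjoint (segment ℝ (entry k) (exit k)) (segment ℝ (entry l) (exit l))

/-- The homology class of a curve in the coordinates given by a marking. -/
def SimpleCurve.homologyClass {ι : Type} {T : IdealTriangulation ι} (γ : SimpleCurve T)
    (θ : Marking T) : ℤ × ℤ :=
  ∑ k, θ.val (γ.arc k).1 ((γ.arc k).2 0) ((γ.arc k).2 2)

/-! ### Regular triangulations, isomorphisms and 2-3 moves -/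

/-- An ideal triangulation of a 3-manifold with torus boundary, with a basis of the homology of the
boundary, a representation `ρ`, and a developing map that takes the four vertices of every
tetrahedron to distinct points; so the triangulation is `ρ`-regular. -/
structure RegularTriangulation (ι : Type) where
  T : IdealTriangulation ι
  torus : T.TorusBoundary
  θ : Marking T
  ρ : Representation T
  δ : DevelopingMap ρ
  regular : ∀ i, Function.Injective (δ.pt i)

/-- Isomorphism: a relabelling `e` of the tetrahedra and orientation-preserving
relabellings `s` of their vertices, a change `g` of the trivializations of the flat bundle (which
includes conjugation of `ρ`), and a change of the marking by a coboundary. -/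
def RegularTriangulation.Isomorphic {ι κ : Type} (X : RegularTriangulation ι)
    (Y : RegularTriangulation κ) : Prop :=
  ∃ (e : ι ≃ κ) (s : ι → Equiv.Perm (Fin 4)) (g : ι → PSL(2, ℂ)) (c : ι → Fin 4 → ℤ × ℤ),
    (∀ i, Equiv.Perm.sign (s i) = 1) ∧
    (∀ i u, Y.T.nbr (e i) (s i u) = e (X.T.nbr i u)) ∧
    (∀ i u w, Y.T.perm (e i) (s i u) (s i w) = s (X.T.nbr i u) (X.T.perm i u w)) ∧
    (∀ i u, Y.ρ.hol (e i) (s i u) = g i * X.ρ.hol i u * (g (X.T.nbr i u))⁻¹) ∧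
    (∀ i v, Moves (g i) (X.δ.pt i v) (Y.δ.pt (e i) (s i v))) ∧
    (∀ i v u, v ≠ u → Y.θ.val (e i) (s i v) (s i u) =
      c i v + X.θ.val i v u - c (X.T.nbr i u) (X.T.perm i u v))

/-- The triangular bipyramid has the equatorial vertices `0, 1, 2` and the apexes `3, 4`. It is the
union of the two tetrahedra with vertices `3 0 1 2` and `4 0 2 1` (positively oriented), and these
are the positions of their vertices. -/
def bipyramidTwo (c : Fin 2) (v : Fin 4) : Fin 5 :=
  (![![3, 0, 1, 2], ![4, 0, 2, 1]] : Fin 2 → Fin 4 → Fin 5) c v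

/-- The bipyramid is also the union of the three tetrahedra with vertices `3 4 1 2`, `3 4 2 0` and
`3 4 0 1` (positively oriented) around its axis. -/
def bipyramidThree (k : Fin 3) (v : Fin 4) : Fin 5 :=
  (![![3, 4, 1, 2], ![3, 4, 2, 0], ![3, 4, 0, 1]] : Fin 3 → Fin 4 → Fin 5) k v

/-- A flag `(i, u, w)` stands for the vertex `w` of the face of the tetrahedron `i` opposite to `u`.
This is the map on flags given by the face gluings. -/
def IdealTriangulation.flagMap {ι : Type} (T : IdealTriangulation ι) (x : ι × Fin 4 × Fin 4) :
    ι × Fin 4 × Fin 4 :=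
  (T.nbr x.1 x.2.1, T.perm x.1 x.2.1 x.2.1, T.perm x.1 x.2.1 x.2.2)

/-- The correspondence between the flags of the faces that are not interior to the bipyramid, before
and after a 2-3 move. The tetrahedra outside of the bipyramid are indexed by `R`. The face of the
tetrahedron `c` in the first decomposition of the bipyramid that is opposite to the equatorial
vertex `k` is the face of the tetrahedron `k` in the second decomposition that is opposite to the
apex not in `c`. -/
inductive OuterFlag {R : Type} :
    (Fin 2 ⊕ R) × Fin 4 × Fin 4 → (Fin 3 ⊕ R) × Fin 4 × Fin 4 → Prop
  | rest (r : R) (u w : Fin 4) (h : w ≠ u) : OuterFlag (Sum.inr r, u, w) (Sum.inr r, u, w)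
  | bipyramid (c : Fin 2) (k : Fin 3) (u w u' w' : Fin 4)
      (hu : bipyramidTwo c u = k.castLE (by omega))
      (hu' : bipyramidThree k u' = bipyramidTwo (c + 1) 0)
      (hwu : w ≠ u) (hw : bipyramidTwo c w = bipyramidThree k w') :
      OuterFlag (Sum.inl c, u, w) (Sum.inl k, u', w')

/-- The 2-3 move in standard position, which replaces two tetrahedra glued along a face by three
tetrahedra around a new edge. All other gluings, the representation, the images of the ideal vertices
under the developing map and the marking of the boundary remain the same. -/
structure StandardMove {R : Type} (X : RegularTriangulation (Fin 2 ⊕ R))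
    (Y : RegularTriangulation (Fin 3 ⊕ R)) : Prop where
  nbr_two : X.T.nbr (Sum.inl 0) 0 = Sum.inl 1
  perm_two : ∀ w, w ≠ 0 → bipyramidTwo 1 (X.T.perm (Sum.inl 0) 0 w) = bipyramidTwo 0 w
  nbr_three : ∀ k : Fin 3, Y.T.nbr (Sum.inl k) 2 = Sum.inl (k + 1)
  perm_three : ∀ (k : Fin 3) (w), w ≠ 2 →
    bipyramidThree (k + 1) (Y.T.perm (Sum.inl k) 2 w) = bipyramidThree k w
  glue : ∀ x y, OuterFlag x y → OuterFlag (X.T.flagMap x) (Y.T.flagMap y)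
  hol_two : X.ρ.hol (Sum.inl 0) 0 = 1
  hol_three : ∀ k : Fin 3, Y.ρ.hol (Sum.inl k) 2 = 1
  hol_outer : ∀ x y, OuterFlag x y → X.ρ.hol x.1 x.2.1 = Y.ρ.hol y.1 y.2.1
  pt_rest : ∀ r v, X.δ.pt (Sum.inr r) v = Y.δ.pt (Sum.inr r) v
  pt_bipyramid : ∀ (c : Fin 2) (k : Fin 3) (v v' : Fin 4),
    bipyramidTwo c v = bipyramidThree k v' → X.δ.pt (Sum.inl c) v = Y.δ.pt (Sum.inl k) v'
  val_two : ∀ w, w ≠ 0 → X.θ.val (Sum.inl 0) w 0 = 0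
  val_three : ∀ (k : Fin 3) (w), w ≠ 2 → Y.θ.val (Sum.inl k) w 2 = 0
  val_outer : ∀ x y, OuterFlag x y → X.θ.val x.1 x.2.2 x.2.1 = Y.θ.val y.1 y.2.2 y.2.1

/-- The triangulation `Y` arises from `X` by a 2-3 move, up to isomorphism. -/
def RegularTriangulation.TwoThreeMove {ι κ : Type} (X : RegularTriangulation ι)
    (Y : RegularTriangulation κ) : Prop :=
  ∃ (R : Type) (X' : RegularTriangulation (Fin 2 ⊕ R)) (Y' : RegularTriangulation (Fin 3 ⊕ R)),
    X.Isomorphic X' ∧ StandardMove X' Y' ∧ Y'.Isomorphic Y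

/-! ### The Neumann-Zagier datum and the torsion -/

open Classical in
/-- The number of edges in the `p`-th pair of opposite edges of the tetrahedron `j` that are incident
to the edge `E` of the triangulation. -/
noncomputable def IdealTriangulation.edgeCount {ι : Type} (T : IdealTriangulation ι) (E : T.Edge)
    (j : ι) (p : Fin 3) : ℤ :=
  ((Finset.univ.filter fun x : Fin 4 × Fin 4 =>
    pairType x.1 x.2 = p ∧ ∃ h : x.1 < x.2, T.edgeOf ⟨(j, x), h.ne⟩ = E).card : ℤ)

open Classical in
/-- The signed number of times that a curve turns around a corner in the `p`-th pair of opposite edges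
of the tetrahedron `j`, counted with a plus sign for the counterclockwise direction. -/
noncomputable def SimpleCurve.curveCount {ι : Type} {T : IdealTriangulation ι} (γ : SimpleCurve T)
    (j : ι) (p : Fin 3) : ℤ :=
  ∑ k, if (γ.arc k).1 = j ∧ pairType ((γ.arc k).2 0) ((γ.arc k).2 3) = p
    then (Equiv.Perm.sign (γ.arc k).2 : ℤ) else 0

/-- The choices on which the Neumann-Zagier matrices depend: a quad type for each
tetrahedron, an enumeration of the edges, one redundant edge (the one in row `last`), whose gluing
equation is replaced by the meridian equation, a meridian curve `μ`, and a longitude curve `lam`. -/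
structure NZChoice {ι : Type} (X : RegularTriangulation ι) where
  quad : ι → Fin 3
  row : ι ≃ X.T.Edge
  last : ι
  μ : SimpleCurve X.T
  μ_class : μ.homologyClass X.θ = (1, 0)
  lam : SimpleCurve X.T
  lam_class : lam.homologyClass X.θ = (0, 1)

namespace NZChoice

variable {ι : Type} {X : RegularTriangulation ι} (D : NZChoice X)

/-- The first shape parameter, on the pair of edges chosen by the quad type. -/
noncomputable def z (j : ι) : ℂ := X.δ.shape j (D.quad j)

/-- The second shape parameter, `z' = 1 / (1 - z)`. -/
noncomputable def z' (j : ι) : ℂ := X.δ.shape j (D.quad j + 1)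

/-- The third shape parameter, `z'' = 1 - 1 / z`. -/
noncomputable def z'' (j : ι) : ℂ := X.δ.shape j (D.quad j + 2)

open Classical in
/-- The coefficients of the `i`-th equation (an edge equation, or the meridian equation in row
`last`) at the `p`-th pair of opposite edges of the tetrahedron `j`. -/
noncomputable def coeff (i j : ι) (p : Fin 3) : ℤ :=
  if i = D.last then D.μ.curveCount j p else X.T.edgeCount (D.row i) j p

/-- The Neumann-Zagier matrix `A = G - G'`. -/
noncomputable def A : Matrix ι ι ℤ :=
  Matrix.of fun i j => D.coeff i j (D.quad j) - D.coeff i j (D.quad j + 1)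

/-- The Neumann-Zagier matrix `B = G'' - G'`. -/
noncomputable def B : Matrix ι ι ℤ :=
  Matrix.of fun i j => D.coeff i j (D.quad j + 2) - D.coeff i j (D.quad j + 1)

open Classical in
/-- The vector `η`. -/
noncomputable def η [Fintype ι] (i : ι) : ℤ :=
  (if i = D.last then 0 else 2) - ∑ j, D.coeff i j (D.quad j + 1)

end NZChoice

/-- An enhanced Neumann-Zagier datum of a `ρ`-regular triangulation, for the meridian eigenvalue `m`:
the shapes satisfy the deformed gluing equations, and `(f, f', f'')` is a combinatorial
flattening that is compatible with the longitude. -/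
structure EnhancedNZDatum {ι : Type} [Fintype ι] [DecidableEq ι] (X : RegularTriangulation ι) (m : ℂ)
    extends NZChoice X where
  gluing : ∀ i, ∏ j, toNZChoice.z j ^ toNZChoice.A i j * toNZChoice.z'' j ^ toNZChoice.B i j =
    (-1) ^ toNZChoice.η i * (if i = last then m ^ 2 else 1)
  f : ι → ℤ
  f' : ι → ℤ
  f'' : ι → ℤ
  f_sum : ∀ j, f j + f' j + f'' j = 1
  f_edge : ∀ E : X.T.Edge, ∑ j, (X.T.edgeCount E j (quad j) * f j
    + X.T.edgeCount E j (quad j + 1) * f' j + X.T.edgeCount E j (quad j + 2) * f'' j) = 2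
  f_meridian : ∑ j, (μ.curveCount j (quad j) * f j
    + μ.curveCount j (quad j + 1) * f' j + μ.curveCount j (quad j + 2) * f'' j) = 0
  f_longitude : ∑ j, (lam.curveCount j (quad j) * f j
    + lam.curveCount j (quad j + 1) * f' j + lam.curveCount j (quad j + 2) * f'' j) = 0

/-- The generalized torsion (a number of which only the class up to sign matters). -/
noncomputable def EnhancedNZDatum.torsion {ι : Type} [Fintype ι] [DecidableEq ι]
    {X : RegularTriangulation ι} {m : ℂ} (D : EnhancedNZDatum X m) : ℂ :=
  1 / 2 * (D.A.map (Int.cast : ℤ → ℂ) * Matrix.diagonal D.z''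
      + D.B.map (Int.cast : ℤ → ℂ) * (Matrix.diagonal D.z)⁻¹).det
    * ∏ j, D.z j ^ D.f'' j * D.z'' j ^ (- D.f j)

end NeumannZagier

set_option linter.unusedSectionVars false

namespace NeumannZagier

/-! ### Linear algebra of combinatorial maps -/

section CombinatorialMap

variable {D 𝓥 𝓕 : Type}

/-! It suffices to compare the squares of torsions, which removes all signs.

Normal form. Let s₀, s₁, s₂ be the shapes of a tetrahedron. The weights (s₂, -1, 1/s₀) sum to zero
and are, up to a common factor, the logarithmic derivatives of the shapes. In the matrix of the
torsion, the entry of an equation at a tetrahedron is the pairing of its coefficients with the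
weights, times a factor that depends only on the quad type. Because a flattening sums to 1 on every
tetrahedron and s₀s₁s₂ = -1, the monomial absorbs this factor up to sign
(`EnhancedNZDatum.torsion_sq`). The rows of all edges sum to zero. So the numbering and the
distinguished edge affect only the sign, and the meridian row matters only modulo the edge rows
(`sq_det_updateRow_eq`).

Change of curves. A flattening plus a real deformation that vanishes on tetrahedra and edges assigns
angles (in units of π, of any sign) to the corners of the boundary triangles, with sum 1 in each
triangle and 2 around each vertex. The turning of simple closed curves of a fixed primitive class is
then constant. For disjoint curves the surface is cut along both: Gauss–Bonnet, the bound 2 for the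
Euler characteristic of a capped component, Stokes and connectedness leave only components that
contain one side of each curve, and these give two opposite inequalities (`CurvePair.turning_eq`).
In general the curves are lifted to a cyclic cover of large degree and moved to sheets that are far
apart (`HybridData.turning_eq`). The sheets may carry different triangulations, so the same argument
compares a curve before a 2-3 move with a curve after it. By linear duality, the rows of two
meridians differ by a combination of edge rows.

Change of flattening. The difference δ of two flattenings vanishes on tetrahedra, edges and
peripheral curves. Since the two curves detect the first cohomology of the torus, δ comes from an
integral function on the sides of boundary triangles that agrees across the gluings
(`IdealTriangulation.TorusBoundary.exists_side_potential`). Such a function induces integers on the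
edges. The product of the edge equations with these exponents is inverse to the square of the
monomial of δ, up to a power of -1 whose exponent is even (`even_sum_potential`). So the monomial of
δ is a sign (`prod_shape_sq_eq_one`).

Moves. An isomorphism acts on each tetrahedron like a change of quad type. In a 2-3 move the
dihedral angles of the bipyramid add and the shapes multiply, so a flattening after the move merges
to one before it. The rows after the move, paired with deformations of the three shapes that are
tangent to the axis equation, reproduce the rows before the move. The resulting factor between the
determinants is inverse, up to sign, to the factor between the monomials (`StandardMove.sq_det`,
`StandardMove.sq_monomial`). -/

/-- Differences of the values of a function at the two ends of the involution `α`. -/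
def antiDiff (α : Equiv.Perm D) : (D → ℝ) →ₗ[ℝ] (D → ℝ) where
  toFun g := fun d => g d - g (α d)
  map_add' g h := by ext d; simp; ring
  map_smul' c g := by ext d; simp; ring

/-- The functions that change sign under the involution `α`. -/
def antiFun (α : Equiv.Perm D) : Submodule ℝ (D → ℝ) where
  carrier := {w | ∀ d, w (α d) = - w d}
  add_mem' := by
    intro a b ha hb d
    simp only [Set.mem_ofPred_eq] at ha hb
    simp [ha d, hb d]; ring
  zero_mem' := by intro d; simp
  smul_mem' := by
    intro c a ha d
    simp only [Set.mem_ofPred_eq] at ha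
    simp [ha d]

theorem antiDiff_mem {α : Equiv.Perm D} (hα : ∀ d, α (α d) = d) (g : D → ℝ) :
    antiDiff α g ∈ antiFun α := by
  intro d
  simp [antiDiff, hα]

/-- An order on `D` singles out one element of every pair `{d, α d}`. Multiplication by this sign
exchanges odd and even functions. -/
theorem exists_sign {α : Equiv.Perm D} (hα : ∀ d, α (α d) = d) (hne : ∀ d, α d ≠ d) :
    ∃ ε : D → ℝ, (∀ d, ε (α d) = - ε d) ∧ ∀ d, ε d * ε d = 1 := by
  classical
  obtain ⟨_⟩ : Nonempty (LinearOrder D) := ⟨linearOrderOfSTO WellOrderingRel⟩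
  refine ⟨fun d => if d < α d then 1 else -1, fun d => ?_, fun d => ?_⟩
  · simp only [hα]
    rcases lt_trichotomy d (α d) with h | h | h
    · rw [if_neg h.not_gt, if_pos h]
    · exact absurd h.symm (hne d)
    · rw [if_pos h, if_neg h.not_gt, neg_neg]
  · by_cases h : d < α d <;> simp [h]

/-- Odd functions are independent of even ones, and `ε` times an odd function is even; so two copies
of `antiFun α` embed into all functions. The bound is the number of edges. -/
theorem two_mul_finrank_antiFun_le [Fintype D] {α : Equiv.Perm D} (hα : ∀ d, α (α d) = d)
    (hne : ∀ d, α d ≠ d) : 2 * Module.finrank ℝ (antiFun α) ≤ Fintype.card D := by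
  obtain ⟨ε, hε, hε2⟩ := exists_sign hα hne
  let L : (antiFun α × antiFun α) →ₗ[ℝ] (D → ℝ) :=
    { toFun := fun p => fun d => p.1.1 d + ε d * p.2.1 d
      map_add' := by intro p q; ext d; simp; ring
      map_smul' := by intro c p; ext d; simp; ring }
  have hL : Function.Injective L := by
    rw [← LinearMap.ker_eq_bot, LinearMap.ker_eq_bot']
    rintro ⟨⟨a, ha⟩, ⟨b, hb⟩⟩ h
    have h1 : ∀ d, a d + ε d * b d = 0 := fun d => congrFun h d
    have h2 : ∀ d, a d = 0 ∧ b d = 0 := by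
      intro d
      have e1 := h1 d
      have e2 := h1 (α d)
      rw [ha d, hb d, hε d] at e2
      have e3 : ε d * b d = 0 := by linarith
      refine ⟨by linarith, ?_⟩
      have : ε d * (ε d * b d) = 0 := by rw [e3, mul_zero]
      rwa [← mul_assoc, hε2, one_mul] at this
    ext d
    · exact (h2 d).1
    · exact (h2 d).2
  have := LinearMap.finrank_le_finrank_of_injective hL
  rw [Module.finrank_prod, Module.finrank_fintype_fun_eq_card] at this
  omega

theorem sum_antiDiff_mul [Fintype D] {α : Equiv.Perm D} (hα : ∀ d, α (α d) = d)
    {w : D → ℝ} (hw : w ∈ antiFun α) (g : D → ℝ) :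
    ∑ d, w d * antiDiff α g d = 2 * ∑ d, w d * g d := by
  have : ∑ d, w d * g (α d) = - ∑ d, w d * g d := by
    rw [← Equiv.sum_comp α, ← Finset.sum_neg_distrib]
    exact Finset.sum_congr rfl fun d _ => by rw [hα, hw d]; ring
  simp only [antiDiff, LinearMap.coe_mk, AddHom.coe_mk, mul_sub, Finset.sum_sub_distrib, this]
  ring

theorem eq_zero_of_sum_mul_self [Fintype D] {w : D → ℝ} (h : ∑ d, w d * w d = 0) : w = 0 := by
  ext d
  have := (Finset.sum_eq_zero_iff_of_nonneg (fun d _ => mul_self_nonneg (w d))).1 h d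
    (Finset.mem_univ d)
  simpa using this

/-- The discrete form of curl grad = 0: the gradient of a vertex function is orthogonal to the
coboundary of a face function. The rotation `σ` passes to the neighbouring face at the same vertex,
which identifies the two remaining sums. -/
theorem sum_mul_antiDiff_face_vertex [Fintype D] {α σ : Equiv.Perm D} (hα : ∀ d, α (α d) = d)
    {F : D → 𝓕} {V : D → 𝓥} (hF : ∀ d, F (σ d) = F (α d)) (hV : ∀ d, V (σ d) = V d)
    (g : 𝓕 → ℝ) (ψ : 𝓥 → ℝ) :
    ∑ d, antiDiff α (g ∘ F) d * antiDiff α (ψ ∘ V) d = 0 := by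
  rw [sum_antiDiff_mul hα (antiDiff_mem hα _)]
  simp only [antiDiff, LinearMap.coe_mk, AddHom.coe_mk, Function.comp, sub_mul,
    Finset.sum_sub_distrib]
  have : ∑ d, g (F (α d)) * ψ (V d) = ∑ d, g (F d) * ψ (V d) := by
    rw [← Equiv.sum_comp σ fun d => g (F d) * ψ (V d)]
    exact Finset.sum_congr rfl fun d _ => by rw [hF, hV]
  rw [this]; ring

/-- Euler characteristic bound for a connected closed combinatorial map. -/
theorem card_vertex_add_card_face_le_of_surjective [Fintype D] [Fintype 𝓥] [Fintype 𝓕]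
    {α σ : Equiv.Perm D}
    (hα : ∀ d, α (α d) = d) (hne : ∀ d, α d ≠ d)
    {F : D → 𝓕} {V : D → 𝓥} (hF : ∀ d, F (σ d) = F (α d)) (hV : ∀ d, V (σ d) = V d)
    (hFs : Function.Surjective F) (hVs : Function.Surjective V)
    (conn : ∀ u : D → ℝ, (∀ d, u (α d) = u d) → (∀ d, u (σ d) = u d) → ∀ d d', u d = u d') :
    2 * (Fintype.card 𝓥 + Fintype.card 𝓕) ≤ Fintype.card D + 4 := by
  rcases isEmpty_or_nonempty D with hD | ⟨⟨d₀⟩⟩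
  · have : IsEmpty 𝓥 := ⟨fun v => (hVs v).elim fun d _ => hD.elim d⟩
    have : IsEmpty 𝓕 := ⟨fun v => (hFs v).elim fun d _ => hD.elim d⟩
    simp
  -- Face and vertex functions have orthogonal images among the odd functions, and by connectedness
  -- both kernels consist of constants. Hence V + F - 2 is at most the number of edges.
  let L : ((𝓕 → ℝ) × (𝓥 → ℝ)) →ₗ[ℝ] antiFun α :=
    LinearMap.codRestrict (antiFun α)
      ((antiDiff α ∘ₗ LinearMap.funLeft ℝ ℝ F).coprod (antiDiff α ∘ₗ LinearMap.funLeft ℝ ℝ V))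
      (fun p => Submodule.add_mem _ (antiDiff_mem hα _) (antiDiff_mem hα _))
  have hker : ∀ p ∈ LinearMap.ker L, (∀ d, p.1 (F d) = p.1 (F d₀)) ∧
      ∀ d, p.2 (V d) = p.2 (V d₀) := by
    rintro ⟨g, ψ⟩ hp
    have h0 : antiDiff α (g ∘ F) + antiDiff α (ψ ∘ V) = 0 := congrArg Subtype.val hp
    have orth := sum_mul_antiDiff_face_vertex hα hF hV g ψ
    have hψ : antiDiff α (ψ ∘ V) = 0 := by
      apply eq_zero_of_sum_mul_self
      rw [eq_neg_of_add_eq_zero_left h0] at orth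
      simpa using orth
    have hg : antiDiff α (g ∘ F) = 0 := by rwa [hψ, add_zero] at h0
    have hg' : ∀ d, g (F (α d)) = g (F d) := fun d => (sub_eq_zero.1 (congrFun hg d)).symm
    have hψ' : ∀ d, ψ (V (α d)) = ψ (V d) := fun d => (sub_eq_zero.1 (congrFun hψ d)).symm
    exact ⟨fun d => conn (g ∘ F) hg' (fun d => by simp [hF, hg']) d d₀,
      fun d => conn (ψ ∘ V) hψ' (fun d => by simp [hV]) d d₀⟩
  let ev : LinearMap.ker L →ₗ[ℝ] ℝ × ℝ :=
    { toFun := fun p => (p.1.1 (F d₀), p.1.2 (V d₀))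
      map_add' := by intro p q; simp
      map_smul' := by intro c p; simp }
  have hev : Function.Injective ev := by
    rw [← LinearMap.ker_eq_bot, LinearMap.ker_eq_bot']
    rintro ⟨⟨g, ψ⟩, hp⟩ h
    have h1 : g (F d₀) = 0 := congrArg Prod.fst h
    have h2 : ψ (V d₀) = 0 := congrArg Prod.snd h
    obtain ⟨k1, k2⟩ := hker _ hp
    ext x
    · obtain ⟨d, rfl⟩ := hFs x
      exact (k1 d).trans h1
    · obtain ⟨d, rfl⟩ := hVs x
      exact (k2 d).trans h2
  have r1 := LinearMap.finrank_le_finrank_of_injective hev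
  have r2 := LinearMap.finrank_range_add_finrank_ker L
  have r3 := Submodule.finrank_le (LinearMap.range L)
  have r4 := two_mul_finrank_antiFun_le hα hne
  rw [Module.finrank_prod, Module.finrank_self] at r1
  rw [Module.finrank_prod, Module.finrank_fintype_fun_eq_card,
    Module.finrank_fintype_fun_eq_card] at r2
  omega

theorem card_image_vertex_add_card_image_face_le [DecidableEq 𝓥] [DecidableEq 𝓕]
    [DecidableEq D] {α σ : Equiv.Perm D}
    (hα : ∀ d, α (α d) = d) (hne : ∀ d, α d ≠ d)
    {F : D → 𝓕} {V : D → 𝓥} (hF : ∀ d, F (σ d) = F (α d)) (hV : ∀ d, V (σ d) = V d)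
    {Q : Finset D} (hQα : ∀ d, α d ∈ Q ↔ d ∈ Q) (hQσ : ∀ d, σ d ∈ Q ↔ d ∈ Q)
    (conn : ∀ u : D → ℝ, (∀ d, u (α d) = u d) → (∀ d, u (σ d) = u d) →
      ∀ d ∈ Q, ∀ d' ∈ Q, u d = u d') :
    2 * ((Q.image V).card + (Q.image F).card) ≤ Q.card + 4 := by
  let α' : Equiv.Perm Q := α.subtypePerm hQα
  let σ' : Equiv.Perm Q := σ.subtypePerm hQσ
  let F' : Q → Q.image F := fun d => ⟨F d, Finset.mem_image_of_mem _ d.2⟩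
  let V' : Q → Q.image V := fun d => ⟨V d, Finset.mem_image_of_mem _ d.2⟩
  have := card_vertex_add_card_face_le_of_surjective (α := α') (σ := σ') (F := F') (V := V')
    (fun d => Subtype.ext (hα d)) (fun d h => hne d (congrArg Subtype.val h))
    (fun d => Subtype.ext (hF d)) (fun d => Subtype.ext (hV d))
    (by
      rintro ⟨x, hx⟩
      obtain ⟨d, hd, rfl⟩ := Finset.mem_image.1 hx
      exact ⟨⟨d, hd⟩, rfl⟩)
    (by
      rintro ⟨x, hx⟩
      obtain ⟨d, hd, rfl⟩ := Finset.mem_image.1 hx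
      exact ⟨⟨d, hd⟩, rfl⟩)
    (by
      intro u hu1 hu2 d d'
      -- Extension by zero outside of `Q` stays invariant because `Q` is a union of orbits.
      have := conn (fun x => if h : x ∈ Q then u ⟨x, h⟩ else 0)
        (fun x => by
          by_cases h : x ∈ Q
          · have h' := (hQα x).2 h
            simp only [dif_pos h, dif_pos h']; exact hu1 ⟨x, h⟩
          · have h' := fun k => h ((hQα x).1 k)
            simp only [dif_neg h, dif_neg h'])
        (fun x => by
          by_cases h : x ∈ Q
          · have h' := (hQσ x).2 h
            simp only [dif_pos h, dif_pos h']; exact hu2 ⟨x, h⟩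
          · have h' := fun k => h ((hQσ x).1 k)
            simp only [dif_neg h, dif_neg h']) d d.2 d' d'.2
      simpa using this)
  simpa using this

/-- On a connected map of Euler characteristic zero, two closed cochains dual to two functionals
that vanish on exact cochains span the first cohomology. -/
theorem exists_potential [Fintype D] [Fintype 𝓥] [Fintype 𝓕] {α σ : Equiv.Perm D}
    (hα : ∀ d, α (α d) = d) (hne : ∀ d, α d ≠ d)
    {F : D → 𝓕} {V : D → 𝓥} (hF : ∀ d, F (σ d) = F (α d)) (hV : ∀ d, V (σ d) = V d)
    (hFs : Function.Surjective F) (hVs : Function.Surjective V)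
    (conn : ∀ u : D → ℝ, (∀ d, u (α d) = u d) → (∀ d, u (σ d) = u d) → ∀ d d', u d = u d')
    (card : Fintype.card D ≤ 2 * (Fintype.card 𝓥 + Fintype.card 𝓕))
    (l₁ l₂ : (D → ℝ) →ₗ[ℝ] ℝ)
    (hl : ∀ g : 𝓕 → ℝ, l₁ (antiDiff α (g ∘ F)) = 0 ∧ l₂ (antiDiff α (g ∘ F)) = 0)
    (θ₁ θ₂ : D → ℝ) (hθ₁ : θ₁ ∈ antiFun α) (hθ₂ : θ₂ ∈ antiFun α)
    (hc₁ : ∀ ψ : 𝓥 → ℝ, ∑ d, θ₁ d * ψ (V d) = 0) (hc₂ : ∀ ψ : 𝓥 → ℝ, ∑ d, θ₂ d * ψ (V d) = 0)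
    (h11 : l₁ θ₁ = 1) (h12 : l₁ θ₂ = 0) (h21 : l₂ θ₁ = 0) (h22 : l₂ θ₂ = 1)
    (w : D → ℝ) (hw : w ∈ antiFun α) (hcw : ∀ ψ : 𝓥 → ℝ, ∑ d, w d * ψ (V d) = 0)
    (hw₁ : l₁ w = 0) (hw₂ : l₂ w = 0) : ∃ g : 𝓕 → ℝ, w = antiDiff α (g ∘ F) := by
  rcases isEmpty_or_nonempty D with hD | ⟨⟨d₀⟩⟩
  · exact ⟨0, funext fun d => hD.elim d⟩
  -- The closed odd cochains with vanishing periods; the aim is that coboundaries of face functions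
  -- exhaust them.
  let K : Submodule ℝ (D → ℝ) :=
    { carrier := {w | w ∈ antiFun α ∧ (∀ ψ : 𝓥 → ℝ, ∑ d, w d * ψ (V d) = 0) ∧ l₁ w = 0 ∧ l₂ w = 0}
      add_mem' := by
        rintro a b ⟨h1, h2, h3, h4⟩ ⟨k1, k2, k3, k4⟩
        exact ⟨Submodule.add_mem _ h1 k1, fun ψ => by
          simp [add_mul, Finset.sum_add_distrib, h2, k2], by simp [h3, k3], by simp [h4, k4]⟩
      zero_mem' := ⟨Submodule.zero_mem _, by simp, by simp, by simp⟩
      smul_mem' := by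
        rintro c a ⟨h1, h2, h3, h4⟩
        exact ⟨Submodule.smul_mem _ _ h1, fun ψ => by
          simp [mul_assoc, ← Finset.mul_sum, h2], by simp [h3], by simp [h4]⟩ }
  let E : (𝓕 → ℝ) →ₗ[ℝ] K := LinearMap.codRestrict K (antiDiff α ∘ₗ LinearMap.funLeft ℝ ℝ F)
    (fun g => ⟨antiDiff_mem hα _, fun ψ => by
      have h1 := sum_mul_antiDiff_face_vertex hα hF hV g ψ
      rw [sum_antiDiff_mul hα (antiDiff_mem hα _)] at h1
      simpa [Function.comp_def, LinearMap.funLeft] using h1, (hl g).1, (hl g).2⟩)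
  -- Gradients, `K`, `θ₁` and `θ₂` are independent among the odd functions: pairing with `l₁`, `l₂`
  -- kills the coefficients of the `θ`s, and orthogonality kills the gradient. This gives dim K ≤ E
  -- - (V - 1) - 2, which is at most F - 1 by the hypothesis on the Euler characteristic, and F - 1
  -- is attained by coboundaries.
  let X : (((𝓥 → ℝ) × K) × (ℝ × ℝ)) →ₗ[ℝ] antiFun α := LinearMap.codRestrict (antiFun α)
    (((antiDiff α ∘ₗ LinearMap.funLeft ℝ ℝ V).coprod K.subtype).coprod
      ((LinearMap.toSpanSingleton ℝ (D → ℝ) θ₁).coprod (LinearMap.toSpanSingleton ℝ (D → ℝ) θ₂)))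
    (fun p => Submodule.add_mem _ (Submodule.add_mem _ (antiDiff_mem hα _) p.1.2.2.1)
      (Submodule.add_mem _ (Submodule.smul_mem _ _ hθ₁) (Submodule.smul_mem _ _ hθ₂)))
  have hker : ∀ p ∈ LinearMap.ker X, (∀ d, p.1.1 (V d) = p.1.1 (V d₀)) ∧ p.1.2 = 0 ∧ p.2 = 0 := by
    rintro ⟨⟨ψ, k⟩, ⟨a, b⟩⟩ hp
    have h0 : antiDiff α (ψ ∘ V) + k.1 + (a • θ₁ + b • θ₂) = 0 := congrArg Subtype.val hp
    have hcl : ∀ χ : 𝓥 → ℝ, ∑ d, (k.1 + (a • θ₁ + b • θ₂)) d * χ (V d) = 0 := by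
      intro χ
      simp only [Pi.add_apply, Pi.smul_apply, smul_eq_mul, add_mul, Finset.sum_add_distrib,
        k.2.2.1 χ, mul_assoc, ← Finset.mul_sum, hc₁ χ, hc₂ χ]
      simp
    have hk : k.1 + (a • θ₁ + b • θ₂) ∈ antiFun α := Submodule.add_mem _ k.2.1
      (Submodule.add_mem _ (Submodule.smul_mem _ _ hθ₁) (Submodule.smul_mem _ _ hθ₂))
    have hψ : antiDiff α (ψ ∘ V) = 0 := by
      apply eq_zero_of_sum_mul_self
      have := sum_antiDiff_mul hα hk (ψ ∘ V)
      rw [show k.1 + (a • θ₁ + b • θ₂) = - antiDiff α (ψ ∘ V) by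
        rw [add_assoc] at h0; exact eq_neg_of_add_eq_zero_right h0] at this hcl
      have h2 := hcl ψ
      simp only [Function.comp] at this
      rw [h2] at this
      simpa [Finset.sum_neg_distrib] using this
    have hrest : k.1 + (a • θ₁ + b • θ₂) = 0 := by rwa [hψ, zero_add] at h0
    have ha : a = 0 := by
      have := congrArg l₁ hrest
      simpa [h11, h12, k.2.2.2.1] using this
    have hb : b = 0 := by
      have := congrArg l₂ hrest
      simpa [h21, h22, k.2.2.2.2] using this
    have hψ' : ∀ d, ψ (V (α d)) = ψ (V d) := fun d => (sub_eq_zero.1 (congrFun hψ d)).symm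
    refine ⟨fun d => conn (ψ ∘ V) hψ' (fun d => by simp [hV]) d d₀, ?_, by simp [ha, hb]⟩
    rw [ha, hb] at hrest
    exact Subtype.ext (by simpa using hrest)
  let ev : LinearMap.ker X →ₗ[ℝ] ℝ :=
    { toFun := fun p => p.1.1.1 (V d₀)
      map_add' := by intro p q; simp
      map_smul' := by intro c p; simp }
  have hev : Function.Injective ev := by
    refine (injective_iff_map_eq_zero _).2 ?_
    rintro ⟨⟨⟨ψ, k⟩, c⟩, hp⟩ h
    have h1 : ψ (V d₀) = 0 := h
    obtain ⟨k1, k2, k3⟩ := hker _ hp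
    apply Subtype.ext
    refine Prod.ext (Prod.ext ?_ k2) k3
    ext x
    obtain ⟨d, rfl⟩ := hVs x
    exact (k1 d).trans h1
  let evE : LinearMap.ker E →ₗ[ℝ] ℝ :=
    { toFun := fun p => p.1 (F d₀)
      map_add' := by intro p q; simp
      map_smul' := by intro c p; simp }
  have hevE : Function.Injective evE := by
    refine (injective_iff_map_eq_zero _).2 ?_
    rintro ⟨g, hp⟩ h
    have h0 : antiDiff α (g ∘ F) = 0 := congrArg Subtype.val hp
    have h1 : g (F d₀) = 0 := h
    have hg' : ∀ d, g (F (α d)) = g (F d) := fun d => (sub_eq_zero.1 (congrFun h0 d)).symm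
    ext x
    obtain ⟨d, rfl⟩ := hFs x
    exact (conn (g ∘ F) hg' (fun d => by simp [hF, hg']) d d₀).trans h1
  have r1 := LinearMap.finrank_le_finrank_of_injective hev
  have r2 := LinearMap.finrank_range_add_finrank_ker X
  have r3 := Submodule.finrank_le (LinearMap.range X)
  have r4 := two_mul_finrank_antiFun_le hα hne
  have q1 := LinearMap.finrank_le_finrank_of_injective hevE
  have q2 := LinearMap.finrank_range_add_finrank_ker E
  rw [Module.finrank_self] at r1 q1
  rw [Module.finrank_prod, Module.finrank_prod, Module.finrank_prod, Module.finrank_self,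
    Module.finrank_fintype_fun_eq_card] at r2
  rw [Module.finrank_fintype_fun_eq_card] at q2
  have htop : LinearMap.range E = ⊤ :=
    Submodule.eq_top_of_finrank_eq (le_antisymm (Submodule.finrank_le _) (by omega))
  obtain ⟨g, hg⟩ := LinearMap.range_eq_top.1 htop ⟨w, hw, hcw, hw₁, hw₂⟩
  exact ⟨g, (congrArg Subtype.val hg).symm⟩

end CombinatorialMap

end NeumannZagier

namespace NeumannZagier

/-! ### Cutting a triangulated surface along a system of normal arcs -/

/-- A triangulated closed oriented surface, given by the permutations `φ` (next side of the same
triangle) and `α` (other side of the same edge) of its oriented triangle sides, together with a closed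
system of disjoint normal arcs. The arc `a` cuts off the corner at which the side `corner a` starts, at
the distance `u a` on this side and `w a` on the previous side. An element `(a, true)` stands for the
part of the arc's boundary that belongs to the centre of the triangle, `(a, false)` for the one that
belongs to the corner. The involution `j` matches the two sides of a crossing point. -/
structure ArcSystem (D A : Type) where
  φ : Equiv.Perm D
  α : Equiv.Perm D
  φ_three : ∀ d, φ (φ (φ d)) = d
  φ_ne : ∀ d, φ d ≠ d
  α_α : ∀ d, α (α d) = d
  α_ne : ∀ d, α d ≠ d
  corner : A → D
  u : A → ℝ
  w : A → ℝ
  u_pos : ∀ a, 0 < u a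
  u_lt : ∀ a, u a < 1
  w_pos : ∀ a, 0 < w a
  w_lt : ∀ a, w a < 1
  j : A × Bool → A × Bool
  j_j : ∀ h, j (j h) = h
  side_j : ∀ h, (if (j h).2 then corner (j h).1 else φ.symm (corner (j h).1)) =
    α (if h.2 then corner h.1 else φ.symm (corner h.1))
  pos_j : ∀ h, (if (j h).2 then u (j h).1 else 1 - w (j h).1) =
    1 - (if h.2 then u h.1 else 1 - w h.1)
  nested : ∀ a b, corner a = corner b → a ≠ b → (u a < u b ∧ w a < w b) ∨ (u b < u a ∧ w b < w a)
  disjoint : ∀ a b, corner b = φ (corner a) → u a < 1 - w b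

namespace ArcSystem

variable {D A : Type} (S : ArcSystem D A)

/-- The side on which a segment starts. -/
def side : D ⊕ A × Bool → D
  | .inl d => d
  | .inr h => if h.2 then S.corner h.1 else S.φ.symm (S.corner h.1)

/-- The position at which a segment starts. -/
def pos : D ⊕ A × Bool → ℝ
  | .inl _ => 0
  | .inr h => if h.2 then S.u h.1 else 1 - S.w h.1

theorem side_inl (d : D) : S.side (.inl d) = d := rfl

theorem side_true (a : A) : S.side (.inr (a, true)) = S.corner a := rfl

theorem side_false (a : A) : S.side (.inr (a, false)) = S.φ.symm (S.corner a) := rfl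

theorem pos_inl (d : D) : S.pos (.inl d) = 0 := rfl

theorem pos_true (a : A) : S.pos (.inr (a, true)) = S.u a := rfl

theorem pos_false (a : A) : S.pos (.inr (a, false)) = 1 - S.w a := rfl

theorem side_inr_j (h : A × Bool) : S.side (.inr (S.j h)) = S.α (S.side (.inr h)) := S.side_j h

theorem pos_inr_j (h : A × Bool) : S.pos (.inr (S.j h)) = 1 - S.pos (.inr h) := S.pos_j h

theorem pos_inr_pos (h : A × Bool) : 0 < S.pos (.inr h) := by
  obtain ⟨a, b⟩ := h
  cases b
  · simpa [pos] using S.w_lt a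
  · simpa [pos] using S.u_pos a

theorem pos_nonneg (h : D ⊕ A × Bool) : 0 ≤ S.pos h := by
  cases h with
  | inl d => exact le_rfl
  | inr h => exact (S.pos_inr_pos h).le

theorem pos_lt_one (h : D ⊕ A × Bool) : S.pos h < 1 := by
  rcases h with d | ⟨a, b⟩
  · exact zero_lt_one
  · cases b
    · simpa [pos] using S.w_pos a
    · simpa [pos] using S.u_lt a

theorem nested_iff {a b : A} (h : S.corner a = S.corner b) : S.u a < S.u b ↔ S.w a < S.w b := by
  rcases eq_or_ne a b with rfl | hne
  · simp
  · rcases S.nested a b h hne with ⟨h1, h2⟩ | ⟨h1, h2⟩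
    · exact ⟨fun _ => h2, fun _ => h1⟩
    · exact ⟨fun h => absurd h h1.not_gt, fun h => absurd h h2.not_gt⟩

theorem eq_of_u_eq {a b : A} (h : S.corner a = S.corner b) (hu : S.u a = S.u b) : a = b := by
  by_contra hne
  rcases S.nested a b h hne with ⟨h1, _⟩ | ⟨h1, _⟩ <;> exact absurd hu (by linarith)

theorem eq_of_w_eq {a b : A} (h : S.corner a = S.corner b) (hw : S.w a = S.w b) : a = b := by
  by_contra hne
  rcases S.nested a b h hne with ⟨_, h1⟩ | ⟨_, h1⟩ <;> exact absurd hw (by linarith)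

/-- A segment is named by its starting point, a vertex at position 0 or a crossing point;
disjointness of the arcs makes crossing points on one side distinct. -/
theorem eq_of_side_eq_of_pos_eq {h h' : D ⊕ A × Bool} (hs : S.side h = S.side h')
    (hp : S.pos h = S.pos h') : h = h' := by
  rcases h with d | h
  · rcases h' with d' | h'
    · exact congrArg _ hs
    · exact absurd hp (S.pos_inr_pos h').ne
  · rcases h' with d' | h'
    · exact absurd hp (S.pos_inr_pos h).ne'
    · obtain ⟨a, b⟩ := h
      obtain ⟨a', b'⟩ := h'
      cases b <;> cases b' <;> simp only [side_true, side_false, pos_true, pos_false] at hs hp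
      · rw [S.eq_of_w_eq (S.φ.symm.injective hs) (by linarith)]
      · exact absurd (S.disjoint a' a (by rw [← hs, Equiv.apply_symm_apply])) (by linarith)
      · exact absurd (S.disjoint a a' (by rw [hs, Equiv.apply_symm_apply])) (by linarith)
      · rw [S.eq_of_u_eq hs (by linarith)]

section Cut

variable [Fintype D] [Fintype A]

/-- Positions on opposite sides add up to 1, so the reversed segment ends at `1 - pos h`. It starts
at the last vertex or crossing point before that position. -/
theorem exists_cutα (h : D ⊕ A × Bool) : ∃ h', S.side h' = S.α (S.side h) ∧
    S.pos h' < 1 - S.pos h ∧ ∀ k, S.side k = S.α (S.side h) → S.pos k < 1 - S.pos h →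
      S.pos k ≤ S.pos h' := by
  classical
  obtain ⟨h', h1, h2⟩ := Finset.exists_max_image
    (Finset.univ.filter fun k => S.side k = S.α (S.side h) ∧ S.pos k < 1 - S.pos h) S.pos
    ⟨.inl (S.α (S.side h)), by
      have := S.pos_lt_one h
      simp only [Finset.mem_filter_univ]
      exact ⟨rfl, show (0 : ℝ) < _ by linarith⟩⟩
  simp only [Finset.mem_filter_univ] at h1 h2
  exact ⟨h', h1.1, h1.2, fun k hk1 hk2 => h2 k ⟨hk1, hk2⟩⟩

/-- The same segment seen from the other side. -/
noncomputable def cutFun (h : D ⊕ A × Bool) : D ⊕ A × Bool := (S.exists_cutα h).choose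

theorem side_cutFun (h : D ⊕ A × Bool) : S.side (S.cutFun h) = S.α (S.side h) :=
  (S.exists_cutα h).choose_spec.1

theorem pos_cutFun_lt (h : D ⊕ A × Bool) : S.pos (S.cutFun h) < 1 - S.pos h :=
  (S.exists_cutα h).choose_spec.2.1

theorem le_pos_cutFun (h k : D ⊕ A × Bool) (hk : S.side k = S.α (S.side h))
    (hp : S.pos k < 1 - S.pos h) : S.pos k ≤ S.pos (S.cutFun h) :=
  (S.exists_cutα h).choose_spec.2.2 k hk hp

/-- The next crossing point on a side is where the segment ends. -/
theorem le_pos_of_lt (h : D ⊕ A × Bool) (k : A × Bool) (hk : S.side (.inr k) = S.side h)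
    (hp : S.pos h < S.pos (.inr k)) : 1 - S.pos (S.cutFun h) ≤ S.pos (.inr k) := by
  have := S.le_pos_cutFun h (.inr (S.j k)) (by rw [S.side_inr_j, hk])
    (by rw [S.pos_inr_j]; linarith)
  rw [S.pos_inr_j] at this
  linarith

theorem cutFun_cutFun (h : D ⊕ A × Bool) : S.cutFun (S.cutFun h) = h := by
  have hs : S.side (S.cutFun (S.cutFun h)) = S.side h := by
    rw [S.side_cutFun, S.side_cutFun, S.α_α]
  apply S.eq_of_side_eq_of_pos_eq hs
  apply le_antisymm
  · by_contra! hlt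
    have h2 := S.pos_cutFun_lt (S.cutFun h)
    cases hk : S.cutFun (S.cutFun h) with
    | inl d =>
      rw [hk] at hlt
      exact absurd hlt (S.pos_nonneg h).not_gt
    | inr k =>
      rw [hk] at hs hlt h2
      have := S.le_pos_of_lt h k hs hlt
      linarith
  · exact S.le_pos_cutFun _ _ (by rw [S.side_cutFun, S.α_α]) (by linarith [S.pos_cutFun_lt h])

/-- The involution of the cut surface. -/
noncomputable def cutα : Equiv.Perm (D ⊕ A × Bool) :=
  Function.Involutive.toPerm S.cutFun S.cutFun_cutFun

theorem cutα_cutα (h : D ⊕ A × Bool) : S.cutα (S.cutα h) = h := S.cutFun_cutFun h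

theorem side_cutα (h : D ⊕ A × Bool) : S.side (S.cutα h) = S.α (S.side h) := S.side_cutFun h

theorem cutα_ne (h : D ⊕ A × Bool) : S.cutα h ≠ h := fun e =>
  S.α_ne (S.side h) (by rw [← S.side_cutα, e])

/-- Rotation around the vertices of the cut surface, where every boundary circle is capped
by a vertex. -/
def cutσ : Equiv.Perm (D ⊕ A × Bool) :=
  Equiv.sumCongr (S.α.trans S.φ)
    ((Function.Involutive.toPerm S.j S.j_j).trans
      (Equiv.prodCongr (Equiv.refl A) Equiv.boolNot))

theorem cutσ_inl (d : D) : S.cutσ (.inl d) = .inl (S.φ (S.α d)) := rfl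

theorem cutσ_inr (h : A × Bool) : S.cutσ (.inr h) = .inr ((S.j h).1, !(S.j h).2) := rfl

/-- The arcs around the corner at the start of `d` beyond the position `x`. -/
def Beyond (d : D) (x : ℝ) (a : A) : Prop := S.corner a = d ∧ x < S.u a

/-- The next arc around the corner of `d` beyond the position `x` if there is one, and `d`
otherwise. -/
def IsNext (d : D) (x : ℝ) : A ⊕ D → Prop
  | .inl a => S.Beyond d x a ∧ ∀ b, S.Beyond d x b → S.u a ≤ S.u b
  | .inr d' => d' = d ∧ ∀ b, ¬ S.Beyond d x b

theorem exists_isNext (d : D) (x : ℝ) : ∃ r, S.IsNext d x r := by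
  classical
  by_cases h : ∃ a, S.Beyond d x a
  · obtain ⟨a, ha, ha'⟩ := Finset.exists_min_image (Finset.univ.filter fun a => S.Beyond d x a) S.u
      (by obtain ⟨a, ha⟩ := h; exact ⟨a, by simpa using ha⟩)
    simp only [Finset.mem_filter_univ] at ha ha'
    exact ⟨.inl a, ha, ha'⟩
  · exact ⟨.inr d, rfl, fun b hb => h ⟨b, hb⟩⟩

theorem IsNext.unique {d : D} {x : ℝ} {r r' : A ⊕ D} (h : S.IsNext d x r) (h' : S.IsNext d x r') :
    r = r' := by
  rcases r with a | d1 <;> rcases r' with a' | d2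
  · rw [S.eq_of_u_eq (h.1.1.trans h'.1.1.symm) (le_antisymm (h.2 _ h'.1) (h'.2 _ h.1))]
  · exact absurd h.1 (h'.2 a)
  · exact absurd h'.1 (h.2 a')
  · rw [h.1, h'.1]

/-- The piece of the cut triangle to which a segment belongs. Pieces that belong to a corner are named
by their outer arc; the central piece has three names, one for each corner. -/
noncomputable def piece : D ⊕ A × Bool → A ⊕ D
  | .inl d => (S.exists_isNext d 0).choose
  | .inr (a, true) => (S.exists_isNext (S.corner a) (S.u a)).choose
  | .inr (a, false) => .inl a

/-- The segments that start at the central side of an arc or at a vertex. -/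
def Central : D ⊕ A × Bool → Prop
  | .inl _ => True
  | .inr (_, b) => b = true

theorem piece_spec {h : D ⊕ A × Bool} (hc : Central h) :
    S.IsNext (S.side h) (S.pos h) (S.piece h) := by
  rcases h with d | ⟨a, b⟩
  · exact (S.exists_isNext d 0).choose_spec
  · obtain rfl : b = true := hc
    exact (S.exists_isNext (S.corner a) (S.u a)).choose_spec

theorem not_central {h : D ⊕ A × Bool} (hc : ¬ Central h) : ∃ a, h = .inr (a, false) := by
  rcases h with d | ⟨a, b⟩
  · exact absurd trivial hc
  · cases b
    · exact ⟨a, rfl⟩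
    · exact absurd rfl hc

theorem pos_lt_of_corner_eq_φ {h : D ⊕ A × Bool} (hc : Central h) {b : A}
    (hb : S.corner b = S.φ (S.side h)) : S.pos h < 1 - S.w b := by
  rcases h with d | ⟨a, c⟩
  · simpa [pos_inl] using S.w_lt b
  · obtain rfl : c = true := hc
    exact S.disjoint a b hb

/-- The position after which a segment ends, at the crossing point of `k` or at the end
of the side. -/
theorem cutσ_cutα_cases (h : D ⊕ A × Bool) :
    (S.cutα h = .inl (S.α (S.side h)) ∧ S.cutσ (S.cutα h) = .inl (S.φ (S.side h)) ∧
      ∀ k, S.side (.inr k) = S.side h → S.pos (.inr k) ≤ S.pos h) ∨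
    ∃ k, S.cutα h = .inr (S.j k) ∧ S.cutσ (S.cutα h) = .inr (k.1, !k.2) ∧
      S.side (.inr k) = S.side h ∧ S.pos h < S.pos (.inr k) ∧
      ∀ k', S.side (.inr k') = S.side h → S.pos h < S.pos (.inr k') →
        S.pos (.inr k) ≤ S.pos (.inr k') := by
  have hside := S.side_cutα h
  have hlt : S.pos (S.cutα h) < 1 - S.pos h := S.pos_cutFun_lt h
  have hle : ∀ k, S.side (.inr k) = S.side h → S.pos h < S.pos (.inr k) →
      1 - S.pos (S.cutα h) ≤ S.pos (.inr k) := S.le_pos_of_lt h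
  cases hk : S.cutα h with
  | inl d =>
    rw [hk] at hside hle
    obtain rfl : d = S.α (S.side h) := hside
    refine Or.inl ⟨rfl, by rw [S.cutσ_inl, S.α_α], fun k hk1 => ?_⟩
    by_contra! hk2
    have := hle k hk1 hk2
    have h1 := S.pos_lt_one (.inr k)
    simp only [pos_inl] at this h1
    linarith
  | inr k =>
    rw [hk] at hside hlt hle
    refine Or.inr ⟨S.j k, by rw [S.j_j], by rw [S.cutσ_inr], ?_, ?_, fun k' h1 h2 => ?_⟩
    · rw [S.side_inr_j, hside, S.α_α]
    · rw [S.pos_inr_j]; linarith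
    · rw [S.pos_inr_j]; exact hle k' h1 h2

/-- No arc around the starting corner lies beyond such a segment, so it bounds the central piece. It
runs on to the first arc that cuts off the next corner, whose central side continues the boundary,
or to the vertex itself. -/
theorem piece_cut_of_eq_inr {h : D ⊕ A × Bool} (hc : Central h) {d : D}
    (hd : S.piece h = .inr d) : Central (S.cutσ (S.cutα h)) ∧
      S.piece (S.cutσ (S.cutα h)) = .inr (S.φ d) := by
  have hn := S.piece_spec hc
  rw [hd] at hn
  obtain ⟨rfl, hn⟩ := hn
  rcases S.cutσ_cutα_cases h with ⟨_, e, hmax⟩ | ⟨⟨a, b⟩, _, e, hs, hp, hmin⟩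
  · rw [e]
    refine ⟨trivial, (S.piece_spec (h := .inl _) trivial).unique (r' := .inr _) S ⟨rfl, ?_⟩⟩
    rintro b ⟨hb, -⟩
    have h1 := S.pos_lt_of_corner_eq_φ hc hb
    have h2 := hmax (b, false) (by simp [side_false, show S.corner b = S.φ (S.side h) from hb])
    simp only [pos_false] at h2
    linarith
  · cases b
    · rw [e]
      simp only [side_true, side_false, pos_true, pos_false] at hs hp
      have hs' : S.corner a = S.φ (S.side h) := by rw [← hs, Equiv.apply_symm_apply]
      have hnext : S.IsNext (S.corner a) (S.u a) (.inr (S.φ (S.side h))) := by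
        refine ⟨hs'.symm, ?_⟩
        rintro b ⟨hb, hub⟩
        have hw := (S.nested_iff hb.symm).1 hub
        have h1 := S.pos_lt_of_corner_eq_φ hc (hb.trans hs')
        have h2 := hmin (b, false) (by simp [side_false, hb, hs']) (by simpa [pos_false] using h1)
        simp only [pos_false] at h2
        linarith
      exact ⟨rfl, (S.piece_spec (h := .inr (a, true)) rfl).unique S hnext⟩
    · simp only [side_true, side_false, pos_true, pos_false] at hs hp
      exact absurd ⟨hs, hp⟩ (hn a)

/-- The segment runs outwards from a corner to the next arc `a` around it; from there the boundary
of the piece continues on the corner side of `a`. -/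
theorem cut_of_piece_eq_inl {h : D ⊕ A × Bool} (hc : Central h) {a : A}
    (ha : S.piece h = .inl a) : S.cutσ (S.cutα h) = .inr (a, false) := by
  have hn := S.piece_spec hc
  rw [ha] at hn
  obtain ⟨⟨h1, h2⟩, hn⟩ := hn
  rcases S.cutσ_cutα_cases h with ⟨_, e, hmax⟩ | ⟨⟨a', b⟩, _, e, hs, hp, hmin⟩
  · have := hmax (a, true) (by simpa [side_true] using h1)
    simp only [pos_true] at this
    linarith
  · have hm := hmin (a, true) (by simpa [side_true] using h1) (by simpa [pos_true] using h2)
    cases b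
    · simp only [side_true, side_false, pos_true, pos_false] at hs hp hm
      have hs' : S.corner a' = S.φ (S.corner a) := by rw [h1, ← hs, Equiv.apply_symm_apply]
      have := S.disjoint a a' hs'
      linarith
    · simp only [side_true, side_false, pos_true, pos_false] at hs hp hm
      rw [e, S.eq_of_u_eq (hs.trans h1.symm) (le_antisymm hm (hn a' ⟨hs, hp⟩))]
      rfl

/-- From the far end of `a` the side runs towards the corner and meets the next inner arc or the
vertex. So a piece at a corner is a bigon with exactly two segments. -/
theorem central_cut_of_not_central (a : A) : Central (S.cutσ (S.cutα (.inr (a, false)))) ∧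
    S.piece (S.cutσ (S.cutα (.inr (a, false)))) = .inl a := by
  have hside : S.φ (S.side (.inr (a, false))) = S.corner a := by simp [side_false]
  rcases S.cutσ_cutα_cases (.inr (a, false)) with ⟨_, e, hmax⟩ | ⟨⟨a', b⟩, _, e, hs, hp, hmin⟩
  · rw [e, hside]
    refine ⟨trivial, (S.piece_spec (h := .inl _) trivial).unique (r' := .inl a) S
      ⟨⟨rfl, S.u_pos a⟩, ?_⟩⟩
    rintro b ⟨hb, -⟩
    have h2 := hmax (b, false) (by simp [side_false, show S.corner b = S.corner a from hb])
    simp only [pos_false] at h2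
    by_contra! hlt
    have := (S.nested_iff hb).1 hlt
    linarith
  · cases b
    · simp only [side_true, side_false, pos_true, pos_false] at hs hp
      have hs' : S.corner a' = S.corner a := S.φ.symm.injective hs
      have hw : S.w a' < S.w a := by linarith
      have hnext : S.IsNext (S.corner a') (S.u a') (.inl a) := by
        refine ⟨⟨hs'.symm, (S.nested_iff hs').2 hw⟩, ?_⟩
        rintro b ⟨hb, hub⟩
        by_contra! hlt
        have h1 := (S.nested_iff (hb.trans hs')).1 hlt
        have h2 := (S.nested_iff hb.symm).1 hub
        have h3 := hmin (b, false) (by simp [side_false, hb, hs'])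
          (by simp only [pos_false]; linarith)
        simp only [pos_false] at h3
        linarith
      rw [e]
      exact ⟨rfl, (S.piece_spec (h := .inr (a', true)) rfl).unique S hnext⟩
    · simp only [side_true, side_false, pos_true, pos_false] at hs hp
      have := S.disjoint a' a (by rw [hs, Equiv.apply_symm_apply])
      linarith

/-- Two segments of a bigon that are both central have the same successor. Two central segments on
one side with no arc beyond either of them start at the same point. -/
theorem piece_injective {h h' : D ⊕ A × Bool} (hc : Central h) (hc' : Central h')
    (e : S.piece h = S.piece h') : h = h' := by
  cases hp : S.piece h with
  | inl a =>
    exact S.cutα.injective (S.cutσ.injective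
      ((S.cut_of_piece_eq_inl hc hp).trans (S.cut_of_piece_eq_inl hc' (e ▸ hp)).symm))
  | inr d =>
    have h1 := S.piece_spec hc
    have h2 := S.piece_spec hc'
    rw [← e, hp] at h2
    rw [hp] at h1
    have hs : S.side h = S.side h' := h1.1.symm.trans h2.1
    have key : ∀ {k k' : D ⊕ A × Bool}, Central k' → S.side k = S.side k' →
        (∀ b, ¬ S.Beyond (S.side k) (S.pos k) b) → S.pos k' ≤ S.pos k := by
      intro k k' hc hs hb
      rcases k' with d | ⟨a, b⟩
      · exact S.pos_nonneg k
      · obtain rfl : b = true := hc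
        by_contra! hlt
        exact hb a ⟨by simpa [side_true] using hs.symm, by simpa [pos_true] using hlt⟩
    exact S.eq_of_side_eq_of_pos_eq hs (le_antisymm (key hc hs.symm h2.2) (key hc' hs h1.2))

end Cut

end ArcSystem

end NeumannZagier

/-! ### Gauss–Bonnet and Stokes on the cut surface. -/

namespace NeumannZagier

namespace ArcSystem

variable {D A : Type} (S : ArcSystem D A) [Fintype D] [Fintype A]

/-- The angle of the cut surface at the start of a segment. -/
def angle (f : D → ℝ) : D ⊕ A × Bool → ℝ
  | .inl d => f d
  | .inr h => if h.2 then f (S.corner h.1) else - f (S.corner h.1)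

theorem angle_of_central {f : D → ℝ} {h : D ⊕ A × Bool} (hc : Central h) :
    S.angle f h = f (S.side h) := by
  rcases h with d | ⟨a, b⟩
  · rfl
  · obtain rfl : b = true := hc
    rfl

/-- The segment that follows on the boundary of a piece of a cut triangle. -/
noncomputable def next (h : D ⊕ A × Bool) : D ⊕ A × Bool := S.cutσ (S.cutα h)

/-- A triangle of the surface, as the set of its sides. -/
def triangle [DecidableEq D] (d : D) : Finset D := {d, S.φ d, S.φ (S.φ d)}

theorem triangle_φ [DecidableEq D] (d : D) : S.triangle (S.φ d) = S.triangle d := by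
  ext x
  simp only [triangle, Finset.mem_insert, Finset.mem_singleton, S.φ_three]
  tauto

/-- The piece of a cut triangle to which a segment belongs. -/
noncomputable def cutFace [DecidableEq D] (h : D ⊕ A × Bool) : A ⊕ Finset D :=
  Sum.map id S.triangle (S.piece h)

theorem piece_not_central (a : A) : S.piece (.inr (a, false)) = .inl a := rfl

theorem cutFace_next [DecidableEq D] (h : D ⊕ A × Bool) : S.cutFace (S.next h) = S.cutFace h := by
  unfold next cutFace
  by_cases hc : Central h
  · cases hp : S.piece h with
    | inl a => rw [S.cut_of_piece_eq_inl hc hp, S.piece_not_central]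
    | inr d => rw [(S.piece_cut_of_eq_inr hc hp).2, Sum.map_inr, Sum.map_inr, S.triangle_φ]
  · obtain ⟨a, rfl⟩ := not_central hc
    rw [(S.central_cut_of_not_central a).2, S.piece_not_central]

/-- A piece at a corner is a bigon with the angles `f` and `-f`, and the central piece is a triangle
with angle sum 1. So the sum of `1 - angle` is 2 - 0 or 3 - 1. This is flatness of every face after
the cut. -/
theorem sum_angle_cutFace [DecidableEq D] [DecidableEq A] {f : D → ℝ}
    (hf : ∀ d, f d + f (S.φ d) + f (S.φ (S.φ d)) = 1) {Q : Finset (D ⊕ A × Bool)}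
    (hQ : ∀ h ∈ Q, S.next h ∈ Q) {k : D ⊕ A × Bool} (hk : k ∈ Q) :
    ∑ h ∈ Q with S.cutFace h = S.cutFace k, (1 - S.angle f h) = 2 := by
  have case_inl : ∀ a, S.piece k = .inl a →
      ∑ h ∈ Q with S.cutFace h = S.cutFace k, (1 - S.angle f h) = 2 := by
    intro a ha
    obtain ⟨h1, h2⟩ := S.central_cut_of_not_central a
    have hmem : Sum.inr (a, false) ∈ Q := by
      by_cases hc : Central k
      · rw [← S.cut_of_piece_eq_inl hc ha]
        exact hQ k hk
      · obtain ⟨b, rfl⟩ := not_central hc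
        obtain rfl : b = a := Sum.inl_injective ((S.piece_not_central b).symm.trans ha)
        exact hk
    have hset : Q.filter (fun h => S.cutFace h = S.cutFace k) =
        {.inr (a, false), S.next (.inr (a, false))} := by
      ext h
      simp only [Finset.mem_filter, Finset.mem_insert, Finset.mem_singleton]
      constructor
      · rintro ⟨-, h3⟩
        have hp : S.piece h = .inl a := by
          unfold cutFace at h3
          rw [ha] at h3
          cases h4 : S.piece h with
          | inl b => rw [h4] at h3; simpa using h3
          | inr d => rw [h4] at h3; simp at h3
        by_cases hc : Central h
        · exact Or.inr (S.piece_injective hc h1 (hp.trans h2.symm))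
        · obtain ⟨b, rfl⟩ := not_central hc
          exact Or.inl (by rw [Sum.inl_injective ((S.piece_not_central b).symm.trans hp)])
      · rintro (rfl | rfl)
        · exact ⟨hmem, by simp [cutFace, ha, S.piece_not_central]⟩
        · exact ⟨hQ _ hmem, by simp [cutFace, ha, next, h2]⟩
    have hcorner : S.side (S.next (.inr (a, false))) = S.corner a := by
      have := S.piece_spec h1
      rw [h2] at this
      exact this.1.1.symm
    have hne : Sum.inr (a, false) ≠ S.next (.inr (a, false)) := by
      intro e
      have h1' : Central (S.next (.inr (a, false))) := h1
      rw [← e] at h1'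
      exact absurd h1' (by simp [Central])
    rw [hset, Finset.sum_pair hne, S.angle_of_central (h := S.next _) h1, hcorner]
    simp [angle]; ring
  by_cases hc : Central k
  · cases hp : S.piece k with
    | inl a => exact case_inl a hp
    | inr d =>
      have c0 := hc
      obtain ⟨c1, p1⟩ := S.piece_cut_of_eq_inr hc hp
      obtain ⟨c2, p2⟩ := S.piece_cut_of_eq_inr c1 p1
      have hset : Q.filter (fun h => S.cutFace h = S.cutFace k) =
          {k, S.next k, S.next (S.next k)} := by
        ext h
        simp only [Finset.mem_filter, Finset.mem_insert, Finset.mem_singleton]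
        constructor
        · rintro ⟨-, h3⟩
          by_cases hch : Central h
          · have h3' := h3
            unfold cutFace at h3
            rw [hp] at h3
            cases h4 : S.piece h with
            | inl b => rw [h4] at h3; simp at h3
            | inr d' =>
              rw [h4, Sum.map_inr, Sum.map_inr] at h3
              have h5 : d' ∈ S.triangle d := by
                rw [← Sum.inr_injective h3]
                simp [triangle]
              simp only [triangle, Finset.mem_insert, Finset.mem_singleton] at h5
              rcases h5 with rfl | rfl | rfl
              · exact Or.inl (S.piece_injective hch c0 (h4.trans hp.symm))
              · exact Or.inr (Or.inl (S.piece_injective hch c1 (h4.trans p1.symm)))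
              · exact Or.inr (Or.inr (S.piece_injective hch c2 (h4.trans p2.symm)))
          · obtain ⟨b, rfl⟩ := not_central hch
            unfold cutFace at h3
            rw [hp, S.piece_not_central] at h3
            simp at h3
        · rintro (rfl | rfl | rfl)
          · exact ⟨hk, rfl⟩
          · exact ⟨hQ _ hk, S.cutFace_next _⟩
          · exact ⟨hQ _ (hQ _ hk), by rw [S.cutFace_next, S.cutFace_next]⟩
      have s0 := S.piece_spec c0
      have s1 := S.piece_spec c1
      have s2 := S.piece_spec c2
      rw [hp] at s0
      rw [p1] at s1
      rw [p2] at s2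
      have n1 : k ≠ S.next k := by
        intro e
        have : S.side k = S.side (S.next k) := congrArg _ e
        rw [← s0.1, show S.side (S.next k) = S.φ d from s1.1.symm] at this
        exact S.φ_ne _ this.symm
      have n2 : S.next k ≠ S.next (S.next k) := by
        intro e
        have : S.side (S.next k) = S.side (S.next (S.next k)) := congrArg _ e
        rw [show S.side (S.next k) = S.φ d from s1.1.symm,
          show S.side (S.next (S.next k)) = S.φ (S.φ d) from s2.1.symm] at this
        exact S.φ_ne _ this.symm
      have n3 : k ≠ S.next (S.next k) := by
        intro e
        have : S.side k = S.side (S.next (S.next k)) := congrArg _ e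
        rw [← s0.1, show S.side (S.next (S.next k)) = S.φ (S.φ d) from s2.1.symm] at this
        have h3 := congrArg S.φ this
        rw [S.φ_three] at h3
        exact S.φ_ne _ h3
      rw [hset, Finset.sum_insert (by simp [n1, n3]), Finset.sum_pair n2,
        S.angle_of_central c0, S.angle_of_central (h := S.next k) c1,
        S.angle_of_central (h := S.next (S.next k)) c2, ← s0.1,
        show S.side (S.next k) = S.φ d from s1.1.symm,
        show S.side (S.next (S.next k)) = S.φ (S.φ d) from s2.1.symm]
      linarith [hf d]
  · obtain ⟨a, rfl⟩ := not_central hc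
    exact case_inl a rfl

/-- Gauss-Bonnet and the bound on the Euler characteristic for a component `Q` of the cut surface. -/
theorem two_mul_card_caps_le [DecidableEq D] [DecidableEq A] {𝓥 C : Type} [DecidableEq 𝓥]
    [DecidableEq C] {f : D → ℝ} (hf : ∀ d, f d + f (S.φ d) + f (S.φ (S.φ d)) = 1)
    {Q : Finset (D ⊕ A × Bool)} (hQα : ∀ h, S.cutα h ∈ Q ↔ h ∈ Q)
    (hQσ : ∀ h, S.cutσ h ∈ Q ↔ h ∈ Q)
    (conn : ∀ u : D ⊕ A × Bool → ℝ, (∀ d, u (S.cutα d) = u d) → (∀ d, u (S.cutσ d) = u d) →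
      ∀ d ∈ Q, ∀ d' ∈ Q, u d = u d')
    {s : D → 𝓥} (hs : ∀ d, s (S.φ (S.α d)) = s d)
    (hsQ : ∀ d d', Sum.inl d ∈ Q → s d' = s d → Sum.inl d' ∈ Q)
    (hsf : ∀ d, Sum.inl d ∈ Q → ∑ d' with s d' = s d, f d' = 2)
    {cap : A × Bool → C} (hcap : ∀ h, cap ((S.j h).1, !(S.j h).2) = cap h) :
    2 * (((Finset.univ.filter fun h => Sum.inr h ∈ Q).image cap).card : ℝ) ≤
      4 + ∑ h with Sum.inr h ∈ Q, S.angle f (.inr h) := by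
  have hnext : ∀ h ∈ Q, S.next h ∈ Q := fun h hh => (hQσ _).2 ((hQα _).2 hh)
  have euler := card_image_vertex_add_card_image_face_le (α := S.cutα) (σ := S.cutσ)
    (F := S.cutFace) (V := Sum.map s cap) S.cutα_cutα S.cutα_ne
    (fun h => by
      have := S.cutFace_next (S.cutα h)
      rwa [next, S.cutα_cutα] at this)
    (fun h => by
      rcases h with d | h
      · simp [S.cutσ_inl, hs]
      · simp [S.cutσ_inr, hcap]) hQα hQσ conn
  have hV : Q.image (Sum.map s cap) = ((Finset.univ.filter fun d => Sum.inl d ∈ Q).image s).disjSum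
      ((Finset.univ.filter fun h => Sum.inr h ∈ Q).image cap) := by
    ext x
    rcases x with v | c <;> simp
  rw [hV, Finset.card_disjSum] at euler
  have hface : ∑ h ∈ Q, (1 - S.angle f h) = 2 * ((Q.image S.cutFace).card : ℝ) := by
    rw [← Finset.sum_fiberwise_of_maps_to (g := S.cutFace) (t := Q.image S.cutFace)
      (fun h hh => Finset.mem_image_of_mem _ hh), mul_comm, ← nsmul_eq_mul]
    apply Finset.sum_eq_card_nsmul
    intro y hy
    obtain ⟨k, hk, rfl⟩ := Finset.mem_image.1 hy
    exact S.sum_angle_cutFace hf hnext hk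
  have hvert : ∑ d with Sum.inl d ∈ Q, f d =
      2 * ((((Finset.univ.filter fun d => (Sum.inl d : D ⊕ A × Bool) ∈ Q)).image s).card : ℝ) := by
    rw [← Finset.sum_fiberwise_of_maps_to (g := s)
      (t := ((Finset.univ.filter fun d => (Sum.inl d : D ⊕ A × Bool) ∈ Q)).image s)
      (fun h hh => Finset.mem_image_of_mem _ hh), mul_comm, ← nsmul_eq_mul]
    apply Finset.sum_eq_card_nsmul
    intro y hy
    obtain ⟨k, hk, rfl⟩ := Finset.mem_image.1 hy
    simp only [Finset.mem_filter_univ] at hk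
    rw [← hsf k hk, Finset.filter_filter]
    refine Finset.sum_congr (Finset.filter_congr fun d _ => ?_) fun _ _ => rfl
    exact ⟨fun h => h.2, fun h => ⟨hsQ k d hk h, h⟩⟩
  have hsum : ∑ h ∈ Q, S.angle f h =
      ∑ d with Sum.inl d ∈ Q, f d + ∑ h with Sum.inr h ∈ Q, S.angle f (.inr h) := by
    rw [Finset.sum_filter, Finset.sum_filter, ← Finset.univ_inter Q, ← Finset.sum_ite_mem,
      Fintype.sum_sum_type]
    simp [angle]
  -- Every segment contributes 1 = (1 - angle) + angle. The first part counts faces twice, the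
  -- second counts the uncut vertices twice and leaves the boundary angle. Substituting into the
  -- Euler bound leaves only the caps.
  have hcard : (Q.card : ℝ) = ∑ h ∈ Q, (1 - S.angle f h) + ∑ h ∈ Q, S.angle f h := by
    rw [← Finset.sum_add_distrib]; simp
  have euler' : 2 * ((((Finset.univ.filter fun d => (Sum.inl d : D ⊕ A × Bool) ∈ Q).image s).card : ℝ)
      + ((Finset.univ.filter fun h => (Sum.inr h : D ⊕ A × Bool) ∈ Q).image cap).card +
      (Q.image S.cutFace).card) ≤ Q.card + 4 := by exact_mod_cast euler
  rw [hcard, hface, hsum, hvert] at euler'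
  linarith

/-- Stokes' theorem for a component `Q` of the cut surface. -/
theorem sum_side_eq_zero [DecidableEq D] [DecidableEq A] {𝓥 : Type} [DecidableEq 𝓥]
    {Q : Finset (D ⊕ A × Bool)} (hQα : ∀ h, S.cutα h ∈ Q ↔ h ∈ Q) {s : D → 𝓥}
    (hsQ : ∀ d d', Sum.inl d ∈ Q → s d' = s d → Sum.inl d' ∈ Q)
    {ω : D → ℝ} (hω : ∀ d, ω (S.α d) = - ω d)
    (hsω : ∀ d, Sum.inl d ∈ Q → ∑ d' with s d' = s d, ω d' = 0) :
    ∑ h with Sum.inr h ∈ Q, ω (S.side (.inr h)) = 0 := by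
  -- Each segment cancels with its reversal. The terms at uncut vertices vanish by closedness, so
  -- the boundary terms remain.
  have h1 : ∑ h ∈ Q, ω (S.side h) = 0 := by
    have : ∑ h ∈ Q, ω (S.side h) = ∑ h ∈ Q, - ω (S.side h) := by
      refine Finset.sum_bij (fun h _ => S.cutα h) (fun h hh => (hQα h).2 hh)
        (fun a _ b _ e => S.cutα.injective e)
        (fun b hb => ⟨S.cutα b, (hQα b).2 hb, S.cutα_cutα b⟩) (fun h _ => ?_)
      rw [S.side_cutα, hω, neg_neg]
    rw [Finset.sum_neg_distrib] at this
    linarith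
  have h2 : ∑ d with (Sum.inl d : D ⊕ A × Bool) ∈ Q, ω d = 0 := by
    rw [← Finset.sum_fiberwise_of_maps_to (g := s)
      (t := ((Finset.univ.filter fun d => (Sum.inl d : D ⊕ A × Bool) ∈ Q)).image s)
      (fun h hh => Finset.mem_image_of_mem _ hh)]
    apply Finset.sum_eq_zero
    intro y hy
    obtain ⟨k, hk, rfl⟩ := Finset.mem_image.1 hy
    simp only [Finset.mem_filter_univ] at hk
    rw [← hsω k hk, Finset.filter_filter]
    refine Finset.sum_congr (Finset.filter_congr fun d _ => ?_) fun _ _ => rfl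
    exact ⟨fun h => h.2, fun h => ⟨hsQ k d hk h, h⟩⟩
  rw [← Finset.univ_inter Q, ← Finset.sum_ite_mem, Fintype.sum_sum_type, ← Finset.sum_filter,
    ← Finset.sum_filter] at h1
  simp only [side_inl] at h1
  rw [h2, zero_add] at h1
  exact h1

end ArcSystem

end NeumannZagier

/-! ### Turning of two disjoint curves. -/

namespace NeumannZagier

/-- Two disjoint oriented simple closed normal curves (the arcs `a` with `which a = true` and the
others) on a triangulated closed surface. An arc enters its triangle through `inn a` and leaves it
through `out a`, turning around the corner at the start of `corner a`. -/
structure CurvePair (D A : Type) where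
  φ : Equiv.Perm D
  α : Equiv.Perm D
  φ_three : ∀ d, φ (φ (φ d)) = d
  φ_ne : ∀ d, φ d ≠ d
  α_α : ∀ d, α (α d) = d
  α_ne : ∀ d, α d ≠ d
  corner : A → D
  left : A → Bool
  which : A → Bool
  succ : Equiv.Perm A
  u : A → ℝ
  w : A → ℝ
  u_pos : ∀ a, 0 < u a
  u_lt : ∀ a, u a < 1
  w_pos : ∀ a, 0 < w a
  w_lt : ∀ a, w a < 1
  which_succ : ∀ a, which (succ a) = which a
  succ_trans : ∀ U : A → Prop, (∀ a, U a → U (succ a)) → ∀ a b, which a = which b → U a → U b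
  side_succ : ∀ a, (if left (succ a) then corner (succ a) else φ.symm (corner (succ a))) =
    α (if left a then φ.symm (corner a) else corner a)
  pos_succ : ∀ a, (if left (succ a) then u (succ a) else 1 - w (succ a)) =
    1 - (if left a then 1 - w a else u a)
  nested : ∀ a b, corner a = corner b → a ≠ b → (u a < u b ∧ w a < w b) ∨ (u b < u a ∧ w b < w a)
  disjoint : ∀ a b, corner b = φ (corner a) → u a < 1 - w b

namespace CurvePair

variable {D A : Type} (P : CurvePair D A)

/-- The side through which an arc leaves its triangle. -/
def out (a : A) : D := if P.left a then P.φ.symm (P.corner a) else P.corner a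

/-- The side through which an arc enters its triangle. -/
def inn (a : A) : D := if P.left a then P.corner a else P.φ.symm (P.corner a)

/-- The underlying arc system. -/
def toArcSystem : ArcSystem D A where
  φ := P.φ
  α := P.α
  φ_three := P.φ_three
  φ_ne := P.φ_ne
  α_α := P.α_α
  α_ne := P.α_ne
  corner := P.corner
  u := P.u
  w := P.w
  u_pos := P.u_pos
  u_lt := P.u_lt
  w_pos := P.w_pos
  w_lt := P.w_lt
  -- The end `(a, left a)` is where the arc enters; it is matched with the exit of the predecessor.
  -- The other end is matched with the entrance of the successor.
  j h := if h.2 = P.left h.1 then (P.succ.symm h.1, !P.left (P.succ.symm h.1))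
    else (P.succ h.1, P.left (P.succ h.1))
  j_j := by
    rintro ⟨a, b⟩
    dsimp only
    by_cases h : b = P.left a
    · rw [if_pos h]
      dsimp only
      rw [if_neg (by simp)]
      simp [h]
    · rw [if_neg h]
      dsimp only
      rw [if_pos rfl]
      simp only [Equiv.symm_apply_apply, Prod.mk.injEq, true_and]
      revert h; cases b <;> cases P.left a <;> simp
  side_j := by
    rintro ⟨a, b⟩
    dsimp only
    by_cases h : b = P.left a
    · have := P.side_succ (P.succ.symm a)
      rw [Equiv.apply_symm_apply] at this
      rw [if_pos h, h]
      dsimp only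
      rw [this, P.α_α]
      cases P.left (P.succ.symm a) <;> rfl
    · have := P.side_succ a
      rw [if_neg h]
      dsimp only
      rw [this]
      revert h; cases b <;> cases P.left a <;> simp
  pos_j := by
    rintro ⟨a, b⟩
    dsimp only
    by_cases h : b = P.left a
    · have := P.pos_succ (P.succ.symm a)
      rw [Equiv.apply_symm_apply] at this
      rw [if_pos h, h]
      dsimp only
      rw [this]
      cases P.left (P.succ.symm a) <;> simp
    · have := P.pos_succ a
      rw [if_neg h]
      dsimp only
      rw [this]
      revert h; cases b <;> cases P.left a <;> simp
  nested := P.nested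
  disjoint := P.disjoint

/-- The boundary circle of the cut surface on which one of the two sides of an arc lies. -/
def cap (h : A × Bool) : Bool × Bool := (P.which h.1, xor h.2 (P.left h.1))

theorem cap_j (h : A × Bool) :
    P.cap ((P.toArcSystem.j h).1, !(P.toArcSystem.j h).2) = P.cap h := by
  obtain ⟨a, b⟩ := h
  have hw : P.which (P.succ.symm a) = P.which a := by
    conv_rhs => rw [← P.succ.apply_symm_apply a, P.which_succ]
  simp only [toArcSystem, cap]
  by_cases h : b = P.left a
  · rw [if_pos h, h]
    simp [hw]
  · rw [if_neg h]
    simp only [P.which_succ]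
    revert h; cases b <;> cases P.left a <;> simp

theorem which_j (h : A × Bool) : P.which (P.toArcSystem.j h).1 = P.which h.1 :=
  congrArg Prod.fst (P.cap_j h)

/-- The total turning of one of the two curves. -/
def turning [Fintype A] (f : D → ℝ) (c : Bool) : ℝ :=
  ∑ a with P.which a = c, if P.left a then f (P.corner a) else - f (P.corner a)

theorem sum_cap [Fintype A] (g : A × Bool → ℝ) (c b : Bool) :
    ∑ h with P.cap h = (c, b), g h = ∑ a with P.which a = c, g (a, xor b (P.left a)) := by
  refine (Finset.sum_bij (fun a _ => (a, xor b (P.left a))) (fun a ha => ?_)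
    (fun a _ a' _ e => congrArg Prod.fst e) (fun h hh => ?_) (fun _ _ => rfl)).symm
  · simp only [Finset.mem_filter_univ] at ha
    simp [cap, ha]
  · simp only [Finset.mem_filter_univ, cap, Prod.mk.injEq] at hh
    obtain ⟨a, b'⟩ := h
    refine ⟨a, by simpa using hh.1, ?_⟩
    simp [← hh.2]

/-- Walking along a curve on a fixed side of it is rotation by `cutσ` around the cap (second entry
`true`: the left side), so an invariant set contains a boundary circle entirely or not at all. -/
theorem mem_of_cap_eq [Fintype D] [Fintype A] {Q : Finset (D ⊕ A × Bool)}
    (hQσ : ∀ h, P.toArcSystem.cutσ h ∈ Q ↔ h ∈ Q) {h h' : A × Bool} (e : P.cap h = P.cap h')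
    (hh : Sum.inr h ∈ Q) : Sum.inr h' ∈ Q := by
  obtain ⟨a, b⟩ := h
  obtain ⟨a', b'⟩ := h'
  simp only [cap, Prod.mk.injEq] at e
  have key : ∀ (c : Bool) (a : A), Sum.inr (a, xor c (P.left a)) ∈ Q ↔
      Sum.inr (P.succ a, xor c (P.left (P.succ a))) ∈ Q := by
    intro c a
    cases c
    · rw [← hQσ (.inr (P.succ a, _)), P.toArcSystem.cutσ_inr]
      simp [toArcSystem]
    · rw [← hQσ (.inr (a, _)), P.toArcSystem.cutσ_inr]
      simp [toArcSystem]
  have := P.succ_trans (fun a => Sum.inr (a, xor (xor b' (P.left a')) (P.left a)) ∈ Q)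
    (fun a ha => (key _ a).1 ha) a a' e.1
    (by rw [← e.2]; simpa [Bool.xor_assoc] using hh)
  simpa [Bool.xor_assoc] using this

section Hopf

variable [Fintype D] [Fintype A] [DecidableEq D] [DecidableEq A]

open Classical in
/-- The component of a segment in the cut surface. -/
noncomputable def component (h : D ⊕ A × Bool) : Finset (D ⊕ A × Bool) :=
  Finset.univ.filter fun k => Relation.EqvGen
    (fun x y => y = P.toArcSystem.cutα x ∨ y = P.toArcSystem.cutσ x) h k

theorem self_mem_component (h : D ⊕ A × Bool) : h ∈ P.component h := by
  simp only [component, Finset.mem_filter_univ]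
  exact Relation.EqvGen.refl h

theorem cutα_mem_component (h k : D ⊕ A × Bool) :
    P.toArcSystem.cutα k ∈ P.component h ↔ k ∈ P.component h := by
  simp only [component, Finset.mem_filter_univ]
  have := Relation.EqvGen.rel (r := fun x y => y = P.toArcSystem.cutα x ∨ y = P.toArcSystem.cutσ x)
    k (P.toArcSystem.cutα k) (Or.inl rfl)
  exact ⟨fun h1 => h1.trans _ _ _ (this.symm _ _), fun h1 => h1.trans _ _ _ this⟩

theorem cutσ_mem_component (h k : D ⊕ A × Bool) :
    P.toArcSystem.cutσ k ∈ P.component h ↔ k ∈ P.component h := by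
  simp only [component, Finset.mem_filter_univ]
  have := Relation.EqvGen.rel (r := fun x y => y = P.toArcSystem.cutα x ∨ y = P.toArcSystem.cutσ x)
    k (P.toArcSystem.cutσ k) (Or.inr rfl)
  exact ⟨fun h1 => h1.trans _ _ _ (this.symm _ _), fun h1 => h1.trans _ _ _ this⟩

theorem eq_of_mem_component {u : D ⊕ A × Bool → ℝ} (h1 : ∀ d, u (P.toArcSystem.cutα d) = u d)
    (h2 : ∀ d, u (P.toArcSystem.cutσ d) = u d) (h d : D ⊕ A × Bool) (hd : d ∈ P.component h) :
    u h = u d := by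
  simp only [component, Finset.mem_filter_univ] at hd
  induction hd with
  | rel x y e => rcases e with rfl | rfl <;> simp [h1, h2]
  | refl x => rfl
  | symm x y _ ih => exact ih.symm
  | trans x y z _ _ ih1 ih2 => exact ih1.trans ih2

/-- If a component of the cut surface contains both sides of one curve and none of the other one, the
surface is not connected. -/
theorem exists_invariant {Q : Finset (D ⊕ A × Bool)} (hQα : ∀ h, P.toArcSystem.cutα h ∈ Q ↔ h ∈ Q)
    (hQσ : ∀ h, P.toArcSystem.cutσ h ∈ Q ↔ h ∈ Q)
    (hQ : ∀ h, Sum.inr h ∈ Q ↔ P.which h.1 = true) :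
    ∃ U : D → Prop, (∀ d, U (P.φ d) ↔ U d) ∧ (∀ d, U (P.α d) ↔ U d) ∧
      ∀ a, U (P.corner a) ↔ P.which a = true := by
  set S := P.toArcSystem with hS
  have hj : ∀ k, Sum.inr (S.j k) ∈ Q ↔ Sum.inr k ∈ Q := fun k => by rw [hQ, hQ, P.which_j]
  -- Both sides of one curve lie in `Q` and none of the other, so membership does not change at a
  -- crossing point. In a counterexample of least position, the preceding segment on the same side
  -- would be a smaller one.
  have side : ∀ h, h ∈ Q ↔ Sum.inl (S.side h) ∈ Q := by
    by_contra! hcon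
    obtain ⟨h, hh, hmin⟩ := Finset.exists_min_image
      (Finset.univ.filter fun h => ¬ (h ∈ Q ↔ Sum.inl (S.side h) ∈ Q)) S.pos
      (by
        obtain ⟨h, hh⟩ := hcon
        exact ⟨h, by simp only [Finset.mem_filter_univ]; tauto⟩)
    simp only [Finset.mem_filter_univ] at hh hmin
    rcases h with d | k
    · exact hh Iff.rfl
    · have hs : S.side (S.cutα (.inr (S.j k))) = S.side (.inr k) := by
        rw [S.side_cutα, S.side_inr_j, S.α_α]
      have hp : S.pos (S.cutα (.inr (S.j k))) < S.pos (.inr k) := by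
        have := S.pos_cutFun_lt (.inr (S.j k))
        rw [S.pos_inr_j] at this
        exact lt_of_lt_of_eq this (by ring)
      refine hh ?_
      by_contra hne
      have := hmin (S.cutα (.inr (S.j k))) (by
        rw [hs, hQα, hj]
        exact hh)
      linarith
  have hα : ∀ d, Sum.inl (P.α d) ∈ Q ↔ Sum.inl d ∈ Q := by
    intro d
    rw [← hQα, side, S.side_cutα, S.side_inl, show S.α (P.α d) = d from P.α_α d]
  refine ⟨fun d => Sum.inl d ∈ Q, fun d => ?_, hα, fun a => ?_⟩
  · change Sum.inl (P.φ d) ∈ Q ↔ Sum.inl d ∈ Q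
    rw [← hα d, ← hQσ (.inl (P.α d)), S.cutσ_inl, show S.α (P.α d) = d from P.α_α d]
    exact Iff.rfl
  · change Sum.inl (P.corner a) ∈ Q ↔ _
    rw [← hQ (a, true), side (.inr (a, true))]
    exact Iff.rfl

/-- Disjoint simple closed curves on a torus that have period one with respect to the same
closed cochain have the same turning with respect to any angle structure. -/
theorem turning_eq {𝓥 : Type} [DecidableEq 𝓥] {f ω : D → ℝ}
    (hf : ∀ d, f d + f (P.φ d) + f (P.φ (P.φ d)) = 1)
    {s : D → 𝓥} (hs : ∀ d, s (P.φ (P.α d)) = s d)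
    (hsc : ∀ U : D → Prop, (∀ d, U (P.φ (P.α d)) ↔ U d) → ∀ d d', s d' = s d → U d → U d')
    (hsf : ∀ d, ∑ d' with s d' = s d, f d' = 2)
    (hω : ∀ d, ω (P.α d) = - ω d) (hsω : ∀ d, ∑ d' with s d' = s d, ω d' = 0)
    (conn : ∀ U : D → Prop, (∀ d, U (P.φ d) ↔ U d) → (∀ d, U (P.α d) ↔ U d) →
      ∀ a b, P.which a = true → P.which b = false → U (P.corner a) → U (P.corner b))
    (hx : ∀ c, ∑ a with P.which a = c, ω (P.out a) = 1) :
    P.turning f true = P.turning f false := by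
  classical
  set S := P.toArcSystem with hS
  have ωin : ∀ c, ∑ a with P.which a = c, ω (P.inn a) = -1 := by
    intro c
    rw [← hx c, ← Finset.sum_neg_distrib]
    refine (Finset.sum_bij (fun a _ => P.succ a) (fun a ha => ?_)
      (fun a _ b _ e => P.succ.injective e) (fun b hb => ⟨P.succ.symm b, ?_, by simp⟩)
      (fun a _ => ?_)).symm
    · simpa [P.which_succ] using ha
    · simp only [Finset.mem_filter_univ] at hb ⊢
      rw [← P.which_succ, Equiv.apply_symm_apply, hb]
    · rw [← hω]
      exact congrArg ω (P.side_succ a).symm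
  have nonempty : ∀ c, ∃ a, P.which a = c := by
    intro c
    by_contra! h
    have := hx c
    rw [Finset.filter_false_of_mem (fun a _ => h a)] at this
    simp at this
  -- summation over the part of the boundary in a component
  have hcapsum : ∀ (Q : Finset (D ⊕ A × Bool)), (∀ h, S.cutσ h ∈ Q ↔ h ∈ Q) →
      ∀ g : A × Bool → ℝ, ∑ h with Sum.inr h ∈ Q, g h =
        ∑ c ∈ (Finset.univ.filter fun h => Sum.inr h ∈ Q).image P.cap,
          ∑ h with P.cap h = c, g h := by
    intro Q hQσ g
    rw [← Finset.sum_fiberwise_of_maps_to (g := P.cap)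
      (t := (Finset.univ.filter fun h => Sum.inr h ∈ Q).image P.cap)
      (fun h hh => Finset.mem_image_of_mem _ hh)]
    refine Finset.sum_congr rfl fun c hc => ?_
    obtain ⟨k, hk, rfl⟩ := Finset.mem_image.1 hc
    simp only [Finset.mem_filter_univ] at hk
    rw [Finset.filter_filter]
    refine Finset.sum_congr (Finset.filter_congr fun h _ => ?_) fun _ _ => rfl
    exact ⟨fun h => h.2, fun h => ⟨P.mem_of_cap_eq hQσ h.symm hk, h⟩⟩
  have hangle : ∀ c b, ∑ h with P.cap h = (c, b), S.angle f (.inr h) =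
      if b then - P.turning f c else P.turning f c := by
    intro c b
    rw [P.sum_cap]
    cases b
    · simp only [turning, Bool.false_eq_true, if_false]
      refine Finset.sum_congr rfl fun a _ => ?_
      cases h : P.left a <;> simp [ArcSystem.angle, hS, toArcSystem]
    · simp only [turning, if_true, ← Finset.sum_neg_distrib]
      refine Finset.sum_congr rfl fun a _ => ?_
      cases h : P.left a <;> simp [ArcSystem.angle, hS, toArcSystem]
  have hside : ∀ c b, ∑ h with P.cap h = (c, b), ω (S.side (.inr h)) =
      if b then 1 else -1 := by
    intro c b
    rw [P.sum_cap]
    cases b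
    · simp only [Bool.false_eq_true, if_false]
      rw [← ωin c]
      refine Finset.sum_congr rfl fun a _ => ?_
      cases h : P.left a <;> simp [ArcSystem.side, hS, toArcSystem, inn, h]
    · simp only [if_true]
      rw [← hx c]
      refine Finset.sum_congr rfl fun a _ => ?_
      cases h : P.left a <;> simp [ArcSystem.side, hS, toArcSystem, out, h]
  -- the constraints for one component
  have comp : ∀ h₀, ∃ C : Finset (Bool × Bool),
      (∀ h, P.cap h ∈ C ↔ Sum.inr h ∈ P.component h₀) ∧
      ∑ c ∈ C, (if c.2 then (1 : ℝ) else -1) = 0 ∧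
      2 * (C.card : ℝ) ≤ 4 +
        ∑ c ∈ C, (if c.2 then - P.turning f c.1 else P.turning f c.1) ∧
      ¬ (∀ c, c ∈ C ↔ c.1 = true) := by
    intro h₀
    have hQα := P.cutα_mem_component h₀
    have hQσ := P.cutσ_mem_component h₀
    set Q := P.component h₀
    have hsQ : ∀ d d', Sum.inl d ∈ Q → s d' = s d → Sum.inl d' ∈ Q := fun d d' hd e =>
      hsc (fun d => Sum.inl d ∈ Q) (fun d => by
        rw [← hQσ (.inl d), S.cutσ_inl]; exact Iff.rfl) d d' e hd
    have hmem : ∀ h, P.cap h ∈ (Finset.univ.filter fun h => Sum.inr h ∈ Q).image P.cap ↔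
        Sum.inr h ∈ Q := by
      intro h
      simp only [Finset.mem_image, Finset.mem_filter_univ]
      exact ⟨fun ⟨k, hk, e⟩ => P.mem_of_cap_eq hQσ e hk, fun hh => ⟨h, hh, rfl⟩⟩
    refine ⟨(Finset.univ.filter fun h => Sum.inr h ∈ Q).image P.cap, hmem, ?_, ?_, ?_⟩
    · have := S.sum_side_eq_zero hQα hsQ hω fun d _ => hsω d
      rw [hcapsum Q hQσ] at this
      rw [← this]
      exact Finset.sum_congr rfl fun c _ => (hside c.1 c.2).symm
    · have := S.two_mul_card_caps_le hf hQα hQσ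
        (fun u h1 h2 d hd d' hd' => (P.eq_of_mem_component h1 h2 h₀ d hd).symm.trans
          (P.eq_of_mem_component h1 h2 h₀ d' hd')) hs hsQ (fun d _ => hsf d) P.cap_j
      rw [hcapsum Q hQσ] at this
      refine this.trans (le_of_eq ?_)
      congr 1
      exact Finset.sum_congr rfl fun c _ => hangle c.1 c.2
    · intro hC
      obtain ⟨U, hU1, hU2, hU3⟩ := P.exists_invariant hQα hQσ fun h => by
        rw [← hmem, hC]; rfl
      obtain ⟨a, ha⟩ := nonempty true
      obtain ⟨b, hb⟩ := nonempty false
      have := (hU3 b).1 (conn U hU1 hU2 a b ha hb ((hU3 a).2 ha))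
      rw [hb] at this
      exact absurd this (by simp)
  obtain ⟨a, ha⟩ := nonempty true
  have capx : ∀ b, P.cap (a, xor b (P.left a)) = (true, b) := fun b => by
    simp [cap, ha]
  -- In the component of one side of the first curve, Stokes forces as many left as right sides.
  -- Both sides of the first curve alone are excluded by connectedness, and all four boundary
  -- circles would give 8 ≤ 4. There remains one side of each curve, where Gauss–Bonnet bounds one
  -- turning by the other; the other side of the first curve gives the reverse bound.
  have ineq : ∀ b : Bool, (if b then (1 : ℝ) else -1) * (P.turning f true - P.turning f false) ≤ 0 := by
    intro b
    obtain ⟨C, h1, h2, h3, h4⟩ := comp (.inr (a, xor b (P.left a)))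
    have hb : (true, b) ∈ C := by
      rw [← capx, h1]
      exact P.self_mem_component _
    have hsumC : ∀ g : Bool × Bool → ℝ, ∑ c ∈ C, g c =
        (if (true, true) ∈ C then g (true, true) else 0) +
        (if (true, false) ∈ C then g (true, false) else 0) +
        ((if (false, true) ∈ C then g (false, true) else 0) +
        (if (false, false) ∈ C then g (false, false) else 0)) := by
      intro g
      rw [← Finset.univ_inter C, ← Finset.sum_ite_mem, Fintype.sum_prod_type]
      simp
    rw [Finset.cast_card, hsumC, hsumC] at h3
    rw [hsumC] at h2
    have h4' : ¬ ((true, true) ∈ C ∧ (true, false) ∈ C ∧ (false, true) ∉ C ∧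
        (false, false) ∉ C) := by
      rintro ⟨c1, c2, c3, c4⟩
      refine h4 ?_
      rintro ⟨_ | _, _ | _⟩ <;> simp [c1, c2, c3, c4]
    by_cases c1 : (true, true) ∈ C <;> by_cases c2 : (true, false) ∈ C <;>
      by_cases c3 : (false, true) ∈ C <;> by_cases c4 : (false, false) ∈ C <;>
      cases b <;> simp [c1, c2, c3, c4] at h2 h3 h4' hb ⊢ <;> linarith
  have i1 := ineq true
  have i2 := ineq false
  simp only [if_true, Bool.false_eq_true, if_false] at i1 i2
  linarith

end Hopf

end CurvePair

end NeumannZagier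

/-! ### Cyclic covers whose sheets carry different triangulations. -/

namespace NeumannZagier

/-- Two triangulated tori (`pat d` tells to which of them a side `d` belongs) which agree except for
the way in which certain regions are subdivided; the sides inside of these regions are not `outer`, and
`flip` matches the outer sides of both triangulations. The map `loc` groups the corners of triangles
(represented by the sides that start there) according to the corner of the region in which they lie,
`lab` and `g` give the vertices at which they lie and a potential for the cocycle `τ`
around vertices. Locations with `axis` lie at vertices inside of the regions. -/
structure HybridData (𝔻 A 𝓦 𝓛 : Type) extends CurvePair 𝔻 A where
  pat : 𝔻 → Bool
  flip : 𝔻 → 𝔻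
  outer : 𝔻 → Prop
  τ : 𝔻 → ℤ
  ω : 𝔻 → ℝ
  f : 𝔻 → ℝ
  loc : 𝔻 → 𝓦
  axis : 𝓦 → Prop
  lab : 𝓦 → 𝓛
  g : 𝓦 → ℤ
  pat_φ : ∀ d, pat (φ d) = pat d
  pat_α : ∀ d, pat (α d) = pat d
  pat_flip : ∀ d, pat (flip d) = !pat d
  pat_corner : ∀ a, pat (corner a) = which a
  τ_α : ∀ d, τ (α d) = - τ d
  ω_α : ∀ d, ω (α d) = - ω d
  τ_inner : ∀ d, ¬ outer d → τ d = 0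
  ω_inner : ∀ d, ¬ outer d → ω d = 0
  loc_inner : ∀ d, ¬ outer d → loc (φ d) = loc (α d)
  flip_flip : ∀ d, outer d → flip (flip d) = d
  outer_flip : ∀ d, outer d → outer (flip d)
  α_flip : ∀ d, outer d → α (flip d) = flip (α d)
  outer_α : ∀ d, outer d → outer (α d)
  τ_flip : ∀ d, outer d → τ (flip d) = τ d
  ω_flip : ∀ d, outer d → ω (flip d) = ω d
  loc_flip : ∀ d, outer d → loc (flip d) = loc d
  loc_φ_flip : ∀ d, outer d → loc (φ (flip d)) = loc (φ d)
  lab_outer : ∀ d, outer d → lab (loc (φ d)) = lab (loc (α d))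
  g_outer : ∀ d, outer d → g (loc (α d)) = g (loc (φ d)) + τ d
  loc_conn : ∀ U : 𝔻 → Prop, (∀ d, ¬ outer d → (U (φ d) ↔ U (α d))) →
    ∀ d d', pat d = pat d' → loc d = loc d' → U d → U d'
  exists_loc : ∀ d, ¬ axis (loc d) → ∃ d', pat d' = !pat d ∧ loc d' = loc d
  axis_lab : ∀ d d', axis (loc d) → lab (loc d') = lab (loc d) → loc d' = loc d
  exists_not_axis : ∀ d, ¬ axis (loc d) ∨ ¬ axis (loc (φ d)) ∨ ¬ axis (loc (φ (φ d)))
  inner_φ : ∀ d, pat d = true → ¬ outer d → outer (φ d) ∧ outer (φ (φ d))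
  lab_conn : ∀ U : 𝔻 → Prop, (∀ d, U (φ d) ↔ U (α d)) →
    ∀ d d', pat d = true → pat d' = true → lab (loc d) = lab (loc d') → U d → U d'
  conn : ∀ v : 𝔻 → ℤ → Prop, (∀ d n, pat d = true → (v (φ d) n ↔ v d n)) →
    (∀ d n, pat d = true → (v (α d) (n + τ d) ↔ v d n)) →
    ∀ d d' n n', pat d = true → pat d' = true → v d n → v d' n'

namespace HybridData

variable {𝔻 A 𝓦 𝓛 : Type} (H : HybridData 𝔻 A 𝓦 𝓛)

section Cover

variable {K : ℕ} (b : ZMod K → Bool)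

/-- The sides of the cyclic cover of degree `K` in which the sheet `n` carries the triangulation
`b n`. -/
abbrev Cover : Type := {x : 𝔻 × ZMod K // H.pat x.1 = b x.2}

variable {H b} in
theorem Cover.ext {x y : H.Cover b} (h1 : x.1.1 = y.1.1) (h2 : x.1.2 = y.1.2) : x = y :=
  Subtype.ext (Prod.ext h1 h2)

/-- The next side of the same triangle. -/
def coverφ : Equiv.Perm (H.Cover b) where
  toFun x := ⟨(H.φ x.1.1, x.1.2), by rw [H.pat_φ]; exact x.2⟩
  invFun x := ⟨(H.φ.symm x.1.1, x.1.2), by rw [← H.pat_φ, Equiv.apply_symm_apply]; exact x.2⟩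
  left_inv x := Cover.ext (by simp) rfl
  right_inv x := Cover.ext (by simp) rfl

theorem outer_of_ne {d : 𝔻} (h : H.τ d ≠ 0) : H.outer d := by
  by_contra hn
  exact h (H.τ_inner d hn)

/-- The other side of the same edge. -/
def coverαFun (x : H.Cover b) : H.Cover b :=
  ⟨(if b (x.1.2 + H.τ x.1.1) = b x.1.2 then H.α x.1.1 else H.flip (H.α x.1.1),
    x.1.2 + H.τ x.1.1), by
    have hx := x.2
    by_cases h : b (x.1.2 + H.τ x.1.1) = b x.1.2
    · rw [if_pos h]
      change H.pat (H.α x.1.1) = b (x.1.2 + H.τ x.1.1)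
      rw [H.pat_α, hx, h]
    · rw [if_neg h]
      change H.pat (H.flip (H.α x.1.1)) = b (x.1.2 + H.τ x.1.1)
      rw [H.pat_flip, H.pat_α, hx]
      revert h
      cases b x.1.2 <;> cases b (x.1.2 + H.τ x.1.1) <;> simp⟩

/-- Sheets change only where `τ` is nonzero, hence only at outer sides. So the passage between the
two triangulations uses only sides that have a match. -/
theorem outer_of_sheet {x : H.Cover b} (h : b (x.1.2 + H.τ x.1.1) ≠ b x.1.2) : H.outer x.1.1 :=
  H.outer_of_ne fun e => h (by rw [e]; simp)

theorem coverαFun_coverαFun (x : H.Cover b) : H.coverαFun b (H.coverαFun b x) = x := by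
  by_cases h : b (x.1.2 + H.τ x.1.1) = b x.1.2
  · have h1 : H.coverαFun b x = ⟨(H.α x.1.1, x.1.2 + H.τ x.1.1), by
        rw [H.pat_α]; exact x.2.trans h.symm⟩ := Cover.ext (by simp [coverαFun, h]) rfl
    rw [h1]
    apply Cover.ext
    · simp [coverαFun, H.τ_α, h, H.α_α]
    · simp [coverαFun, H.τ_α]
  · have ho := H.outer_of_sheet b h
    have ho' := H.outer_α _ ho
    have h1 : (H.coverαFun b x).1 = (H.flip (H.α x.1.1), x.1.2 + H.τ x.1.1) := by
      simp [coverαFun, h]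
    have hτ : H.τ (H.coverαFun b x).1.1 = - H.τ x.1.1 := by
      rw [h1, H.τ_flip _ ho', H.τ_α]
    have h2 : (H.coverαFun b x).1.2 + ((H.τ (H.coverαFun b x).1.1 : ℤ) : ZMod K) = x.1.2 := by
      rw [hτ, h1]; simp
    apply Cover.ext
    · change (if b ((H.coverαFun b x).1.2 + ((H.τ (H.coverαFun b x).1.1 : ℤ) : ZMod K)) =
        b (H.coverαFun b x).1.2 then _ else _) = _
      rw [h2, if_neg (by rw [h1]; exact fun e => h e.symm), h1]
      dsimp only
      rw [H.α_flip _ ho', H.α_α, H.flip_flip _ ho]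
    · exact h2

/-- The other side of the same edge. -/
def coverα : Equiv.Perm (H.Cover b) :=
  Function.Involutive.toPerm (H.coverαFun b) (H.coverαFun_coverαFun b)

theorem coverα_sheet (x : H.Cover b) : (H.coverα b x).1.2 = x.1.2 + H.τ x.1.1 := rfl

theorem coverα_of_eq {x : H.Cover b} (h : b (x.1.2 + H.τ x.1.1) = b x.1.2) :
    (H.coverα b x).1.1 = H.α x.1.1 := if_pos h

theorem coverα_of_ne {x : H.Cover b} (h : b (x.1.2 + H.τ x.1.1) ≠ b x.1.2) :
    (H.coverα b x).1.1 = H.flip (H.α x.1.1) := if_neg h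

theorem coverα_coverα (x : H.Cover b) : H.coverα b (H.coverα b x) = x :=
  H.coverαFun_coverαFun b x

theorem loc_coverα (x : H.Cover b) : H.loc (H.coverα b x).1.1 = H.loc (H.α x.1.1) := by
  by_cases h : b (x.1.2 + H.τ x.1.1) = b x.1.2
  · rw [H.coverα_of_eq b h]
  · rw [H.coverα_of_ne b h, H.loc_flip _ (H.outer_α _ (H.outer_of_sheet b h))]

theorem ω_coverα (x : H.Cover b) : H.ω (H.coverα b x).1.1 = - H.ω x.1.1 := by
  by_cases h : b (x.1.2 + H.τ x.1.1) = b x.1.2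
  · rw [H.coverα_of_eq b h, H.ω_α]
  · rw [H.coverα_of_ne b h, H.ω_flip _ (H.outer_α _ (H.outer_of_sheet b h)), H.ω_α]

theorem coverα_ne (x : H.Cover b) : H.coverα b x ≠ x := by
  intro e
  by_cases h : b (x.1.2 + H.τ x.1.1) = b x.1.2
  · have := H.coverα_of_eq b h
    rw [e] at this
    exact H.α_ne _ this.symm
  · have := H.coverα_sheet b x
    rw [e] at this
    rw [← this] at h
    exact h rfl

/-- The vertex at which a side of the cover starts. -/
def coverLab (x : H.Cover b) : 𝓛 × ZMod K :=
  (H.lab (H.loc x.1.1), x.1.2 - H.g (H.loc x.1.1))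

theorem lab_φ (d : 𝔻) : H.lab (H.loc (H.φ d)) = H.lab (H.loc (H.α d)) := by
  by_cases h : H.outer d
  · exact H.lab_outer d h
  · rw [H.loc_inner d h]

theorem g_α (d : 𝔻) : H.g (H.loc (H.α d)) = H.g (H.loc (H.φ d)) + H.τ d := by
  by_cases h : H.outer d
  · exact H.g_outer d h
  · rw [H.loc_inner d h, H.τ_inner d h, add_zero]

theorem coverLab_φ (x : H.Cover b) :
    H.coverLab b (H.coverφ b x) = H.coverLab b (H.coverα b x) := by
  unfold coverLab
  rw [H.loc_coverα, H.coverα_sheet, H.g_α, ← H.lab_φ]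
  refine Prod.ext rfl ?_
  change x.1.2 - _ = _
  push_cast
  simp [coverφ]

/-- Corners at one location are linked by crossing inner sides, and there `τ` vanishes, so the links
stay on one sheet. -/
theorem cover_conn_loc {U : H.Cover b → Prop} (hU : ∀ x, U (H.coverφ b x) ↔ U (H.coverα b x))
    {x y : H.Cover b} (h1 : x.1.2 = y.1.2) (h2 : H.loc x.1.1 = H.loc y.1.1) (hx : U x) : U y := by
  have := H.loc_conn (fun d => ∀ h : H.pat d = b x.1.2, U ⟨(d, x.1.2), h⟩) (fun d hd => ?_)
    x.1.1 y.1.1 (by rw [x.2, y.2, h1]) h2 (fun h => hx) (by rw [y.2, h1])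
  · have e : (⟨(y.1.1, x.1.2), by rw [y.2, h1]⟩ : H.Cover b) = y := Cover.ext rfl h1
    rwa [e] at this
  · have key : ∀ h : H.pat d = b x.1.2, U ⟨(H.φ d, x.1.2), by rw [H.pat_φ]; exact h⟩ ↔
        U ⟨(H.α d, x.1.2), by rw [H.pat_α]; exact h⟩ := by
      intro h
      have h3 := hU ⟨(d, x.1.2), h⟩
      have h4 : H.coverα b ⟨(d, x.1.2), h⟩ = ⟨(H.α d, x.1.2), by rw [H.pat_α]; exact h⟩ :=
        Cover.ext (H.coverα_of_eq b (by simp [H.τ_inner d hd]))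
          (by
            change x.1.2 + ((H.τ d : ℤ) : ZMod K) = x.1.2
            simp [H.τ_inner d hd])
      rw [h4] at h3
      exact h3
    exact ⟨fun h3 h => (key (by rwa [H.pat_α] at h)).1 (h3 (by rwa [H.pat_φ, ← H.pat_α])),
      fun h3 h => (key (by rwa [H.pat_φ] at h)).2 (h3 (by rwa [H.pat_α, ← H.pat_φ]))⟩

/-- A property of sides of the cover, read off at a location. -/
def AtLoc (U : H.Cover b → Prop) (d : 𝔻) (n : ZMod K) : Prop :=
  ∃ x : H.Cover b, x.1.2 = n ∧ H.loc x.1.1 = H.loc d ∧ U x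

theorem atLoc_iff {U : H.Cover b → Prop} (hU : ∀ x, U (H.coverφ b x) ↔ U (H.coverα b x))
    {d : 𝔻} {n : ZMod K} {x : H.Cover b} (h1 : x.1.2 = n) (h2 : H.loc x.1.1 = H.loc d) :
    H.AtLoc b U d n ↔ U x :=
  ⟨fun ⟨_, k1, k2, k3⟩ => H.cover_conn_loc b hU (k1.trans h1.symm) (k2.trans h2.symm) k3,
    fun h => ⟨x, h1, h2, h⟩⟩

/-- Whichever triangulation a sheet carries, an outer side is present on it, as itself or as its
match, with the same surroundings. -/
theorem exists_cover (d : 𝔻) (hd : H.outer d) (n : ZMod K) :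
    ∃ x : H.Cover b, x.1.2 = n ∧ H.loc x.1.1 = H.loc d ∧ H.loc (H.φ x.1.1) = H.loc (H.φ d) ∧
      H.loc (H.α x.1.1) = H.loc (H.α d) ∧ H.τ x.1.1 = H.τ d := by
  by_cases h : H.pat d = b n
  · exact ⟨⟨(d, n), h⟩, rfl, rfl, rfl, rfl, rfl⟩
  · refine ⟨⟨(H.flip d, n), ?_⟩, rfl, H.loc_flip d hd, H.loc_φ_flip d hd, ?_, H.τ_flip d hd⟩
    · rw [H.pat_flip]
      revert h
      dsimp only
      cases H.pat d <;> cases b n <;> simp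
    · dsimp only
      rw [H.α_flip d hd, H.loc_flip _ (H.outer_α d hd)]

theorem atLoc_φ {U : H.Cover b → Prop} (hU : ∀ x, U (H.coverφ b x) ↔ U (H.coverα b x))
    (d : 𝔻) (n : ZMod K) : H.AtLoc b U (H.φ d) n ↔ H.AtLoc b U (H.α d) (n + H.τ d) := by
  by_cases h : H.outer d
  · obtain ⟨x, h1, -, h3, h4, h5⟩ := H.exists_cover b d h n
    rw [H.atLoc_iff b hU (x := H.coverφ b x) h1 h3, H.atLoc_iff b hU (x := H.coverα b x)
      (by rw [H.coverα_sheet, h1, h5]) (by rw [H.loc_coverα, h4]), hU]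
  · unfold AtLoc
    rw [H.loc_inner d h, H.τ_inner d h]
    simp

theorem exists_pat_true {d : 𝔻} (h : ¬ H.axis (H.loc d)) :
    ∃ e, H.pat e = true ∧ H.loc e = H.loc d := by
  cases hd : H.pat d
  · obtain ⟨e, h1, h2⟩ := H.exists_loc d h
    exact ⟨e, by rw [h1, hd]; rfl, h2⟩
  · exact ⟨d, hd, rfl⟩

/-- A location away from the axis occurs in both triangulations, so `AtLoc` makes sense on every
sheet and connectedness around a vertex can be borrowed from the first triangulation. An axis vertex
consists of a single location. -/
theorem cover_conn_lab {U : H.Cover b → Prop} (hU : ∀ x, U (H.coverφ b x) ↔ U (H.coverα b x))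
    {x y : H.Cover b} (h : H.coverLab b x = H.coverLab b y) (hx : U x) : U y := by
  have h1 : H.lab (H.loc x.1.1) = H.lab (H.loc y.1.1) := congrArg Prod.fst h
  have h2 : x.1.2 - H.g (H.loc x.1.1) = y.1.2 - H.g (H.loc y.1.1) := congrArg Prod.snd h
  by_cases hax : H.axis (H.loc x.1.1)
  · have h3 := H.axis_lab x.1.1 y.1.1 hax h1.symm
    rw [h3] at h2
    exact H.cover_conn_loc b hU (sub_left_injective h2) h3.symm hx
  · have hay : ¬ H.axis (H.loc y.1.1) := fun hay =>
      hax (by rwa [H.axis_lab y.1.1 x.1.1 hay h1])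
    obtain ⟨e, e1, e2⟩ := H.exists_pat_true hax
    obtain ⟨e', e1', e2'⟩ := H.exists_pat_true hay
    have := H.lab_conn
      (fun d => H.AtLoc b U d (x.1.2 - H.g (H.loc x.1.1) + H.g (H.loc d)))
      (fun d => by
        rw [H.atLoc_φ b hU, H.g_α]
        push_cast
        rw [add_assoc]) e e' e1 e1' (by rw [e2, e2', h1])
      ((H.atLoc_iff b hU (x := x) (by rw [e2]; ring) e2.symm).2 hx)
    exact (H.atLoc_iff b hU (x := y) (by rw [e2', h2]; ring) e2'.symm).1 this

/-- Connectedness of the infinite cyclic cover of the first triangulation passes to the mixed finite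
cover by reading properties at locations. Every triangle has a corner away from the axis, at which
such a reading is possible. -/
theorem cover_conn {U : H.Cover b → Prop} (h1 : ∀ x, U (H.coverφ b x) ↔ U x)
    (h2 : ∀ x, U (H.coverα b x) ↔ U x) {x y : H.Cover b} (hx : U x) : U y := by
  have hU : ∀ x, U (H.coverφ b x) ↔ U (H.coverα b x) := fun x => by rw [h1, h2]
  have houter : ∀ d, H.outer d → ∀ n, (H.AtLoc b U (H.φ d) n ↔ H.AtLoc b U d n) := by
    intro d hd n
    obtain ⟨x, k1, k2, k3, -, -⟩ := H.exists_cover b d hd n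
    rw [H.atLoc_iff b hU (x := H.coverφ b x) k1 k3, H.atLoc_iff b hU (x := x) k1 k2, h1]
  have hφ : ∀ d n, H.pat d = true → (H.AtLoc b U (H.φ d) n ↔ H.AtLoc b U d n) := by
    intro d n hd
    by_cases ho : H.outer d
    · exact houter d ho n
    · obtain ⟨o1, o2⟩ := H.inner_φ d hd ho
      rw [← houter _ o1, ← houter _ o2, H.φ_three]
  have key : ∀ d d' : 𝔻, H.pat d = true → H.pat d' = true → ∀ n n' : ZMod K,
      H.AtLoc b U d n → H.AtLoc b U d' n' := by
    intro d d' hd hd' n n' h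
    obtain ⟨m, rfl⟩ := ZMod.intCast_surjective n
    obtain ⟨m', rfl⟩ := ZMod.intCast_surjective n'
    refine H.conn (fun d m => H.AtLoc b U d (m : ZMod K)) (fun d n hd => hφ d n hd)
      (fun d n hd => ?_) d d' m m' hd hd' h
    rw [← hφ d n hd, H.atLoc_φ b hU]
    push_cast
    rfl
  have toNotAxis : ∀ x : H.Cover b, ∃ y : H.Cover b, ¬ H.axis (H.loc y.1.1) ∧ (U y ↔ U x) := by
    intro x
    rcases H.exists_not_axis x.1.1 with h | h | h
    · exact ⟨x, h, Iff.rfl⟩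
    · exact ⟨H.coverφ b x, h, h1 x⟩
    · exact ⟨H.coverφ b (H.coverφ b x), h, by rw [h1, h1]⟩
  obtain ⟨x', hax, ex⟩ := toNotAxis x
  obtain ⟨y', hay, ey⟩ := toNotAxis y
  obtain ⟨e, e1, e2⟩ := H.exists_pat_true hax
  obtain ⟨e', e1', e2'⟩ := H.exists_pat_true hay
  have h3 := key e e' e1 e1' x'.1.2 y'.1.2
    ((H.atLoc_iff b hU (x := x') rfl e2.symm).2 (ex.2 hx))
  exact ey.1 ((H.atLoc_iff b hU (x := y') rfl e2'.symm).1 h3)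

/-- At a location away from the axis both triangulations contribute the same sum, so all sheets can
be treated as if they carried the first triangulation. The sum around a vertex of the cover then
reduces to the sum below. -/
theorem cover_sum [Fintype 𝔻] [NeZero K] [Fintype (H.Cover b)] [DecidableEq 𝓛] [DecidableEq 𝓦]
    {wt : 𝔻 → ℝ} {C : ℝ}
    (dist : ∀ l, ¬ H.axis l → ∑ d with H.loc d = l ∧ H.pat d = true, wt d =
      ∑ d with H.loc d = l ∧ H.pat d = false, wt d)
    (hC : ∀ d, ∑ d' with H.pat d' = H.pat d ∧ H.lab (H.loc d') = H.lab (H.loc d), wt d' = C)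
    (x : H.Cover b) : ∑ y with H.coverLab b y = H.coverLab b x, wt y.1.1 = C := by
  classical
  have h0 : ∑ y with H.coverLab b y = H.coverLab b x, wt y.1.1 =
      ∑ n : ZMod K, ∑ d with H.pat d = b n ∧ (H.lab (H.loc d), n - (H.g (H.loc d) : ZMod K)) =
        H.coverLab b x, wt d := by
    rw [Finset.sum_sigma']
    refine Finset.sum_bij (fun y _ => ⟨y.1.2, y.1.1⟩) (fun y hy => ?_) (fun y _ y' _ e => ?_)
      (fun p hp => ?_) fun y _ => rfl
    · simp only [Finset.mem_sigma, Finset.mem_univ, Finset.mem_filter, true_and] at hy ⊢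
      exact ⟨y.2, hy⟩
    · exact Cover.ext (congrArg (fun p : (_ : ZMod K) × 𝔻 => p.2) e)
        (congrArg (fun p : (_ : ZMod K) × 𝔻 => p.1) e)
    · simp only [Finset.mem_sigma, Finset.mem_univ, Finset.mem_filter, true_and] at hp
      exact ⟨⟨(p.2, p.1), hp.1⟩, by simpa [coverLab] using hp.2, rfl⟩
  rw [h0]
  by_cases hax : H.axis (H.loc x.1.1)
  · rw [Finset.sum_eq_single x.1.2]
    · rw [← hC x.1.1]
      refine Finset.sum_congr (Finset.filter_congr fun d _ => ?_) fun _ _ => rfl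
      constructor
      · rintro ⟨k1, k2⟩
        exact ⟨k1.trans x.2.symm, congrArg Prod.fst k2⟩
      · rintro ⟨k1, k2⟩
        refine ⟨k1.trans x.2, ?_⟩
        rw [H.axis_lab _ _ hax k2]
        rfl
    · intro n _ hn
      apply Finset.sum_eq_zero
      intro d hd
      simp only [Finset.mem_filter_univ] at hd
      refine absurd ?_ hn
      have k1 : H.lab (H.loc d) = _ := congrArg Prod.fst hd.2
      have k2 : n - (H.g (H.loc d) : ZMod K) = x.1.2 - (H.g (H.loc x.1.1) : ZMod K) :=
        congrArg Prod.snd hd.2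
      rw [H.axis_lab _ _ hax k1] at k2
      exact sub_left_injective k2
    · simp
  · have h1 : ∀ n : ZMod K, ∑ d with H.pat d = b n ∧
        (H.lab (H.loc d), n - (H.g (H.loc d) : ZMod K)) = H.coverLab b x, wt d =
        ∑ d with H.pat d = true ∧
        (H.lab (H.loc d), n - (H.g (H.loc d) : ZMod K)) = H.coverLab b x, wt d := by
      intro n
      rw [← Finset.sum_fiberwise_of_maps_to (g := H.loc) (t := Finset.univ.image H.loc)
        (fun d _ => Finset.mem_image_of_mem _ (Finset.mem_univ d)),
        ← Finset.sum_fiberwise_of_maps_to (g := H.loc) (t := Finset.univ.image H.loc)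
        (fun d _ => Finset.mem_image_of_mem _ (Finset.mem_univ d))]
      refine Finset.sum_congr rfl fun l _ => ?_
      rw [Finset.filter_filter, Finset.filter_filter]
      by_cases hl : (H.lab l, n - (H.g l : ZMod K)) = H.coverLab b x ∧ ¬ H.axis l
      · have := dist l hl.2
        have e : ∀ c : Bool, ∑ d with (H.pat d = c ∧ (H.lab (H.loc d), n - (H.g (H.loc d) : ZMod K))
            = H.coverLab b x) ∧ H.loc d = l, wt d = ∑ d with H.loc d = l ∧ H.pat d = c, wt d := by
          intro c
          refine Finset.sum_congr (Finset.filter_congr fun d _ => ?_) fun _ _ => rfl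
          constructor
          · rintro ⟨⟨k1, _⟩, k3⟩
            exact ⟨k3, k1⟩
          · rintro ⟨rfl, k1⟩
            exact ⟨⟨k1, hl.1⟩, rfl⟩
        rw [e, e]
        cases b n
        · exact this.symm
        · rfl
      · have e : ∀ c : Bool, ∑ d with (H.pat d = c ∧ (H.lab (H.loc d), n - (H.g (H.loc d) : ZMod K))
            = H.coverLab b x) ∧ H.loc d = l, wt d = 0 := by
          intro c
          apply Finset.sum_eq_zero
          intro d hd
          simp only [Finset.mem_filter_univ] at hd
          obtain ⟨⟨_, k2⟩, rfl⟩ := hd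
          refine absurd ⟨k2, fun hd => hax ?_⟩ hl
          rwa [H.axis_lab d x.1.1 hd (congrArg Prod.fst k2).symm]
        rw [e, e]
    obtain ⟨e, e1, e2⟩ := H.exists_pat_true hax
    rw [Finset.sum_congr rfl fun n _ => h1 n, ← hC e]
    simp_rw [Finset.sum_filter]
    rw [Finset.sum_comm]
    refine Finset.sum_congr rfl fun d _ => ?_
    by_cases hd : H.pat d = true ∧ H.lab (H.loc d) = H.lab (H.loc x.1.1)
    · rw [if_pos ⟨hd.1.trans e1.symm, hd.2.trans (by rw [e2])⟩,
        Finset.sum_eq_single (x.1.2 - (H.g (H.loc x.1.1) : ZMod K) + H.g (H.loc d))]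
      · rw [if_pos ⟨hd.1, Prod.ext hd.2 (by simp [coverLab])⟩]
      · intro n _ hn
        rw [if_neg]
        rintro ⟨_, k⟩
        have k2 : n - (H.g (H.loc d) : ZMod K) = x.1.2 - (H.g (H.loc x.1.1) : ZMod K) :=
          congrArg Prod.snd k
        exact hn (by rw [← k2]; ring)
      · simp
    · rw [if_neg fun k => hd ⟨k.1.trans e1, k.2.trans (by rw [e2])⟩]
      apply Finset.sum_eq_zero
      intro n _
      rw [if_neg fun k => hd ⟨k.1, congrArg Prod.fst k.2⟩]

/-- The lift of the two curves to the cover. -/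
def coverPair {ν : A → ZMod K} (hν : ∀ a, ν (H.succ a) = ν a + H.τ (H.toCurvePair.out a))
    (hb : ∀ a, b (ν a) = H.which a) : CurvePair (H.Cover b) A where
  φ := H.coverφ b
  α := H.coverα b
  φ_three x := Cover.ext (H.φ_three _) rfl
  φ_ne x e := H.φ_ne x.1.1 (congrArg (fun y : H.Cover b => y.1.1) e)
  α_α := H.coverα_coverα b
  α_ne := H.coverα_ne b
  corner a := ⟨(H.corner a, ν a), by rw [H.pat_corner, hb]⟩
  left := H.left
  which := H.which
  succ := H.succ
  u := H.u
  w := H.w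
  u_pos := H.u_pos
  u_lt := H.u_lt
  w_pos := H.w_pos
  w_lt := H.w_lt
  which_succ := H.which_succ
  succ_trans := H.succ_trans
  side_succ a := by
    have hside := H.side_succ a
    have hν' := hν a
    have e : (if H.left a then (H.coverφ b).symm ⟨(H.corner a, ν a), by rw [H.pat_corner, hb]⟩
        else (⟨(H.corner a, ν a), by rw [H.pat_corner, hb]⟩ : H.Cover b)) =
        ⟨(H.toCurvePair.out a, ν a), by
          unfold CurvePair.out
          split_ifs
          · rw [← H.pat_φ, Equiv.apply_symm_apply, H.pat_corner, hb]
          · rw [H.pat_corner, hb]⟩ := by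
      apply Cover.ext <;> unfold CurvePair.out <;> split_ifs <;> rfl
    have hbb : b (ν a + H.τ (H.toCurvePair.out a)) = b (ν a) := by
      rw [← hν', hb, hb, H.which_succ]
    rw [e]
    apply Cover.ext
    · refine Eq.trans ?_ (hside.trans (H.coverα_of_eq b (x := ⟨(H.toCurvePair.out a, ν a), _⟩)
        hbb).symm)
      split_ifs <;> rfl
    · change _ = ν a + _
      rw [← hν']
      split_ifs <;> rfl
  pos_succ := H.pos_succ
  nested a a' h := H.nested a a' (congrArg (fun y : H.Cover b => y.1.1) h)
  disjoint a a' h := H.disjoint a a' (congrArg (fun y : H.Cover b => y.1.1) h)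

end Cover

/-- Simple closed curves of the same class on two triangulations of a torus have the same turning. -/
theorem turning_eq [Fintype 𝔻] [Fintype A] [DecidableEq 𝓛] [DecidableEq 𝓦]
    (hf : ∀ d, H.f d + H.f (H.φ d) + H.f (H.φ (H.φ d)) = 1)
    (fdist : ∀ l, ¬ H.axis l → ∑ d with H.loc d = l ∧ H.pat d = true, H.f d =
      ∑ d with H.loc d = l ∧ H.pat d = false, H.f d)
    (fsum : ∀ d, ∑ d' with H.pat d' = H.pat d ∧ H.lab (H.loc d') = H.lab (H.loc d), H.f d' = 2)
    (ωsum : ∀ d, ∑ d' with H.pat d' = H.pat d ∧ H.lab (H.loc d') = H.lab (H.loc d), H.ω d' = 0)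
    (hω : ∀ c, ∑ a with H.which a = c, H.ω (H.toCurvePair.out a) = 1)
    (hτ : ∃ ν : A → ℤ, ∀ a, ν (H.succ a) = ν a + H.τ (H.toCurvePair.out a)) :
    H.toCurvePair.turning H.f true = H.toCurvePair.turning H.f false := by
  classical
  obtain ⟨ν, hν⟩ := hτ
  obtain ⟨M, hM⟩ : ∃ M : ℕ, ∀ a, |ν a| < M := by
    obtain ⟨M, hM⟩ := (Set.finite_range fun a => (|ν a|).toNat).bddAbove
    refine ⟨M + 1, fun a => ?_⟩
    have h1 : (|ν a|).toNat ≤ M := hM (Set.mem_range_self a)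
    have h2 := abs_nonneg (ν a)
    omega
  -- Only outer sides contribute to sums of `ω`, and `flip` matches these.
  have ωdist : ∀ l, ¬ H.axis l → ∑ d with H.loc d = l ∧ H.pat d = true, H.ω d =
      ∑ d with H.loc d = l ∧ H.pat d = false, H.ω d := by
    have e : ∀ l c, ∑ d with H.loc d = l ∧ H.pat d = c, H.ω d =
        ∑ d with H.outer d ∧ H.loc d = l ∧ H.pat d = c, H.ω d := by
      intro l c
      symm
      apply Finset.sum_subset
      · intro d
        simp
      · intro d hd hd'
        simp only [Finset.mem_filter_univ] at hd hd'
        exact H.ω_inner d fun ho => hd' ⟨ho, hd⟩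
    intro l _
    rw [e, e]
    refine Finset.sum_bij' (fun d _ => H.flip d) (fun d _ => H.flip d) ?_ ?_ ?_ ?_ ?_
    · intro d hd
      simp only [Finset.mem_filter_univ] at hd ⊢
      exact ⟨H.outer_flip d hd.1, by rw [H.loc_flip d hd.1, hd.2.1],
        by rw [H.pat_flip, hd.2.2]; rfl⟩
    · intro d hd
      simp only [Finset.mem_filter_univ] at hd ⊢
      exact ⟨H.outer_flip d hd.1, by rw [H.loc_flip d hd.1, hd.2.1],
        by rw [H.pat_flip, hd.2.2]; rfl⟩
    · intro d hd
      simp only [Finset.mem_filter_univ] at hd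
      exact H.flip_flip d hd.1
    · intro d hd
      simp only [Finset.mem_filter_univ] at hd
      exact H.flip_flip d hd.1
    · intro d hd
      simp only [Finset.mem_filter_univ] at hd
      exact (H.ω_flip d hd.1).symm
  rcases isEmpty_or_nonempty A with hA | ⟨⟨a₀⟩⟩
  · simp [CurvePair.turning]
  have hM0 : 0 < M := by
    have := (abs_nonneg (ν a₀)).trans_lt (hM a₀)
    exact_mod_cast this
  have : NeZero (4 * M) := ⟨by omega⟩
  -- A lift wanders fewer than `M` sheets from level 0. Started at the levels `M` and `3 * M`, the
  -- two lifts stay in different halves of the `4 * M` sheets, so they are disjoint, and each meets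
  -- only sheets with its own triangulation.
  let b : ZMod (4 * M) → Bool := fun n => decide (n.val < 2 * M)
  let ν' : A → ZMod (4 * M) := fun a => ((ν a + if H.which a then (M : ℤ) else 3 * M : ℤ) : ZMod (4 * M))
  have hν' : ∀ a, ν' (H.succ a) = ν' a + H.τ (H.toCurvePair.out a) := by
    intro a
    simp only [ν', H.which_succ, hν a]
    push_cast
    ring
  have hb : ∀ a, b (ν' a) = H.which a := by
    intro a
    have h1 := abs_lt.1 (hM a)
    have h2 : ∀ x : ℤ, 0 ≤ x → x < 4 * M → ((x : ZMod (4 * M)).val : ℤ) = x := by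
      intro x hx hx'
      rw [ZMod.val_intCast]
      exact Int.emod_eq_of_lt hx (by push_cast; exact hx')
    cases h : H.which a
    · have := h2 (ν a + 3 * M) (by linarith) (by linarith)
      simp only [b, ν', h, Bool.false_eq_true, if_false, decide_eq_false_iff_not, not_lt]
      zify
      push_cast at this
      rw [this]
      linarith
    · have := h2 (ν a + M) (by linarith) (by linarith)
      simp only [b, ν', h, if_true, decide_eq_true_eq]
      zify
      push_cast at this
      rw [this]
      linarith
  have : Fintype (H.Cover b) := Fintype.ofFinite _
  have main := (H.coverPair b hν' hb).turning_eq (f := fun x => H.f x.1.1) (ω := fun x => H.ω x.1.1)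
    (s := H.coverLab b) (fun x => hf x.1.1)
    (fun x => by
      change H.coverLab b (H.coverφ b (H.coverα b x)) = _
      rw [H.coverLab_φ, H.coverα_coverα])
    (fun U hU d d' e hd => H.cover_conn_lab b
      (fun x => by
        have := hU (H.coverα b x)
        change U (H.coverφ b (H.coverα b (H.coverα b x))) ↔ _ at this
        rwa [H.coverα_coverα] at this) e.symm hd)
    (H.cover_sum b fdist fsum) (H.ω_coverα b) (H.cover_sum b ωdist ωsum)
    (fun U h1 h2 a c _ _ hU => H.cover_conn b h1 h2 hU)
    (fun c => by
      rw [← hω c]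
      refine Finset.sum_congr rfl fun a _ => ?_
      unfold CurvePair.out
      change H.ω (if H.left a then _ else _ : H.Cover b).1.1 = _
      split_ifs <;> rfl)
  exact main

end HybridData

end NeumannZagier

namespace NeumannZagier

/-! ### The boundary torus as a combinatorial map -/

/-- The side of a boundary triangle at the vertex `v` that follows the side opposite to `u` in the
counterclockwise direction. -/
def rot (v u : Fin 4) : Fin 4 :=
  (![![0, 3, 1, 2], ![2, 1, 3, 0], ![3, 0, 2, 1], ![1, 2, 0, 3]] : Fin 4 → Fin 4 → Fin 4) v u

theorem rot_three : ∀ v u, rot v (rot v (rot v u)) = u := by decide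

theorem rot_ne_left : ∀ v u, v ≠ u → v ≠ rot v u := by decide

theorem rot_ne : ∀ v u, v ≠ u → rot v u ≠ u := by decide

theorem rot_cases : ∀ v u w, v ≠ u → w ≠ v → w ≠ u → w = rot v u ∨ w = rot v (rot v u) := by decide

theorem pairType_comm : ∀ v u, pairType v u = pairType u v := by decide

theorem pairType_rot : ∀ v u, v ≠ u → pairType v (rot v u) = pairType v u + 1 := by decide

theorem rot_of_even : ∀ π : Equiv.Perm (Fin 4), Equiv.Perm.sign π = 1 →
    rot (π 0) (π 1) = π 3 ∧ rot (π 0) (π 3) = π 2 ∧ rot (π 0) (π 2) = π 1 := by decide +kernel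

theorem rot_of_odd : ∀ π : Equiv.Perm (Fin 4), Equiv.Perm.sign π = -1 →
    rot (π 0) (π 2) = π 3 ∧ rot (π 0) (π 3) = π 1 ∧ rot (π 0) (π 1) = π 2 := by decide +kernel

theorem odd_rot : ∀ π : Equiv.Perm (Fin 4), Equiv.Perm.sign π = -1 →
    ∀ v u, v ≠ u → rot (π v) (π u) = π (rot v (rot v u)) := by decide +kernel

theorem even_rot : ∀ π : Equiv.Perm (Fin 4), Equiv.Perm.sign π = 1 →
    ∀ v u, rot (π v) (π u) = π (rot v u) := by decide +kernel

theorem exists_even_perm : ∀ v a : Fin 4, v ≠ a → ∃ π : Equiv.Perm (Fin 4),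
    Equiv.Perm.sign π = 1 ∧ π 0 = v ∧ π 3 = a := by decide +kernel

theorem even_perm_ext {π π' : Equiv.Perm (Fin 4)} (h : Equiv.Perm.sign π = 1)
    (h' : Equiv.Perm.sign π' = 1) (h0 : π 0 = π' 0) (h3 : π 3 = π' 3) : π = π' := by
  obtain ⟨-, h2, h1⟩ := rot_of_even π h
  obtain ⟨-, h2', h1'⟩ := rot_of_even π' h'
  have e2 : π 2 = π' 2 := by rw [← h2, ← h2', h0, h3]
  have e1 : π 1 = π' 1 := by rw [← h1, ← h1', h0, e2]
  ext i
  fin_cases i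
  · exact congrArg _ h0
  · exact congrArg _ e1
  · exact congrArg _ e2
  · exact congrArg _ h3

variable {ι : Type}

theorem DirEdge.ext {x y : DirEdge ι} (h1 : x.1.1 = y.1.1) (h2 : x.1.2.1 = y.1.2.1)
    (h3 : x.1.2.2 = y.1.2.2) : x = y :=
  Subtype.ext (Prod.ext h1 (Prod.ext h2 h3))

/-- A directed edge `(i, v, u)` of a tetrahedron also stands for the side of the boundary
triangle `(i, v)` on the face opposite to `u`; this is the next side in counterclockwise
direction. The side `x` starts at the corner of the boundary triangle that lies on
the directed edge `nextSide x`. -/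
def nextSide : Equiv.Perm (DirEdge ι) where
  toFun x := ⟨(x.1.1, x.1.2.1, rot x.1.2.1 x.1.2.2), rot_ne_left _ _ x.2⟩
  invFun x := ⟨(x.1.1, x.1.2.1, rot x.1.2.1 (rot x.1.2.1 x.1.2.2)),
    rot_ne_left _ _ (rot_ne_left _ _ x.2)⟩
  left_inv _ := DirEdge.ext rfl rfl (rot_three _ _)
  right_inv _ := DirEdge.ext rfl rfl (rot_three _ _)

theorem nextSide_three (x : DirEdge ι) : nextSide (nextSide (nextSide x)) = x :=
  DirEdge.ext rfl rfl (rot_three _ _)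

theorem nextSide_ne (x : DirEdge ι) : nextSide x ≠ x := fun e =>
  rot_ne _ _ x.2 (congrArg (fun y : DirEdge ι => y.1.2.2) e)

theorem rev_rev (x : DirEdge ι) : x.rev.rev = x := rfl

/-- A function of the pairs of opposite edges as a function of sides of boundary triangles, read off at
the corner at which the side starts. -/
def cornerFun {α : Type*} (F : ι → Fin 3 → α) (x : DirEdge ι) : α :=
  F x.1.1 (pairType x.1.2.1 (rot x.1.2.1 x.1.2.2))

theorem cornerFun_sum (F : ι → Fin 3 → ℝ) (x : DirEdge ι) :
    cornerFun F x + cornerFun F (nextSide x) + cornerFun F (nextSide (nextSide x)) =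
      ∑ p, F x.1.1 p := by
  have h1 := pairType_rot x.1.2.1 _ x.2
  have h2 := pairType_rot x.1.2.1 _ (rot_ne_left _ _ x.2)
  have h3 := pairType_rot x.1.2.1 _ (rot_ne_left _ _ (rot_ne_left _ _ x.2))
  simp only [cornerFun, nextSide, Equiv.coe_fn_mk]
  rw [h3, h2, h1, Fin.sum_univ_three]
  generalize pairType x.1.2.1 x.1.2.2 = p
  fin_cases p
  · change F x.1.1 1 + F x.1.1 2 + F x.1.1 0 = _
    ring
  · change F x.1.1 2 + F x.1.1 0 + F x.1.1 1 = _
    ring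
  · change F x.1.1 0 + F x.1.1 1 + F x.1.1 2 = _
    ring

namespace IdealTriangulation

variable (T : IdealTriangulation ι)

/-- The other side of the same edge of the boundary surface. -/
def opp : Equiv.Perm (DirEdge ι) :=
  Function.Involutive.toPerm
    (fun x => ⟨(T.nbr x.1.1 x.1.2.2, T.perm x.1.1 x.1.2.2 x.1.2.1, T.perm x.1.1 x.1.2.2 x.1.2.2),
      fun h => x.2 ((T.perm _ _).injective h)⟩)
    (fun x => by
      apply DirEdge.ext
      · exact T.nbr_nbr _ _
      · change T.perm _ _ (T.perm _ _ _) = _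
        rw [T.perm_perm]
        exact Equiv.symm_apply_apply _ _
      · change T.perm _ _ (T.perm _ _ _) = _
        rw [T.perm_perm]
        exact Equiv.symm_apply_apply _ _)

theorem opp_opp (x : DirEdge ι) : T.opp (T.opp x) = x :=
  Function.Involutive.toPerm_involutive _ x

theorem opp_ne (x : DirEdge ι) : T.opp x ≠ x := fun e =>
  T.not_self_glued x.1.1 x.1.2.2 ⟨congrArg (fun y : DirEdge ι => y.1.1) e,
    congrArg (fun y : DirEdge ι => y.1.2.2) e⟩

/-- The next corner around a vertex of the boundary surface, in counterclockwise direction. -/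
def cornerStep (x : DirEdge ι) : DirEdge ι := T.across x (rot x.1.2.1 x.1.2.2)

/-- Face gluings are odd and carry the counterclockwise rotation to its inverse, which is `rot`
applied twice. This aligns the conventions for `opp` and `cornerStep`. -/
theorem nextSide_opp (x : DirEdge ι) :
    nextSide (T.opp x) = T.cornerStep (nextSide (nextSide x)) := by
  have h := odd_rot _ (T.sign_perm x.1.1 x.1.2.2) _ _ x.2
  have h3 := rot_three x.1.2.1 x.1.2.2
  apply DirEdge.ext
  · change T.nbr _ _ = T.nbr x.1.1 (rot x.1.2.1 (rot x.1.2.1 (rot x.1.2.1 x.1.2.2)))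
    rw [h3]
  · change T.perm _ _ _ = T.perm x.1.1 (rot x.1.2.1 (rot x.1.2.1 (rot x.1.2.1 x.1.2.2))) _
    rw [h3]
    rfl
  · change rot _ _ = T.perm x.1.1 (rot x.1.2.1 (rot x.1.2.1 (rot x.1.2.1 x.1.2.2))) _
    rw [h3]
    exact h

theorem edgeStep_cornerStep (x : DirEdge ι) : T.EdgeStep x (T.cornerStep x) :=
  ⟨_, (rot_ne_left _ _ x.2).symm, rot_ne _ _ x.2, rfl⟩

/-- Only two faces of a tetrahedron contain a given edge; crossing one of them is the
counterclockwise step, crossing the other its inverse. -/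
theorem eq_cornerStep_of_edgeStep {x y : DirEdge ι} (h : T.EdgeStep x y) :
    y = T.cornerStep x ∨ x = T.cornerStep y := by
  obtain ⟨u, h1, h2, rfl⟩ := h
  rcases rot_cases _ _ u x.2 h1 h2 with rfl | rfl
  · exact Or.inl rfl
  · refine Or.inr ?_
    have h := odd_rot _ (T.sign_perm x.1.1 (rot x.1.2.1 (rot x.1.2.1 x.1.2.2))) _ _ x.2
    have h' := T.perm_perm x.1.1 (rot x.1.2.1 (rot x.1.2.1 x.1.2.2))
    apply DirEdge.ext
    · change _ = T.nbr (T.nbr _ _) (rot (T.perm _ _ _) (T.perm _ _ _))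
      rw [h, T.nbr_nbr]
    · change _ = T.perm (T.nbr _ _) (rot (T.perm _ _ _) (T.perm _ _ _)) (T.perm _ _ _)
      rw [h, h']
      exact (Equiv.symm_apply_apply _ _).symm
    · change _ = T.perm (T.nbr _ _) (rot (T.perm _ _ _) (T.perm _ _ _)) (T.perm _ _ _)
      rw [h, h']
      exact (Equiv.symm_apply_apply _ _).symm

/-- The vertices of the boundary surface. -/
abbrev Vertex : Type := Quot T.EdgeStep

/-- The vertex at which a side starts. -/
def vertexOf (x : DirEdge ι) : T.Vertex := Quot.mk _ (nextSide x)

theorem vertexOf_nextSide (x : DirEdge ι) : T.vertexOf (nextSide x) = T.vertexOf (T.opp x) := by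
  unfold vertexOf
  rw [nextSide_opp]
  exact Quot.sound (T.edgeStep_cornerStep _)

/-- A property that holds at the end of a side iff it holds at the start of the opposite side is a
property of vertices. -/
theorem vertex_conn {U : DirEdge ι → Prop} (hU : ∀ x, U (nextSide x) ↔ U (T.opp x))
    {x y : DirEdge ι} (h : T.vertexOf x = T.vertexOf y) : U x ↔ U y := by
  have key : ∀ x, U (nextSide.symm x) ↔ U (nextSide.symm (T.cornerStep x)) := by
    intro x
    have h1 := T.nextSide_opp (nextSide x)
    rw [nextSide_three] at h1
    rw [← h1, Equiv.symm_apply_apply, ← hU]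
    rfl
  have h2 : ∀ x y, T.EdgeStep x y → (U (nextSide.symm x)) = (U (nextSide.symm y)) := by
    intro x y hxy
    rcases T.eq_cornerStep_of_edgeStep hxy with rfl | rfl
    · exact propext (key x)
    · exact propext (key y).symm
  have := congrArg (Quot.lift (fun x => U (nextSide.symm x)) h2) h
  simpa [vertexOf] using this

end IdealTriangulation

/-! ### Potentials around vertices -/

theorem sum_iterate_mod {X : Type*} (f : X → X) (w : X → ℤ) (x : X)
    (h : ∑ k ∈ Finset.range (Function.minimalPeriod f x), w (f^[k] x) = 0) (n : ℕ) :
    ∑ k ∈ Finset.range (n % Function.minimalPeriod f x), w (f^[k] x) =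
      ∑ k ∈ Finset.range n, w (f^[k] x) := by
  set P := Function.minimalPeriod f x with hP
  have key : ∀ m, ∑ k ∈ Finset.range (P * m), w (f^[k] x) = 0 := by
    intro m
    induction m with
    | zero => simp
    | succ m ih =>
      rw [mul_add, mul_one, Finset.sum_range_add, ih, zero_add, ← h]
      refine Finset.sum_congr rfl fun k _ => ?_
      rw [← Function.iterate_mod_minimalPeriod_eq, ← hP, Nat.mul_add_mod, hP,
        Function.iterate_mod_minimalPeriod_eq]
  conv_rhs => rw [← Nat.div_add_mod n P, Finset.sum_range_add, key, zero_add]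
  refine Finset.sum_congr rfl fun k _ => ?_
  rw [← Function.iterate_mod_minimalPeriod_eq (n := P * (n / P) + k), ← hP, Nat.mul_add_mod, hP,
    Function.iterate_mod_minimalPeriod_eq]

/-- A function with vanishing sums over the cycles of a permutation has a potential. -/
theorem exists_potential_of_period {X : Type*} [Finite X] (f : Equiv.Perm X) (w : X → ℤ)
    (h : ∀ x, ∑ k ∈ Finset.range (Function.minimalPeriod f x), w (f^[k] x) = 0) :
    ∃ g : X → ℤ, ∀ x, g (f x) = g x + w x := by
  classical
  -- A base point on the cycle of `x`. The potential is the sum of `w` along the cycle from the base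
  -- point; the number of steps matters only modulo the period.
  let r : X → X := fun x => (Quotient.mk (Equiv.Perm.SameCycle.setoid f) x).out
  have hr : ∀ x, f.SameCycle (r x) x := fun x => Quotient.mk_out (s := Equiv.Perm.SameCycle.setoid f) x
  have hrf : ∀ x, r (f x) = r x := fun x => by
    simp only [r]
    congr 1
    exact Quotient.sound (s := Equiv.Perm.SameCycle.setoid f)
      (Equiv.Perm.sameCycle_apply_left.2 (Equiv.Perm.SameCycle.refl f x))
  have hn : ∀ x, ∃ n : ℕ, f^[n] (r x) = x := fun x => by
    obtain ⟨n, hn⟩ := (hr x).exists_nat_pow_eq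
    exact ⟨n, by rw [Equiv.Perm.iterate_eq_pow]; exact hn⟩
  choose n hn using hn
  refine ⟨fun x => ∑ k ∈ Finset.range (n x), w (f^[k] (r x)), fun x => ?_⟩
  have e : f^[n (f x)] (r x) = f^[n x + 1] (r x) := by
    rw [Function.iterate_succ_apply', hn x, ← hrf x, hn (f x)]
  have hpos : 0 < Function.minimalPeriod f (r x) :=
    Function.minimalPeriod_pos_of_mem_periodicPts (f.injective.mem_periodicPts _)
  have e2 : n (f x) % Function.minimalPeriod f (r x) = (n x + 1) % Function.minimalPeriod f (r x) :=
    Function.iterate_injOn_Iio_minimalPeriod (f := f) (x := r x) (Nat.mod_lt _ hpos)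
      (Nat.mod_lt _ hpos) (by
        change f^[_] (r x) = f^[_] (r x)
        rw [Function.iterate_mod_minimalPeriod_eq, Function.iterate_mod_minimalPeriod_eq, e])
  change ∑ k ∈ Finset.range (n (f x)), w (f^[k] (r (f x))) = _
  rw [hrf, ← sum_iterate_mod f w (r x) (h _) (n (f x)), e2, sum_iterate_mod f w (r x) (h _),
    Finset.sum_range_succ, hn x]

namespace IdealTriangulation

variable (T : IdealTriangulation ι)

theorem turn_injective : Function.Injective T.turn := by
  rintro ⟨i, π⟩ ⟨j, π'⟩ h
  have h1 : T.nbr i (π 2) = T.nbr j (π' 2) := congrArg Prod.fst h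
  have h2 : T.perm i (π 2) * π * Equiv.swap 1 2 = T.perm j (π' 2) * π' * Equiv.swap 1 2 :=
    congrArg Prod.snd h
  have h3 : T.perm i (π 2) (π 2) = T.perm j (π' 2) (π' 2) := by
    simpa using congrArg (fun p : Equiv.Perm (Fin 4) => p 1) h2
  have h4 := T.nbr_nbr i (π 2)
  have h5 := T.perm_perm i (π 2)
  rw [h1, h3] at h4 h5
  rw [T.nbr_nbr] at h4
  rw [T.perm_perm, inv_inj] at h5
  rw [h5] at h2
  exact Prod.ext h4.symm (mul_left_cancel (mul_right_cancel h2)).symm.symm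

theorem exists_arcs : ∃ a : DirEdge ι → ι × Equiv.Perm (Fin 4),
    ∀ x, (a x).1 = x.1.1 ∧ Equiv.Perm.sign (a x).2 = 1 ∧ (a x).2 0 = x.1.2.1 ∧
      (a x).2 3 = x.1.2.2 := by
  choose a h1 h2 h3 using exists_even_perm
  exact ⟨fun x => (x.1.1, a _ _ x.2), fun x => ⟨rfl, h1 _ _ _, h2 _ _ _, h3 _ _ _⟩⟩

end IdealTriangulation

/-- The cocycle on sides given by a coordinate of a marking. -/
def Marking.side {T : IdealTriangulation ι} (θ : Marking T) (L : ℤ × ℤ →+ ℤ) (x : DirEdge ι) : ℤ :=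
  L (θ.val x.1.1 x.1.2.1 x.1.2.2)

theorem Marking.side_opp {T : IdealTriangulation ι} (θ : Marking T) (L : ℤ × ℤ →+ ℤ)
    (x : DirEdge ι) : θ.side L (T.opp x) = - θ.side L x := by
  unfold Marking.side
  rw [← map_neg, ← θ.val_neg _ _ _ x.2]
  rfl

/-- A marking has a potential around the vertices of the boundary. -/
theorem Marking.exists_vertex_potential [Finite ι] {T : IdealTriangulation ι} (θ : Marking T)
    (L : ℤ × ℤ →+ ℤ) : ∃ g : DirEdge ι → ℤ,
      ∀ x, g (nextSide (T.opp x)) = g (nextSide (nextSide x)) + θ.side L x := by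
  obtain ⟨g, hg⟩ := exists_potential_of_period
    (Equiv.ofBijective T.turn (Finite.injective_iff_bijective.1 T.turn_injective))
    (fun x => L (θ.val x.1 (x.2 0) (x.2 2))) (fun x => by
      rw [← map_sum]
      exact (congrArg L (θ.val_corner x)).trans (map_zero L))
  obtain ⟨a, ha⟩ := IdealTriangulation.exists_arcs (ι := ι)
  refine ⟨fun x => g (a x), fun x => ?_⟩
  obtain ⟨h1, h2, h3, h4⟩ := ha (nextSide (nextSide x))
  obtain ⟨k1, k2, k3, k4⟩ := ha (nextSide (T.opp x))
  have h5 := (rot_of_even _ h2).2.1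
  have h6 : (a (nextSide (nextSide x))).2 2 = x.1.2.2 := by
    rw [← h5, h3, h4]
    exact rot_three _ _
  have key : a (nextSide (T.opp x)) = T.turn (a (nextSide (nextSide x))) := by
    have k6 := T.nextSide_opp x
    unfold IdealTriangulation.turn
    rw [h1, h6]
    refine Prod.ext (k1.trans ?_) (even_perm_ext k2 ?_ (k3.trans ?_) (k4.trans ?_))
    · rfl
    · simp [h2, T.sign_perm]
    · simp [h3, Equiv.swap_apply_of_ne_of_ne]
      rfl
    · rw [k6]
      simp [Equiv.swap_apply_of_ne_of_ne, IdealTriangulation.cornerStep,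
        IdealTriangulation.across, nextSide, rot_three]
      exact h4.symm
  change g (a _) = g (a _) + _
  rw [key]
  refine (hg _).trans ?_
  rw [h1, h3, h6]
  rfl

/-- The potential around vertices turns the sum into the difference of two sums over all sides that
agree after reindexing. Thus a marking is a closed cochain at every vertex. -/
theorem Marking.sum_vertex [Fintype ι] {T : IdealTriangulation ι} (θ : Marking T)
    (L : ℤ × ℤ →+ ℤ) (ψ : T.Vertex → ℝ) : ∑ x, (θ.side L x : ℝ) * ψ (T.vertexOf x) = 0 := by
  obtain ⟨g, hg⟩ := θ.exists_vertex_potential L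
  have h1 : ∀ x, (θ.side L (T.opp x) : ℝ) * ψ (T.vertexOf (T.opp x)) =
      (g (nextSide (nextSide x)) : ℝ) * ψ (T.vertexOf (nextSide x)) -
        g (nextSide (T.opp x)) * ψ (T.vertexOf (T.opp x)) := by
    intro x
    rw [T.vertexOf_nextSide, hg, θ.side_opp]
    push_cast
    ring
  rw [← Equiv.sum_comp T.opp, Finset.sum_congr rfl fun x _ => h1 x, Finset.sum_sub_distrib,
    Equiv.sum_comp nextSide (fun x => (g (nextSide x) : ℝ) * ψ (T.vertexOf x)),
    Equiv.sum_comp T.opp (fun x => (g (nextSide x) : ℝ) * ψ (T.vertexOf x)), sub_self]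

end NeumannZagier

namespace NeumannZagier

/-! ### Normal curves -/

theorem fin_four_cases : ∀ v u x : Fin 4, v ≠ u →
    x = v ∨ x = u ∨ x = rot v u ∨ x = rot v (rot v u) := by decide

/-- Two segments that connect points on the same two sides of an angle and are not nested
intersect. -/
theorem exists_intersection_same_corner {u w u' w' : ℝ} (hu : 0 < u) (hw : 0 < w)
    (hu' : 0 < u') (hw' : 0 < w') (h1 : u ≤ u') (h2 : w' ≤ w) :
    ∃ s ∈ Set.Icc (0 : ℝ) 1, ∃ t ∈ Set.Icc (0 : ℝ) 1, s * w = t * w' ∧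
      (1 - s) * u = (1 - t) * u' := by
  rcases h1.eq_or_lt with rfl | h1
  · exact ⟨0, by simp, 0, by simp, by simp, by simp⟩
  · have hden : 0 < u' * w - u * w' := by nlinarith
    have hnum : 0 ≤ u' - u := by linarith
    -- Cramer's rule for the two linear equations in the parameters of the segments; `hden` is the
    -- positivity of the determinant.
    refine ⟨(u' - u) * w' / (u' * w - u * w'), ⟨by positivity, ?_⟩,
      (u' - u) * w / (u' * w - u * w'), ⟨by positivity, ?_⟩, ?_, ?_⟩
    · rw [div_le_one hden]; nlinarith
    · rw [div_le_one hden]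
      nlinarith [mul_nonneg hu.le (sub_nonneg.2 h2)]
    · field_simp
    · have := hden.ne'
      field_simp
      ring

/-- Two segments that cut off different corners of a triangle and overlap on the common side
intersect. -/
theorem exists_intersection_next_corner {u w u' w' : ℝ} (hu : u < 1)
    (hw : 0 < w) (hw1 : w < 1) (hu' : 0 < u') (hu1' : u' < 1) (hw1' : w' < 1)
    (h : 1 - w' ≤ u) :
    ∃ s ∈ Set.Icc (0 : ℝ) 1, ∃ t ∈ Set.Icc (0 : ℝ) 1, s * w = t * u' ∧
      (1 - s) * u = (1 - t) * (1 - w') + t * (1 - u') := by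
  have hden : 0 < w * w' - w * u' + u * u' := by
    have hw0 : 0 < w' := by linarith
    have : 0 < w * w' * (1 - u') := mul_pos (mul_pos hw hw0) (sub_pos.2 hu1')
    have h4 : 0 ≤ u' * (1 - w') * (1 - w) :=
      mul_nonneg (mul_nonneg hu'.le (sub_nonneg.2 hw1'.le)) (sub_nonneg.2 hw1.le)
    have h5 : 0 ≤ u' * (u - (1 - w')) := mul_nonneg hu'.le (sub_nonneg.2 h)
    nlinarith
  have hw0 : 0 < w' := by linarith
  have hu0 : 0 < u := by linarith
  have hnum : 0 ≤ u + w' - 1 := by linarith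
  refine ⟨u' * (u + w' - 1) / (w * w' - w * u' + u * u'), ⟨by positivity, ?_⟩,
    w * (u + w' - 1) / (w * w' - w * u' + u * u'), ⟨by positivity, ?_⟩, ?_, ?_⟩
  · rw [div_le_one hden]
    have : 0 ≤ w * w' * (1 - u') + u' * (1 - w') * (1 - w) := by
      have h1 := mul_nonneg (mul_nonneg hu'.le (sub_nonneg.2 hw1'.le)) (sub_nonneg.2 hw1.le)
      have h2 := mul_nonneg (mul_nonneg hw.le hw0.le) (sub_nonneg.2 hu1'.le)
      linarith
    nlinarith
  · rw [div_le_one hden]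
    have h1 := mul_nonneg (mul_nonneg hw.le (sub_nonneg.2 hu.le)) (sub_nonneg.2 hu1'.le)
    have h2 := mul_nonneg (mul_nonneg hu0.le hu'.le) (sub_nonneg.2 hw1.le)
    nlinarith
  · field_simp
  · have := hden.ne'
    rw [one_sub_div this, one_sub_div this, div_mul_eq_mul_div, div_mul_eq_mul_div,
      div_mul_eq_mul_div, ← add_div]
    congr 1
    ring

variable {ι : Type} {T : IdealTriangulation ι}

namespace SimpleCurve

variable (γ : SimpleCurve T)

/-- Whether an arc turns counterclockwise. -/
def left (k : Fin (γ.len + 1)) : Bool := decide (Equiv.Perm.sign (γ.arc k).2 = 1)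

/-- The side through which an arc leaves its triangle. -/
def out (k : Fin (γ.len + 1)) : DirEdge ι :=
  ⟨((γ.arc k).1, (γ.arc k).2 0, (γ.arc k).2 2), fun h => by
    simpa using (γ.arc k).2.injective h⟩

/-- The side through which an arc enters its triangle. -/
def inn (k : Fin (γ.len + 1)) : DirEdge ι :=
  ⟨((γ.arc k).1, (γ.arc k).2 0, (γ.arc k).2 1), fun h => by
    simpa using (γ.arc k).2.injective h⟩

theorem inn_succ (k : Fin (γ.len + 1)) : γ.inn (k + 1) = T.opp (γ.out k) :=
  DirEdge.ext (γ.arc_tet k) (γ.arc_vertex k) (γ.arc_side k)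

/-- The side that starts at the corner cut off by an arc. -/
def cornerSide (k : Fin (γ.len + 1)) : DirEdge ι := if γ.left k then γ.inn k else γ.out k

/-- The end point of an arc on the side that starts at the corner. -/
def near (k : Fin (γ.len + 1)) : Fin 4 → ℝ := if γ.left k then γ.entry k else γ.exit k

/-- The end point of an arc on the side that ends at the corner. -/
def far (k : Fin (γ.len + 1)) : Fin 4 → ℝ := if γ.left k then γ.exit k else γ.entry k

theorem sign_of_left {k : Fin (γ.len + 1)} (h : γ.left k = true) :
    Equiv.Perm.sign (γ.arc k).2 = 1 := of_decide_eq_true h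

theorem sign_of_not_left {k : Fin (γ.len + 1)} (h : γ.left k = false) :
    Equiv.Perm.sign (γ.arc k).2 = -1 :=
  (Int.units_eq_one_or _).resolve_left (of_decide_eq_false h)

theorem rot_cornerSide (k : Fin (γ.len + 1)) :
    rot (γ.cornerSide k).1.2.1 (γ.cornerSide k).1.2.2 = (γ.arc k).2 3 := by
  unfold cornerSide
  cases h : γ.left k
  · exact (rot_of_odd _ (γ.sign_of_not_left h)).1
  · exact (rot_of_even _ (γ.sign_of_left h)).1

theorem cornerSide_one (k : Fin (γ.len + 1)) : (γ.cornerSide k).1.1 = (γ.arc k).1 := by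
  unfold cornerSide
  split_ifs <;> rfl

theorem cornerSide_two (k : Fin (γ.len + 1)) : (γ.cornerSide k).1.2.1 = (γ.arc k).2 0 := by
  unfold cornerSide
  split_ifs <;> rfl

theorem out_of_left {k : Fin (γ.len + 1)} (h : γ.left k = true) :
    γ.out k = nextSide.symm (γ.cornerSide k) := by
  have := rot_of_even _ (γ.sign_of_left h)
  unfold cornerSide
  rw [if_pos h]
  refine DirEdge.ext rfl rfl ?_
  change _ = rot _ (rot _ _)
  change _ = rot ((γ.arc k).2 0) (rot ((γ.arc k).2 0) ((γ.arc k).2 1))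
  rw [this.1, this.2.1]
  rfl

theorem inn_of_not_left {k : Fin (γ.len + 1)} (h : γ.left k = false) :
    γ.inn k = nextSide.symm (γ.cornerSide k) := by
  have := rot_of_odd _ (γ.sign_of_not_left h)
  unfold cornerSide
  rw [if_neg (by simp [h])]
  refine DirEdge.ext rfl rfl ?_
  change _ = rot ((γ.arc k).2 0) (rot ((γ.arc k).2 0) ((γ.arc k).2 2))
  rw [this.1, this.2.1]
  rfl

theorem exit_sum (k : Fin (γ.len + 1)) : ∑ w, γ.exit k w = 1 := by
  rw [← γ.entry_sum (k + 1),
    ← Equiv.sum_comp (T.perm (γ.arc k).1 ((γ.arc k).2 2)) (γ.entry (k + 1))]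
  exact Finset.sum_congr rfl fun w _ => (γ.entry_succ k w).symm

theorem entry_add (k : Fin (γ.len + 1)) :
    γ.entry k ((γ.arc k).2 2) + γ.entry k ((γ.arc k).2 3) = 1 := by
  have h := γ.entry_sum k
  obtain ⟨h0, h1, -⟩ := γ.entry_mem k
  rw [← Equiv.sum_comp (γ.arc k).2, Fin.sum_univ_four, h0, h1] at h
  linarith

theorem exit_add (k : Fin (γ.len + 1)) :
    γ.exit k ((γ.arc k).2 1) + γ.exit k ((γ.arc k).2 3) = 1 := by
  have h := γ.exit_sum k
  obtain ⟨h0, h1, -⟩ := γ.exit_mem k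
  rw [← Equiv.sum_comp (γ.arc k).2, Fin.sum_univ_four, h0, h1] at h
  linarith

/-- The distance of an arc from the corner, on the side that starts there. -/
def nearDist (k : Fin (γ.len + 1)) : ℝ := 1 - γ.near k ((γ.arc k).2 3)

/-- The distance of an arc from the corner, on the side that ends there. -/
def farDist (k : Fin (γ.len + 1)) : ℝ := 1 - γ.far k ((γ.arc k).2 3)

theorem near_coords (k : Fin (γ.len + 1)) :
    γ.near k (γ.cornerSide k).1.2.1 = 0 ∧ γ.near k (γ.cornerSide k).1.2.2 = 0 ∧
    γ.near k (rot (γ.cornerSide k).1.2.1 (γ.cornerSide k).1.2.2) = 1 - γ.nearDist k ∧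
    γ.near k (rot (γ.cornerSide k).1.2.1 (rot (γ.cornerSide k).1.2.1 (γ.cornerSide k).1.2.2)) =
      γ.nearDist k ∧ 0 < γ.nearDist k ∧ γ.nearDist k < 1 := by
  rw [γ.rot_cornerSide, γ.cornerSide_two]
  unfold nearDist near cornerSide
  cases h : γ.left k
  · simp only [Bool.false_eq_true, if_false]
    obtain ⟨h0, h1, h2, h3⟩ := γ.exit_mem k
    have h4 := γ.exit_add k
    rw [(rot_of_odd _ (γ.sign_of_not_left h)).2.1]
    exact ⟨h0, h1, by ring, by linarith, by linarith, by linarith⟩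
  · simp only [if_true]
    obtain ⟨h0, h1, h2, h3⟩ := γ.entry_mem k
    have h4 := γ.entry_add k
    rw [(rot_of_even _ (γ.sign_of_left h)).2.1]
    exact ⟨h0, h1, by ring, by linarith, by linarith, by linarith⟩

theorem far_coords (k : Fin (γ.len + 1)) :
    γ.far k (γ.cornerSide k).1.2.1 = 0 ∧ γ.far k (γ.cornerSide k).1.2.2 = γ.farDist k ∧
    γ.far k (rot (γ.cornerSide k).1.2.1 (γ.cornerSide k).1.2.2) = 1 - γ.farDist k ∧
    γ.far k (rot (γ.cornerSide k).1.2.1 (rot (γ.cornerSide k).1.2.1 (γ.cornerSide k).1.2.2)) =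
      0 ∧ 0 < γ.farDist k ∧ γ.farDist k < 1 := by
  rw [γ.rot_cornerSide, γ.cornerSide_two]
  unfold farDist far cornerSide
  cases h : γ.left k
  · simp only [Bool.false_eq_true, if_false]
    obtain ⟨h0, h1, h2, h3⟩ := γ.entry_mem k
    have h4 := γ.entry_add k
    rw [(rot_of_odd _ (γ.sign_of_not_left h)).2.1]
    refine ⟨h0, ?_, by ring, h1, by linarith, by linarith⟩
    change γ.entry k ((γ.arc k).2 2) = _
    linarith
  · simp only [if_true]
    obtain ⟨h0, h1, h2, h3⟩ := γ.exit_mem k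
    have h4 := γ.exit_add k
    rw [(rot_of_even _ (γ.sign_of_left h)).2.1]
    refine ⟨h0, ?_, by ring, h1, by linarith, by linarith⟩
    change γ.exit k ((γ.arc k).2 1) = _
    linarith

theorem mem_segment (k : Fin (γ.len + 1)) {s : ℝ} (hs : s ∈ Set.Icc (0 : ℝ) 1) :
    (1 - s) • γ.near k + s • γ.far k ∈ segment ℝ (γ.entry k) (γ.exit k) := by
  unfold near far
  cases h : γ.left k
  · rw [segment_symm]
    exact ⟨1 - s, s, by linarith [hs.2], hs.1, by ring, rfl⟩
  · exact ⟨1 - s, s, by linarith [hs.2], hs.1, by ring, rfl⟩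

theorem ne_point {k l : Fin (γ.len + 1)} (hkl : k ≠ l)
    (h1 : (γ.cornerSide k).1.1 = (γ.cornerSide l).1.1)
    (h2 : (γ.cornerSide k).1.2.1 = (γ.cornerSide l).1.2.1) {s t : ℝ}
    (hs : s ∈ Set.Icc (0 : ℝ) 1) (ht : t ∈ Set.Icc (0 : ℝ) 1) :
    (1 - s) • γ.near k + s • γ.far k ≠ (1 - t) • γ.near l + t • γ.far l := by
  intro e
  rw [γ.cornerSide_one, γ.cornerSide_one] at h1
  rw [γ.cornerSide_two, γ.cornerSide_two] at h2
  exact Set.disjoint_left.1 (γ.simple k l hkl h1 h2) (γ.mem_segment k hs)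
    (e ▸ γ.mem_segment l ht)

/-- Two arcs around one corner whose order on one side is not their order on the other side would
intersect. -/
theorem not_crossing {k l : Fin (γ.len + 1)} (h : γ.cornerSide k = γ.cornerSide l) (hkl : k ≠ l)
    (h1 : γ.nearDist k ≤ γ.nearDist l) : γ.farDist k < γ.farDist l := by
  by_contra! h2
  obtain ⟨a1, a2, a3, a4, a5, a6⟩ := γ.near_coords k
  obtain ⟨b1, b2, b3, b4, b5, b6⟩ := γ.far_coords k
  obtain ⟨c1, c2, c3, c4, c5, c6⟩ := γ.near_coords l
  obtain ⟨d1, d2, d3, d4, d5, d6⟩ := γ.far_coords l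
  obtain ⟨s, hs, t, ht, e1, e2⟩ := exists_intersection_same_corner a5 b5 c5 d5 h1 h2
  refine γ.ne_point hkl (by rw [h]) (by rw [h]) hs ht (funext fun x => ?_)
  simp only [Pi.add_apply, Pi.smul_apply, smul_eq_mul]
  rw [← h] at c1 c2 c3 c4 d1 d2 d3 d4
  rcases fin_four_cases _ _ x (γ.cornerSide k).2 with rfl | rfl | rfl | rfl
  · rw [a1, b1, c1, d1]; ring
  · rw [a2, b2, c2, d2]; linarith
  · rw [a3, b3, c3, d3]; linarith
  · rw [a4, b4, c4, d4]; linarith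

theorem nested {k l : Fin (γ.len + 1)} (h : γ.cornerSide k = γ.cornerSide l) (hkl : k ≠ l) :
    (γ.nearDist k < γ.nearDist l ∧ γ.farDist k < γ.farDist l) ∨
      (γ.nearDist l < γ.nearDist k ∧ γ.farDist l < γ.farDist k) := by
  rcases lt_trichotomy (γ.nearDist k) (γ.nearDist l) with h1 | h1 | h1
  · exact Or.inl ⟨h1, γ.not_crossing h hkl h1.le⟩
  · exact absurd ((γ.not_crossing h hkl h1.le).trans (γ.not_crossing h.symm hkl.symm h1.ge))
      (lt_irrefl _)
  · exact Or.inr ⟨h1, γ.not_crossing h.symm hkl.symm h1.le⟩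

/-- Arcs around consecutive corners that overlap on the common side would intersect. -/
theorem disjoint {k l : Fin (γ.len + 1)} (h : γ.cornerSide l = nextSide (γ.cornerSide k)) :
    γ.nearDist k < 1 - γ.farDist l := by
  by_contra! h2
  have hkl : k ≠ l := by
    rintro rfl
    exact nextSide_ne _ h.symm
  obtain ⟨a1, a2, a3, a4, a5, a6⟩ := γ.near_coords k
  obtain ⟨b1, b2, b3, b4, b5, b6⟩ := γ.far_coords k
  obtain ⟨c1, c2, c3, c4, c5, c6⟩ := γ.near_coords l
  obtain ⟨d1, d2, d3, d4, d5, d6⟩ := γ.far_coords l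
  obtain ⟨s, hs, t, ht, e1, e2⟩ := exists_intersection_next_corner a6 b5 b6 c5 c6 d6 h2
  have ht' : 1 - t ∈ Set.Icc (0 : ℝ) 1 := ⟨by linarith [ht.2], by linarith [ht.1]⟩
  refine γ.ne_point hkl (by rw [h]; rfl) (by rw [h]; rfl) hs ht' (funext fun x => ?_)
  simp only [Pi.add_apply, Pi.smul_apply, smul_eq_mul]
  have e21 : (γ.cornerSide l).1.2.1 = (γ.cornerSide k).1.2.1 := by rw [h]; rfl
  have e22 : (γ.cornerSide l).1.2.2 = rot (γ.cornerSide k).1.2.1 (γ.cornerSide k).1.2.2 := by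
    rw [h]; rfl
  rw [e21] at c1 c3 c4 d1 d3 d4
  rw [e22] at c2 c3 c4 d2 d3 d4
  rw [rot_three] at c4 d4
  rcases fin_four_cases _ _ x (γ.cornerSide k).2 with rfl | rfl | rfl | rfl
  · rw [a1, b1, c1, d1]; ring
  · rw [a2, b2, c4, d4]; linarith
  · rw [a3, b3, c2, d2]; linarith
  · rw [a4, b4, c3, d3]; linarith

theorem side_succ (k : Fin (γ.len + 1)) :
    (if γ.left (k + 1) then γ.cornerSide (k + 1) else nextSide.symm (γ.cornerSide (k + 1))) =
      T.opp (if γ.left k then nextSide.symm (γ.cornerSide k) else γ.cornerSide k) := by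
  have h1 : ∀ l, (if γ.left l then γ.cornerSide l else nextSide.symm (γ.cornerSide l)) =
      γ.inn l := by
    intro l
    cases h : γ.left l
    · rw [if_neg (by simp), γ.inn_of_not_left h]
    · rw [if_pos rfl, cornerSide, if_pos h]
  have h2 : (if γ.left k then nextSide.symm (γ.cornerSide k) else γ.cornerSide k) = γ.out k := by
    cases h : γ.left k
    · rw [if_neg (by simp), cornerSide, if_neg (by simp [h])]
    · rw [if_pos rfl, γ.out_of_left h]
  rw [h1, h2, γ.inn_succ]

theorem pos_succ (k : Fin (γ.len + 1)) :
    (if γ.left (k + 1) then γ.nearDist (k + 1) else 1 - γ.farDist (k + 1)) =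
      1 - (if γ.left k then 1 - γ.farDist k else γ.nearDist k) := by
  have h1 : ∀ l, (if γ.left l then γ.nearDist l else 1 - γ.farDist l) =
      1 - γ.entry l (rot ((γ.arc l).2 0) ((γ.arc l).2 1)) := by
    intro l
    have h4 := γ.entry_add l
    unfold nearDist farDist near far
    cases h : γ.left l
    · simp only [Bool.false_eq_true, if_false]
      rw [(rot_of_odd _ (γ.sign_of_not_left h)).2.2]
      linarith
    · simp only [if_true]
      rw [(rot_of_even _ (γ.sign_of_left h)).1]
  have h2 : 1 - (if γ.left k then 1 - γ.farDist k else γ.nearDist k) =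
      γ.exit k (rot ((γ.arc k).2 0) ((γ.arc k).2 2)) := by
    have h4 := γ.exit_add k
    unfold nearDist farDist near far
    cases h : γ.left k
    · simp only [Bool.false_eq_true, if_false]
      rw [(rot_of_odd _ (γ.sign_of_not_left h)).1]
      linarith
    · simp only [if_true]
      rw [(rot_of_even _ (γ.sign_of_left h)).2.2]
      linarith
  have h3 : γ.exit k (rot ((γ.arc k).2 0) ((γ.arc k).2 2)) +
      γ.exit k (rot ((γ.arc k).2 0) (rot ((γ.arc k).2 0) ((γ.arc k).2 2))) = 1 := by
    have h4 := γ.exit_add k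
    rcases Int.units_eq_one_or (Equiv.Perm.sign (γ.arc k).2) with h | h
    · obtain ⟨r1, r2, r3⟩ := rot_of_even _ h
      rw [r3, r1, h4]
    · obtain ⟨r1, r2, r3⟩ := rot_of_odd _ h
      rw [r1, r2]
      linarith
  rw [h1, h2, γ.arc_vertex, γ.arc_side, odd_rot _ (T.sign_perm _ _) ((γ.arc k).2 0) ((γ.arc k).2 2) (γ.out k).2,
    γ.entry_succ]
  change 1 - γ.exit k (rot ((γ.arc k).2 0) (rot ((γ.arc k).2 0) ((γ.arc k).2 2))) = _
  linarith

/-- The turning of a curve, in terms of the arcs. -/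
theorem sum_curveCount [Fintype ι] (F : ι → Fin 3 → ℝ) :
    ∑ j, ∑ p, (γ.curveCount j p : ℝ) * F j p =
      ∑ k, if γ.left k then cornerFun F (γ.cornerSide k) else - cornerFun F (γ.cornerSide k) := by
  classical
  have h1 : ∀ k, (if γ.left k then cornerFun F (γ.cornerSide k)
      else - cornerFun F (γ.cornerSide k)) = ∑ j, ∑ p, (if (γ.arc k).1 = j ∧
        pairType ((γ.arc k).2 0) ((γ.arc k).2 3) = p
        then ((Equiv.Perm.sign (γ.arc k).2 : ℤ) : ℝ) else 0) * F j p := by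
    intro k
    rw [Finset.sum_eq_single (γ.arc k).1, Finset.sum_eq_single
      (pairType ((γ.arc k).2 0) ((γ.arc k).2 3)), 
      if_pos (show (γ.arc k).1 = (γ.arc k).1 ∧ pairType ((γ.arc k).2 0) ((γ.arc k).2 3) =
        pairType ((γ.arc k).2 0) ((γ.arc k).2 3) from ⟨rfl, rfl⟩)]
    · unfold cornerFun
      rw [γ.rot_cornerSide, γ.cornerSide_one, γ.cornerSide_two]
      cases h : γ.left k
      · simp [γ.sign_of_not_left h]
      · simp [γ.sign_of_left h]
    · intro p _ hp
      rw [if_neg (fun h => hp h.2.symm), zero_mul]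
    · simp
    · intro j _ hj
      apply Finset.sum_eq_zero
      intro p _
      rw [if_neg (fun h => hj h.1.symm), zero_mul]
    · simp
  rw [Finset.sum_congr rfl fun k _ => h1 k]
  conv_rhs => rw [Finset.sum_comm]
  refine Finset.sum_congr rfl fun j _ => ?_
  conv_rhs => rw [Finset.sum_comm]
  refine Finset.sum_congr rfl fun p _ => ?_
  rw [← Finset.sum_mul, curveCount]
  push_cast
  rfl

theorem sum_side (θ : Marking T) (L : ℤ × ℤ →+ ℤ) :
    ∑ k, θ.side L (γ.out k) = L (γ.homologyClass θ) := by
  unfold homologyClass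
  rw [map_sum]
  rfl

end SimpleCurve

open scoped Fin.NatCast in
theorem exists_cyclic_potential {n : ℕ} (w : Fin (n + 1) → ℤ) (h : ∑ k, w k = 0) :
    ∃ ν : Fin (n + 1) → ℤ, ∀ k, ν (k + 1) = ν k + w k := by
  refine ⟨fun k => ∑ l ∈ Finset.range k.val, w (l : Fin (n + 1)), fun k => ?_⟩
  have h1 : (∑ l ∈ Finset.range k.val, w (l : Fin (n + 1))) + w k =
      ∑ l ∈ Finset.range (k.val + 1), w (l : Fin (n + 1)) := by
    rw [Finset.sum_range_succ, Fin.cast_val_eq_self]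
  simp only
  rw [h1]
  rcases eq_or_ne k (Fin.last n) with rfl | hk
  · rw [Fin.last_add_one]
    have h2 : ∑ l ∈ Finset.range ((Fin.last n).val + 1), w (l : Fin (n + 1)) = 0 := by
      rw [← h]
      refine (Fin.sum_univ_eq_sum_range (fun l : ℕ => w (l : Fin (n + 1))) (n + 1)).symm.trans ?_
      exact Finset.sum_congr rfl fun l _ => by rw [Fin.cast_val_eq_self]
    rw [h2]
    simp
  · rw [Fin.val_add_one, if_neg hk]

open scoped Fin.NatCast in
theorem cyclic_trans {n : ℕ} {U : Fin (n + 1) → Prop} (hU : ∀ k, U k → U (k + 1)) {a b : Fin (n + 1)}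
    (h : U a) : U b := by
  have key : ∀ m : ℕ, U (a + (m : Fin (n + 1))) := by
    intro m
    induction m with
    | zero => simpa using h
    | succ m ih =>
      have := hU _ ih
      rwa [add_assoc, ← Nat.cast_succ] at this
  have := key (b - a).val
  rwa [Fin.cast_val_eq_self, add_sub_cancel] at this

namespace SimpleCurve

variable {ι₁ ι₂ : Type} {T₁ : IdealTriangulation ι₁} {T₂ : IdealTriangulation ι₂}

/-- Two curves on two triangulations. -/
def pair (γ₁ : SimpleCurve T₁) (γ₂ : SimpleCurve T₂) :
    CurvePair (DirEdge ι₁ ⊕ DirEdge ι₂) (Fin (γ₁.len + 1) ⊕ Fin (γ₂.len + 1)) where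
  φ := Equiv.sumCongr nextSide nextSide
  α := Equiv.sumCongr T₁.opp T₂.opp
  φ_three d := by
    rcases d with d | d
    · exact congrArg _ (nextSide_three d)
    · exact congrArg _ (nextSide_three d)
  φ_ne d := by
    rcases d with d | d
    · exact fun e => nextSide_ne d (Sum.inl_injective e)
    · exact fun e => nextSide_ne d (Sum.inr_injective e)
  α_α d := by
    rcases d with d | d
    · exact congrArg _ (T₁.opp_opp d)
    · exact congrArg _ (T₂.opp_opp d)
  α_ne d := by
    rcases d with d | d
    · exact fun e => T₁.opp_ne d (Sum.inl_injective e)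
    · exact fun e => T₂.opp_ne d (Sum.inr_injective e)
  corner := Sum.map γ₁.cornerSide γ₂.cornerSide
  left := Sum.elim γ₁.left γ₂.left
  which := Sum.isLeft
  succ := Equiv.sumCongr (Equiv.addRight 1) (Equiv.addRight 1)
  u := Sum.elim γ₁.nearDist γ₂.nearDist
  w := Sum.elim γ₁.farDist γ₂.farDist
  u_pos a := by
    rcases a with a | a
    exacts [(γ₁.near_coords a).2.2.2.2.1, (γ₂.near_coords a).2.2.2.2.1]
  u_lt a := by
    rcases a with a | a
    exacts [(γ₁.near_coords a).2.2.2.2.2, (γ₂.near_coords a).2.2.2.2.2]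
  w_pos a := by
    rcases a with a | a
    exacts [(γ₁.far_coords a).2.2.2.2.1, (γ₂.far_coords a).2.2.2.2.1]
  w_lt a := by
    rcases a with a | a
    exacts [(γ₁.far_coords a).2.2.2.2.2, (γ₂.far_coords a).2.2.2.2.2]
  which_succ a := by
    rcases a with a | a <;> rfl
  succ_trans U hU a b := by
    rcases a with a | a <;> rcases b with b | b
    · exact fun _ h => cyclic_trans (U := fun k => U (Sum.inl k)) (fun k => hU _) h
    · exact fun e => by simp at e
    · exact fun e => by simp at e
    · exact fun _ h => cyclic_trans (U := fun k => U (Sum.inr k)) (fun k => hU _) h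
  side_succ a := by
    rcases a with a | a
    · have := congrArg (Sum.inl (β := DirEdge ι₂)) (γ₁.side_succ a)
      rw [apply_ite Sum.inl] at this
      refine this.trans ?_
      change Sum.inl _ = Equiv.sumCongr T₁.opp T₂.opp (if γ₁.left a then _ else _)
      split_ifs <;> rfl
    · have := congrArg (Sum.inr (α := DirEdge ι₁)) (γ₂.side_succ a)
      rw [apply_ite Sum.inr] at this
      refine this.trans ?_
      change Sum.inr _ = Equiv.sumCongr T₁.opp T₂.opp (if γ₂.left a then _ else _)
      split_ifs <;> rfl
  pos_succ a := by
    rcases a with a | a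
    exacts [γ₁.pos_succ a, γ₂.pos_succ a]
  nested a b h hab := by
    rcases a with a | a <;> rcases b with b | b
    · exact γ₁.nested (Sum.inl_injective h) (fun e => hab (congrArg _ e))
    · simp at h
    · simp at h
    · exact γ₂.nested (Sum.inr_injective h) (fun e => hab (congrArg _ e))
  disjoint a b h := by
    rcases a with a | a <;> rcases b with b | b
    · exact γ₁.disjoint (Sum.inl_injective h)
    · simp at h
    · simp at h
    · exact γ₂.disjoint (Sum.inr_injective h)

theorem pair_out_inl (γ₁ : SimpleCurve T₁) (γ₂ : SimpleCurve T₂) (k : Fin (γ₁.len + 1)) :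
    (γ₁.pair γ₂).out (Sum.inl k) = Sum.inl (γ₁.out k) := by
  change (if γ₁.left k then _ else _) = _
  cases h : γ₁.left k
  · rw [if_neg (by simp)]
    change Sum.inl (γ₁.cornerSide k) = _
    rw [cornerSide, if_neg (by simp [h])]
  · rw [if_pos rfl, γ₁.out_of_left h]
    rfl

theorem pair_out_inr (γ₁ : SimpleCurve T₁) (γ₂ : SimpleCurve T₂) (k : Fin (γ₂.len + 1)) :
    (γ₁.pair γ₂).out (Sum.inr k) = Sum.inr (γ₂.out k) := by
  change (if γ₂.left k then _ else _) = _
  cases h : γ₂.left k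
  · rw [if_neg (by simp)]
    change Sum.inr (γ₂.cornerSide k) = _
    rw [cornerSide, if_neg (by simp [h])]
  · rw [if_pos rfl, γ₂.out_of_left h]
    rfl

theorem sum_which_true (γ₁ : SimpleCurve T₁) (γ₂ : SimpleCurve T₂)
    (w : Fin (γ₁.len + 1) ⊕ Fin (γ₂.len + 1) → ℝ) :
    ∑ a with (γ₁.pair γ₂).which a = true, w a = ∑ k, w (Sum.inl k) := by
  rw [Finset.sum_filter, Fintype.sum_sum_type]
  simp [pair]

theorem sum_which_false (γ₁ : SimpleCurve T₁) (γ₂ : SimpleCurve T₂)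
    (w : Fin (γ₁.len + 1) ⊕ Fin (γ₂.len + 1) → ℝ) :
    ∑ a with (γ₁.pair γ₂).which a = false, w a = ∑ k, w (Sum.inr k) := by
  rw [Finset.sum_filter, Fintype.sum_sum_type]
  simp [pair]

variable [Fintype ι₁] [Fintype ι₂]

theorem pair_turning_true (γ₁ : SimpleCurve T₁) (γ₂ : SimpleCurve T₂) (F₁ : ι₁ → Fin 3 → ℝ)
    (F₂ : ι₂ → Fin 3 → ℝ) :
    (γ₁.pair γ₂).turning (Sum.elim (cornerFun F₁) (cornerFun F₂)) true =
      ∑ j, ∑ p, (γ₁.curveCount j p : ℝ) * F₁ j p := by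
  rw [γ₁.sum_curveCount, CurvePair.turning, sum_which_true]
  rfl

theorem pair_turning_false (γ₁ : SimpleCurve T₁) (γ₂ : SimpleCurve T₂) (F₁ : ι₁ → Fin 3 → ℝ)
    (F₂ : ι₂ → Fin 3 → ℝ) :
    (γ₁.pair γ₂).turning (Sum.elim (cornerFun F₁) (cornerFun F₂)) false =
      ∑ j, ∑ p, (γ₂.curveCount j p : ℝ) * F₂ j p := by
  rw [γ₂.sum_curveCount, CurvePair.turning, sum_which_false]
  rfl

/-- Curves that are trivial for a cocycle have a common potential. -/
theorem exists_pair_potential (γ₁ : SimpleCurve T₁) (γ₂ : SimpleCurve T₂) (τ₁ : DirEdge ι₁ → ℤ)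
    (τ₂ : DirEdge ι₂ → ℤ) (h₁ : ∑ k, τ₁ (γ₁.out k) = 0) (h₂ : ∑ k, τ₂ (γ₂.out k) = 0) :
    ∃ ν : Fin (γ₁.len + 1) ⊕ Fin (γ₂.len + 1) → ℤ, ∀ a,
      ν ((γ₁.pair γ₂).succ a) = ν a + Sum.elim τ₁ τ₂ ((γ₁.pair γ₂).out a) := by
  obtain ⟨ν₁, hν₁⟩ := exists_cyclic_potential _ h₁
  obtain ⟨ν₂, hν₂⟩ := exists_cyclic_potential _ h₂
  refine ⟨Sum.elim ν₁ ν₂, fun a => ?_⟩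
  rcases a with a | a
  · rw [pair_out_inl]
    exact hν₁ a
  · rw [pair_out_inr]
    exact hν₂ a

end SimpleCurve

end NeumannZagier

/-! ### Edges as pairs of boundary vertices, and homology invariance of the turning. -/

namespace NeumannZagier

variable {ι : Type}

/-- A function of the pairs of opposite edges as a function of directed edges. -/
def edgeFun {α : Type*} (F : ι → Fin 3 → α) (x : DirEdge ι) : α :=
  F x.1.1 (pairType x.1.2.1 x.1.2.2)

theorem edgeFun_rev {α : Type*} (F : ι → Fin 3 → α) (x : DirEdge ι) :
    edgeFun F x.rev = edgeFun F x := by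
  unfold edgeFun
  rw [pairType_comm]
  rfl

namespace IdealTriangulation

variable (T : IdealTriangulation ι)

theorem edgeStep_rev {x y : DirEdge ι} (h : T.EdgeStep x y) : T.EdgeStep x.rev y.rev := by
  obtain ⟨u, h1, h2, rfl⟩ := h
  exact ⟨u, h2, h1, rfl⟩

theorem mk_rev_eq {x y : DirEdge ι} (h : (Quot.mk _ x : T.Vertex) = Quot.mk _ y) :
    (Quot.mk _ x.rev : T.Vertex) = Quot.mk _ y.rev :=
  congrArg (Quot.map DirEdge.rev fun _ _ => T.edgeStep_rev) h

theorem edgeOf_eq_iff {x y : DirEdge ι} : T.edgeOf x = T.edgeOf y ↔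
    (Quot.mk _ x : T.Vertex) = Quot.mk _ y ∨ (Quot.mk _ x : T.Vertex) = Quot.mk _ y.rev := by
  constructor
  · intro h
    have h1 : ∀ x y : DirEdge ι, T.EdgeStep x y ∨ y = x.rev →
        ({Quot.mk _ x, Quot.mk _ x.rev} : Set T.Vertex) = {Quot.mk _ y, Quot.mk _ y.rev} := by
      rintro x y (h | rfl)
      · have e : (Quot.mk _ x : T.Vertex) = Quot.mk _ y := Quot.sound h
        rw [e, T.mk_rev_eq e]
      · rw [rev_rev, Set.pair_comm]
    have h2 := congrArg (Quot.lift (fun x : DirEdge ι =>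
      ({Quot.mk _ x, Quot.mk _ x.rev} : Set T.Vertex)) h1) h
    have h3 : (Quot.mk _ x : T.Vertex) ∈ ({Quot.mk _ x, Quot.mk _ x.rev} : Set T.Vertex) :=
      Or.inl rfl
    have h4 : (Quot.mk _ x : T.Vertex) ∈ ({Quot.mk _ y, Quot.mk _ y.rev} : Set T.Vertex) :=
      (Set.ext_iff.1 h2 _).1 h3
    exact h4
  · have key : ∀ {x y : DirEdge ι}, (Quot.mk _ x : T.Vertex) = Quot.mk _ y →
        T.edgeOf x = T.edgeOf y := fun h =>
      congrArg (Quot.lift T.edgeOf fun x y hxy => Quot.sound (Or.inl hxy)) h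
    rintro (h | h)
    · exact key h
    · exact (key h).trans (Quot.sound (r := fun x y : DirEdge ι => T.EdgeStep x y ∨ y = x.rev)
        (Or.inr rfl)).symm

theorem edgeOf_rev (x : DirEdge ι) : T.edgeOf x.rev = T.edgeOf x :=
  T.edgeOf_eq_iff.2 (Or.inr rfl)

theorem edgeOf_surjective : Function.Surjective T.edgeOf := Quot.mk_surjective

variable {T} in
-- The two ends of an edge are different vertices of the boundary torus; this is where the manifold
-- condition enters.
theorem TorusBoundary.mk_rev_ne (hT : T.TorusBoundary) (x : DirEdge ι) :
    (Quot.mk _ x : T.Vertex) ≠ Quot.mk _ x.rev := fun h =>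
  hT.not_reversed x (Quot.eqvGen_exact h)

open Classical in
theorem sum_edgeCount [Fintype ι] {R : Type*} [CommRing R] (E : T.Edge) (F : ι → Fin 3 → R) :
    ∑ j, ∑ p, (T.edgeCount E j p : R) * F j p =
      ∑ x : DirEdge ι with x.1.2.1 < x.1.2.2 ∧ T.edgeOf x = E, edgeFun F x := by
  let G : ι × Fin 4 × Fin 4 → R := fun y =>
    if ∃ h : y.2.1 < y.2.2, T.edgeOf ⟨y, h.ne⟩ = E then F y.1 (pairType y.2.1 y.2.2) else 0
  have h1 : ∀ j p, (T.edgeCount E j p : R) * F j p =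
      ∑ x : Fin 4 × Fin 4, if pairType x.1 x.2 = p then G (j, x) else 0 := by
    intro j p
    unfold edgeCount
    push_cast
    rw [Finset.card_filter]
    push_cast
    rw [Finset.sum_mul]
    refine Finset.sum_congr rfl fun x _ => ?_
    by_cases hp : pairType x.1 x.2 = p
    · subst hp
      by_cases hx : ∃ h : x.1 < x.2, T.edgeOf ⟨(j, x), h.ne⟩ = E
      · simp only [G]
        rw [if_pos ⟨trivial, hx⟩, if_pos trivial, if_pos hx, one_mul]
      · simp only [G]
        rw [if_neg (fun h => hx h.2), if_pos trivial, if_neg hx, zero_mul]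
    · rw [if_neg (fun h => hp h.1), if_neg hp, zero_mul]
  have h2 : ∑ j, ∑ p, (T.edgeCount E j p : R) * F j p = ∑ y, G y := by
    rw [Fintype.sum_prod_type]
    refine Finset.sum_congr rfl fun j _ => ?_
    rw [Finset.sum_congr rfl fun p _ => h1 j p, Finset.sum_comm]
    refine Finset.sum_congr rfl fun x _ => ?_
    simp
  rw [h2, Finset.sum_filter]
  have h3 : ∀ x : DirEdge ι, (if x.1.2.1 < x.1.2.2 ∧ T.edgeOf x = E then edgeFun F x else 0) =
      G x.1 := by
    intro x
    simp only [G]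
    by_cases h : x.1.2.1 < x.1.2.2 ∧ T.edgeOf x = E
    · rw [if_pos h, if_pos ⟨h.1, h.2⟩]
      rfl
    · rw [if_neg h, if_neg fun ⟨k1, k2⟩ => h ⟨k1, k2⟩]
  rw [Finset.sum_congr rfl fun x _ => h3 x,
    ← Finset.sum_subtype (Finset.univ.filter fun y : ι × Fin 4 × Fin 4 => y.2.1 ≠ y.2.2)
      (fun x => by simp) G, Finset.sum_filter_of_ne]
  intro y _ hy e
  apply hy
  simp only [G]
  rw [if_neg]
  rintro ⟨h, -⟩
  exact h.ne e

open Classical in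
theorem sum_edge_eq [Fintype ι] {R : Type*} [CommRing R] (E : T.Edge) (F : ι → Fin 3 → R) :
    ∑ x with T.edgeOf x = E, edgeFun F x = 2 * ∑ j, ∑ p, (T.edgeCount E j p : R) * F j p := by
  rw [sum_edgeCount, two_mul, ← Finset.sum_filter_add_sum_filter_not _ (fun x => x.1.2.1 < x.1.2.2),
    Finset.filter_filter, Finset.filter_filter]
  congr 1
  · refine Finset.sum_congr (Finset.filter_congr fun x _ => and_comm) fun _ _ => rfl
  · refine Finset.sum_bij' (fun x _ => x.rev) (fun x _ => x.rev) ?_ ?_ ?_ ?_ ?_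
    · intro x hx
      simp only [Finset.mem_filter_univ] at hx ⊢
      rw [edgeOf_rev]
      exact ⟨lt_of_le_of_ne (not_lt.1 hx.2) x.2.symm, hx.1⟩
    · intro x hx
      simp only [Finset.mem_filter_univ] at hx ⊢
      rw [edgeOf_rev]
      exact ⟨hx.2, hx.1.le.not_gt⟩
    · intro x _
      rfl
    · intro x _
      rfl
    · intro x _
      rw [edgeFun_rev]

open Classical in
-- The directed edges over an edge of the triangulation fall into two classes exchanged by reversal.
-- Each class is a boundary vertex and sees every coefficient of the edge equation exactly once.
theorem TorusBoundary.sum_class [Fintype ι] {T : IdealTriangulation ι} (hT : T.TorusBoundary)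
    (F : ι → Fin 3 → ℝ) (y : DirEdge ι) :
    ∑ x with (Quot.mk _ x : T.Vertex) = Quot.mk _ y, edgeFun F x =
      ∑ j, ∑ p, (T.edgeCount (T.edgeOf y) j p : ℝ) * F j p := by
  have h1 := T.sum_edge_eq (T.edgeOf y) F
  rw [← Finset.sum_filter_add_sum_filter_not _ (fun x => (Quot.mk _ x : T.Vertex) = Quot.mk _ y),
    Finset.filter_filter, Finset.filter_filter] at h1
  have h2 : ∑ x with T.edgeOf x = T.edgeOf y ∧ (Quot.mk _ x : T.Vertex) = Quot.mk _ y,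
      edgeFun F x = ∑ x with (Quot.mk _ x : T.Vertex) = Quot.mk _ y, edgeFun F x := by
    refine Finset.sum_congr (Finset.filter_congr fun x _ => ?_) fun _ _ => rfl
    exact ⟨fun h => h.2, fun h => ⟨T.edgeOf_eq_iff.2 (Or.inl h), h⟩⟩
  have h3 : ∑ x with T.edgeOf x = T.edgeOf y ∧ ¬ (Quot.mk _ x : T.Vertex) = Quot.mk _ y,
      edgeFun F x = ∑ x with (Quot.mk _ x : T.Vertex) = Quot.mk _ y, edgeFun F x := by
    refine Finset.sum_bij' (fun x _ => x.rev) (fun x _ => x.rev) ?_ ?_ ?_ ?_ ?_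
    · intro x hx
      simp only [Finset.mem_filter_univ] at hx ⊢
      have := (T.edgeOf_eq_iff.1 hx.1).resolve_left hx.2
      simpa [rev_rev] using T.mk_rev_eq this
    · intro x hx
      simp only [Finset.mem_filter_univ] at hx ⊢
      refine ⟨by rw [edgeOf_rev]; exact T.edgeOf_eq_iff.2 (Or.inl hx), fun h => ?_⟩
      exact hT.mk_rev_ne x (hx.trans h.symm)
    · intro x _
      rfl
    · intro x _
      rfl
    · intro x _
      rw [edgeFun_rev]
  rw [h2, h3, ← two_mul] at h1
  exact mul_left_cancel₀ two_ne_zero h1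

open Classical in
theorem TorusBoundary.sum_vertexOf [Fintype ι] {T : IdealTriangulation ι} (hT : T.TorusBoundary)
    (F : ι → Fin 3 → ℝ) (y : DirEdge ι) :
    ∑ x with T.vertexOf x = T.vertexOf y, cornerFun F x =
      ∑ j, ∑ p, (T.edgeCount (T.edgeOf (nextSide y)) j p : ℝ) * F j p := by
  rw [← hT.sum_class, Finset.sum_filter, Finset.sum_filter,
    ← Equiv.sum_comp nextSide (fun x => if (Quot.mk _ x : T.Vertex) = Quot.mk _ (nextSide y) then
      edgeFun F x else 0)]
  rfl

/-- The infinite cyclic cover given by a coordinate of the marking is connected if there is a curve on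
which the coordinate takes the value `1`. -/
theorem TorusBoundary.twisted_conn {T : IdealTriangulation ι} (hT : T.TorusBoundary)
    {θ : Marking T} {L : ℤ × ℤ →+ ℤ} {γ : SimpleCurve T} (hγ : L (γ.homologyClass θ) = 1)
    {v : DirEdge ι → ℤ → Prop} (h1 : ∀ d n, v (nextSide d) n ↔ v d n)
    (h2 : ∀ d n, v (T.opp d) (n + θ.side L d) ↔ v d n) (d d' : DirEdge ι) (n n' : ℤ)
    (h : v d n) : v d' n' := by
  have same : ∀ d d' : DirEdge ι, d.1.1 = d'.1.1 → d.1.2.1 = d'.1.2.1 → ∀ n, v d n ↔ v d' n := by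
    rintro ⟨⟨i, a, b⟩, hd⟩ ⟨⟨j, a', b'⟩, hd'⟩ e1 e2 n
    dsimp only at e1 e2
    subst e1 e2
    rcases fin_four_cases a b b' hd with rfl | rfl | rfl | rfl
    · exact absurd rfl hd'
    · rfl
    · exact (h1 ⟨(i, a, b), hd⟩ n).symm
    · exact (h1 ⟨(i, a, b), hd⟩ n).symm.trans (h1 (nextSide ⟨(i, a, b), hd⟩) n).symm
  have exists_side : ∀ x : ι × Fin 4, ∃ d : DirEdge ι, d.1.1 = x.1 ∧ d.1.2.1 = x.2 := by
    intro x
    obtain ⟨u, hu⟩ := exists_ne x.2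
    exact ⟨⟨(x.1, x.2, u), hu.symm⟩, rfl, rfl⟩
  -- Connectedness of the boundary gives a level shift between any two triangles; the curve `γ` is
  -- then needed to show that all levels at one triangle are linked.
  let r : ι × Fin 4 → ι × Fin 4 → Prop := fun x y => ∃ k : ℤ, ∀ d d' : DirEdge ι,
    d.1.1 = x.1 → d.1.2.1 = x.2 → d'.1.1 = y.1 → d'.1.2.1 = y.2 → ∀ n, v d n ↔ v d' (n + k)
  have hr : ∀ x y, r x y := by
    intro x y
    induction hT.connected x y with
    | rel x y h =>
      obtain ⟨u, hu, rfl⟩ := h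
      refine ⟨θ.side L ⟨(x.1, x.2, u), hu.symm⟩, fun d d' e1 e2 e3 e4 n => ?_⟩
      rw [same d ⟨(x.1, x.2, u), hu.symm⟩ e1 e2, ← h2]
      exact same _ _ e3.symm e4.symm _
    | refl x =>
      refine ⟨0, fun d d' e1 e2 e3 e4 n => ?_⟩
      rw [add_zero]
      exact same d d' (e1.trans e3.symm) (e2.trans e4.symm) n
    | symm x y _ ih =>
      obtain ⟨k, hk⟩ := ih
      refine ⟨-k, fun d d' e1 e2 e3 e4 n => ?_⟩
      rw [hk d' d e3 e4 e1 e2, neg_add_cancel_right]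
    | trans x y z _ _ ih1 ih2 =>
      obtain ⟨k, hk⟩ := ih1
      obtain ⟨l, hl⟩ := ih2
      refine ⟨k + l, fun d d' e1 e2 e3 e4 n => ?_⟩
      obtain ⟨e, h3, h4⟩ := exists_side y
      rw [hk d e e1 e2 h3 h4, hl e d' h3 h4 e3 e4, add_assoc]
  have step : ∀ k n, v (γ.inn (k + 1)) (n + θ.side L (γ.out k)) ↔ v (γ.inn k) n := by
    intro k n
    rw [γ.inn_succ, h2]
    exact same (γ.out k) (γ.inn k) rfl rfl n
  -- The total of the cocycle along `γ` is 1. Removing 1 at the arc 0 leaves a sum of zero and hence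
  -- a potential; the removed unit reappears as a shift by one level after a full turn around `γ`.
  obtain ⟨ν, hν⟩ := exists_cyclic_potential (fun k => θ.side L (γ.out k) - if k = 0 then 1 else 0) (by
    rw [Finset.sum_sub_distrib, γ.sum_side, hγ]
    simp)
  have shift : ∀ n, v (γ.inn 0) (n + 1) ↔ v (γ.inn 0) n := by
    have key : ∀ k, ∀ n, v (γ.inn (k + 1)) (n + ν (k + 1) + 1) ↔ v (γ.inn (0 + 1)) (n + ν (0 + 1) + 1) := by
      intro k
      refine cyclic_trans (U := fun k => ∀ n, v (γ.inn (k + 1)) (n + ν (k + 1) + 1) ↔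
        v (γ.inn (0 + 1)) (n + ν (0 + 1) + 1)) (fun k hk n => ?_) (a := 0) (fun n => Iff.rfl)
      by_cases hk0 : k + 1 = 0
      · rw [hk0]
      · rw [← hk n, ← step (k + 1), hν (k + 1), if_neg hk0]
        ring_nf
    intro n
    have h3 := key (Fin.last _) (n - ν 0)
    rw [Fin.last_add_one, hν 0, if_pos rfl] at h3
    rw [← step 0 n]
    ring_nf at h3 ⊢
    exact h3
  obtain ⟨k, hk⟩ := hr (d.1.1, d.1.2.1) ((γ.inn 0).1.1, (γ.inn 0).1.2.1)
  obtain ⟨l, hl⟩ := hr ((γ.inn 0).1.1, (γ.inn 0).1.2.1) (d'.1.1, d'.1.2.1)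
  have all : ∀ m : ℤ, v (γ.inn 0) m := by
    have h0 : v (γ.inn 0) (n + k) := (hk d _ rfl rfl rfl rfl n).1 h
    intro m
    induction m using Int.inductionOn' (b := n + k) with
    | zero => exact h0
    | succ m _ ih => exact (shift m).2 ih
    | pred m _ ih => exact (shift (m - 1)).1 (by rwa [sub_add_cancel])
  have := (hl _ d' rfl rfl rfl rfl (n' - l)).1 (all _)
  rwa [sub_add_cancel] at this

end IdealTriangulation

open IdealTriangulation in
/-- The turning of a simple closed curve with respect to an angle structure depends only on the
homology class of the curve. -/
theorem IdealTriangulation.TorusBoundary.turning_eq [Fintype ι] {T : IdealTriangulation ι}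
    (hT : T.TorusBoundary) (θ : Marking T) (L L' : ℤ × ℤ →+ ℤ) {γ₀ γ₁ γ₂ : SimpleCurve T}
    (h0 : L (γ₀.homologyClass θ) = 1) (h1 : L (γ₁.homologyClass θ) = 0)
    (h2 : L (γ₂.homologyClass θ) = 0) (h1' : L' (γ₁.homologyClass θ) = 1)
    (h2' : L' (γ₂.homologyClass θ) = 1) (F : ι → Fin 3 → ℝ) (hF : ∀ j, ∑ p, F j p = 1)
    (hE : ∀ E, ∑ j, ∑ p, (T.edgeCount E j p : ℝ) * F j p = 2) :
    ∑ j, ∑ p, (γ₁.curveCount j p : ℝ) * F j p = ∑ j, ∑ p, (γ₂.curveCount j p : ℝ) * F j p := by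
  classical
  obtain ⟨g, hg⟩ := θ.exists_vertex_potential L
  -- Two copies of one triangulation, every side outer and matched with its copy: the mixed cover is
  -- then the ordinary cyclic cover.
  let H : HybridData (DirEdge ι ⊕ DirEdge ι) (Fin (γ₁.len + 1) ⊕ Fin (γ₂.len + 1)) (DirEdge ι)
      T.Vertex :=
    { γ₁.pair γ₂ with
      pat := Sum.isLeft
      flip := Sum.swap
      outer := fun _ => True
      τ := Sum.elim (θ.side L) (θ.side L)
      ω := Sum.elim (fun d => (θ.side L' d : ℝ)) (fun d => (θ.side L' d : ℝ))
      f := Sum.elim (cornerFun F) (cornerFun F)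
      loc := Sum.elim id id
      axis := fun _ => False
      lab := T.vertexOf
      g := fun d => g (nextSide d)
      pat_φ := by rintro (d | d) <;> rfl
      pat_α := by rintro (d | d) <;> rfl
      pat_flip := by rintro (d | d) <;> rfl
      pat_corner := by rintro (d | d) <;> rfl
      τ_α := by rintro (d | d) <;> exact θ.side_opp L d
      ω_α := by
        rintro (d | d) <;> exact (congrArg Int.cast (θ.side_opp L' d)).trans (Int.cast_neg _)
      τ_inner := fun d hd => absurd trivial hd
      ω_inner := fun d hd => absurd trivial hd
      loc_inner := fun d hd => absurd trivial hd
      flip_flip := by rintro (d | d) _ <;> rfl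
      outer_flip := fun _ _ => trivial
      α_flip := by rintro (d | d) _ <;> rfl
      outer_α := fun _ _ => trivial
      τ_flip := by rintro (d | d) _ <;> rfl
      ω_flip := by rintro (d | d) _ <;> rfl
      loc_flip := by rintro (d | d) _ <;> rfl
      loc_φ_flip := by rintro (d | d) _ <;> rfl
      lab_outer := by rintro (d | d) _ <;> exact T.vertexOf_nextSide d
      g_outer := by rintro (d | d) _ <;> exact hg d
      loc_conn := by
        rintro U _ (d | d) (d' | d') h h' hU
        · obtain rfl : d = d' := h'
          exact hU
        · exact absurd h (by simp)
        · exact absurd h (by simp)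
        · obtain rfl : d = d' := h'
          exact hU
      exists_loc := by
        rintro (d | d) _
        exacts [⟨Sum.inr d, rfl, rfl⟩, ⟨Sum.inl d, rfl, rfl⟩]
      axis_lab := fun _ _ h => h.elim
      exists_not_axis := fun _ => Or.inl id
      inner_φ := fun d _ hd => absurd trivial hd
      lab_conn := by
        rintro U hU (d | d) (d' | d') h h' e hd
        · exact (T.vertex_conn (U := fun d => U (Sum.inl d)) (fun x => hU (Sum.inl x)) e).1 hd
        · exact absurd h' (by simp)
        · exact absurd h (by simp)
        · exact absurd h (by simp)
      conn := by
        rintro v v1 v2 (d | d) (d' | d') n n' h h' hd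
        · exact hT.twisted_conn h0 (v := fun d n => v (Sum.inl d) n)
            (fun d n => v1 (Sum.inl d) n rfl) (fun d n => v2 (Sum.inl d) n rfl) d d' n n' hd
        · exact absurd h' (by simp)
        · exact absurd h (by simp)
        · exact absurd h (by simp) }
  have sum_eq : ∀ (w : DirEdge ι → ℝ) (d : DirEdge ι ⊕ DirEdge ι) (C : ℝ)
      (hC : ∀ d, ∑ d' with T.vertexOf d' = T.vertexOf d, w d' = C),
      ∑ d' with H.pat d' = H.pat d ∧ H.lab (H.loc d') = H.lab (H.loc d), Sum.elim w w d' = C := by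
    intro w d C hC
    rw [Finset.sum_filter, Fintype.sum_sum_type]
    rcases d with d | d
    · rw [← hC d, Finset.sum_filter]
      simp [H]
    · rw [← hC d, Finset.sum_filter]
      simp [H]
  have dist_eq : ∀ (w : DirEdge ι → ℝ) (l : DirEdge ι),
      ∑ d with H.loc d = l ∧ H.pat d = true, Sum.elim w w d =
        ∑ d with H.loc d = l ∧ H.pat d = false, Sum.elim w w d := by
    intro w l
    rw [Finset.sum_filter, Fintype.sum_sum_type, Finset.sum_filter, Fintype.sum_sum_type]
    simp [H]
  have main := H.turning_eq
    (by
      rintro (d | d)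
      · exact (cornerFun_sum F d).trans (hF _)
      · exact (cornerFun_sum F d).trans (hF _))
    (fun l _ => dist_eq _ l)
    (fun d => sum_eq _ d 2 fun d => (hT.sum_vertexOf F d).trans (hE _))
    (fun d => sum_eq _ d 0 fun d => by
      have := θ.sum_vertex L' (fun V => if V = T.vertexOf d then 1 else 0)
      rw [Finset.sum_filter]
      simpa using this)
    (by
      rintro (_ | _)
      · refine (SimpleCurve.sum_which_false γ₁ γ₂ _).trans ?_
        have := γ₂.sum_side θ L'
        rw [h2'] at this
        refine Eq.trans (Finset.sum_congr rfl fun k _ => congrArg H.ω (γ₁.pair_out_inr γ₂ k)) ?_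
        exact (Int.cast_sum _ _).symm.trans ((congrArg Int.cast this).trans Int.cast_one)
      · refine (SimpleCurve.sum_which_true γ₁ γ₂ _).trans ?_
        have := γ₁.sum_side θ L'
        rw [h1'] at this
        refine Eq.trans (Finset.sum_congr rfl fun k _ => congrArg H.ω (γ₁.pair_out_inl γ₂ k)) ?_
        exact (Int.cast_sum _ _).symm.trans ((congrArg Int.cast this).trans Int.cast_one))
    (γ₁.exists_pair_potential γ₂ (θ.side L) (θ.side L) ((γ₁.sum_side θ L).trans h1)
      ((γ₂.sum_side θ L).trans h2))
  rw [← SimpleCurve.pair_turning_true γ₁ γ₂ F F, ← SimpleCurve.pair_turning_false γ₁ γ₂ F F]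
  exact main

end NeumannZagier

/-! ### Angle deformations that vanish on all equations and peripheral curves. -/

namespace NeumannZagier

variable {ι : Type}

theorem vertex_zero_ne : ∀ p : Fin 3, (0 : Fin 4) ≠ (![1, 3, 2] : Fin 3 → Fin 4) p := by decide

theorem opposite_ne : ∀ p : Fin 3,
    (![2, 1, 1] : Fin 3 → Fin 4) p ≠ (![3, 2, 3] : Fin 3 → Fin 4) p := by decide

/-- The edge of the `p`-th pair of opposite edges that contains the vertex `0`. -/
def edgeA (j : ι) (p : Fin 3) : DirEdge ι := ⟨(j, 0, ![1, 3, 2] p), vertex_zero_ne p⟩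

/-- The edge of the `p`-th pair of opposite edges that does not contain the vertex `0`. -/
def edgeB (j : ι) (p : Fin 3) : DirEdge ι := ⟨(j, ![2, 1, 1] p, ![3, 2, 3] p), opposite_ne p⟩

open Classical in
theorem IdealTriangulation.edgeCount_eq (T : IdealTriangulation ι) (E : T.Edge) (j : ι) (p : Fin 3) :
    T.edgeCount E j p = (if T.edgeOf (edgeA j p) = E then 1 else 0) +
      (if T.edgeOf (edgeB j p) = E then 1 else 0) := by
  unfold edgeCount
  rw [Finset.card_filter]
  push_cast
  rw [Fintype.sum_prod_type]
  simp only [Fin.sum_univ_four]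
  fin_cases p <;> simp [pairType, edgeA, edgeB] <;> rfl

theorem IdealTriangulation.sum_edge_mul_edgeCount (T : IdealTriangulation ι) [Fintype T.Edge]
    (h : T.Edge → ℤ) (j : ι) (p : Fin 3) : ∑ E, h E * T.edgeCount E j p =
      h (T.edgeOf (edgeA j p)) + h (T.edgeOf (edgeB j p)) := by
  classical
  simp_rw [T.edgeCount_eq, mul_add, Finset.sum_add_distrib]
  simp

theorem IdealTriangulation.sum_edgeCount_eq_two (T : IdealTriangulation ι) [Fintype T.Edge]
    (j : ι) (p : Fin 3) : ∑ E, T.edgeCount E j p = 2 := by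
  have := T.sum_edge_mul_edgeCount (fun _ => 1) j p
  simpa using this

instance [Finite ι] (T : IdealTriangulation ι) : Finite T.Edge := Quot.finite _

open IdealTriangulation in
-- Every edge has two different ends, each determining the edge. This supplies the vertices needed
-- for Euler characteristic zero.
theorem IdealTriangulation.TorusBoundary.two_mul_card_edge_le [Finite ι] {T : IdealTriangulation ι}
    (hT : T.TorusBoundary) : 2 * Nat.card T.Edge ≤ Nat.card T.Vertex := by
  have h := Function.surjInv_eq T.edgeOf_surjective
  rw [mul_comm, ← Nat.card_eq_two_iff.2 ⟨false, true, by simp, by ext b; cases b <;> simp⟩,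
    ← Nat.card_prod]
  refine Nat.card_le_card_of_injective (fun E : T.Edge × Bool =>
    (Quot.mk _ (if E.2 then (Function.surjInv T.edgeOf_surjective E.1).rev
      else Function.surjInv T.edgeOf_surjective E.1) : T.Vertex)) ?_
  rintro ⟨E, b⟩ ⟨E', b'⟩ e
  have hE : ∀ (E : T.Edge) (b : Bool), T.edgeOf (if b then (Function.surjInv T.edgeOf_surjective E).rev
      else Function.surjInv T.edgeOf_surjective E) = E := by
    intro E b
    cases b
    · exact h E
    · exact (T.edgeOf_rev _).trans (h E)
  obtain rfl : E = E' := by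
    rw [← hE E b, ← hE E' b']
    exact T.edgeOf_eq_iff.2 (Or.inl e)
  cases b <;> cases b'
  · rfl
  · exact absurd e (hT.mk_rev_ne _)
  · exact absurd e.symm (hT.mk_rev_ne _)
  · rfl

/-- The sum of a cochain on sides along a curve. -/
def SimpleCurve.along {T : IdealTriangulation ι} (γ : SimpleCurve T) : (DirEdge ι → ℝ) →ₗ[ℝ] ℝ :=
  ∑ k, LinearMap.proj (γ.out k)

theorem SimpleCurve.along_apply {T : IdealTriangulation ι} (γ : SimpleCurve T) (w : DirEdge ι → ℝ) :
    γ.along w = ∑ k, w (γ.out k) := by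
  simp [along]

theorem SimpleCurve.along_antiDiff {T : IdealTriangulation ι} (γ : SimpleCurve T)
    (r : DirEdge ι → ℝ) : γ.along (antiDiff T.opp r) = ∑ k, (r (γ.out k) - r (γ.inn k)) := by
  rw [γ.along_apply, Finset.sum_sub_distrib, ← Equiv.sum_comp (Equiv.addRight 1) fun k => r (γ.inn k),
    ← Finset.sum_sub_distrib]
  refine Finset.sum_congr rfl fun k _ => ?_
  change r _ - r _ = r _ - r (γ.inn (k + 1))
  rw [γ.inn_succ]

open IdealTriangulation in
/-- A deformation of angles that preserves the sums over tetrahedra and edges and the peripheral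
turning comes from a function on the sides of boundary triangles. -/
theorem IdealTriangulation.TorusBoundary.exists_side_potential [Fintype ι]
    {T : IdealTriangulation ι} (hT : T.TorusBoundary) (θ : Marking T) {μ lam : SimpleCurve T}
    (hμ : μ.homologyClass θ = (1, 0)) (hlam : lam.homologyClass θ = (0, 1))
    (δ R : ι → Fin 3 → ℤ) (hR : ∀ j p, R j (p + 2) - R j p = δ j p)
    (hE : ∀ E, ∑ j, ∑ p, T.edgeCount E j p * δ j p = 0)
    (hδμ : ∑ j, ∑ p, μ.curveCount j p * δ j p = 0)
    (hδlam : ∑ j, ∑ p, lam.curveCount j p * δ j p = 0) :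
    ∃ G : ι → Fin 4 → ℤ, ∀ x : DirEdge ι, cornerFun R (T.opp x) + G (T.opp x).1.1 (T.opp x).1.2.1 =
      cornerFun R x + G x.1.1 x.1.2.1 := by
  classical
  have hRr : ∀ x : DirEdge ι, cornerFun R (nextSide.symm x) - cornerFun R x = cornerFun δ x := by
    intro x
    have h1 := pairType_rot x.1.2.1 _ (rot_ne_left _ _ x.2)
    have h2 := pairType_rot x.1.2.1 _ (rot_ne_left _ _ (rot_ne_left _ _ x.2))
    unfold cornerFun
    rw [← hR]
    change R x.1.1 (pairType x.1.2.1 (rot x.1.2.1 (rot x.1.2.1 (rot x.1.2.1 x.1.2.2)))) - _ = _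
    rw [h2, h1, add_assoc]
    rfl
  -- The jumps of `r` across sides form a cochain whose sum along a curve is the turning with
  -- respect to `δ`, and whose sum around a vertex is, up to sign, the value of an edge equation on
  -- `δ`. So it is closed with vanishing periods, hence exact.
  let r : DirEdge ι → ℝ := fun x => ((cornerFun R x : ℤ) : ℝ)
  let w := antiDiff T.opp r
  let F : DirEdge ι → ι × Fin 4 := fun x => (x.1.1, x.1.2.1)
  let δ' : ι → Fin 3 → ℝ := fun j p => δ j p
  have hδ' : ∀ x, cornerFun δ' x = ((cornerFun δ x : ℤ) : ℝ) := fun x => rfl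
  have : Fintype T.Vertex := Fintype.ofFinite _
  have along_w : ∀ γ : SimpleCurve T, γ.along w = ∑ j, ∑ p, (γ.curveCount j p : ℝ) * δ' j p := by
    intro γ
    rw [γ.along_antiDiff, γ.sum_curveCount]
    refine Finset.sum_congr rfl fun k _ => ?_
    rw [hδ', ← hRr]
    push_cast
    cases h : γ.left k
    · rw [γ.inn_of_not_left h, if_neg (by simp), SimpleCurve.cornerSide, if_neg (by simp [h])]
      ring
    · rw [γ.out_of_left h, if_pos rfl, SimpleCurve.cornerSide, if_pos h]
  have closed : ∀ ψ : T.Vertex → ℝ, ∑ d, w d * ψ (T.vertexOf d) = 0 := by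
    intro ψ
    have h1 : ∀ d, w (T.opp d) * ψ (T.vertexOf (T.opp d)) =
        r (T.opp d) * ψ (T.vertexOf (T.opp d)) - r (nextSide d) * ψ (T.vertexOf (nextSide d)) -
          cornerFun δ' (nextSide d) * ψ (T.vertexOf (nextSide d)) := by
      intro d
      have h2 : r d = r (nextSide d) + cornerFun δ' (nextSide d) := by
        have := hRr (nextSide d)
        rw [Equiv.symm_apply_apply] at this
        simp only [r]
        rw [hδ', ← this]
        push_cast
        ring
      rw [T.vertexOf_nextSide]
      change (r (T.opp d) - r (T.opp (T.opp d))) * _ = _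
      rw [T.opp_opp, h2]
      ring
    rw [← Equiv.sum_comp T.opp, Finset.sum_congr rfl fun d _ => h1 d, Finset.sum_sub_distrib,
      Finset.sum_sub_distrib, Equiv.sum_comp T.opp (fun d => r d * ψ (T.vertexOf d)),
      Equiv.sum_comp nextSide (fun d => r d * ψ (T.vertexOf d)),
      Equiv.sum_comp nextSide (fun d => cornerFun δ' d * ψ (T.vertexOf d)), sub_self, zero_sub,
      neg_eq_zero, ← Finset.sum_fiberwise_of_maps_to (g := T.vertexOf) (t := Finset.univ)
      (fun d _ => Finset.mem_univ _)]
    apply Finset.sum_eq_zero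
    intro V _
    obtain ⟨y, rfl⟩ : ∃ y, T.vertexOf y = V := by
      obtain ⟨x, rfl⟩ := Quot.exists_rep V
      exact ⟨nextSide.symm x, by simp [vertexOf]⟩
    have h3 := hT.sum_vertexOf δ' y
    have h4 : ∑ j, ∑ p, (T.edgeCount (T.edgeOf (nextSide y)) j p : ℝ) * δ' j p = 0 := by
      simp only [δ']
      exact_mod_cast hE (T.edgeOf (nextSide y))
    rw [h4] at h3
    rw [← zero_mul (ψ (T.vertexOf y)), ← h3, Finset.sum_mul]
    refine Finset.sum_congr rfl fun d hd => ?_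
    rw [(Finset.mem_filter.1 hd).2]
  have side_mem : ∀ L : ℤ × ℤ →+ ℤ, (fun x => (θ.side L x : ℝ)) ∈ antiFun T.opp := by
    intro L x
    have := θ.side_opp L x
    exact (congrArg Int.cast this).trans (Int.cast_neg _)
  have along_side : ∀ (γ : SimpleCurve T) (L : ℤ × ℤ →+ ℤ), γ.along (fun x => (θ.side L x : ℝ)) =
      (L (γ.homologyClass θ) : ℝ) := by
    intro γ L
    rw [γ.along_apply, ← γ.sum_side]
    push_cast
    rfl
  -- There are 12N sides, at least 2N vertices and 4N triangles.
  have card : Fintype.card (DirEdge ι) ≤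
      2 * (Fintype.card T.Vertex + Fintype.card (ι × Fin 4)) := by
    have h1 := hT.two_mul_card_edge_le
    rw [hT.card_edge, Nat.card_eq_fintype_card, Nat.card_eq_fintype_card] at h1
    have h2 : Fintype.card (DirEdge ι) = 12 * Fintype.card ι := by
      let e : DirEdge ι ≃ ι × {x : Fin 4 × Fin 4 // x.1 ≠ x.2} :=
        { toFun := fun x => (x.1.1, ⟨x.1.2, x.2⟩)
          invFun := fun x => ⟨(x.1, x.2.1), x.2.2⟩
          left_inv := fun _ => rfl
          right_inv := fun _ => rfl }
      rw [Fintype.card_congr e, Fintype.card_prod, mul_comm]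
      congr 1
    rw [h2, Fintype.card_prod, Fintype.card_fin]
    omega
  have fsurj : Function.Surjective F := by
    rintro ⟨i, v⟩
    obtain ⟨u, hu⟩ := exists_ne v
    exact ⟨⟨(i, v, u), hu.symm⟩, rfl⟩
  have vsurj : Function.Surjective T.vertexOf := by
    intro V
    obtain ⟨x, rfl⟩ := Quot.exists_rep V
    exact ⟨nextSide.symm x, by simp [vertexOf]⟩
  have hl : ∀ (γ : SimpleCurve T) (g : ι × Fin 4 → ℝ), γ.along (antiDiff T.opp (g ∘ F)) = 0 := by
    intro γ g
    rw [γ.along_antiDiff]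
    exact Finset.sum_eq_zero fun k _ => sub_self _
  obtain ⟨g, hg⟩ := exists_potential (α := T.opp) (σ := T.opp.trans nextSide) T.opp_opp T.opp_ne
    (F := F) (V := T.vertexOf) (fun d => rfl)
    (fun d => by
      change T.vertexOf (nextSide (T.opp d)) = _
      rw [T.vertexOf_nextSide, T.opp_opp]) fsurj vsurj
    (fun u h1 h2 d d' => by
      refine (hT.twisted_conn (θ := θ) (L := AddMonoidHom.fst ℤ ℤ) (γ := μ) (by rw [hμ]; rfl)
        (v := fun x _ => u d = u x) (fun x n => ?_) (fun x n => ?_) d d' 0 0 rfl)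
      · have := h2 (T.opp x)
        change u (nextSide (T.opp (T.opp x))) = _ at this
        rw [T.opp_opp, h1] at this
        rw [this]
      · rw [h1]) card μ.along lam.along
    (fun g => ⟨hl μ g, hl lam g⟩) _ _ (side_mem (AddMonoidHom.fst ℤ ℤ))
    (side_mem (AddMonoidHom.snd ℤ ℤ)) (fun ψ => θ.sum_vertex _ ψ) (fun ψ => θ.sum_vertex _ ψ)
    (by rw [along_side, hμ]; simp) (by rw [along_side, hμ]; simp)
    (by rw [along_side, hlam]; simp) (by rw [along_side, hlam]; simp)
    w (antiDiff_mem T.opp_opp r) closed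
    (by rw [along_w]; simp only [δ']; exact_mod_cast hδμ)
    (by rw [along_w]; simp only [δ']; exact_mod_cast hδlam)
  -- The potential is only real. Since the values of `R` are integers, taking floors of the equation
  -- between the two sides yields an integral potential.
  refine ⟨fun i v => ⌊- g (i, v)⌋, fun x => ?_⟩
  have h1 : r x - r (T.opp x) = g (F x) - g (F (T.opp x)) := congrFun hg x
  have h2 : r (T.opp x) + - g (F (T.opp x)) = r x + - g (F x) := by linarith
  have h3 := congrArg Int.floor h2
  rwa [Int.floor_intCast_add, Int.floor_intCast_add] at h3

/-- The parity of a sum over the vertices of a tetrahedron in terms of symmetric functions of the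
values on the sides in its faces. -/
theorem face_parity : ∀ (R : Fin 3 → ZMod 2) (G : Fin 4 → ZMod 2),
    ∑ v, G v = ∑ u, (∏ v with v ≠ u, (1 + (R (pairType v u + 1) + G v)) +
      ∏ v with v ≠ u, (R (pairType v u + 1) + G v) + 1) := by decide +kernel

/-- Modulo 2, `face_parity` writes the sum over the vertices of a tetrahedron as one term per face,
symmetric in the three side values on that face. The two tetrahedra at a face give equal terms,
which cancel. -/
theorem even_sum_potential [Fintype ι] (T : IdealTriangulation ι) (R : ι → Fin 3 → ℤ)
    (G : ι → Fin 4 → ℤ) (h : ∀ x : DirEdge ι, cornerFun R (T.opp x) +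
      G (T.opp x).1.1 (T.opp x).1.2.1 = cornerFun R x + G x.1.1 x.1.2.1) :
    Even (∑ j, ∑ v, G j v) := by
  classical
  rw [← ZMod.intCast_eq_zero_iff_even]
  push_cast
  let r : ι × Fin 4 → ZMod 2 := fun y =>
    ∏ v with v ≠ y.2, (1 + ((R y.1 (pairType v y.2 + 1) : ZMod 2) + G y.1 v)) +
      ∏ v with v ≠ y.2, ((R y.1 (pairType v y.2 + 1) : ZMod 2) + G y.1 v) + 1
  have h1 : ∑ j, ∑ v, (G j v : ZMod 2) = ∑ y, r y := by
    rw [Fintype.sum_prod_type]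
    exact Finset.sum_congr rfl fun j _ => face_parity (fun p => R j p) (fun v => G j v)
  rw [h1]
  have hval : ∀ i v u, v ≠ u → (R (T.nbr i u) (pairType (T.perm i u v) (T.perm i u u) + 1) : ZMod 2) +
      G (T.nbr i u) (T.perm i u v) = R i (pairType v u + 1) + G i v := by
    intro i v u hvu
    have h2 := h ⟨(i, v, u), hvu⟩
    have h3 : ∀ x : DirEdge ι, cornerFun R x = R x.1.1 (pairType x.1.2.1 x.1.2.2 + 1) := by
      intro x
      unfold cornerFun
      rw [pairType_rot _ _ x.2]
    rw [h3, h3] at h2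
    exact_mod_cast congrArg (Int.cast : ℤ → ZMod 2) h2
  have hr : ∀ i u, r (T.nbr i u, T.perm i u u) = r (i, u) := by
    intro i u
    simp only [r]
    have e : (Finset.univ.filter fun v => v ≠ T.perm i u u) =
        (Finset.univ.filter fun v => v ≠ u).map (T.perm i u).toEmbedding := by
      ext v
      simp only [Finset.mem_filter_univ, Finset.mem_map_equiv]
      rw [not_iff_not, Equiv.symm_apply_eq]
    rw [e, Finset.prod_map, Finset.prod_map]
    congr 2
    · refine Finset.prod_congr rfl fun v hv => ?_
      rw [Finset.mem_filter_univ] at hv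
      exact congrArg _ (hval i v u hv)
    · refine Finset.prod_congr rfl fun v hv => ?_
      rw [Finset.mem_filter_univ] at hv
      exact hval i v u hv
  refine Finset.sum_involution (fun y _ => (T.nbr y.1 y.2, T.perm y.1 y.2 y.2)) ?_ ?_ ?_ ?_
  · intro y _
    rw [hr]
    exact CharTwo.add_self_eq_zero _
  · intro y _ _ e
    exact T.not_self_glued y.1 y.2 ⟨congrArg Prod.fst e, congrArg Prod.snd e⟩
  · intro y _
    exact Finset.mem_univ _
  · intro y _
    refine Prod.ext (T.nbr_nbr _ _) ?_
    change T.perm _ _ (T.perm _ _ _) = _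
    rw [T.perm_perm]
    exact Equiv.symm_apply_apply _ _

theorem pairType_face : ∀ v a u : Fin 4, v ≠ a → u ≠ v → u ≠ a →
    (pairType v u + 1 = pairType v a + 2 ∧ pairType a u + 1 = pairType v a) ∨
      (pairType v u + 1 = pairType v a ∧ pairType a u + 1 = pairType v a + 2) := by decide

theorem zpow_sum₀ {κ : Type*} {a : ℂ} (ha : a ≠ 0) (s : Finset κ) (n : κ → ℤ) :
    a ^ (∑ k ∈ s, n k) = ∏ k ∈ s, a ^ n k := by
  classical
  induction s using Finset.induction_on with
  | empty => simp
  | insert k s hk ih => rw [Finset.sum_insert hk, Finset.prod_insert hk, zpow_add₀ ha, ih]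

/-- A solution of the gluing equations evaluates to a sign on deformations of angles that come from a
function on the sides of boundary triangles. -/
theorem prod_shape_sq_eq_one [Fintype ι] {T : IdealTriangulation ι} {s : ι → Fin 3 → ℂ}
    (hs : ∀ j p, s j p ≠ 0) (hs3 : ∀ j, s j 0 * s j 1 * s j 2 = -1)
    (hE : ∀ E, ∏ j, ∏ p, s j p ^ T.edgeCount E j p = 1) {δ R : ι → Fin 3 → ℤ}
    (hR : ∀ j p, R j (p + 2) - R j p = δ j p) {G : ι → Fin 4 → ℤ}
    (h : ∀ x : DirEdge ι, cornerFun R (T.opp x) + G (T.opp x).1.1 (T.opp x).1.2.1 =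
      cornerFun R x + G x.1.1 x.1.2.1) :
    (∏ j, s j 0 ^ δ j 2 * s j 2 ^ (- δ j 0)) ^ 2 = 1 := by
  have : Fintype T.Edge := Fintype.ofFinite _
  have h3 : ∀ x : DirEdge ι, cornerFun R x = R x.1.1 (pairType x.1.2.1 x.1.2.2 + 1) := by
    intro x
    unfold cornerFun
    rw [pairType_rot _ _ x.2]
  -- In either face that contains the edge, this is the sum of the values of `R` plus `G` on the two
  -- sides at its ends. The hypothesis `h` carries this sum across a face gluing, so it defines an
  -- integer for each edge of the triangulation.
  let m₀ : DirEdge ι → ℤ := fun x => R x.1.1 (pairType x.1.2.1 x.1.2.2 + 2) +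
    R x.1.1 (pairType x.1.2.1 x.1.2.2) + G x.1.1 x.1.2.1 + G x.1.1 x.1.2.2
  have hm : ∀ (x : DirEdge ι) (u : Fin 4) (h1 : u ≠ x.1.2.1) (h2 : u ≠ x.1.2.2), m₀ x =
      (cornerFun R (⟨(x.1.1, x.1.2.1, u), h1.symm⟩ : DirEdge ι) + G x.1.1 x.1.2.1) +
      (cornerFun R (⟨(x.1.1, x.1.2.2, u), h2.symm⟩ : DirEdge ι) + G x.1.1 x.1.2.2) := by
    intro x u h1 h2
    rw [h3, h3]
    simp only [m₀]
    rcases pairType_face _ _ u x.2 h1 h2 with ⟨e1, e2⟩ | ⟨e1, e2⟩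
    · rw [e1, e2]
      ring
    · rw [e1, e2]
      ring
  have hstep : ∀ x y : DirEdge ι, T.EdgeStep x y ∨ y = x.rev → m₀ x = m₀ y := by
    rintro x y (⟨u, h1, h2, rfl⟩ | rfl)
    · rw [hm x u h1 h2, hm (T.across x u) (T.perm x.1.1 u u) (fun e => h1 ((T.perm _ _).injective e))
        (fun e => h2 ((T.perm _ _).injective e))]
      exact (congrArg₂ (· + ·) (h ⟨(x.1.1, x.1.2.1, u), h1.symm⟩)
        (h ⟨(x.1.1, x.1.2.2, u), h2.symm⟩)).symm
    · simp only [m₀, DirEdge.rev]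
      rw [pairType_comm]
      ring
  let m : T.Edge → ℤ := Quot.lift m₀ hstep
  have hS : ∀ j p, m (T.edgeOf (edgeA j p)) + m (T.edgeOf (edgeB j p)) =
      2 * (R j (p + 2) + R j p) + ∑ v, G j v := by
    intro j p
    change m₀ _ + m₀ _ = _
    rw [Fin.sum_univ_four]
    fin_cases p <;> simp [m₀, edgeA, edgeB, pairType] <;> ring
  -- The product of the edge equations, each raised to the integer of its edge.
  have hprod : ∏ j, ∏ p, s j p ^ (m (T.edgeOf (edgeA j p)) + m (T.edgeOf (edgeB j p))) = 1 := by
    have h1 : ∀ j p, s j p ^ (m (T.edgeOf (edgeA j p)) + m (T.edgeOf (edgeB j p))) =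
        ∏ E, (s j p ^ T.edgeCount E j p) ^ m E := by
      intro j p
      rw [← T.sum_edge_mul_edgeCount m, zpow_sum₀ (hs j p)]
      refine Finset.prod_congr rfl fun E _ => ?_
      rw [← zpow_mul, mul_comm]
    rw [Finset.prod_congr rfl fun j _ => Finset.prod_congr rfl fun p _ => h1 j p,
      Finset.prod_congr rfl fun j _ => Finset.prod_comm, Finset.prod_comm]
    refine Finset.prod_eq_one fun E _ => ?_
    simp_rw [Finset.prod_zpow]
    rw [hE E, one_zpow]
  -- The square of the monomial raises the exponents of `s j 0` and `s j 2` to that of `s j 1`, so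
  -- each tetrahedron gives a power of s₀s₁s₂ = -1.
  have hj : ∀ j, (s j 0 ^ δ j 2 * s j 2 ^ (- δ j 0)) ^ 2 *
      ∏ p, s j p ^ (m (T.edgeOf (edgeA j p)) + m (T.edgeOf (edgeB j p))) =
      (-1) ^ (2 * (R j (1 + 2) + R j 1) + ∑ v, G j v) := by
    intro j
    have e : ∀ p, s j p ^ (m (T.edgeOf (edgeA j p)) + m (T.edgeOf (edgeB j p))) =
      s j p ^ (2 * (R j (p + 2) + R j p) + ∑ v, G j v) := fun p => by rw [hS]
    rw [Fin.prod_univ_three, e, e, e, ← hs3 j, mul_zpow, mul_zpow, ← hR, ← hR, ← zpow_natCast,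
      mul_zpow, ← zpow_mul, ← zpow_mul]
    generalize ∑ v, G j v = g
    have a0 : s j 0 ^ (2 * (R j (1 + 2) + R j 1) + g) = s j 0 ^ ((R j (2 + 2) - R j 2) * (2 : ℕ)) *
        s j 0 ^ (2 * (R j (0 + 2) + R j 0) + g) := by
      rw [← zpow_add₀ (hs j 0)]
      congr 1
      change 2 * (R j 0 + R j 1) + g = (R j 1 - R j 2) * 2 + (2 * (R j 2 + R j 0) + g)
      ring
    have a2 : s j 2 ^ (2 * (R j (1 + 2) + R j 1) + g) = s j 2 ^ (-(R j (0 + 2) - R j 0) * (2 : ℕ)) *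
        s j 2 ^ (2 * (R j (2 + 2) + R j 2) + g) := by
      rw [← zpow_add₀ (hs j 2)]
      congr 1
      change 2 * (R j 0 + R j 1) + g = -(R j 2 - R j 0) * 2 + (2 * (R j 1 + R j 2) + g)
      ring
    rw [a0, a2]
    ring
  have hG := even_sum_potential T R G h
  have h4 : (∏ j, (s j 0 ^ δ j 2 * s j 2 ^ (- δ j 0)) ^ 2 *
      ∏ p, s j p ^ (m (T.edgeOf (edgeA j p)) + m (T.edgeOf (edgeB j p)))) = 1 := by
    rw [Finset.prod_congr rfl fun j _ => hj j, ← zpow_sum₀ (by norm_num), Finset.sum_add_distrib,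
      ← Finset.mul_sum]
    exact Even.neg_one_zpow (Even.add (even_two_mul _) hG)
  rw [Finset.prod_mul_distrib, hprod, mul_one] at h4
  rw [← Finset.prod_pow]
  exact h4

end NeumannZagier

namespace NeumannZagier

/-! ### Shapes -/

theorem bracket_ne_zero {x y : CP1} (h : x ≠ y) : bracket x y ≠ 0 := by
  intro e
  apply h
  rw [← x.mk_rep, ← y.mk_rep, Projectivization.mk_eq_mk_iff']
  have hx := x.rep_nonzero
  have hy := y.rep_nonzero
  unfold bracket at e
  by_cases h0 : y.rep 0 = 0
  · have h1 : y.rep 1 ≠ 0 := fun h1 => hy (by ext i; fin_cases i <;> assumption)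
    refine ⟨x.rep 1 / y.rep 1, ?_⟩
    rw [h0, mul_zero, sub_zero] at e
    ext i
    fin_cases i
    · simpa [h0] using ((mul_eq_zero.1 e).resolve_right h1).symm
    · simp [h1]
  · refine ⟨x.rep 0 / y.rep 0, ?_⟩
    ext i
    fin_cases i
    · simp [h0]
    · simp only [Pi.smul_apply, smul_eq_mul]
      change x.rep 0 / y.rep 0 * y.rep 1 = x.rep 1
      field_simp
      linear_combination e

theorem bracket_swap (x y : CP1) : bracket y x = - bracket x y := by
  unfold bracket
  ring

theorem bracket_plucker (a b c d : CP1) :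
    bracket a b * bracket c d - bracket a c * bracket b d + bracket a d * bracket b c = 0 := by
  unfold bracket
  ring

/-- Both relations are the Plücker relation of the four points after clearing denominators, which
are nonzero because the points are distinct. -/
theorem crossRatio_relations {a b c d : CP1} (hab : a ≠ b) (hac : a ≠ c) (had : a ≠ d) (hbc : b ≠ c)
    (hbd : b ≠ d) (hcd : c ≠ d) :
    crossRatio a b c d ≠ 0 ∧ crossRatio a d b c * (1 - crossRatio a b c d) = 1 ∧
      crossRatio a b c d * crossRatio a c d b = crossRatio a b c d - 1 := by
  have h1 := bracket_ne_zero hab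
  have h2 := bracket_ne_zero hac
  have h3 := bracket_ne_zero had
  have h4 := bracket_ne_zero hbc
  have h5 := bracket_ne_zero hbd
  have h6 := bracket_ne_zero hcd
  have hp := bracket_plucker a b c d
  unfold crossRatio
  rw [bracket_swap a d, bracket_swap b c, bracket_swap a c, bracket_swap b d, bracket_swap a b,
    bracket_swap c d]
  refine ⟨?_, ?_, ?_⟩
  · refine div_ne_zero ?_ ?_ <;> simp [*]
  · field_simp
    linear_combination -hp
  · field_simp
    linear_combination -hp

variable {ι : Type}

section Shape

variable (X : RegularTriangulation ι)

theorem RegularTriangulation.shape_relations (j : ι) (p : Fin 3) :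
    X.δ.shape j p ≠ 0 ∧ X.δ.shape j (p + 1) * (1 - X.δ.shape j p) = 1 ∧
      X.δ.shape j p * X.δ.shape j (p + 2) = X.δ.shape j p - 1 := by
  have h : ∀ a b : Fin 4, a ≠ b → X.δ.pt j a ≠ X.δ.pt j b := fun a b hab e =>
    hab (X.regular j e)
  fin_cases p
  · exact crossRatio_relations (h 0 1 (by decide)) (h 0 2 (by decide)) (h 0 3 (by decide))
      (h 1 2 (by decide)) (h 1 3 (by decide)) (h 2 3 (by decide))
  · exact crossRatio_relations (h 0 3 (by decide)) (h 0 1 (by decide)) (h 0 2 (by decide))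
      (h 3 1 (by decide)) (h 3 2 (by decide)) (h 1 2 (by decide))
  · exact crossRatio_relations (h 0 2 (by decide)) (h 0 3 (by decide)) (h 0 1 (by decide))
      (h 2 3 (by decide)) (h 2 1 (by decide)) (h 3 1 (by decide))

theorem RegularTriangulation.shape_ne_zero (j : ι) (p : Fin 3) : X.δ.shape j p ≠ 0 :=
  (X.shape_relations j p).1

theorem RegularTriangulation.shape_ne_one (j : ι) (p : Fin 3) : X.δ.shape j p ≠ 1 := by
  intro e
  have := (X.shape_relations j p).2.1
  rw [e] at this
  simp at this

theorem RegularTriangulation.shape_prod (j : ι) :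
    X.δ.shape j 0 * X.δ.shape j 1 * X.δ.shape j 2 = -1 := by
  obtain ⟨-, h1, h2⟩ := X.shape_relations j 0
  change X.δ.shape j 1 * _ = 1 at h1
  change _ * X.δ.shape j 2 = _ at h2
  linear_combination X.δ.shape j 1 * h2 - h1

/-- The coefficients of the logarithmic derivatives of the shapes. -/
noncomputable def RegularTriangulation.weight (j : ι) : Fin 3 → ℂ :=
  ![X.δ.shape j 2, -1, (X.δ.shape j 0)⁻¹]

theorem RegularTriangulation.sum_weight (j : ι) : ∑ p, X.weight j p = 0 := by
  obtain ⟨h0, -, h2⟩ := X.shape_relations j 0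
  change _ * X.δ.shape j 2 = _ at h2
  rw [Fin.sum_univ_three]
  simp only [weight, Matrix.cons_val_zero, Matrix.cons_val_one, Matrix.cons_val]
  field_simp
  linear_combination h2

/-- The gluing equations of all edges. -/
def RegularTriangulation.Glued [Fintype ι] : Prop :=
  ∀ E : X.T.Edge, ∏ j, ∏ p, X.δ.shape j p ^ X.T.edgeCount E j p = 1

/-- The linear form of the shape parameters that belongs to the coefficients of an equation. -/
noncomputable def RegularTriangulation.rowOf (c : ι → Fin 3 → ℂ) : ι → ℂ :=
  fun j => ∑ p, c j p * X.weight j p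

/-- The linear form of the shape parameters that belongs to an edge. -/
noncomputable def RegularTriangulation.edgeRow (E : X.T.Edge) : ι → ℂ :=
  X.rowOf fun j p => X.T.edgeCount E j p

theorem RegularTriangulation.sum_edgeRow [Fintype X.T.Edge] : ∑ E, X.edgeRow E = 0 := by
  funext j
  rw [Finset.sum_apply]
  simp only [edgeRow, rowOf]
  rw [Finset.sum_comm]
  have h : ∀ p, ∑ E, (X.T.edgeCount E j p : ℂ) = 2 := fun p => by
    exact_mod_cast X.T.sum_edgeCount_eq_two j p
  simp_rw [← Finset.sum_mul, h]
  rw [← Finset.mul_sum, X.sum_weight]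
  simp

end Shape

/-! ### Determinants -/

section Det

variable {n κ : Type*} [Fintype n] [DecidableEq n]

theorem det_eq_zero_of_sum_eq_zero {N : Matrix n n ℂ} (h : ∑ i, N i = 0) (a : n) : N.det = 0 := by
  apply Matrix.exists_vecMul_eq_zero_iff.1
  refine ⟨fun _ => 1, fun e => one_ne_zero (congrFun e a), ?_⟩
  rw [Matrix.vecMul_eq_sum]
  simpa using h

/-- Since `N` is singular, replacing row `a` by `l` has the same determinant as adding `l` to row
`a`. The rows then sum to `l`, so moving `l` to row `b` is multiplication by 1 plus (e_b - e_a)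
times the row of ones, a matrix of determinant 1. -/
theorem det_updateRow_of_sum_eq_zero {N : Matrix n n ℂ} (h : ∑ i, N i = 0) (a b : n) (l : n → ℂ) :
    (N.updateRow a l).det = (N.updateRow b l).det := by
  have h0 := det_eq_zero_of_sum_eq_zero h a
  let u : n → Matrix n n ℂ := fun a => N + Matrix.vecMulVec (Pi.single a 1) l
  have h1 : ∀ a, (N.updateRow a l).det = (u a).det := by
    intro a
    have e : u a = N.updateRow a (N a + l) := by
      ext i j
      by_cases hi : i = a
      · subst hi
        simp [u, Matrix.vecMulVec_apply]
      · simp [u, Matrix.vecMulVec_apply, hi]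
    rw [e, Matrix.det_updateRow_add, Matrix.updateRow_eq_self, h0, zero_add]
  have h2 : u b = (1 + Matrix.replicateCol Unit ((Pi.single b 1 - Pi.single a 1 : n → ℂ)) *
      Matrix.replicateRow Unit (fun _ : n => (1 : ℂ))) * u a := by
    ext i j
    have h3 : ∑ k, N k j = 0 := by
      exact (Finset.sum_apply j Finset.univ (fun k => (N k : n → ℂ))).symm.trans (congrFun h j)
    have h4 : ∑ k, u a k j = l j := by
      simp [u, Matrix.vecMulVec_apply, Finset.sum_add_distrib, h3, Pi.single_apply]
    rw [add_mul, one_mul, Matrix.mul_assoc, Matrix.add_apply, Matrix.mul_apply]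
    simp only [Matrix.replicateCol_apply, Finset.univ_unique, Finset.sum_singleton,
      Matrix.mul_apply, Matrix.replicateRow_apply, one_mul, h4]
    simp only [u, Matrix.add_apply, Matrix.vecMulVec_apply, Pi.sub_apply]
    ring
  rw [h1, h1, h2, Matrix.det_mul, Matrix.det_one_add_replicateCol_mul_replicateRow]
  simp [dotProduct]

/-- The determinant in which one of several linear forms with vanishing sum is replaced by `l`
depends on the choice of that form only up to sign, and depends on `l` only modulo the linear forms. -/
theorem sq_det_updateRow_eq {e : κ → n → ℂ} [Fintype κ] (h : ∑ k, e k = 0) (r r' : n ≃ κ) (a a' : n)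
    {l l' : n → ℂ} (hl : l - l' ∈ Submodule.span ℂ (Set.range e)) :
    (Matrix.updateRow (Matrix.of (e ∘ r)) a l).det ^ 2 =
      (Matrix.updateRow (Matrix.of (e ∘ r')) a' l').det ^ 2 := by
  have hs : ∀ r : n ≃ κ, ∑ i, (Matrix.of (e ∘ r)) i = 0 := fun r => by
    rw [← h, ← Equiv.sum_comp r]
    rfl
  have h1 : (Matrix.updateRow (Matrix.of (e ∘ r)) a l).det =
      (Matrix.updateRow (Matrix.of (e ∘ r)) a l').det := by
    -- Put in place of row `a`, the form `e k` may be moved to the row where it already stands,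
    -- which restores the singular matrix of all forms.
    have h2 : Submodule.span ℂ (Set.range e) ≤
        LinearMap.ker (Matrix.detRowAlternating.toMultilinearMap.toLinearMap
          (Matrix.of (e ∘ r)) a) := by
      rw [Submodule.span_le]
      rintro _ ⟨k, rfl⟩
      rw [SetLike.mem_coe, LinearMap.mem_ker]
      change (Matrix.updateRow (Matrix.of (e ∘ r)) a (e k)).det = 0
      rw [det_updateRow_of_sum_eq_zero (hs r) a (r.symm k)]
      have : (Matrix.of (e ∘ r)).updateRow (r.symm k) (e k) = Matrix.of (e ∘ r) := by
        ext i j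
        by_cases hi : i = r.symm k
        · subst hi
          simp
        · simp [hi]
      rw [this]
      exact det_eq_zero_of_sum_eq_zero (hs r) a
    have h3 : (Matrix.updateRow (Matrix.of (e ∘ r)) a (l - l')).det = 0 := h2 hl
    have h4 := Matrix.det_updateRow_add (Matrix.of (e ∘ r)) a (l - l') l'
    rw [sub_add_cancel, h3, zero_add] at h4
    exact h4
  rw [h1]
  let σ : Equiv.Perm n := r'.trans r.symm
  have h5 : Matrix.updateRow (Matrix.of (e ∘ r')) a' l' =
      (Matrix.updateRow (Matrix.of (e ∘ r)) (σ a') l').submatrix σ id := by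
    ext i j
    by_cases hi : i = a'
    · subst hi
      simp
    · rw [Matrix.updateRow_ne hi, Matrix.submatrix_apply,
        Matrix.updateRow_ne fun e => hi (σ.injective e)]
      simp [σ]
  rw [h5, Matrix.det_permute, mul_pow, det_updateRow_of_sum_eq_zero (hs r) a (σ a')]
  rcases Int.units_eq_one_or (Equiv.Perm.sign σ) with h | h <;> simp [h]

end Det

end NeumannZagier

namespace NeumannZagier

variable {ι : Type} [Fintype ι] [DecidableEq ι]

/-! ### The torsion in a normal form without choice of quad types -/

/-- Peripheral curves and a flattening. -/
structure Frame (X : RegularTriangulation ι) where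
  row : ι ≃ X.T.Edge
  last : ι
  μ : SimpleCurve X.T
  μ_class : μ.homologyClass X.θ = (1, 0)
  lam : SimpleCurve X.T
  lam_class : lam.homologyClass X.θ = (0, 1)
  F : ι → Fin 3 → ℤ
  F_sum : ∀ j, ∑ p, F j p = 1
  F_edge : ∀ E, ∑ j, ∑ p, X.T.edgeCount E j p * F j p = 2
  F_meridian : ∑ j, ∑ p, μ.curveCount j p * F j p = 0
  F_longitude : ∑ j, ∑ p, lam.curveCount j p * F j p = 0

/-- The matrix of the gluing equations in which one edge is replaced by a linear form. -/
noncomputable def RegularTriangulation.edgeMatrix (X : RegularTriangulation ι) (r : ι ≃ X.T.Edge)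
    (a : ι) (l : ι → ℂ) : Matrix ι ι ℂ :=
  Matrix.updateRow (Matrix.of (X.edgeRow ∘ r)) a l

/-- The monomial in the shapes that belongs to integral angles. -/
noncomputable def RegularTriangulation.monomial (X : RegularTriangulation ι)
    (F : ι → Fin 3 → ℤ) : ℂ :=
  ∏ j, X.δ.shape j 0 ^ F j 2 * X.δ.shape j 2 ^ (- F j 0)

theorem RegularTriangulation.monomial_add (X : RegularTriangulation ι) (F F' : ι → Fin 3 → ℤ) :
    X.monomial (fun j p => F j p + F' j p) = X.monomial F * X.monomial F' := by
  unfold monomial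
  rw [← Finset.prod_mul_distrib]
  refine Finset.prod_congr rfl fun j _ => ?_
  rw [zpow_add₀ (X.shape_ne_zero j 0), neg_add, zpow_add₀ (X.shape_ne_zero j 2)]
  ring

/-- The linear form of the shape parameters that belongs to a curve. -/
noncomputable def RegularTriangulation.curveRow (X : RegularTriangulation ι) (γ : SimpleCurve X.T) :
    ι → ℂ :=
  X.rowOf fun j p => γ.curveCount j p

/-- The torsion in normal form. -/
noncomputable def Frame.torsion {X : RegularTriangulation ι} (C : Frame X) : ℂ :=
  1 / 2 * (X.edgeMatrix C.row C.last (X.curveRow C.μ)).det * X.monomial C.F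

theorem sum_quad (q : Fin 3) (c : Fin 3 → ℤ) (a b d : ℤ) :
    c q * a + c (q + 1) * b + c (q + 2) * d =
      ∑ p, c p * (![a, b, d] : Fin 3 → ℤ) (p - q) := by
  rw [Fin.sum_univ_three]
  fin_cases q <;> simp <;> ring_nf

/-- The flattening of a datum in canonical order. -/
def EnhancedNZDatum.flattening {X : RegularTriangulation ι} {m : ℂ} (D : EnhancedNZDatum X m) (j : ι)
    (p : Fin 3) : ℤ :=
  (![D.f j, D.f' j, D.f'' j] : Fin 3 → ℤ) (p - D.quad j)

/-- The frame of an enhanced Neumann-Zagier datum. -/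
def EnhancedNZDatum.toFrame {X : RegularTriangulation ι} {m : ℂ} (D : EnhancedNZDatum X m) :
    Frame X where
  row := D.row
  last := D.last
  μ := D.μ
  μ_class := D.μ_class
  lam := D.lam
  lam_class := D.lam_class
  F := D.flattening
  F_sum j := by
    have := sum_quad (D.quad j) (fun _ => 1) (D.f j) (D.f' j) (D.f'' j)
    simp only [one_mul, D.f_sum] at this
    exact this.symm
  F_edge E := by
    rw [← D.f_edge E]
    exact Finset.sum_congr rfl fun j _ => (sum_quad _ _ _ _ _).symm
  F_meridian := by
    rw [← D.f_meridian]
    exact Finset.sum_congr rfl fun j _ => (sum_quad _ _ _ _ _).symm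
  F_longitude := by
    rw [← D.f_longitude]
    exact Finset.sum_congr rfl fun j _ => (sum_quad _ _ _ _ _).symm

theorem neg_one_zpow_sq (n : ℤ) : (((-1 : ℂ) ^ n)) ^ 2 = 1 := by
  rcases Int.even_or_odd n with h | h
  · rw [h.neg_one_zpow]; norm_num
  · rw [h.neg_one_zpow]; norm_num

/-- The factor by which a change of the quad type changes a column of the matrix. -/
noncomputable def RegularTriangulation.quadFactor (X : RegularTriangulation ι) (j : ι) : Fin 3 → ℂ :=
  ![1, - X.δ.shape j 0, X.δ.shape j 0 * X.δ.shape j 1]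

/-- Starting the cyclic order at another shape gives a proportional weight vector, by the relations
between the three shapes; `quadFactor` is the ratio. -/
theorem RegularTriangulation.weight_quad (X : RegularTriangulation ι) (j : ι) (q : Fin 3)
    (c : Fin 3 → ℂ) :
    (c q - c (q + 1)) * X.δ.shape j (q + 2) + (c (q + 2) - c (q + 1)) * (X.δ.shape j q)⁻¹ =
      (∑ p, c p * X.weight j p) * X.quadFactor j q := by
  have h0 := X.shape_ne_zero j 0
  have h1 := X.shape_ne_zero j 1
  have h2 := X.shape_ne_zero j 2
  obtain ⟨-, -, k0⟩ := X.shape_relations j 0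
  obtain ⟨-, -, k1⟩ := X.shape_relations j 1
  obtain ⟨-, -, k2⟩ := X.shape_relations j 2
  have hp := X.shape_prod j
  rw [Fin.sum_univ_three]
  change X.δ.shape j 0 * X.δ.shape j 2 = _ at k0
  change X.δ.shape j 1 * X.δ.shape j 0 = _ at k1
  change X.δ.shape j 2 * X.δ.shape j 1 = _ at k2
  fin_cases q
  · change (c 0 - c 1) * X.δ.shape j 2 + (c 2 - c 1) * (X.δ.shape j 0)⁻¹ =
      (c 0 * X.δ.shape j 2 + c 1 * (-1) + c 2 * (X.δ.shape j 0)⁻¹) * 1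
    field_simp
    linear_combination -c 1 * k0
  · change (c 1 - c 2) * X.δ.shape j 0 + (c 0 - c 2) * (X.δ.shape j 1)⁻¹ =
      (c 0 * X.δ.shape j 2 + c 1 * (-1) + c 2 * (X.δ.shape j 0)⁻¹) * (-X.δ.shape j 0)
    field_simp
    linear_combination -c 2 * k1 + c 0 * hp
  · change (c 2 - c 0) * X.δ.shape j 1 + (c 1 - c 0) * (X.δ.shape j 2)⁻¹ =
      (c 0 * X.δ.shape j 2 + c 1 * (-1) + c 2 * (X.δ.shape j 0)⁻¹) *
        (X.δ.shape j 0 * X.δ.shape j 1)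
    field_simp
    linear_combination -c 0 * k2 + (c 1 - c 0 * X.δ.shape j 2) * hp

/-- Eliminating the middle shape by s₀s₁s₂ = -1 turns the monomial for one quad type into that for
another. As the exponents sum to 1, the discrepancy is exactly the column factor, up to a sign that
the square removes. -/
theorem RegularTriangulation.monomial_quad (X : RegularTriangulation ι) (j : ι) (q : Fin 3)
    {a b d : ℤ} (h : a + b + d = 1) :
    (X.quadFactor j q * (X.δ.shape j q ^ d * X.δ.shape j (q + 2) ^ (-a))) ^ 2 =
      (X.δ.shape j 0 ^ (![a, b, d] : Fin 3 → ℤ) (2 - q) *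
        X.δ.shape j 2 ^ (-(![a, b, d] : Fin 3 → ℤ) (0 - q))) ^ 2 := by
  have h0 := X.shape_ne_zero j 0
  have h1 := X.shape_ne_zero j 1
  have h2 := X.shape_ne_zero j 2
  have hp := X.shape_prod j
  have e1 : X.δ.shape j 1 = (-1) * (X.δ.shape j 0)⁻¹ * (X.δ.shape j 2)⁻¹ := by
    field_simp
    linear_combination hp
  fin_cases q
  · change (1 * (X.δ.shape j 0 ^ d * X.δ.shape j 2 ^ (-a))) ^ 2 =
      (X.δ.shape j 0 ^ d * X.δ.shape j 2 ^ (-a)) ^ 2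
    rw [one_mul]
  · change (-X.δ.shape j 0 * (X.δ.shape j 1 ^ d * X.δ.shape j 0 ^ (-a))) ^ 2 =
      (X.δ.shape j 0 ^ b * X.δ.shape j 2 ^ (-d)) ^ 2
    have hb : b = 1 - d - a := by linarith
    rw [e1, mul_zpow, mul_zpow, inv_zpow', inv_zpow', hb, sub_eq_add_neg, zpow_add₀ h0,
      sub_eq_add_neg, zpow_add₀ h0, zpow_one]
    simp only [mul_pow, neg_one_zpow_sq, neg_sq]
    ring
  · change (X.δ.shape j 0 * X.δ.shape j 1 * (X.δ.shape j 2 ^ d * X.δ.shape j 1 ^ (-a))) ^ 2 =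
      (X.δ.shape j 0 ^ a * X.δ.shape j 2 ^ (-b)) ^ 2
    have hb : -b = a + d + -1 := by linarith
    rw [e1, mul_zpow, mul_zpow, inv_zpow', inv_zpow', neg_neg, hb, zpow_add₀ h2, zpow_add₀ h2,
      zpow_neg_one]
    have e3 : X.δ.shape j 0 * (-1 * (X.δ.shape j 0)⁻¹ * (X.δ.shape j 2)⁻¹) =
      - (X.δ.shape j 2)⁻¹ := by field_simp
    rw [e3]
    simp only [mul_pow, neg_one_zpow_sq, neg_sq]
    ring

/-- The column factors leave the determinant as a diagonal matrix and are absorbed by the monomial,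
tetrahedron by tetrahedron. -/
theorem EnhancedNZDatum.torsion_sq {X : RegularTriangulation ι} {m : ℂ} (D : EnhancedNZDatum X m) :
    D.torsion ^ 2 = D.toFrame.torsion ^ 2 := by
  have hM : D.A.map (Int.cast : ℤ → ℂ) * Matrix.diagonal D.z'' +
      D.B.map (Int.cast : ℤ → ℂ) * (Matrix.diagonal D.z)⁻¹ =
      X.edgeMatrix D.row D.last (X.curveRow D.μ) *
        Matrix.diagonal fun j => X.quadFactor j (D.quad j) := by
    have hinv : (Matrix.diagonal D.z)⁻¹ = Matrix.diagonal fun j => (D.z j)⁻¹ := by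
      apply Matrix.inv_eq_right_inv
      rw [Matrix.diagonal_mul_diagonal, ← Matrix.diagonal_one]
      congr 1
      funext j
      exact mul_inv_cancel₀ (X.shape_ne_zero _ _)
    rw [hinv]
    ext i j
    rw [Matrix.add_apply, Matrix.mul_diagonal, Matrix.mul_diagonal, Matrix.mul_diagonal]
    have h1 : X.edgeMatrix D.row D.last (X.curveRow D.μ) i j =
        ∑ p, (D.coeff i j p : ℂ) * X.weight j p := by
      unfold RegularTriangulation.edgeMatrix
      by_cases hi : i = D.last
      · rw [hi, Matrix.updateRow_self]
        simp only [RegularTriangulation.curveRow, RegularTriangulation.rowOf, NZChoice.coeff,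
          if_true]
      · rw [Matrix.updateRow_ne hi]
        simp only [Matrix.of_apply, Function.comp_apply, RegularTriangulation.edgeRow,
          RegularTriangulation.rowOf, NZChoice.coeff, if_neg hi]
    rw [h1, ← X.weight_quad j (D.quad j) (fun p => (D.coeff i j p : ℂ))]
    simp [NZChoice.A, NZChoice.B, NZChoice.z, NZChoice.z'']
  unfold EnhancedNZDatum.torsion Frame.torsion
  rw [hM, Matrix.det_mul, Matrix.det_diagonal]
  have h2 : (∏ j, X.quadFactor j (D.quad j)) ^ 2 * (∏ j, D.z j ^ D.f'' j * D.z'' j ^ (- D.f j)) ^ 2 =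
      X.monomial D.toFrame.F ^ 2 := by
    unfold RegularTriangulation.monomial
    rw [← Finset.prod_pow, ← Finset.prod_pow, ← Finset.prod_pow, ← Finset.prod_mul_distrib]
    refine Finset.prod_congr rfl fun j _ => ?_
    rw [← mul_pow]
    exact X.monomial_quad j (D.quad j) (D.f_sum j)
  have h3 : (X.edgeMatrix D.row D.last (X.curveRow D.μ)) =
    X.edgeMatrix D.toFrame.row D.toFrame.last (X.curveRow D.toFrame.μ) := rfl
  rw [← h3, mul_pow _ (X.monomial _), ← h2]
  ring

/-- The signs in the rows come from eliminating z' through the product -1 of the shapes, so each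
remaining edge equation has product 1. The equation of the distinguished edge follows, since the
product over all edges is that of the squares of s₀s₁s₂. -/
theorem EnhancedNZDatum.glued {X : RegularTriangulation ι} {m : ℂ} (D : EnhancedNZDatum X m) :
    X.Glued := by
  have : Fintype X.T.Edge := Fintype.ofFinite _
  have hj : ∀ j (q : Fin 3) (c : Fin 3 → ℤ), ∏ p, X.δ.shape j p ^ c p =
      X.δ.shape j q ^ (c q - c (q + 1)) * X.δ.shape j (q + 2) ^ (c (q + 2) - c (q + 1)) *
        (-1) ^ c (q + 1) := by
    intro j q c
    have h0 := X.shape_ne_zero j 0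
    have h1 := X.shape_ne_zero j 1
    have h2 := X.shape_ne_zero j 2
    rw [← X.shape_prod j, Fin.prod_univ_three, mul_zpow, mul_zpow]
    fin_cases q
    · change _ = X.δ.shape j 0 ^ (c 0 - c 1) * X.δ.shape j 2 ^ (c 2 - c 1) * _
      rw [zpow_sub₀ h0, zpow_sub₀ h2]
      change _ = _ * (X.δ.shape j 0 ^ c 1 * X.δ.shape j 1 ^ c 1 * X.δ.shape j 2 ^ c 1)
      field_simp
    · change _ = X.δ.shape j 1 ^ (c 1 - c 2) * X.δ.shape j 0 ^ (c 0 - c 2) * _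
      rw [zpow_sub₀ h0, zpow_sub₀ h1]
      change _ = _ * (X.δ.shape j 0 ^ c 2 * X.δ.shape j 1 ^ c 2 * X.δ.shape j 2 ^ c 2)
      field_simp
    · change _ = X.δ.shape j 2 ^ (c 2 - c 0) * X.δ.shape j 1 ^ (c 1 - c 0) * _
      rw [zpow_sub₀ h2, zpow_sub₀ h1]
      change _ = _ * (X.δ.shape j 0 ^ c 0 * X.δ.shape j 1 ^ c 0 * X.δ.shape j 2 ^ c 0)
      field_simp
  have h1 : ∀ i, i ≠ D.last → ∏ j, ∏ p, X.δ.shape j p ^ X.T.edgeCount (D.row i) j p = 1 := by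
    intro i hi
    have h2 := D.gluing i
    rw [if_neg hi, mul_one] at h2
    have hc : ∀ j p, X.T.edgeCount (D.row i) j p = D.coeff i j p := fun j p => by
      simp only [NZChoice.coeff, if_neg hi]
    have h3 : ∏ j, ∏ p, X.δ.shape j p ^ X.T.edgeCount (D.row i) j p =
        (∏ j, D.z j ^ D.A i j * D.z'' j ^ D.B i j) * ∏ j, (-1) ^ D.coeff i j (D.quad j + 1) := by
      rw [← Finset.prod_mul_distrib]
      refine Finset.prod_congr rfl fun j _ => ?_
      rw [hj j (D.quad j)]
      simp only [hc]
      rfl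
    rw [h3, h2, ← zpow_sum₀ (by norm_num), ← zpow_add₀ (by norm_num)]
    simp only [NZChoice.η, if_neg hi, sub_add_cancel]
    norm_num
  have hall : ∏ E, ∏ j, ∏ p, X.δ.shape j p ^ X.T.edgeCount E j p = 1 := by
    rw [Finset.prod_comm]
    refine Finset.prod_eq_one fun j _ => ?_
    rw [Finset.prod_comm]
    have : ∀ p, ∏ E, X.δ.shape j p ^ X.T.edgeCount E j p = X.δ.shape j p ^ 2 := by
      intro p
      rw [← zpow_sum₀ (X.shape_ne_zero j p), X.T.sum_edgeCount_eq_two]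
      norm_cast
    rw [Finset.prod_congr rfl fun p _ => this p, Finset.prod_pow, Fin.prod_univ_three,
      X.shape_prod]
    norm_num
  have h4 : ∏ j, ∏ p, X.δ.shape j p ^ X.T.edgeCount (D.row D.last) j p = 1 := by
    rw [← Equiv.prod_comp D.row, Finset.prod_eq_single D.last (fun i _ hi => h1 i hi) (by simp)]
      at hall
    exact hall
  intro E
  by_cases hi : D.row.symm E = D.last
  · rw [← hi, Equiv.apply_symm_apply] at h4
    exact h4
  · have := h1 _ hi
    rwa [Equiv.apply_symm_apply] at this

end NeumannZagier

namespace NeumannZagier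

variable {ι : Type} [Fintype ι]

/-! ### Independence of the choices -/

/-- The value of linear coefficients on angles. -/
def angleSum {R : Type*} [CommRing R] (c F : ι → Fin 3 → R) : R := ∑ j, ∑ p, c j p * F j p

theorem angleSum_add {R : Type*} [CommRing R] (c F F' : ι → Fin 3 → R) :
    angleSum c (fun j p => F j p + F' j p) = angleSum c F + angleSum c F' := by
  simp only [angleSum, mul_add, Finset.sum_add_distrib]

theorem angleSum_cast (c F : ι → Fin 3 → ℤ) :
    angleSum (fun j p => (c j p : ℝ)) (fun j p => (F j p : ℝ)) = (angleSum c F : ℤ) := by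
  unfold angleSum
  push_cast
  rfl

theorem exists_primitive {δ : ι → Fin 3 → ℤ} (h : ∀ j, ∑ p, δ j p = 0) :
    ∃ R : ι → Fin 3 → ℤ, ∀ j p, R j (p + 2) - R j p = δ j p := by
  refine ⟨fun j => ![0, δ j 0 + δ j 2, δ j 0], fun j p => ?_⟩
  have := h j
  rw [Fin.sum_univ_three] at this
  fin_cases p
  · change δ j 0 - 0 = δ j 0
    ring
  · change 0 - (δ j 0 + δ j 2) = δ j 1
    linarith
  · change δ j 0 + δ j 2 - δ j 0 = δ j 2
    ring

/-- A linear form that takes the same value on all solutions of linear equations is a linear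
combination of the equations. -/
theorem mem_span_of_forall {c : ι → Fin 3 → ℝ} {κ : Type*} {e : κ → ι → Fin 3 → ℝ}
    (h : ∀ δ : ι → Fin 3 → ℝ, (∀ j, ∑ p, δ j p = 0) → (∀ k, angleSum (e k) δ = 0) →
      angleSum c δ = 0) (x : ι → Fin 3 → ℂ) (hx : ∀ j, ∑ p, x j p = 0) :
    (fun j => ∑ p, (c j p : ℂ) * x j p) ∈
      Submodule.span ℂ (Set.range fun k => fun j => ∑ p, (e k j p : ℂ) * x j p) := by
  classical
  -- The sums over single tetrahedra are admitted as further equations; evaluated on `x` they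
  -- vanish, so they do not appear in the conclusion.
  let U : Submodule ℝ (ι → Fin 3 → ℝ) := Submodule.span ℝ
    (Set.range e ∪ Set.range fun j : ι => (Pi.single j (fun _ => 1) : ι → Fin 3 → ℝ))
  have hc : c ∈ U := by
    by_contra hc
    -- A functional that vanishes on `U` but not on `c`, written in coordinates, is an excluded
    -- deformation.
    obtain ⟨φ, h1, h2⟩ := Submodule.exists_le_ker_of_notMem hc
    have hφ : ∀ c, φ c = angleSum c (fun j p => φ (Pi.single j (Pi.single p 1))) := by
      intro c
      have : c = ∑ j, ∑ p, c j p • (Pi.single j (Pi.single p 1) : ι → Fin 3 → ℝ) := by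
        ext j p
        simp [Finset.sum_apply, Pi.single_apply, Finset.sum_ite_eq, ite_apply]
      conv_lhs => rw [this]
      simp [angleSum]
    apply h1
    rw [hφ]
    refine h _ (fun j => ?_) (fun k => ?_)
    · have h3 : φ (Pi.single j (fun _ => 1)) = 0 :=
        h2 (Submodule.subset_span (Or.inr ⟨j, rfl⟩))
      rw [← h3, ← map_sum]
      congr 1
      ext j' p
      simp [Finset.sum_apply, Pi.single_apply, Finset.sum_ite_eq, ite_apply]
    · rw [← hφ]
      exact h2 (Submodule.subset_span (Or.inl ⟨k, rfl⟩))
  let Φ : (ι → Fin 3 → ℝ) →ₗ[ℝ] (ι → ℂ) :=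
    { toFun := fun c j => ∑ p, (c j p : ℂ) * x j p
      map_add' := fun c c' => by
        funext j
        simp [add_mul, Finset.sum_add_distrib]
      map_smul' := fun a c => by
        funext j
        simp [Finset.mul_sum, mul_assoc] }
  have hU : U ≤ ((Submodule.span ℂ (Set.range fun k => fun j => ∑ p, (e k j p : ℂ) *
      x j p)).restrictScalars ℝ).comap Φ := by
    rw [Submodule.span_le]
    rintro _ (⟨k, rfl⟩ | ⟨j, rfl⟩)
    · exact Submodule.subset_span ⟨k, rfl⟩
    · have : Φ (Pi.single j (fun _ => 1)) = 0 := by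
        funext j'
        by_cases hj : j' = j
        · subst hj
          simpa [Φ] using hx j'
        · simp [Φ, hj]
      rw [SetLike.mem_coe, Submodule.mem_comap, this]
      exact Submodule.zero_mem _
  exact hU hc

variable [DecidableEq ι] {X : RegularTriangulation ι}

namespace Frame

variable (C : Frame X)

theorem isAngle {δ : ι → Fin 3 → ℝ} (h0 : ∀ j, ∑ p, δ j p = 0)
    (hE : ∀ E, angleSum (fun j p => (X.T.edgeCount E j p : ℝ)) δ = 0) :
    (∀ j, ∑ p, ((C.F j p : ℝ) + δ j p) = 1) ∧
      ∀ E, ∑ j, ∑ p, (X.T.edgeCount E j p : ℝ) * ((C.F j p : ℝ) + δ j p) = 2 := by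
  constructor
  · intro j
    rw [Finset.sum_add_distrib, h0, add_zero]
    exact_mod_cast C.F_sum j
  · intro E
    have h1 := angleSum_add (fun j p => (X.T.edgeCount E j p : ℝ)) (fun j p => (C.F j p : ℝ)) δ
    rw [hE E, add_zero] at h1
    refine h1.trans ?_
    rw [angleSum_cast]
    exact_mod_cast C.F_edge E

/-- Meridians lift to the cyclic cover given by the longitude coordinate, which is connected because
of the longitude, and both have period 1 for the meridian coordinate. -/
theorem turning_meridian_eq {γ γ' : SimpleCurve X.T} (h : γ.homologyClass X.θ = (1, 0))
    (h' : γ'.homologyClass X.θ = (1, 0)) {δ : ι → Fin 3 → ℝ} (h0 : ∀ j, ∑ p, δ j p = 0)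
    (hE : ∀ E, angleSum (fun j p => (X.T.edgeCount E j p : ℝ)) δ = 0) :
    angleSum (fun j p => (γ.curveCount j p : ℝ)) (fun j p => (C.F j p : ℝ) + δ j p) =
      angleSum (fun j p => (γ'.curveCount j p : ℝ)) (fun j p => (C.F j p : ℝ) + δ j p) :=
  X.torus.turning_eq X.θ (AddMonoidHom.snd ℤ ℤ) (AddMonoidHom.fst ℤ ℤ) (γ₀ := C.lam)
    (by rw [C.lam_class]; rfl) (by rw [h]; rfl) (by rw [h']; rfl) (by rw [h]; rfl)
    (by rw [h']; rfl) _ (C.isAngle h0 hE).1 (C.isAngle h0 hE).2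

theorem turning_longitude_eq {γ γ' : SimpleCurve X.T} (h : γ.homologyClass X.θ = (0, 1))
    (h' : γ'.homologyClass X.θ = (0, 1)) {δ : ι → Fin 3 → ℝ} (h0 : ∀ j, ∑ p, δ j p = 0)
    (hE : ∀ E, angleSum (fun j p => (X.T.edgeCount E j p : ℝ)) δ = 0) :
    angleSum (fun j p => (γ.curveCount j p : ℝ)) (fun j p => (C.F j p : ℝ) + δ j p) =
      angleSum (fun j p => (γ'.curveCount j p : ℝ)) (fun j p => (C.F j p : ℝ) + δ j p) :=
  X.torus.turning_eq X.θ (AddMonoidHom.fst ℤ ℤ) (AddMonoidHom.snd ℤ ℤ) (γ₀ := C.μ)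
    (by rw [C.μ_class]; rfl) (by rw [h]; rfl) (by rw [h']; rfl) (by rw [h]; rfl)
    (by rw [h']; rfl) _ (C.isAngle h0 hE).1 (C.isAngle h0 hE).2

/-- The turning of the meridian changes in the same way for all meridians. -/
theorem deformation_meridian_eq (C : Frame X) {γ γ' : SimpleCurve X.T} (h : γ.homologyClass X.θ = (1, 0))
    (h' : γ'.homologyClass X.θ = (1, 0)) {δ : ι → Fin 3 → ℝ} (h0 : ∀ j, ∑ p, δ j p = 0)
    (hE : ∀ E, angleSum (fun j p => (X.T.edgeCount E j p : ℝ)) δ = 0) :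
    angleSum (fun j p => (γ.curveCount j p : ℝ)) δ =
      angleSum (fun j p => (γ'.curveCount j p : ℝ)) δ := by
  have h1 := C.turning_meridian_eq h h' h0 hE
  have h2 := C.turning_meridian_eq h h' (δ := fun _ _ => 0) (by simp) (by simp [angleSum])
  rw [angleSum_add, angleSum_add] at h1
  simp only [add_zero] at h2
  linarith

/-- By `mem_span_of_forall` it is enough that both meridians change their turning equally under
every deformation that vanishes on tetrahedra and edges. -/
theorem sub_mem_span (C' : Frame X) : X.curveRow C.μ - X.curveRow C'.μ ∈
    Submodule.span ℂ (Set.range X.edgeRow) := by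
  have := mem_span_of_forall (c := fun j p => (C.μ.curveCount j p : ℝ) - C'.μ.curveCount j p)
    (e := fun E j p => (X.T.edgeCount E j p : ℝ)) (fun δ h0 hE => by
      have h1 := C.deformation_meridian_eq C.μ_class C'.μ_class h0 hE
      rw [← sub_eq_zero] at h1
      rw [← h1]
      simp only [angleSum, sub_mul, Finset.sum_sub_distrib]) X.weight X.sum_weight
  convert this using 1
  · simp only [Complex.ofReal_intCast]
    rfl
  · funext j
    simp [RegularTriangulation.curveRow, RegularTriangulation.rowOf, sub_mul]

/-- The torsion does not depend on the choice of curves and of the flattening. -/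
theorem torsion_sq_eq (hX : X.Glued) (C' : Frame X) : C'.torsion ^ 2 = C.torsion ^ 2 := by
  have : Fintype X.T.Edge := Fintype.ofFinite _
  have hdet := sq_det_updateRow_eq X.sum_edgeRow C'.row C.row C'.last C.last (C'.sub_mem_span C)
  let δ : ι → Fin 3 → ℤ := fun j p => C'.F j p - C.F j p
  have hsum : (fun j p => C.F j p + δ j p) = C'.F := by
    funext j p
    simp only [δ]
    ring
  have h0 : ∀ j, ∑ p, δ j p = 0 := fun j => by
    simp only [δ, Finset.sum_sub_distrib, C.F_sum, C'.F_sum, sub_self]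
  have hδ : ∀ c : ι → Fin 3 → ℤ, angleSum c δ = angleSum c C'.F - angleSum c C.F := fun c => by
    have := angleSum_add c C.F δ
    rw [hsum] at this
    linarith
  have hE : ∀ E, angleSum (X.T.edgeCount E) δ = 0 := fun E => by
    rw [hδ]
    exact sub_eq_zero.2 ((C'.F_edge E).trans (C.F_edge E).symm)
  have hFC' : (fun j p => ((C'.F j p : ℤ) : ℝ)) =
      fun j p => (C'.F j p : ℝ) + (fun _ _ => (0 : ℝ)) j p := by
    simp
  -- Homology invariance moves the vanishing turning of the flattening of `C'` from its own meridian
  -- to the meridian of `C`; likewise for the longitude.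
  have hμ : angleSum C.μ.curveCount δ = 0 := by
    have h1 := C'.turning_meridian_eq C.μ_class C'.μ_class (δ := fun _ _ => 0) (by simp)
      (by simp [angleSum])
    rw [← hFC', angleSum_cast, angleSum_cast] at h1
    rw [hδ, Int.cast_injective h1]
    exact sub_eq_zero.2 (C'.F_meridian.trans C.F_meridian.symm)
  have hlam : angleSum C.lam.curveCount δ = 0 := by
    have h1 := C'.turning_longitude_eq C.lam_class C'.lam_class (δ := fun _ _ => 0) (by simp)
      (by simp [angleSum])
    rw [← hFC', angleSum_cast, angleSum_cast] at h1
    rw [hδ, Int.cast_injective h1]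
    exact sub_eq_zero.2 (C'.F_longitude.trans C.F_longitude.symm)
  obtain ⟨R, hR⟩ := exists_primitive h0
  obtain ⟨G, hG⟩ := X.torus.exists_side_potential X.θ C.μ_class C.lam_class δ R hR hE hμ hlam
  have hmon : X.monomial δ ^ 2 = 1 :=
    prod_shape_sq_eq_one X.shape_ne_zero X.shape_prod hX hR hG
  unfold torsion
  have hm : X.monomial C'.F = X.monomial C.F * X.monomial δ := by
    rw [← X.monomial_add, hsum]
  rw [hm]
  have h5 : (X.edgeMatrix C'.row C'.last (X.curveRow C'.μ)).det ^ 2 =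
    (X.edgeMatrix C.row C.last (X.curveRow C.μ)).det ^ 2 := hdet
  rw [mul_pow, mul_pow (1 / 2 : ℂ), h5, mul_pow (X.monomial _), hmon]
  ring

end Frame

theorem EnhancedNZDatum.torsion_sq_eq {m : ℂ} (D D' : EnhancedNZDatum X m) :
    D'.torsion ^ 2 = D.torsion ^ 2 := by
  rw [D.torsion_sq, D'.torsion_sq, D.toFrame.torsion_sq_eq D.glued]

end NeumannZagier

namespace NeumannZagier

/-! ### Invariance of the shapes -/

theorem moves_iff {h : PSL(2, ℂ)} {x y : CP1} : Moves h x y ↔ h • x = y := by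
  constructor
  · rintro ⟨g, rfl, rfl⟩
    rfl
  · rintro rfl
    obtain ⟨g, rfl⟩ := QuotientGroup.mk_surjective h
    exact ⟨g, rfl, rfl⟩

theorem Moves.symm {h : PSL(2, ℂ)} {x y : CP1} (hxy : Moves h x y) : Moves h⁻¹ y x := by
  rw [moves_iff] at hxy ⊢
  rw [← hxy, inv_smul_smul]

theorem exists_rep_smul (g : SL(2, ℂ)) (x : CP1) :
    ∃ c : ℂ, c ≠ 0 ∧ (g • x).rep = c • g.1.mulVec x.rep := by
  have h := Projectivization.smul_mk (K := ℂ) g x.rep_nonzero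
  rw [x.mk_rep] at h
  have h2 := (g • x).mk_rep
  conv_rhs at h2 => rw [h]
  rw [Projectivization.mk_eq_mk_iff] at h2
  obtain ⟨c, hc⟩ := h2
  exact ⟨c, c.ne_zero, hc.symm⟩

theorem exists_bracket_smul (g : SL(2, ℂ)) : ∃ c : CP1 → ℂ, (∀ x, c x ≠ 0) ∧
    ∀ x y, bracket (g • x) (g • y) = c x * c y * bracket x y := by
  choose c h1 h2 using exists_rep_smul g
  refine ⟨c, h1, fun x y => ?_⟩
  unfold bracket
  rw [h2 x, h2 y]
  have h3 := g.2
  rw [Matrix.det_fin_two] at h3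
  simp only [Pi.smul_apply, smul_eq_mul, Matrix.mulVec, dotProduct, Fin.sum_univ_two]
  linear_combination (c x * c y * (x.rep 0 * y.rep 1 - x.rep 1 * y.rep 0)) * h3

/-- A matrix of determinant 1 changes brackets only by the scalars of the chosen representatives,
and every point occurs once above and once below. -/
theorem crossRatio_smul (h : PSL(2, ℂ)) (a b c d : CP1) :
    crossRatio (h • a) (h • b) (h • c) (h • d) = crossRatio a b c d := by
  obtain ⟨g, rfl⟩ := QuotientGroup.mk_surjective h
  obtain ⟨k, h1, h2⟩ := exists_bracket_smul g
  change crossRatio (g • a) (g • b) (g • c) (g • d) = _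
  unfold crossRatio
  rw [h2, h2, h2, h2]
  have ha := h1 a
  have hb := h1 b
  have hc := h1 c
  have hd := h1 d
  by_cases e : bracket c a * bracket d b = 0
  · rw [e, div_zero]
    rw [show k c * k a * bracket c a * (k d * k b * bracket d b) =
      k c * k a * (k d * k b) * (bracket c a * bracket d b) by ring, e, mul_zero, div_zero]
  · have e1 := left_ne_zero_of_mul e
    have e2 := right_ne_zero_of_mul e
    field_simp

theorem crossRatio_symm₁ (a b c d : CP1) : crossRatio b a d c = crossRatio a b c d := by
  unfold crossRatio
  rw [mul_comm (bracket c b), mul_comm (bracket d b)]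

theorem crossRatio_symm₂ (a b c d : CP1) : crossRatio c d a b = crossRatio a b c d := by
  unfold crossRatio
  rw [bracket_swap c b, bracket_swap d a, bracket_swap c a, bracket_swap d b]
  rw [neg_mul_neg, neg_mul_neg, mul_comm (bracket c b)]

theorem crossRatio_symm₃ (a b c d : CP1) : crossRatio d c b a = crossRatio a b c d := by
  rw [crossRatio_symm₂, crossRatio_symm₁]

/-- The shape on the edge from `a` to `b`, computed from an even ordering of the vertices that starts
with `a` and `b`. -/
theorem DevelopingMap.crossRatio_eq_shape {ι : Type} {T : IdealTriangulation ι}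
    {ρ : Representation T} (δ : DevelopingMap ρ) (i : ι) (a b : Fin 4) (h : a ≠ b) :
    crossRatio (δ.pt i a) (δ.pt i b) (δ.pt i (rot a (rot a b))) (δ.pt i (rot a b)) =
      δ.shape i (pairType a b) := by
  fin_cases a <;> fin_cases b
  · exact absurd rfl h
  · rfl
  · rfl
  · rfl
  · exact crossRatio_symm₁ _ _ _ _
  · exact absurd rfl h
  · exact crossRatio_symm₂ (δ.pt i 0) (δ.pt i 3) (δ.pt i 1) (δ.pt i 2)
  · exact crossRatio_symm₃ (δ.pt i 0) (δ.pt i 2) (δ.pt i 3) (δ.pt i 1)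
  · exact crossRatio_symm₁ (δ.pt i 0) (δ.pt i 2) (δ.pt i 3) (δ.pt i 1)
  · exact crossRatio_symm₃ (δ.pt i 0) (δ.pt i 3) (δ.pt i 1) (δ.pt i 2)
  · exact absurd rfl h
  · exact crossRatio_symm₂ (δ.pt i 0) (δ.pt i 1) (δ.pt i 2) (δ.pt i 3)
  · exact crossRatio_symm₁ (δ.pt i 0) (δ.pt i 3) (δ.pt i 1) (δ.pt i 2)
  · exact crossRatio_symm₂ (δ.pt i 0) (δ.pt i 2) (δ.pt i 3) (δ.pt i 1)
  · exact crossRatio_symm₃ (δ.pt i 0) (δ.pt i 1) (δ.pt i 2) (δ.pt i 3)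
  · exact absurd rfl h

/-- The even permutations of the vertices act on the three pairs of opposite edges through the
quotient of A₄ by the Klein group, that is, by cyclic shifts. -/
theorem exists_shift : ∀ σ : Equiv.Perm (Fin 4), Equiv.Perm.sign σ = 1 → ∃ k : Fin 3,
    ∀ a b, a ≠ b → pairType (σ a) (σ b) = pairType a b + k := by decide +kernel

theorem exists_pairType : ∀ p : Fin 3, ∃ a b : Fin 4, a ≠ b ∧ pairType a b = p := by decide

/-! ### Isomorphisms of triangulations -/

/-- An orientation-preserving isomorphism of ideal triangulations. -/
structure IdealTriangulation.Iso {ι κ : Type} (T : IdealTriangulation ι)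
    (T' : IdealTriangulation κ) where
  e : ι ≃ κ
  s : ι → Equiv.Perm (Fin 4)
  k : ι → Fin 3
  sign_s : ∀ i, Equiv.Perm.sign (s i) = 1
  pairType_s : ∀ i a b, a ≠ b → pairType (s i a) (s i b) = pairType a b + k i
  nbr_e : ∀ i u, T'.nbr (e i) (s i u) = e (T.nbr i u)
  perm_e : ∀ i u w, T'.perm (e i) (s i u) (s i w) = s (T.nbr i u) (T.perm i u w)

variable {ι κ : Type}

namespace IdealTriangulation.Iso

variable {T : IdealTriangulation ι} {T' : IdealTriangulation κ} (I : T.Iso T')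

/-- The map on directed edges of tetrahedra. -/
def dir : DirEdge ι ≃ DirEdge κ where
  toFun x := ⟨(I.e x.1.1, I.s x.1.1 x.1.2.1, I.s x.1.1 x.1.2.2),
    fun h => x.2 ((I.s _).injective h)⟩
  invFun x := ⟨(I.e.symm x.1.1, (I.s (I.e.symm x.1.1)).symm x.1.2.1,
    (I.s (I.e.symm x.1.1)).symm x.1.2.2), fun h => x.2 ((I.s _).symm.injective h)⟩
  left_inv x := DirEdge.ext (by simp) (by simp) (by simp)
  right_inv x := DirEdge.ext (by simp) (by simp) (by simp)

theorem dir_across (x : DirEdge ι) (u : Fin 4) :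
    I.dir (T.across x u) = T'.across (I.dir x) (I.s x.1.1 u) :=
  DirEdge.ext (I.nbr_e _ _).symm (I.perm_e _ _ _).symm (I.perm_e _ _ _).symm

theorem edgeStep_iff (x y : DirEdge ι) : T'.EdgeStep (I.dir x) (I.dir y) ↔ T.EdgeStep x y := by
  constructor
  · rintro ⟨u, h1, h2, h⟩
    obtain ⟨u, rfl⟩ := (I.s x.1.1).surjective u
    rw [← I.dir_across] at h
    exact ⟨u, fun e => h1 (congrArg _ e), fun e => h2 (congrArg _ e), I.dir.injective h⟩
  · rintro ⟨u, h1, h2, rfl⟩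
    exact ⟨I.s x.1.1 u, fun e => h1 ((I.s _).injective e), fun e => h2 ((I.s _).injective e),
      I.dir_across x u⟩

/-- The map on edges. -/
def edge : T.Edge ≃ T'.Edge :=
  Quot.congr I.dir fun x y => or_congr (I.edgeStep_iff x y).symm (by
    rw [show (I.dir x).rev = I.dir x.rev from rfl, I.dir.apply_eq_iff_eq])

theorem edge_edgeOf (x : DirEdge ι) : I.edge (T.edgeOf x) = T'.edgeOf (I.dir x) := rfl

theorem edgeFun_dir (F' : κ → Fin 3 → ℤ) (x : DirEdge ι) :
    edgeFun F' (I.dir x) = edgeFun (fun j p => F' (I.e j) (p + I.k j)) x := by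
  exact congrArg (F' _) (I.pairType_s _ _ _ x.2)

theorem edgeCount_eq [Fintype ι] [Fintype κ] (E : T.Edge) (j : ι) (p : Fin 3) :
    T'.edgeCount (I.edge E) (I.e j) (p + I.k j) = T.edgeCount E j p := by
  classical
  have key : ∀ {ι : Type} [Fintype ι] (T : IdealTriangulation ι) (E : T.Edge) (j : ι) (p : Fin 3),
      2 * T.edgeCount E j p = ∑ x with T.edgeOf x = E,
        edgeFun (fun j' p' => if j' = j ∧ p' = p then (1 : ℤ) else 0) x := by
    intro ι _ T E j p
    rw [T.sum_edge_eq]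
    congr 1
    rw [Finset.sum_eq_single j, Finset.sum_eq_single p]
    · simp
    · intro p' _ hp
      simp [hp]
    · simp
    · intro j' _ hj
      simp [hj]
    · simp
  have h1 := key T' (I.edge E) (I.e j) (p + I.k j)
  rw [Finset.sum_filter, ← Equiv.sum_comp I.dir] at h1
  have h2 := key T E j p
  rw [Finset.sum_filter] at h2
  have h3 : ∀ x, (if T'.edgeOf (I.dir x) = I.edge E then edgeFun (fun j' p' =>
      if j' = I.e j ∧ p' = p + I.k j then (1 : ℤ) else 0) (I.dir x) else 0) =
      if T.edgeOf x = E then edgeFun (fun j' p' => if j' = j ∧ p' = p then (1 : ℤ) else 0) x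
        else 0 := by
    intro x
    rw [← I.edge_edgeOf, I.edge.apply_eq_iff_eq, I.edgeFun_dir]
    congr 2
    funext j' p'
    refine if_congr ?_ rfl rfl
    rw [I.e.apply_eq_iff_eq]
    constructor
    · rintro ⟨rfl, h⟩
      exact ⟨rfl, add_left_injective _ h⟩
    · rintro ⟨rfl, rfl⟩
      exact ⟨rfl, rfl⟩
  rw [Finset.sum_congr rfl fun x _ => h3 x, ← h2] at h1
  linarith

theorem mem_segment_comp {σ : Equiv.Perm (Fin 4)} {a b z : Fin 4 → ℝ}
    (h : z ∈ segment ℝ (a ∘ σ.symm) (b ∘ σ.symm)) : z ∘ σ ∈ segment ℝ a b := by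
  obtain ⟨s, t, hs, ht, hst, rfl⟩ := h
  refine ⟨s, t, hs, ht, hst, ?_⟩
  funext w
  simp

/-- The image of a curve. -/
def curve (γ : SimpleCurve T) : SimpleCurve T' where
  len := γ.len
  arc k := (I.e (γ.arc k).1, I.s (γ.arc k).1 * (γ.arc k).2)
  arc_tet k := by
    rw [γ.arc_tet]
    exact (I.nbr_e _ _).symm
  arc_vertex k := by
    simp only [Equiv.Perm.mul_apply]
    rw [I.perm_e, ← γ.arc_vertex, ← γ.arc_tet]
  arc_side k := by
    simp only [Equiv.Perm.mul_apply]
    rw [I.perm_e, ← γ.arc_side, ← γ.arc_tet]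
  entry k := γ.entry k ∘ (I.s (γ.arc k).1).symm
  exit k := γ.exit k ∘ (I.s (γ.arc k).1).symm
  entry_sum k := by
    rw [← γ.entry_sum k]
    exact Equiv.sum_comp (I.s (γ.arc k).1).symm (γ.entry k)
  entry_mem k := by simpa using γ.entry_mem k
  exit_mem k := by simpa using γ.exit_mem k
  entry_succ k w := by
    obtain ⟨w, rfl⟩ := (I.s (γ.arc k).1).surjective w
    simp only [Equiv.Perm.mul_apply, Function.comp_apply, Equiv.symm_apply_apply]
    rw [I.perm_e, ← γ.arc_tet, Equiv.symm_apply_apply, γ.entry_succ]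
  simple k l hkl h1 h2 := by
    have e1 : (γ.arc k).1 = (γ.arc l).1 := I.e.injective h1
    simp only [Equiv.Perm.mul_apply] at h2
    rw [e1] at h2 ⊢
    rw [Set.disjoint_left]
    intro z hz hz'
    exact Set.disjoint_left.1 (γ.simple k l hkl e1 ((I.s _).injective h2)) (mem_segment_comp hz)
      (mem_segment_comp hz')

theorem curveCount_curve (γ : SimpleCurve T) (j : ι) (p : Fin 3) :
    (I.curve γ).curveCount (I.e j) (p + I.k j) = γ.curveCount j p := by
  classical
  refine Finset.sum_congr rfl fun k _ => ?_
  change (if I.e (γ.arc k).1 = I.e j ∧ pairType (I.s (γ.arc k).1 ((γ.arc k).2 0))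
    (I.s (γ.arc k).1 ((γ.arc k).2 3)) = p + I.k j then
    ((Equiv.Perm.sign (I.s (γ.arc k).1 * (γ.arc k).2) : ℤˣ) : ℤ) else 0) = _
  rw [I.e.apply_eq_iff_eq, I.pairType_s _ _ _ (fun h => by simpa using (γ.arc k).2.injective h),
    Equiv.Perm.sign_mul, I.sign_s, one_mul]
  refine if_congr ?_ rfl rfl
  constructor
  · rintro ⟨rfl, h⟩
    exact ⟨rfl, add_left_injective _ h⟩
  · rintro ⟨rfl, rfl⟩
    exact ⟨rfl, rfl⟩

/-- The coboundary that changes the marking telescopes around the closed curve. -/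
theorem homologyClass_curve {θ : Marking T} {θ' : Marking T'} {c : ι → Fin 4 → ℤ × ℤ}
    (h : ∀ i v u, v ≠ u → θ'.val (I.e i) (I.s i v) (I.s i u) =
      c i v + θ.val i v u - c (T.nbr i u) (T.perm i u v)) (γ : SimpleCurve T) :
    (I.curve γ).homologyClass θ' = γ.homologyClass θ := by
  unfold SimpleCurve.homologyClass
  have h1 : ∀ k : Fin (γ.len + 1), θ'.val ((I.curve γ).arc k).1 (((I.curve γ).arc k).2 0)
      (((I.curve γ).arc k).2 2) = c (γ.arc k).1 ((γ.arc k).2 0) +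
        θ.val (γ.arc k).1 ((γ.arc k).2 0) ((γ.arc k).2 2) -
        c (γ.arc (k + 1)).1 ((γ.arc (k + 1)).2 0) := by
    intro k
    refine (h _ _ _ fun h => by simpa using (γ.arc k).2.injective h).trans ?_
    rw [γ.arc_tet, γ.arc_vertex]
  have h2 := Equiv.sum_comp (Equiv.addRight (1 : Fin (γ.len + 1)))
    (fun k => c (γ.arc k).1 ((γ.arc k).2 0))
  refine (Finset.sum_congr rfl fun k _ => h1 k).trans ?_
  change ∑ k : Fin (γ.len + 1), (c (γ.arc k).1 ((γ.arc k).2 0) +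
    θ.val (γ.arc k).1 ((γ.arc k).2 0) ((γ.arc k).2 2) -
      c (γ.arc (k + 1)).1 ((γ.arc (k + 1)).2 0)) = _
  simp only [Equiv.coe_addRight] at h2
  rw [Finset.sum_sub_distrib, Finset.sum_add_distrib, h2]
  abel

theorem sum_transport [Fintype ι] [Fintype κ] {R : Type*} [CommRing R] {c F : ι → Fin 3 → R}
    {c' F' : κ → Fin 3 → R} (h1 : ∀ j p, c' (I.e j) (p + I.k j) = c j p)
    (h2 : ∀ j p, F' (I.e j) (p + I.k j) = F j p) :
    ∑ j, ∑ p, c' j p * F' j p = ∑ j, ∑ p, c j p * F j p := by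
  rw [← Equiv.sum_comp I.e]
  refine Finset.sum_congr rfl fun j _ => ?_
  rw [← Equiv.sum_comp (Equiv.addRight (I.k j))]
  refine Finset.sum_congr rfl fun p _ => ?_
  simp only [Equiv.coe_addRight, h1, h2]

end IdealTriangulation.Iso

/-- The combinatorial part of an isomorphism. -/
theorem RegularTriangulation.Isomorphic.exists_iso {X : RegularTriangulation ι}
    {Y : RegularTriangulation κ} (h : X.Isomorphic Y) : ∃ I : X.T.Iso Y.T,
      (∃ g : ι → PSL(2, ℂ), ∀ i v, Moves (g i) (X.δ.pt i v) (Y.δ.pt (I.e i) (I.s i v))) ∧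
      ∃ c : ι → Fin 4 → ℤ × ℤ, ∀ i v u, v ≠ u → Y.θ.val (I.e i) (I.s i v) (I.s i u) =
        c i v + X.θ.val i v u - c (X.T.nbr i u) (X.T.perm i u v) := by
  obtain ⟨e, s, g, c, h1, h2, h3, -, h5, h6⟩ := h
  choose k hk using fun i => exists_shift (s i) (h1 i)
  exact ⟨⟨e, s, k, h1, hk, h2, h3⟩, ⟨g, h5⟩, ⟨c, h6⟩⟩

theorem RegularTriangulation.Isomorphic.symm {X : RegularTriangulation ι}
    {Y : RegularTriangulation κ} (h : X.Isomorphic Y) : Y.Isomorphic X := by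
  obtain ⟨e, s, g, c, h1, h2, h3, h4, h5, h6⟩ := h
  have key : ∀ {P : κ → Prop}, (∀ i, P (e i)) → ∀ j, P j := fun hP j => by
    simpa using hP (e.symm j)
  refine ⟨e.symm, fun j => (s (e.symm j))⁻¹, fun j => (g (e.symm j))⁻¹,
    fun j v => - c (e.symm j) ((s (e.symm j))⁻¹ v), ?_, ?_, ?_, ?_, ?_, ?_⟩
  · intro j
    rw [Equiv.Perm.sign_inv, h1]
  · refine key fun i u => ?_
    obtain ⟨u, rfl⟩ := (s i).surjective u
    simp [h2]
  · refine key fun i u w => ?_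
    obtain ⟨u, rfl⟩ := (s i).surjective u
    obtain ⟨w, rfl⟩ := (s i).surjective w
    simp [h2, h3]
  · refine key fun i u => ?_
    obtain ⟨u, rfl⟩ := (s i).surjective u
    simp [h2, h4, mul_assoc]
  · refine key fun i v => ?_
    obtain ⟨v, rfl⟩ := (s i).surjective v
    simpa using (h5 i v).symm
  · refine key fun i v u hvu => ?_
    obtain ⟨u, rfl⟩ := (s i).surjective u
    obtain ⟨v, rfl⟩ := (s i).surjective v
    rw [h6 i v u fun e => hvu (congrArg _ e), h2, h3]
    simp
    abel

theorem IdealTriangulation.Iso.shape_eq {X : RegularTriangulation ι} {Y : RegularTriangulation κ}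
    (I : X.T.Iso Y.T) {g : ι → PSL(2, ℂ)}
    (hg : ∀ i v, Moves (g i) (X.δ.pt i v) (Y.δ.pt (I.e i) (I.s i v))) (j : ι) (p : Fin 3) :
    Y.δ.shape (I.e j) (p + I.k j) = X.δ.shape j p := by
  obtain ⟨a, b, hab, rfl⟩ := exists_pairType p
  rw [← I.pairType_s j a b hab, ← X.δ.crossRatio_eq_shape j a b hab,
    ← Y.δ.crossRatio_eq_shape _ _ _ fun h => hab ((I.s j).injective h),
    even_rot _ (I.sign_s j), even_rot _ (I.sign_s j)]
  have h := fun v => moves_iff.1 (hg j v)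
  rw [← h, ← h, ← h, ← h, crossRatio_smul]

variable [Fintype ι] [Fintype κ]

theorem RegularTriangulation.Isomorphic.glued {X : RegularTriangulation ι}
    {Y : RegularTriangulation κ} (h : X.Isomorphic Y) (hX : X.Glued) : Y.Glued := by
  obtain ⟨I, ⟨g, hg⟩, -⟩ := h.exists_iso
  intro E
  obtain ⟨E, rfl⟩ := I.edge.surjective E
  rw [← hX E, ← Equiv.prod_comp I.e]
  refine Finset.prod_congr rfl fun j _ => ?_
  rw [← Equiv.prod_comp (Equiv.addRight (I.k j))]
  refine Finset.prod_congr rfl fun p _ => ?_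
  simp only [Equiv.coe_addRight]
  rw [I.shape_eq hg, I.edgeCount_eq]

variable [DecidableEq ι] [DecidableEq κ]

/-- The image of a frame. -/
def IdealTriangulation.Iso.frame {X : RegularTriangulation ι} {Y : RegularTriangulation κ}
    (I : X.T.Iso Y.T) {c : ι → Fin 4 → ℤ × ℤ}
    (hc : ∀ i v u, v ≠ u → Y.θ.val (I.e i) (I.s i v) (I.s i u) =
      c i v + X.θ.val i v u - c (X.T.nbr i u) (X.T.perm i u v)) (C : Frame X) : Frame Y :=
  have hF : ∀ j p, C.F (I.e.symm (I.e j)) (p + I.k j - I.k (I.e.symm (I.e j))) = C.F j p :=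
    fun j p => by simp
  { row := I.e.symm.trans (C.row.trans I.edge)
    last := I.e C.last
    μ := I.curve C.μ
    μ_class := (I.homologyClass_curve hc C.μ).trans C.μ_class
    lam := I.curve C.lam
    lam_class := (I.homologyClass_curve hc C.lam).trans C.lam_class
    F := fun j p => C.F (I.e.symm j) (p - I.k (I.e.symm j))
    F_sum := fun j => by
      rw [← C.F_sum (I.e.symm j)]
      exact Equiv.sum_comp (Equiv.subRight (I.k (I.e.symm j))) (C.F (I.e.symm j))
    F_edge := fun E => by
      obtain ⟨E, rfl⟩ := I.edge.surjective E
      rw [← C.F_edge E]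
      exact I.sum_transport (I.edgeCount_eq E) hF
    F_meridian := by
      rw [← C.F_meridian]
      exact I.sum_transport (I.curveCount_curve C.μ) hF
    F_longitude := by
      rw [← C.F_longitude]
      exact I.sum_transport (I.curveCount_curve C.lam) hF }

/-- On each tetrahedron an isomorphism shifts the pairs of opposite edges cyclically, which acts
like a change of quad type; `weight_quad` and `monomial_quad` again make the factors cancel. -/
theorem RegularTriangulation.Isomorphic.exists_frame {X : RegularTriangulation ι}
    {Y : RegularTriangulation κ} (h : X.Isomorphic Y) (C : Frame X) :
    ∃ C' : Frame Y, C'.torsion ^ 2 = C.torsion ^ 2 := by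
  obtain ⟨I, ⟨g, hg⟩, c, hc⟩ := h.exists_iso
  refine ⟨I.frame hc C, ?_⟩
  have hs := I.shape_eq hg
  have row_eq : ∀ {c : ι → Fin 3 → ℂ} {c' : κ → Fin 3 → ℂ}
      (h1 : ∀ j p, c' (I.e j) (p + I.k j) = c j p) (j : ι),
      Y.rowOf c' (I.e j) = X.rowOf c j * X.quadFactor j (- I.k j) := by
    intro c c' h1 j
    have hw := Y.weight_quad (I.e j) 0 (c' (I.e j))
    have hw' := X.weight_quad j (- I.k j) (c j)
    rw [← h1, ← h1, ← h1, ← hs, ← hs] at hw'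
    have hz : ∀ a : Fin 3, - I.k j + a + I.k j = a := fun a => by abel
    rw [hz, hz, neg_add_cancel] at hw'
    unfold RegularTriangulation.rowOf
    rw [← hw']
    refine Eq.trans ?_ hw.symm
    exact (mul_one _).symm
  have hmat : (Y.edgeMatrix (I.frame hc C).row (I.frame hc C).last
      (Y.curveRow (I.frame hc C).μ)).submatrix I.e I.e =
      X.edgeMatrix C.row C.last (X.curveRow C.μ) *
        Matrix.diagonal fun j => X.quadFactor j (- I.k j) := by
    ext i j
    rw [Matrix.mul_diagonal, Matrix.submatrix_apply]
    unfold RegularTriangulation.edgeMatrix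
    by_cases hi : i = C.last
    · subst hi
      change Matrix.updateRow _ (I.e C.last) _ (I.e C.last) _ = _
      rw [Matrix.updateRow_self, Matrix.updateRow_self]
      exact row_eq (fun j p => by
        exact_mod_cast congrArg (Int.cast : ℤ → ℂ) (I.curveCount_curve C.μ j p)) j
    · change Matrix.updateRow _ (I.e C.last) _ (I.e i) _ = _
      rw [Matrix.updateRow_ne hi, Matrix.updateRow_ne fun e => hi (I.e.injective e)]
      have : (I.frame hc C).row (I.e i) = I.edge (C.row i) := by
        change I.edge (C.row (I.e.symm (I.e i))) = _
        rw [Equiv.symm_apply_apply]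
      change Y.edgeRow ((I.frame hc C).row (I.e i)) (I.e j) = _
      rw [this]
      exact row_eq (c := fun j p => (X.T.edgeCount (C.row i) j p : ℂ))
        (c' := fun j p => (Y.T.edgeCount (I.edge (C.row i)) j p : ℂ)) (fun j p => by
        exact_mod_cast congrArg (Int.cast : ℤ → ℂ) (I.edgeCount_eq (C.row i) j p)) j
  have hdet := congrArg Matrix.det hmat
  rw [Matrix.det_submatrix_equiv_self, Matrix.det_mul, Matrix.det_diagonal] at hdet
  have hmon : (∏ j, X.quadFactor j (- I.k j)) ^ 2 * Y.monomial (I.frame hc C).F ^ 2 =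
      X.monomial C.F ^ 2 := by
    unfold RegularTriangulation.monomial
    rw [← Equiv.prod_comp I.e, ← Finset.prod_pow, ← Finset.prod_pow, ← Finset.prod_pow,
      ← Finset.prod_mul_distrib]
    refine Finset.prod_congr rfl fun j _ => ?_
    have h1 := X.monomial_quad j (- I.k j) (a := C.F j (- I.k j)) (b := C.F j (- I.k j + 1))
      (d := C.F j (- I.k j + 2)) (by
        have := sum_quad (- I.k j) (fun _ => 1) (C.F j (- I.k j)) (C.F j (- I.k j + 1))
          (C.F j (- I.k j + 2))
        rw [← C.F_sum j, Fin.sum_univ_three]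
        generalize - I.k j = q
        fin_cases q
        · rfl
        · change C.F j 1 + C.F j 2 + C.F j 0 = _
          ring
        · change C.F j 2 + C.F j 0 + C.F j 1 = _
          ring)
    have h2 : ∀ q t : Fin 3, (![C.F j q, C.F j (q + 1), C.F j (q + 2)] : Fin 3 → ℤ) (t - q) =
        C.F j t := by
      intro q t
      fin_cases q <;> fin_cases t <;> rfl
    rw [h2, h2] at h1
    rw [← h1, mul_pow (X.quadFactor j _)]
    have h3 : ∀ a : Fin 3, (I.frame hc C).F (I.e j) a = C.F j (a - I.k j) := by
      intro a
      change C.F (I.e.symm (I.e j)) (a - I.k (I.e.symm (I.e j))) = _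
      rw [Equiv.symm_apply_apply]
    rw [h3, h3, ← hs, ← hs]
    have hz : ∀ a : Fin 3, - I.k j + a + I.k j = a := fun a => by abel
    rw [hz, neg_add_cancel, sub_eq_neg_add, sub_eq_neg_add, add_zero]
  unfold Frame.torsion
  rw [hdet, mul_pow _ (X.monomial _), ← hmon]
  ring

end NeumannZagier

namespace NeumannZagier

/-! ### Combinatorics of the bipyramid -/

section Bipyramid

theorem bipyramidTwo_injective : ∀ c, Function.Injective (bipyramidTwo c) := by decide

theorem bipyramidThree_injective : ∀ k, Function.Injective (bipyramidThree k) := by decide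

theorem bipyramidTwo_apex_injective : ∀ c c' : Fin 2,
    bipyramidTwo (c + 1) 0 = bipyramidTwo (c' + 1) 0 → c = c' := by decide

theorem exists_three_of_two : ∀ (c : Fin 2) (u w : Fin 4), u ≠ 0 → w ≠ u →
    ∃ (k : Fin 3) (u' w' : Fin 4), w' ≠ u' ∧ bipyramidTwo c u = k.castLE (by omega) ∧
      bipyramidThree k u' = bipyramidTwo (c + 1) 0 ∧ bipyramidTwo c w = bipyramidThree k w' := by
  decide +kernel

theorem exists_two_of_three : ∀ (k : Fin 3) (u' w' : Fin 4), u' ≠ 2 → u' ≠ 3 → w' ≠ u' →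
    ∃ (c : Fin 2) (u w : Fin 4), w ≠ u ∧ bipyramidTwo c u = k.castLE (by omega) ∧
      bipyramidThree k u' = bipyramidTwo (c + 1) 0 ∧ bipyramidTwo c w = bipyramidThree k w' := by
  decide +kernel

theorem bipyramid_outer : ∀ (c : Fin 2) (k : Fin 3) (u w u' w' : Fin 4),
    bipyramidTwo c u = k.castLE (by omega) → bipyramidThree k u' = bipyramidTwo (c + 1) 0 →
    w ≠ u → bipyramidTwo c w = bipyramidThree k w' →
    u ≠ 0 ∧ u' ≠ 2 ∧ u' ≠ 3 ∧ w' ≠ u' ∧ bipyramidTwo c (rot w u) = bipyramidThree k (rot w' u') ∧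
      bipyramidTwo c (rot w (rot w u)) = bipyramidThree k (rot w' (rot w' u')) := by
  decide +kernel

theorem bipyramidTwo_inner : ∀ (c : Fin 2) (v : Fin 4), v ≠ 0 →
    bipyramidTwo c v = bipyramidTwo (c + 1) (Equiv.swap 2 3 v) ∧
      bipyramidTwo c (rot v (rot v 0)) =
        bipyramidTwo (c + 1) (rot (Equiv.swap 2 3 v) 0) := by
  decide

theorem bipyramidThree_inner : ∀ (k : Fin 3) (v : Fin 4),
    (v ≠ 2 → bipyramidThree k v = bipyramidThree (k + 1) (Equiv.swap 2 3 v) ∧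
      bipyramidThree k (rot v (rot v 2)) = bipyramidThree (k + 1) (rot (Equiv.swap 2 3 v) 3)) ∧
    (v ≠ 3 → bipyramidThree k v = bipyramidThree (k + 2) (Equiv.swap 2 3 v) ∧
      bipyramidThree k (rot v (rot v 3)) =
        bipyramidThree (k + 2) (rot (Equiv.swap 2 3 v) 2)) := by
  decide

set_option synthInstance.maxHeartbeats 200000 in
set_option synthInstance.maxSize 4000 in
theorem bipyramidTwo_conn : ∀ (c c' : Fin 2) (v u v' u' : Fin 4), v ≠ u → v' ≠ u' →
    bipyramidTwo c v = bipyramidTwo c' v' → bipyramidTwo c (rot v u) = bipyramidTwo c' (rot v' u') →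
    c = c' ∧ v = v' ∧ u = u' ∨ c' = c + 1 ∧
      (rot v (rot v u) = 0 ∧ v' = Equiv.swap 2 3 v ∧ u' = 0 ∨
        rot v' (rot v' u') = 0 ∧ v = Equiv.swap 2 3 v' ∧ u = 0) := by
  decide +kernel

set_option synthInstance.maxHeartbeats 200000 in
set_option synthInstance.maxSize 4000 in
-- Any two of the three tetrahedra share a face, so different boundary corners at one place of the
-- bipyramid are related by a single inner gluing, in one direction or the other.
theorem bipyramidThree_conn : ∀ (k k' : Fin 3) (v u v' u' : Fin 4), v ≠ u → v' ≠ u' →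
    bipyramidThree k v = bipyramidThree k' v' →
    bipyramidThree k (rot v u) = bipyramidThree k' (rot v' u') →
    k = k' ∧ v = v' ∧ u = u' ∨
      k' = k + 1 ∧ (rot v (rot v u) = 2 ∧ v' = Equiv.swap 2 3 v ∧ u' = 3 ∨
        rot v' (rot v' u') = 3 ∧ v = Equiv.swap 2 3 v' ∧ u = 2) ∨
      k = k' + 1 ∧ (rot v (rot v u) = 3 ∧ v' = Equiv.swap 2 3 v ∧ u' = 2 ∨
        rot v' (rot v' u') = 2 ∧ v = Equiv.swap 2 3 v' ∧ u = 3) := by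
  decide +kernel

theorem bipyramidTwo_exists_loc : ∀ (c : Fin 2) (v u : Fin 4), v ≠ u →
    ∃ (k : Fin 3) (v' u' : Fin 4), v' ≠ u' ∧ bipyramidThree k v' = bipyramidTwo c v ∧
      bipyramidThree k (rot v' u') = bipyramidTwo c (rot v u) := by
  decide +kernel

/-- The pairs of apexes of the bipyramid. -/
def IsAxis (p : Fin 5 × Fin 5) : Prop := p = (3, 4) ∨ p = (4, 3)

instance : DecidablePred IsAxis := fun _ => inferInstanceAs (Decidable (_ ∨ _))

theorem bipyramidThree_exists_loc : ∀ (k : Fin 3) (v u : Fin 4), v ≠ u →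
    ¬ IsAxis (bipyramidThree k v, bipyramidThree k (rot v u)) →
    ∃ (c : Fin 2) (v' u' : Fin 4), v' ≠ u' ∧ bipyramidTwo c v' = bipyramidThree k v ∧
      bipyramidTwo c (rot v' u') = bipyramidThree k (rot v u) := by
  decide +kernel

theorem bipyramidTwo_not_isAxis : ∀ (c : Fin 2) (v w : Fin 4),
    ¬ IsAxis (bipyramidTwo c v, bipyramidTwo c w) := by decide

theorem bipyramidThree_not_isAxis : ∀ (k : Fin 3) (v u : Fin 4), v ≠ u →
    ¬ IsAxis (bipyramidThree k v, bipyramidThree k (rot v u)) ∨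
      ¬ IsAxis (bipyramidThree k v, bipyramidThree k (rot v (rot v u))) := by decide

theorem rot_zero_ne : ∀ v : Fin 4, v ≠ 0 → rot v 0 ≠ 0 ∧ rot v (rot v 0) ≠ 0 := by decide

end Bipyramid

/-- The position of a directed edge of a tetrahedron. -/
def position {κ R : Type} (b : κ → Fin 4 → Fin 5) (x : DirEdge (κ ⊕ R)) :
    (Fin 5 × Fin 5) ⊕ (R × Fin 4 × Fin 4) :=
  x.1.1.elim (fun c => Sum.inl (b c x.1.2.1, b c x.1.2.2)) fun r => Sum.inr (r, x.1.2.1, x.1.2.2)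

theorem position_inr_injective {κ R : Type} {b : κ → Fin 4 → Fin 5} {x y : DirEdge (κ ⊕ R)} {r r' : R}
    (hx : x.1.1 = Sum.inr r) (hy : y.1.1 = Sum.inr r') (h : position b x = position b y) : x = y := by
  unfold position at h
  rw [hx, hy] at h
  simp only [Sum.elim_inr, Sum.inr.injEq, Prod.mk.injEq] at h
  exact DirEdge.ext (by rw [hx, hy, h.1]) h.2.1 h.2.2

variable {R : Type}

/-- The correspondence of outer sides of boundary triangles in a 2-3 move. -/
def OuterSide (x : DirEdge (Fin 2 ⊕ R)) (y : DirEdge (Fin 3 ⊕ R)) : Prop :=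
  OuterFlag (x.1.1, x.1.2.2, x.1.2.1) (y.1.1, y.1.2.2, y.1.2.1)

namespace OuterSide

variable {x x' : DirEdge (Fin 2 ⊕ R)} {y y' : DirEdge (Fin 3 ⊕ R)}

theorem right_unique (h : OuterSide x y) (h' : OuterSide x y') : y = y' := by
  obtain ⟨⟨i, v, u⟩, hx⟩ := x
  obtain ⟨⟨j, v1, u1⟩, hy⟩ := y
  obtain ⟨⟨j', v2, u2⟩, hy'⟩ := y'
  unfold OuterSide at h h'
  dsimp only at h h'
  cases h with
  | rest r u w h =>
    cases h' with
    | rest r u w h => rfl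
  | bipyramid c k u w u' w' hu hu' hwu hw =>
    cases h' with
    | bipyramid c k' u w u2 w2 hu2 hu2' hwu hw2 =>
      obtain rfl : k = k' := Fin.castLE_injective _ (hu.symm.trans hu2)
      obtain rfl := bipyramidThree_injective k (hu'.trans hu2'.symm)
      obtain rfl := bipyramidThree_injective k (hw.symm.trans hw2)
      rfl

theorem left_unique (h : OuterSide x y) (h' : OuterSide x' y) : x = x' := by
  obtain ⟨⟨i, v, u⟩, hx⟩ := x
  obtain ⟨⟨i', v1, u1⟩, hx'⟩ := x'
  obtain ⟨⟨j, v2, u2⟩, hy⟩ := y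
  unfold OuterSide at h h'
  dsimp only at h h'
  cases h with
  | rest r u w h =>
    cases h' with
    | rest r u w h => rfl
  | bipyramid c k u w u' w' hu hu' hwu hw =>
    cases h' with
    | bipyramid c' k u2 w2 u' w' hu2 hu2' hwu2 hw2 =>
      obtain rfl : c = c' := bipyramidTwo_apex_injective _ _ (hu'.symm.trans hu2')
      obtain rfl := bipyramidTwo_injective c (hu.trans hu2.symm)
      obtain rfl := bipyramidTwo_injective c (hw.trans hw2.symm)
      rfl

theorem position_eq (h : OuterSide x y) :
    position bipyramidTwo (nextSide x) = position bipyramidThree (nextSide y) ∧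
      position bipyramidTwo (nextSide (nextSide x)) =
        position bipyramidThree (nextSide (nextSide y)) := by
  obtain ⟨⟨i, v, u⟩, hx⟩ := x
  obtain ⟨⟨j, v1, u1⟩, hy⟩ := y
  unfold OuterSide at h
  dsimp only at h
  cases h with
  | rest r u w h => exact ⟨rfl, rfl⟩
  | bipyramid c k u w u' w' hu hu' hwu hw =>
    obtain ⟨-, -, -, -, h1, h2⟩ := bipyramid_outer _ _ _ _ _ _ hu hu' hwu hw
    exact ⟨congrArg Sum.inl (Prod.ext hw h1), congrArg Sum.inl (Prod.ext hw h2)⟩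

theorem exists_right (hx : ∀ c, x.1.1 = Sum.inl c → x.1.2.2 ≠ 0) :
    ∃ y : DirEdge (Fin 3 ⊕ R), OuterSide x y := by
  obtain ⟨⟨i | r, v, u⟩, h⟩ := x
  · obtain ⟨k, u', w', h1, h2, h3, h4⟩ := exists_three_of_two i u v (hx i rfl) h
    exact ⟨⟨(Sum.inl k, w', u'), h1⟩, OuterFlag.bipyramid i k u v u' w' h2 h3 h h4⟩
  · exact ⟨⟨(Sum.inr r, v, u), h⟩, OuterFlag.rest r u v h⟩

theorem exists_left (hy : ∀ k, y.1.1 = Sum.inl k → y.1.2.2 ≠ 2 ∧ y.1.2.2 ≠ 3) :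
    ∃ x : DirEdge (Fin 2 ⊕ R), OuterSide x y := by
  obtain ⟨⟨i | r, v, u⟩, h⟩ := y
  · obtain ⟨c, u', w', h1, h2, h3, h4⟩ := exists_two_of_three i u v (hy i rfl).1 (hy i rfl).2 h
    exact ⟨⟨(Sum.inl c, w', u'), h1⟩, OuterFlag.bipyramid c i u' w' u v h2 h3 h1 h4⟩
  · exact ⟨⟨(Sum.inr r, v, u), h⟩, OuterFlag.rest r u v h⟩

end OuterSide

/-! ### The sides of both triangulations -/

/-- The sides of the boundary triangles of both triangulations. -/
abbrev BothSides (R : Type) : Type := DirEdge (Fin 2 ⊕ R) ⊕ DirEdge (Fin 3 ⊕ R)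

namespace BothSides

/-- The sides that lie on faces which are not interior to the bipyramid. -/
def Outer : BothSides R → Prop :=
  Sum.elim (fun x => ∃ y, OuterSide x y) fun y => ∃ x, OuterSide x y

/-- The relation between outer sides of both triangulations. -/
def Match : BothSides R → BothSides R → Prop :=
  Sum.elim (fun x => Sum.elim (fun _ => False) fun y => OuterSide x y)
    fun y => Sum.elim (fun x => OuterSide x y) fun _ => False

theorem Match.symm {d d' : BothSides R} (h : Match d d') : Match d' d := by
  rcases d with d | d <;> rcases d' with d' | d' <;> exact h

theorem Match.unique {d d' d'' : BothSides R} (h : Match d d') (h' : Match d d'') : d' = d'' := by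
  rcases d with d | d <;> rcases d' with d' | d' <;> rcases d'' with d'' | d''
  · exact h.elim
  · exact h.elim
  · exact h'.elim
  · exact congrArg _ (OuterSide.right_unique h h')
  · exact congrArg _ (OuterSide.left_unique h h')
  · exact h'.elim
  · exact h.elim
  · exact h.elim

theorem Match.isLeft {d d' : BothSides R} (h : Match d d') : d'.isLeft = !d.isLeft := by
  rcases d with d | d <;> rcases d' with d' | d'
  · exact h.elim
  · rfl
  · rfl
  · exact h.elim

theorem outer_iff {d : BothSides R} : Outer d ↔ ∃ d', Match d d' := by
  rcases d with d | d
  · exact ⟨fun ⟨y, h⟩ => ⟨Sum.inr y, h⟩, fun ⟨d', h⟩ => by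
      rcases d' with d' | d'
      exacts [h.elim, ⟨d', h⟩]⟩
  · exact ⟨fun ⟨y, h⟩ => ⟨Sum.inl y, h⟩, fun ⟨d', h⟩ => by
      rcases d' with d' | d'
      exacts [⟨d', h⟩, h.elim]⟩

theorem Match.outer {d d' : BothSides R} (h : Match d d') : Outer d := outer_iff.2 ⟨d', h⟩

open Classical in
/-- The matching side of the other triangulation. -/
noncomputable def flip (d : BothSides R) : BothSides R :=
  if h : ∃ d', Match d d' then h.choose else
    d.elim (fun _ => Sum.inr ⟨(Sum.inl 0, 0, 1), zero_ne_one⟩) fun _ =>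
      Sum.inl ⟨(Sum.inl 0, 0, 1), zero_ne_one⟩

theorem match_flip {d : BothSides R} (h : Outer d) : Match d d.flip := by
  rw [outer_iff] at h
  unfold flip
  rw [dif_pos h]
  exact h.choose_spec

theorem Match.flip_eq {d d' : BothSides R} (h : Match d d') : d.flip = d' :=
  (match_flip h.outer).unique h

theorem isLeft_flip (d : BothSides R) : d.flip.isLeft = !d.isLeft := by
  by_cases h : Outer d
  · exact (match_flip h).isLeft
  · unfold flip
    rw [dif_neg (by rwa [← outer_iff])]
    rcases d with d | d <;> rfl

/-- The position of the corner at which a side starts. -/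
def loc (d : BothSides R) : (Fin 5 × Fin 5) ⊕ (R × Fin 4 × Fin 4) :=
  d.elim (fun x => position bipyramidTwo (nextSide x)) fun y => position bipyramidThree (nextSide y)

/-- The next side of the same triangle. -/
def next : Equiv.Perm (BothSides R) := Equiv.sumCongr nextSide nextSide

theorem Match.loc_eq {d d' : BothSides R} (h : Match d d') : d.loc = d'.loc := by
  rcases d with d | d <;> rcases d' with d' | d'
  · exact h.elim
  · exact (OuterSide.position_eq h).1
  · exact (OuterSide.position_eq h).1.symm
  · exact h.elim

theorem Match.loc_next_eq {d d' : BothSides R} (h : Match d d') :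
    (next d).loc = (next d').loc := by
  rcases d with d | d <;> rcases d' with d' | d'
  · exact h.elim
  · exact (OuterSide.position_eq h).2
  · exact (OuterSide.position_eq h).2.symm
  · exact h.elim

theorem not_outer_inl {x : DirEdge (Fin 2 ⊕ R)} (h : ¬ Outer (Sum.inl x)) :
    ∃ c, x.1.1 = Sum.inl c ∧ x.1.2.2 = 0 := by
  by_contra hn
  push Not at hn
  exact h (OuterSide.exists_right hn)

theorem not_outer_inr {y : DirEdge (Fin 3 ⊕ R)} (h : ¬ Outer (Sum.inr y)) :
    ∃ k, y.1.1 = Sum.inl k ∧ (y.1.2.2 = 2 ∨ y.1.2.2 = 3) := by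
  by_contra hn
  push Not at hn
  exact h (OuterSide.exists_left hn)

theorem not_outer_of_two {x : DirEdge (Fin 2 ⊕ R)} {c : Fin 2} (h1 : x.1.1 = Sum.inl c)
    (h2 : x.1.2.2 = 0) : ¬ Outer (Sum.inl x) := by
  rintro ⟨y, hy⟩
  obtain ⟨⟨i, v, u⟩, hx⟩ := x
  obtain ⟨⟨j, v1, u1⟩, hy'⟩ := y
  dsimp only at h1 h2
  subst h1 h2
  cases hy with
  | bipyramid c k u w u' w' hu hu' hwu hw =>
    exact (bipyramid_outer _ _ _ _ _ _ hu hu' hwu hw).1 rfl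

theorem not_outer_of_three {y : DirEdge (Fin 3 ⊕ R)} {k : Fin 3} (h1 : y.1.1 = Sum.inl k)
    (h2 : y.1.2.2 = 2 ∨ y.1.2.2 = 3) : ¬ Outer (Sum.inr y) := by
  rintro ⟨x, hx⟩
  obtain ⟨⟨i, v, u⟩, hx'⟩ := x
  obtain ⟨⟨j, v1, u1⟩, hy'⟩ := y
  dsimp only at h1 h2
  subst h1
  cases hx with
  | bipyramid c k u w u' w' hu hu' hwu hw =>
    obtain ⟨-, h3, h4, -⟩ := bipyramid_outer _ _ _ _ _ _ hu hu' hwu hw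
    exact h2.elim h3 h4

/-- The positions on the axis of the bipyramid. -/
def Axis (l : (Fin 5 × Fin 5) ⊕ (R × Fin 4 × Fin 4)) : Prop := l.elim IsAxis fun _ => False

theorem not_axis_inl (x : DirEdge (Fin 2 ⊕ R)) : ¬ Axis (loc (Sum.inl x)) := by
  obtain ⟨⟨i | r, v, u⟩, h⟩ := x
  · exact bipyramidTwo_not_isAxis _ _ _
  · exact id

theorem Outer.not_axis {d : BothSides R} (h : Outer d) : ¬ Axis (loc d) := by
  rcases d with d | d
  · exact not_axis_inl d
  · rw [(match_flip h).loc_eq]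
    obtain ⟨x, hx⟩ := h
    rw [Match.flip_eq (d := Sum.inr d) (d' := Sum.inl x) hx]
    exact not_axis_inl x

theorem Outer.not_axis_next {d : BothSides R} (h : Outer d) : ¬ Axis (loc (next d)) := by
  rcases d with d | d
  · exact not_axis_inl _
  · rw [(match_flip h).loc_next_eq]
    obtain ⟨x, hx⟩ := h
    rw [Match.flip_eq (d := Sum.inr d) (d' := Sum.inl x) hx]
    exact not_axis_inl _

theorem exists_loc (d : BothSides R) (h : ¬ Axis d.loc) :
    ∃ d' : BothSides R, d'.isLeft = !d.isLeft ∧ d'.loc = d.loc := by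
  obtain ⟨⟨i | r, v, u⟩, hd⟩ | ⟨⟨i | r, v, u⟩, hd⟩ := d
  · obtain ⟨k, v', u', h1, h2, h3⟩ := bipyramidTwo_exists_loc i v u hd
    exact ⟨Sum.inr ⟨(Sum.inl k, v', u'), h1⟩, rfl, congrArg Sum.inl (Prod.ext h2 h3)⟩
  · exact ⟨Sum.inr ⟨(Sum.inr r, v, u), hd⟩, rfl, rfl⟩
  · obtain ⟨k, v', u', h1, h2, h3⟩ := bipyramidThree_exists_loc i v u hd h
    exact ⟨Sum.inl ⟨(Sum.inl k, v', u'), h1⟩, rfl, congrArg Sum.inl (Prod.ext h2 h3)⟩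
  · exact ⟨Sum.inl ⟨(Sum.inr r, v, u), hd⟩, rfl, rfl⟩

theorem exists_not_axis (d : BothSides R) : ¬ Axis d.loc ∨ ¬ Axis (next d).loc := by
  obtain d | ⟨⟨i | r, v, u⟩, hd⟩ := d
  · exact Or.inl (not_axis_inl d)
  · exact bipyramidThree_not_isAxis i v u hd
  · exact Or.inl id

theorem outer_next {x : DirEdge (Fin 2 ⊕ R)} (h : ¬ Outer (Sum.inl x)) :
    Outer (next (Sum.inl x)) ∧ Outer (next (next (Sum.inl x))) := by
  obtain ⟨c, -, h2⟩ := not_outer_inl h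
  have h3 := rot_zero_ne x.1.2.1 (by rw [← h2]; exact x.2)
  rw [← h2] at h3
  constructor
  · exact OuterSide.exists_right fun _ _ e => h3.1 (e.trans h2.symm)
  · exact OuterSide.exists_right fun _ _ e => h3.2 (e.trans h2.symm)

end BothSides

end NeumannZagier

/-! ### Gluings and markings in a standard 2-3 move. -/

namespace NeumannZagier

theorem eq_swap_of_two : ∀ σ : Equiv.Perm (Fin 4),
    (∀ w, w ≠ 0 → bipyramidTwo 1 (σ w) = bipyramidTwo 0 w) → σ = Equiv.swap 2 3 := by
  decide +kernel

theorem eq_swap_of_three : ∀ (k : Fin 3) (σ : Equiv.Perm (Fin 4)),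
    (∀ w, w ≠ 2 → bipyramidThree (k + 1) (σ w) = bipyramidThree k w) → σ = Equiv.swap 2 3 := by
  decide +kernel

variable {R : Type} {X : RegularTriangulation (Fin 2 ⊕ R)} {Y : RegularTriangulation (Fin 3 ⊕ R)}

namespace StandardMove

theorem gluing_two (h : StandardMove X Y) (c : Fin 2) : X.T.nbr (Sum.inl c) 0 = Sum.inl (c + 1) ∧
    X.T.perm (Sum.inl c) 0 = Equiv.swap 2 3 := by
  have h1 := eq_swap_of_two _ h.perm_two
  have h2 : c = 0 ∨ c = 1 := by
    fin_cases c <;> simp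
  rcases h2 with rfl | rfl
  · exact ⟨h.nbr_two, h1⟩
  · have h3 := X.T.nbr_nbr (Sum.inl 0) 0
    have h4 := X.T.perm_perm (Sum.inl 0) 0
    rw [h.nbr_two, h1] at h3 h4
    exact ⟨h3, h4.trans (Equiv.swap_inv _ _)⟩

theorem gluing_three (h : StandardMove X Y) (k : Fin 3) : (Y.T.nbr (Sum.inl k) 2 = Sum.inl (k + 1) ∧
    Y.T.perm (Sum.inl k) 2 = Equiv.swap 2 3) ∧ Y.T.nbr (Sum.inl k) 3 = Sum.inl (k + 2) ∧
      Y.T.perm (Sum.inl k) 3 = Equiv.swap 2 3 := by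
  refine ⟨⟨h.nbr_three k, eq_swap_of_three k _ (h.perm_three k)⟩, ?_⟩
  have h1 := eq_swap_of_three (k + 2) _ (h.perm_three (k + 2))
  have h2 := h.nbr_three (k + 2)
  have h3 := Y.T.nbr_nbr (Sum.inl (k + 2)) 2
  have h4 := Y.T.perm_perm (Sum.inl (k + 2)) 2
  have h5 : k + 2 + 1 = k := by
    rw [add_assoc]
    exact add_zero k
  rw [h2, h1, h5, Equiv.swap_apply_left] at h3 h4
  exact ⟨h3, h4.trans (Equiv.swap_inv _ _)⟩

theorem opp_two (h : StandardMove X Y) {x : DirEdge (Fin 2 ⊕ R)} {c : Fin 2} (h1 : x.1.1 = Sum.inl c) (h2 : x.1.2.2 = 0) :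
    (X.T.opp x).1 = (Sum.inl (c + 1), Equiv.swap 2 3 x.1.2.1, 0) := by
  obtain ⟨h3, h4⟩ := h.gluing_two c
  change (X.T.nbr x.1.1 x.1.2.2, X.T.perm x.1.1 x.1.2.2 x.1.2.1,
    X.T.perm x.1.1 x.1.2.2 x.1.2.2) = _
  rw [h1, h2, h3, h4]
  rfl

theorem opp_three (h : StandardMove X Y) {y : DirEdge (Fin 3 ⊕ R)} {k : Fin 3} (h1 : y.1.1 = Sum.inl k) :
    (y.1.2.2 = 2 → (Y.T.opp y).1 = (Sum.inl (k + 1), Equiv.swap 2 3 y.1.2.1, 3)) ∧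
    (y.1.2.2 = 3 → (Y.T.opp y).1 = (Sum.inl (k + 2), Equiv.swap 2 3 y.1.2.1, 2)) := by
  obtain ⟨⟨h3, h4⟩, h5, h6⟩ := h.gluing_three k
  change (_ → (Y.T.nbr y.1.1 y.1.2.2, Y.T.perm y.1.1 y.1.2.2 y.1.2.1,
    Y.T.perm y.1.1 y.1.2.2 y.1.2.2) = _) ∧ (_ → (Y.T.nbr y.1.1 y.1.2.2,
      Y.T.perm y.1.1 y.1.2.2 y.1.2.1, Y.T.perm y.1.1 y.1.2.2 y.1.2.2) = _)
  rw [h1]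
  constructor
  · intro h2
    rw [h2, h3, h4]
    rfl
  · intro h2
    rw [h2, h5, h6]
    rfl

end StandardMove

namespace BothSides

/-- The other side of the same edge of the boundary. -/
def other (X : RegularTriangulation (Fin 2 ⊕ R)) (Y : RegularTriangulation (Fin 3 ⊕ R)) :
    Equiv.Perm (BothSides R) := Equiv.sumCongr X.T.opp Y.T.opp

/-- The cocycle given by the markings. -/
def side (X : RegularTriangulation (Fin 2 ⊕ R)) (Y : RegularTriangulation (Fin 3 ⊕ R))
    (L : ℤ × ℤ →+ ℤ) (d : BothSides R) : ℤ := d.elim (X.θ.side L) (Y.θ.side L)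

theorem isLeft_next (d : BothSides R) : (next d).isLeft = d.isLeft := by
  rcases d with d | d <;> rfl

theorem isLeft_other (d : BothSides R) : (other X Y d).isLeft = d.isLeft := by
  rcases d with d | d <;> rfl

end BothSides

namespace StandardMove

open BothSides

theorem match_other (h : StandardMove X Y) {d d' : BothSides R} (hd : Match d d') :
    Match (other X Y d) (other X Y d') := by
  rcases d with d | d <;> rcases d' with d' | d'
  · exact hd.elim
  · exact h.glue _ _ hd
  · exact h.glue _ _ hd
  · exact hd.elim

theorem outer_other (h : StandardMove X Y) {d : BothSides R} (hd : Outer d) : Outer (other X Y d) :=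
  (h.match_other (match_flip hd)).outer

theorem other_flip (h : StandardMove X Y) {d : BothSides R} (hd : Outer d) : other X Y d.flip = (other X Y d).flip :=
  (h.match_other (match_flip hd)).flip_eq.symm

theorem side_match (h : StandardMove X Y) (L : ℤ × ℤ →+ ℤ) {d d' : BothSides R} (hd : Match d d') :
    side X Y L d = side X Y L d' := by
  rcases d with d | d <;> rcases d' with d' | d'
  · exact hd.elim
  · exact congrArg L (h.val_outer _ _ hd)
  · exact congrArg L (h.val_outer _ _ hd).symm
  · exact hd.elim

theorem side_inner (h : StandardMove X Y) (L : ℤ × ℤ →+ ℤ) {d : BothSides R} (hd : ¬ Outer d) : side X Y L d = 0 := by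
  rcases d with d | d
  · obtain ⟨c, h1, h2⟩ := not_outer_inl hd
    have key : ∀ x : DirEdge (Fin 2 ⊕ R), x.1.1 = Sum.inl 0 → x.1.2.2 = 0 → X.θ.side L x = 0 := by
      intro x h1 h2
      have h3 := x.2
      unfold Marking.side
      rw [h2] at h3 ⊢
      rw [h1, h.val_two _ h3, map_zero]
    have h4 : c = 0 ∨ c = 1 := by
      fin_cases c <;> simp
    rcases h4 with rfl | rfl
    · exact key d h1 h2
    · have h5 := h.opp_two h1 h2
      have h6 := X.θ.side_opp L d
      rw [key _ (congrArg Prod.fst h5) (congrArg (fun p => p.2.2) h5)] at h6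
      exact neg_eq_zero.1 h6.symm
  · obtain ⟨k, h1, h2⟩ := not_outer_inr hd
    have key : ∀ (k : Fin 3) (y : DirEdge (Fin 3 ⊕ R)), y.1.1 = Sum.inl k → y.1.2.2 = 2 →
        Y.θ.side L y = 0 := by
      intro k y h1 h2
      have h3 := y.2
      unfold Marking.side
      rw [h2] at h3 ⊢
      rw [h1, h.val_three _ _ h3, map_zero]
    rcases h2 with h2 | h2
    · exact key k d h1 h2
    · have h5 := (h.opp_three h1).2 h2
      have h6 := Y.θ.side_opp L d
      rw [key _ _ (congrArg Prod.fst h5) (congrArg (fun p => p.2.2) h5)] at h6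
      exact neg_eq_zero.1 h6.symm

theorem loc_inner (h : StandardMove X Y) {d : BothSides R} (hd : ¬ Outer d) : loc (next d) = loc (other X Y d) := by
  obtain ⟨⟨i, v, u⟩, hx⟩ | ⟨⟨i, v, u⟩, hx⟩ := d
  · obtain ⟨c, h1, h2⟩ := not_outer_inl hd
    dsimp only at h1 h2
    subst h1 h2
    have h5 := h.opp_two (x := ⟨(Sum.inl c, v, 0), hx⟩) rfl rfl
    obtain ⟨h3, h4⟩ := bipyramidTwo_inner c v hx
    have h6 : X.T.opp ⟨(Sum.inl c, v, 0), hx⟩ = ⟨(Sum.inl (c + 1), Equiv.swap 2 3 v, 0), by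
      rw [← h5]; exact (X.T.opp _).2⟩ := Subtype.ext h5
    change _ = position bipyramidTwo (nextSide (X.T.opp ⟨(Sum.inl c, v, 0), hx⟩))
    rw [h6]
    exact congrArg Sum.inl (Prod.ext h3 h4)
  · obtain ⟨k, h1, h2⟩ := not_outer_inr hd
    dsimp only at h1 h2
    subst h1
    have h5 := h.opp_three (y := ⟨(Sum.inl k, v, u), hx⟩) rfl
    have h3 := bipyramidThree_inner k v
    rcases h2 with rfl | rfl
    · have h6 : Y.T.opp ⟨(Sum.inl k, v, 2), hx⟩ = ⟨(Sum.inl (k + 1), Equiv.swap 2 3 v, 3), by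
        rw [← h5.1 rfl]; exact (Y.T.opp _).2⟩ := Subtype.ext (h5.1 rfl)
      change _ = position bipyramidThree (nextSide (Y.T.opp ⟨(Sum.inl k, v, 2), hx⟩))
      rw [h6]
      exact congrArg Sum.inl (Prod.ext (h3.1 hx).1 (h3.1 hx).2)
    · have h6 : Y.T.opp ⟨(Sum.inl k, v, 3), hx⟩ = ⟨(Sum.inl (k + 2), Equiv.swap 2 3 v, 2), by
        rw [← h5.2 rfl]; exact (Y.T.opp _).2⟩ := Subtype.ext (h5.2 rfl)
      change _ = position bipyramidThree (nextSide (Y.T.opp ⟨(Sum.inl k, v, 3), hx⟩))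
      rw [h6]
      exact congrArg Sum.inl (Prod.ext (h3.2 hx).1 (h3.2 hx).2)

/-- Corners of one triangulation at the same position inside the bipyramid differ by at most one
crossing of an inner face; outside of it a position determines its corner. -/
theorem loc_conn (h : StandardMove X Y) {U : BothSides R → Prop} (hU : ∀ d, ¬ Outer d → (U (next d) ↔ U (other X Y d)))
    {d d' : BothSides R} (h1 : d.isLeft = d'.isLeft) (h2 : d.loc = d'.loc) : U d ↔ U d' := by
  have two : ∀ (c c' : Fin 2) (v u v' u' : Fin 4) (h3 : v ≠ u) (h4 : v' ≠ u'), c' = c + 1 →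
      rot v (rot v u) = 0 → v' = Equiv.swap 2 3 v → u' = 0 →
      (U (Sum.inl ⟨(Sum.inl c, v, u), h3⟩) ↔ U (Sum.inl ⟨(Sum.inl c', v', u'), h4⟩)) := by
    rintro c c' v u v' u' h3 h4 rfl h5 rfl rfl
    let x : DirEdge (Fin 2 ⊕ R) := ⟨(Sum.inl c, v, rot v (rot v u)),
      rot_ne_left _ _ (rot_ne_left _ _ h3)⟩
    have e1 : nextSide x = ⟨(Sum.inl c, v, u), h3⟩ := DirEdge.ext rfl rfl (rot_three v u)
    have e2 : X.T.opp x = ⟨(Sum.inl (c + 1), Equiv.swap 2 3 v, 0), h4⟩ :=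
      Subtype.ext (h.opp_two rfl h5)
    rw [← e1, ← e2]
    exact hU (Sum.inl x) (not_outer_of_two rfl h5)
  have three : ∀ (k k' : Fin 3) (v u v' u' : Fin 4) (h3 : v ≠ u) (h4 : v' ≠ u'),
      (k' = k + 1 ∧ rot v (rot v u) = 2 ∧ u' = 3 ∨ k' = k + 2 ∧ rot v (rot v u) = 3 ∧ u' = 2) →
      v' = Equiv.swap 2 3 v →
      (U (Sum.inr ⟨(Sum.inl k, v, u), h3⟩) ↔ U (Sum.inr ⟨(Sum.inl k', v', u'), h4⟩)) := by
    rintro k k' v u v' u' h3 h4 h5 rfl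
    let x : DirEdge (Fin 3 ⊕ R) := ⟨(Sum.inl k, v, rot v (rot v u)),
      rot_ne_left _ _ (rot_ne_left _ _ h3)⟩
    have e1 : nextSide x = ⟨(Sum.inl k, v, u), h3⟩ := DirEdge.ext rfl rfl (rot_three v u)
    have e2 : Y.T.opp x = ⟨(Sum.inl k', Equiv.swap 2 3 v, u'), h4⟩ := by
      rcases h5 with ⟨rfl, h5, rfl⟩ | ⟨rfl, h5, rfl⟩
      · exact Subtype.ext ((h.opp_three rfl).1 h5)
      · exact Subtype.ext ((h.opp_three rfl).2 h5)
    rw [← e1, ← e2]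
    refine hU (Sum.inr x) (not_outer_of_three rfl ?_)
    rcases h5 with ⟨-, h5, -⟩ | ⟨-, h5, -⟩
    exacts [Or.inl h5, Or.inr h5]
  have add_one_add_one : ∀ c : Fin 2, c = c + 1 + 1 := by decide
  have add_one_add_two : ∀ k : Fin 3, k = k + 1 + 2 := by decide
  obtain ⟨⟨i | r, v, u⟩, hd⟩ | ⟨⟨i | r, v, u⟩, hd⟩ := d <;>
    obtain ⟨⟨i' | r', v', u'⟩, hd'⟩ | ⟨⟨i' | r', v', u'⟩, hd'⟩ := d'
  all_goals first
    | (simp at h1; done)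
    | (simp [loc, position, nextSide] at h2; done)
    | skip
  · have h3 := Prod.ext_iff.1 (Sum.inl_injective h2)
    rcases bipyramidTwo_conn i i' v u v' u' hd hd' h3.1 h3.2 with
      ⟨rfl, rfl, rfl⟩ | ⟨rfl, ⟨e1, e2, e3⟩ | ⟨e1, e2, e3⟩⟩
    · rfl
    · exact two _ _ _ _ _ _ _ _ rfl e1 e2 e3
    · exact (two _ _ _ _ _ _ _ _ (add_one_add_one i) e1 e2 e3).symm
  · have h3 := nextSide.injective (position_inr_injective (b := bipyramidTwo)
      (x := nextSide ⟨(Sum.inr r, v, u), hd⟩) (y := nextSide ⟨(Sum.inr r', v', u'), hd'⟩) rfl rfl h2)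
    rw [h3]
  · have h3 := Prod.ext_iff.1 (Sum.inl_injective h2)
    rcases bipyramidThree_conn i i' v u v' u' hd hd' h3.1 h3.2 with
      ⟨rfl, rfl, rfl⟩ | ⟨rfl, ⟨e1, e2, e3⟩ | ⟨e1, e2, e3⟩⟩ | ⟨rfl, ⟨e1, e2, e3⟩ | ⟨e1, e2, e3⟩⟩
    · rfl
    · exact three _ _ _ _ _ _ _ _ (Or.inl ⟨rfl, e1, e3⟩) e2
    · exact (three _ _ _ _ _ _ _ _ (Or.inr ⟨add_one_add_two i, e1, e3⟩) e2).symm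
    · exact three _ _ _ _ _ _ _ _ (Or.inr ⟨add_one_add_two i', e1, e3⟩) e2
    · exact (three _ _ _ _ _ _ _ _ (Or.inl ⟨rfl, e1, e3⟩) e2).symm
  · have h3 := nextSide.injective (position_inr_injective (b := bipyramidThree)
      (x := nextSide ⟨(Sum.inr r, v, u), hd⟩) (y := nextSide ⟨(Sum.inr r', v', u'), hd'⟩) rfl rfl h2)
    rw [h3]

end StandardMove

/-! ### Labels of the vertices -/

namespace BothSides

/-- Two positions around the same vertex of the boundary. -/
def Adjacent (X : RegularTriangulation (Fin 2 ⊕ R)) (Y : RegularTriangulation (Fin 3 ⊕ R))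
    (l l' : (Fin 5 × Fin 5) ⊕ (R × Fin 4 × Fin 4)) : Prop :=
  ∃ d : BothSides R, Outer d ∧ l = loc (next d) ∧ l' = loc (other X Y d)

/-- The vertex at which a position lies. -/
def label (X : RegularTriangulation (Fin 2 ⊕ R)) (Y : RegularTriangulation (Fin 3 ⊕ R))
    (l : (Fin 5 × Fin 5) ⊕ (R × Fin 4 × Fin 4)) : Quot (Adjacent X Y) := Quot.mk _ l

end BothSides

namespace StandardMove

open BothSides

theorem label_next (h : StandardMove X Y) (d : BothSides R) :
    label X Y (loc (next d)) = label X Y (loc (other X Y d)) := by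
  by_cases hd : Outer d
  · exact Quot.sound ⟨d, hd, rfl, rfl⟩
  · rw [h.loc_inner hd]

/-- An adjacency of positions may be witnessed by a side of the other triangulation. That side is
outer, so its match witnesses the same adjacency, and the walk can be carried out within one
triangulation. -/
theorem label_conn (h : StandardMove X Y) {U : BothSides R → Prop} (hU : ∀ d, U (next d) ↔ U (other X Y d))
    {d d' : BothSides R} (h1 : d.isLeft = d'.isLeft)
    (h2 : label X Y d.loc = label X Y d'.loc) : U d ↔ U d' := by
  let V : (Fin 5 × Fin 5) ⊕ (R × Fin 4 × Fin 4) → Prop := fun l =>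
    ∃ e : BothSides R, e.isLeft = d.isLeft ∧ e.loc = l ∧ U e
  have hV : ∀ e : BothSides R, e.isLeft = d.isLeft → (V e.loc ↔ U e) := by
    intro e he
    constructor
    · rintro ⟨e', h3, h4, h5⟩
      exact (h.loc_conn (fun d _ => hU d) (h3.trans he.symm) h4).1 h5
    · exact fun he' => ⟨e, he, rfl, he'⟩
  have hr : ∀ l l', Adjacent X Y l l' → V l = V l' := by
    have key : ∀ e : BothSides R, Outer e → e.isLeft = d.isLeft →
        V (loc (next e)) = V (loc (other X Y e)) := by
      intro e he hl
      rw [hV _ ((isLeft_next e).trans hl), hV _ ((isLeft_other e).trans hl), hU]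
    rintro _ _ ⟨e, he, rfl, rfl⟩
    by_cases hl : e.isLeft = d.isLeft
    · exact key e he hl
    · have hm := match_flip he
      rw [hm.loc_next_eq, (h.match_other hm).loc_eq]
      refine key _ hm.symm.outer ?_
      rw [isLeft_flip]
      revert hl
      cases e.isLeft <;> cases d.isLeft <;> simp
  have h3 : V d.loc = V d'.loc := congrArg (Quot.lift V hr) h2
  rw [← hV d rfl, h3, hV d' h1.symm]

/-- No outer side starts or ends at a position on the axis, so such a position is isolated for
`Adjacent`. -/
theorem label_axis (h : StandardMove X Y) {l l' : (Fin 5 × Fin 5) ⊕ (R × Fin 4 × Fin 4)} (hl : Axis l)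
    (h2 : label X Y l' = label X Y l) : l' = l := by
  have hr : ∀ a b, Adjacent X Y a b → (a = l) = (b = l) := by
    rintro _ _ ⟨e, he, rfl, rfl⟩
    have h3 : loc (next e) ≠ l := fun e' => he.not_axis_next (e' ▸ hl)
    have h4 : loc (other X Y e) ≠ l := fun e' => (h.outer_other he).not_axis (e' ▸ hl)
    rw [eq_false h3, eq_false h4]
  have h3 : (l' = l) = (l = l) := congrArg (Quot.lift (fun a => a = l) hr) h2
  rw [h3]

theorem label_eq_iff_inl (h : StandardMove X Y) {x x' : DirEdge (Fin 2 ⊕ R)} :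
    label X Y (loc (Sum.inl x)) = label X Y (loc (Sum.inl x')) ↔
      X.T.vertexOf x = X.T.vertexOf x' := by
  constructor
  · intro h2
    exact ((h.label_conn (U := Sum.elim (fun z => X.T.vertexOf z = X.T.vertexOf x) fun _ => True)
      (by
        rintro (d | d)
        · exact iff_of_eq (congrArg (· = _) (X.T.vertexOf_nextSide d))
        · exact Iff.rfl) (d := Sum.inl x) (d' := Sum.inl x') rfl h2).1 rfl).symm
  · intro h2
    exact ((X.T.vertex_conn (U := fun z => label X Y (loc (Sum.inl z)) = label X Y (loc (Sum.inl x)))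
      (fun z => iff_of_eq (congrArg (· = _) (h.label_next (Sum.inl z)))) h2).1 rfl).symm

theorem label_eq_iff_inr (h : StandardMove X Y) {y y' : DirEdge (Fin 3 ⊕ R)} :
    label X Y (loc (Sum.inr y)) = label X Y (loc (Sum.inr y')) ↔
      Y.T.vertexOf y = Y.T.vertexOf y' := by
  constructor
  · intro h2
    exact ((h.label_conn (U := Sum.elim (fun _ => True) fun z => Y.T.vertexOf z = Y.T.vertexOf y)
      (by
        rintro (d | d)
        · exact Iff.rfl
        · exact iff_of_eq (congrArg (· = _) (Y.T.vertexOf_nextSide d)))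
      (d := Sum.inr y) (d' := Sum.inr y') rfl h2).1 rfl).symm
  · intro h2
    exact ((Y.T.vertex_conn (U := fun z => label X Y (loc (Sum.inr z)) = label X Y (loc (Sum.inr y)))
      (fun z => iff_of_eq (congrArg (· = _) (h.label_next (Sum.inr z)))) h2).1 rfl).symm

/-- The marking vanishes on inner sides, so the vertex potential of `X` is constant on each
location. The default value 0 is harmless: locations that do not occur in `X` are never at the ends
of an outer side. -/
theorem exists_loc_potential (h : StandardMove X Y) [Finite R] (L : ℤ × ℤ →+ ℤ) :
    ∃ g : (Fin 5 × Fin 5) ⊕ (R × Fin 4 × Fin 4) → ℤ, ∀ d : BothSides R, Outer d →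
      g (loc (other X Y d)) = g (loc (next d)) + side X Y L d := by
  classical
  obtain ⟨g, hg⟩ := X.θ.exists_vertex_potential L
  let g' : (Fin 5 × Fin 5) ⊕ (R × Fin 4 × Fin 4) → ℤ := fun l =>
    if e : ∃ x : DirEdge (Fin 2 ⊕ R), loc (Sum.inl x) = l then g (nextSide e.choose) else 0
  have h1 : ∀ x : DirEdge (Fin 2 ⊕ R), g' (loc (Sum.inl x)) = g (nextSide x) := by
    intro x
    have e : ∃ x' : DirEdge (Fin 2 ⊕ R), loc (Sum.inl x') = loc (Sum.inl x) := ⟨x, rfl⟩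
    simp only [g']
    rw [dif_pos e]
    refine (h.loc_conn (U := Sum.elim (fun z => g (nextSide z) = g (nextSide x)) fun _ => True) ?_
      (d := Sum.inl e.choose) (d' := Sum.inl x) rfl e.choose_spec).2 rfl
    rintro (d | d) hd
    · have h2 := hg d
      have h3 : X.θ.side L d = 0 := h.side_inner L hd
      rw [h3, add_zero] at h2
      exact iff_of_eq (congrArg (· = _) h2.symm)
    · exact Iff.rfl
  have h2 : ∀ x : DirEdge (Fin 2 ⊕ R), g' (loc (other X Y (Sum.inl x))) =
      g' (loc (next (Sum.inl x))) + side X Y L (Sum.inl x) := by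
    intro x
    refine (h1 (X.T.opp x)).trans ?_
    rw [hg x]
    exact congrArg (· + _) (h1 (nextSide x)).symm
  refine ⟨g', ?_⟩
  rintro (d | d) hd
  · exact h2 d
  · have hm := match_flip hd
    obtain ⟨x, hx⟩ : ∃ x, flip (Sum.inr d : BothSides R) = Sum.inl x := by
      obtain ⟨x, hx⟩ := hd
      exact ⟨x, Match.flip_eq (d := Sum.inr d) (d' := Sum.inl x) hx⟩
    rw [(h.match_other hm).loc_eq, hm.loc_next_eq, h.side_match L hm, hx]
    exact h2 x

end StandardMove

end NeumannZagier

namespace NeumannZagier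

variable {R : Type} {K : Type*} [Field K] [CharZero K]

/-! ### Angles before and after the move -/

/-- The angles of the two tetrahedra which are sums of the angles of the three tetrahedra. -/
def mergeAngles {K : Type*} [Add K] (F : Fin 3 ⊕ R → Fin 3 → K) : Fin 2 ⊕ R → Fin 3 → K :=
  Sum.elim (![![F (Sum.inl 1) 1 + F (Sum.inl 2) 2, F (Sum.inl 0) 1 + F (Sum.inl 1) 2,
      F (Sum.inl 2) 1 + F (Sum.inl 0) 2],
    ![F (Sum.inl 1) 2 + F (Sum.inl 2) 1, F (Sum.inl 2) 2 + F (Sum.inl 0) 1,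
      F (Sum.inl 0) 2 + F (Sum.inl 1) 1]] : Fin 2 → Fin 3 → K) fun r => F (Sum.inr r)

/-- The merged angles of each of the two tetrahedra are all angles of the three tetrahedra except
those on the axis: 3c - 2c. -/
theorem mergeAngles_sum {F : Fin 3 ⊕ R → Fin 3 → K} {c : K} (hF : ∀ j, ∑ p, F j p = c)
    (hA : ∑ k, F (Sum.inl k) 0 = 2 * c) (j : Fin 2 ⊕ R) : ∑ p, mergeAngles F j p = c := by
  have h0 := hF (Sum.inl 0)
  have h1 := hF (Sum.inl 1)
  have h2 := hF (Sum.inl 2)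
  rw [Fin.sum_univ_three] at h0 h1 h2 hA
  rcases j with j | r
  · rw [Fin.sum_univ_three]
    fin_cases j
    · simp [mergeAngles]
      linear_combination h0 + h1 + h2 - hA
    · simp [mergeAngles]
      linear_combination h0 + h1 + h2 - hA
  · exact hF (Sum.inr r)

theorem sum_dirEdge {ι : Type} [Fintype ι] [DecidableEq ι] (G : ι × Fin 4 × Fin 4 → K) :
    ∑ x : DirEdge ι, G x.1 = ∑ i, ∑ v, ∑ w, if v = w then 0 else G (i, v, w) := by
  rw [← Finset.sum_subtype (Finset.univ.filter fun y : ι × Fin 4 × Fin 4 => y.2.1 ≠ y.2.2)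
      (fun x => by simp) G, Finset.sum_filter, Fintype.sum_prod_type]
  refine Finset.sum_congr rfl fun i _ => ?_
  rw [Fintype.sum_prod_type]
  refine Finset.sum_congr rfl fun v _ => Finset.sum_congr rfl fun w _ => ?_
  rw [ite_not]

variable [Fintype R] [DecidableEq R]

theorem sum_position {κ : Type} [Fintype κ] [DecidableEq κ] (b : κ → Fin 4 → Fin 5)
    (F : κ ⊕ R → Fin 3 → K) (l : (Fin 5 × Fin 5) ⊕ (R × Fin 4 × Fin 4)) :
    ∑ x with position b x = l, edgeFun F x =
      l.elim (fun p => ∑ c, ∑ v, ∑ w, if v = w then 0 else if (b c v, b c w) = p then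
        F (Sum.inl c) (pairType v w) else 0)
      fun q => if q.2.1 = q.2.2 then 0 else F (Sum.inr q.1) (pairType q.2.1 q.2.2) := by
  rw [Finset.sum_filter]
  have h1 := sum_dirEdge (ι := κ ⊕ R) (K := K) fun y =>
    if (y.1.elim (fun c => Sum.inl (b c y.2.1, b c y.2.2)) fun r => Sum.inr (r, y.2.1, y.2.2) :
      (Fin 5 × Fin 5) ⊕ (R × Fin 4 × Fin 4)) = l then F y.1 (pairType y.2.1 y.2.2) else 0
  refine h1.trans ?_
  rw [Fintype.sum_sum_type]
  rcases l with p | ⟨r, v, w⟩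
  · simp
  · simp only [Sum.elim_inl, reduceCtorEq, if_false, ite_self, Finset.sum_const_zero, zero_add,
      Sum.elim_inr, Sum.inr.injEq, Prod.mk.injEq]
    rw [Finset.sum_eq_single r, Finset.sum_eq_single v, Finset.sum_eq_single w]
    · simp
    · intro w' _ hw
      simp [hw]
    · simp
    · intro v' _ hv
      simp [hv]
    · simp
    · intro r' _ hr
      simp [hr]
    · simp

set_option maxHeartbeats 4000000 in
-- Away from the axis, the bipyramid has the same dihedral angles in both decompositions. At an edge
-- through an apex this is how merging was defined. At an equatorial edge, the four contributing
-- angles of two of the three tetrahedra sum to 2c minus their axis angles, which is the axis angle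
-- of the remaining one.
theorem sum_position_eq {F : Fin 3 ⊕ R → Fin 3 → K} {c : K} (hF : ∀ j, ∑ p, F j p = c)
    (hA : ∑ k, F (Sum.inl k) 0 = 2 * c) {l : (Fin 5 × Fin 5) ⊕ (R × Fin 4 × Fin 4)}
    (hl : ¬ BothSides.Axis l) :
    ∑ x with position bipyramidTwo x = l, edgeFun (mergeAngles F) x =
      ∑ y with position bipyramidThree y = l, edgeFun F y := by
  rw [sum_position, sum_position]
  have h0 := hF (Sum.inl 0)
  have h1 := hF (Sum.inl 1)
  have h2 := hF (Sum.inl 2)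
  rw [Fin.sum_univ_three] at h0 h1 h2 hA
  rcases l with ⟨p, q⟩ | l
  · simp only [Sum.elim_inl, Fin.sum_univ_two, Fin.sum_univ_three, Fin.sum_univ_four, mergeAngles,
      bipyramidTwo, bipyramidThree, pairType]
    fin_cases p <;> fin_cases q
    all_goals first
      | exact absurd (Or.inl rfl) hl
      | exact absurd (Or.inr rfl) hl
      | skip
    all_goals simp
    all_goals first
      | ring1
      | linear_combination h0 + h1 - hA
      | linear_combination h0 + h2 - hA
      | linear_combination h1 + h2 - hA
  · rfl

end NeumannZagier

namespace NeumannZagier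

variable {R : Type} {X : RegularTriangulation (Fin 2 ⊕ R)} {Y : RegularTriangulation (Fin 3 ⊕ R)}

/-! ### Edges before and after the move -/

theorem position_rev {κ κ' : Type} {b : κ → Fin 4 → Fin 5} {b' : κ' → Fin 4 → Fin 5}
    {x : DirEdge (κ ⊕ R)} {y : DirEdge (κ' ⊕ R)} (h : position b x = position b' y) :
    position b x.rev = position b' y.rev := by
  obtain ⟨⟨i | r, v, w⟩, hx⟩ := x <;> obtain ⟨⟨i' | r', v', w'⟩, hy⟩ := y
  · have h1 := Prod.ext_iff.1 (Sum.inl_injective h)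
    exact congrArg Sum.inl (Prod.ext h1.2 h1.1)
  · exact absurd h (by simp [position])
  · exact absurd h (by simp [position])
  · have h1 := Sum.inr_injective h
    simp only [Prod.mk.injEq] at h1
    exact congrArg Sum.inr (Prod.ext h1.1 (Prod.ext h1.2.2 h1.2.1))

open BothSides

theorem mk_eq_iff_two (h : StandardMove X Y) {x x' : DirEdge (Fin 2 ⊕ R)} :
    (Quot.mk _ x : X.T.Vertex) = Quot.mk _ x' ↔
      label X Y (position bipyramidTwo x) = label X Y (position bipyramidTwo x') := by
  have h1 := h.label_eq_iff_inl (x := nextSide.symm x) (x' := nextSide.symm x')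
  unfold IdealTriangulation.vertexOf at h1
  rw [Equiv.apply_symm_apply, Equiv.apply_symm_apply] at h1
  rw [← h1]
  simp [loc]

theorem mk_eq_iff_three (h : StandardMove X Y) {y y' : DirEdge (Fin 3 ⊕ R)} :
    (Quot.mk _ y : Y.T.Vertex) = Quot.mk _ y' ↔
      label X Y (position bipyramidThree y) = label X Y (position bipyramidThree y') := by
  have h1 := h.label_eq_iff_inr (y := nextSide.symm y) (y' := nextSide.symm y')
  unfold IdealTriangulation.vertexOf at h1
  rw [Equiv.apply_symm_apply, Equiv.apply_symm_apply] at h1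
  rw [← h1]
  simp [loc]

theorem edgeOf_eq_iff_two (h : StandardMove X Y) {x x' : DirEdge (Fin 2 ⊕ R)} :
    X.T.edgeOf x = X.T.edgeOf x' ↔
      label X Y (position bipyramidTwo x) = label X Y (position bipyramidTwo x') ∨
      label X Y (position bipyramidTwo x) = label X Y (position bipyramidTwo x'.rev) := by
  rw [X.T.edgeOf_eq_iff, mk_eq_iff_two h, mk_eq_iff_two h]

theorem edgeOf_eq_iff_three (h : StandardMove X Y) {y y' : DirEdge (Fin 3 ⊕ R)} :
    Y.T.edgeOf y = Y.T.edgeOf y' ↔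
      label X Y (position bipyramidThree y) = label X Y (position bipyramidThree y') ∨
      label X Y (position bipyramidThree y) = label X Y (position bipyramidThree y'.rev) := by
  rw [Y.T.edgeOf_eq_iff, mk_eq_iff_three h, mk_eq_iff_three h]

/-- A directed edge on the axis of the bipyramid. -/
def axisDir (R : Type) : DirEdge (Fin 3 ⊕ R) := ⟨(Sum.inl 0, 0, 1), zero_ne_one⟩

theorem position_axisDir : position bipyramidThree (axisDir R) = Sum.inl (3, 4) ∧
    position bipyramidThree (axisDir R).rev = Sum.inl (4, 3) := ⟨rfl, rfl⟩

theorem edgeOf_eq_axis_iff (h : StandardMove X Y) {y : DirEdge (Fin 3 ⊕ R)} :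
    Y.T.edgeOf y = Y.T.edgeOf (axisDir R) ↔ Axis (position bipyramidThree y) := by
  rw [edgeOf_eq_iff_three h, position_axisDir.1, position_axisDir.2]
  constructor
  · rintro (h1 | h1)
    · rw [h.label_axis (l := Sum.inl (3, 4)) (Or.inl rfl) h1]
      exact Or.inl rfl
    · rw [h.label_axis (l := Sum.inl (4, 3)) (Or.inr rfl) h1]
      exact Or.inr rfl
  · intro h1
    generalize position bipyramidThree y = l at h1
    rcases l with l | l
    · rcases h1 with rfl | rfl
      exacts [Or.inl rfl, Or.inr rfl]
    · exact h1.elim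

theorem position_two_not_axis (x : DirEdge (Fin 2 ⊕ R)) : ¬ Axis (position bipyramidTwo x) := by
  have := not_axis_inl (nextSide.symm x)
  simpa [loc] using this

theorem exists_position_eq (x : DirEdge (Fin 2 ⊕ R)) :
    ∃ y : DirEdge (Fin 3 ⊕ R), position bipyramidTwo x = position bipyramidThree y := by
  obtain ⟨d, h1, h2⟩ := exists_loc (Sum.inl (nextSide.symm x)) (not_axis_inl _)
  rcases d with d | d
  · exact absurd h1 (by simp)
  · exact ⟨nextSide d, by simpa [loc] using h2.symm⟩

/-- The old edges together with the new axis inject into the new edges. Both triangulations have as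
many edges as tetrahedra, so counting makes the injection bijective. -/
theorem exists_edgeEquiv [Finite R] (h : StandardMove X Y) :
    ∃ e : Option X.T.Edge ≃ Y.T.Edge, e none = Y.T.edgeOf (axisDir R) ∧
      ∀ E, ∃ x y, X.T.edgeOf x = E ∧ Y.T.edgeOf y = e (some E) ∧
        position bipyramidTwo x = position bipyramidThree y := by
  choose x hx using X.T.edgeOf_surjective
  choose y hy using exists_position_eq (R := R)
  let e : Option X.T.Edge → Y.T.Edge := fun E =>
    E.elim (Y.T.edgeOf (axisDir R)) fun E => Y.T.edgeOf (y (x E))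
  have axis_ne : ∀ E, Y.T.edgeOf (y (x E)) ≠ Y.T.edgeOf (axisDir R) := fun E he => by
    rw [edgeOf_eq_axis_iff h, ← hy] at he
    exact position_two_not_axis _ he
  have he : Function.Injective e := by
    rintro (_ | E) (_ | E') hE
    · rfl
    · exact absurd hE.symm (axis_ne E')
    · exact absurd hE (axis_ne E)
    · rw [← hx E, ← hx E']
      congr 1
      rw [edgeOf_eq_iff_two h, hy, hy, position_rev (hy (x E')), ← edgeOf_eq_iff_three h]
      exact hE
  have : Fintype R := Fintype.ofFinite R
  have hcX := X.torus.card_edge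
  have hcY := Y.torus.card_edge
  rw [Nat.card_sum, Nat.card_fin] at hcX hcY
  have hb : Function.Bijective e := he.bijective_of_nat_card_le (by
    rw [Finite.card_option]
    omega)
  exact ⟨Equiv.ofBijective e hb, rfl, fun E => ⟨x E, y (x E), hx E, rfl, hy _⟩⟩

section Sums

variable {K : Type*} [Field K] [CharZero K] [Fintype R] [DecidableEq R]

/-- An edge before the move and its counterpart after it occupy the same positions, none of them on
the axis; at each position the sums agree by `sum_position_eq`. -/
theorem sum_edge_merge (h : StandardMove X Y) {F : Fin 3 ⊕ R → Fin 3 → K} {c : K}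
    (hF : ∀ j, ∑ p, F j p = c) (hA : ∑ k, F (Sum.inl k) 0 = 2 * c) {x : DirEdge (Fin 2 ⊕ R)}
    {y : DirEdge (Fin 3 ⊕ R)} (hxy : position bipyramidTwo x = position bipyramidThree y) :
    ∑ j, ∑ p, (X.T.edgeCount (X.T.edgeOf x) j p : K) * mergeAngles F j p =
      ∑ j, ∑ p, (Y.T.edgeCount (Y.T.edgeOf y) j p : K) * F j p := by
  classical
  have h1 := X.T.sum_edge_eq (X.T.edgeOf x) (mergeAngles F)
  have h2 := Y.T.sum_edge_eq (Y.T.edgeOf y) F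
  apply mul_left_cancel₀ (two_ne_zero' K)
  rw [← h1, ← h2]
  let W : Finset ((Fin 5 × Fin 5) ⊕ (R × Fin 4 × Fin 4)) := Finset.univ.filter fun l =>
    label X Y l = label X Y (position bipyramidThree y) ∨
      label X Y l = label X Y (position bipyramidThree y.rev)
  rw [← Finset.sum_fiberwise_of_maps_to (t := W) (g := position bipyramidTwo) (by
      intro z hz
      rw [Finset.mem_filter_univ, edgeOf_eq_iff_two h, hxy, position_rev hxy] at hz
      exact (Finset.mem_filter_univ _).2 hz),
    ← Finset.sum_fiberwise_of_maps_to (t := W) (g := position bipyramidThree) (by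
      intro z hz
      rw [Finset.mem_filter_univ, edgeOf_eq_iff_three h] at hz
      exact (Finset.mem_filter_univ _).2 hz)]
  refine Finset.sum_congr rfl fun l hl => ?_
  have hl' : label X Y l = label X Y (position bipyramidThree y) ∨
      label X Y l = label X Y (position bipyramidThree y.rev) := (Finset.mem_filter.1 hl).2
  have hax : ¬ Axis l := by
    intro ha
    rcases hl' with h3 | h3
    · rw [← h.label_axis ha h3.symm, ← hxy] at ha
      exact position_two_not_axis _ ha
    · rw [← h.label_axis ha h3.symm, ← position_rev hxy] at ha
      exact position_two_not_axis _ ha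
  rw [Finset.filter_filter, Finset.filter_filter,
    Finset.filter_congr (q := fun z => position bipyramidTwo z = l) fun z _ =>
      ⟨fun h3 => h3.2, fun h3 => ⟨(edgeOf_eq_iff_two h).2 (by
        rw [h3, hxy, position_rev hxy]; exact hl'), h3⟩⟩,
    Finset.filter_congr (q := fun z => position bipyramidThree z = l) fun z _ =>
      ⟨fun h3 => h3.2, fun h3 => ⟨(edgeOf_eq_iff_three h).2 (by
        rw [h3]; exact hl'), h3⟩⟩]
  exact sum_position_eq hF hA hax

theorem sum_axis (h : StandardMove X Y) (F : Fin 3 ⊕ R → Fin 3 → K) :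
    ∑ j, ∑ p, (Y.T.edgeCount (Y.T.edgeOf (axisDir R)) j p : K) * F j p =
      ∑ k, F (Sum.inl k) 0 := by
  classical
  have h2 := Y.T.sum_edge_eq (Y.T.edgeOf (axisDir R)) F
  apply mul_left_cancel₀ (two_ne_zero' K)
  rw [← h2]
  rw [← Finset.sum_fiberwise_of_maps_to (t := {Sum.inl (3, 4), Sum.inl (4, 3)})
    (g := position bipyramidThree) (by
      intro z hz
      rw [Finset.mem_filter_univ, edgeOf_eq_axis_iff h] at hz
      generalize position bipyramidThree z = l at hz
      rcases l with l | l
      · rcases hz with rfl | rfl <;> simp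
      · exact hz.elim), Finset.sum_pair (by simp)]
  have key : ∀ l, Axis l → ∑ z ∈ {z | Y.T.edgeOf z = Y.T.edgeOf (axisDir R)} with
      position bipyramidThree z = l, edgeFun F z =
      ∑ z with position bipyramidThree z = l, edgeFun F z := fun l hl => by
    rw [Finset.filter_filter]
    refine Finset.sum_congr (Finset.filter_congr fun z _ => ⟨fun h3 => h3.2, fun h3 => ⟨?_, h3⟩⟩)
      fun _ _ => rfl
    rw [edgeOf_eq_axis_iff h, h3]
    exact hl
  rw [key (Sum.inl (3, 4)) (Or.inl rfl), key (Sum.inl (4, 3)) (Or.inr rfl), sum_position, sum_position]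
  simp [Fin.sum_univ_three, Fin.sum_univ_four, bipyramidThree, pairType]
  ring

end Sums

end NeumannZagier

/-! ### Turning before and after the move. -/

namespace NeumannZagier

variable {R : Type} [Fintype R] {X : RegularTriangulation (Fin 2 ⊕ R)}
  {Y : RegularTriangulation (Fin 3 ⊕ R)}

open BothSides

theorem sum_corner_position {κ : Type} [Fintype κ] [DecidableEq κ] [DecidableEq R]
    (b : κ → Fin 4 → Fin 5) (F : κ ⊕ R → Fin 3 → ℝ) (l : (Fin 5 × Fin 5) ⊕ (R × Fin 4 × Fin 4)) :
    ∑ x with position b (nextSide x) = l, cornerFun F x =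
      ∑ x with position b x = l, edgeFun F x := by
  rw [Finset.sum_filter, Finset.sum_filter, ← Equiv.sum_comp nextSide
    (fun x => if position b x = l then edgeFun F x else 0)]
  rfl

/-- Simple closed curves of the same class before and after the move have the same turning. -/
theorem StandardMove.turning_eq (h : StandardMove X Y) (L L' : ℤ × ℤ →+ ℤ)
    {γ₀ γ₁ : SimpleCurve X.T} {γ₂ : SimpleCurve Y.T}
    (h0 : L (γ₀.homologyClass X.θ) = 1) (h1 : L (γ₁.homologyClass X.θ) = 0)
    (h2 : L (γ₂.homologyClass Y.θ) = 0) (h1' : L' (γ₁.homologyClass X.θ) = 1)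
    (h2' : L' (γ₂.homologyClass Y.θ) = 1) (F : Fin 3 ⊕ R → Fin 3 → ℝ) (hF : ∀ j, ∑ p, F j p = 1)
    (hE : ∀ E, ∑ j, ∑ p, (Y.T.edgeCount E j p : ℝ) * F j p = 2) :
    ∑ j, ∑ p, (γ₁.curveCount j p : ℝ) * mergeAngles F j p =
      ∑ j, ∑ p, (γ₂.curveCount j p : ℝ) * F j p := by
  classical
  obtain ⟨g, hg⟩ := h.exists_loc_potential L
  have hA : ∑ k, F (Sum.inl k) 0 = 2 * 1 := by
    rw [mul_one, ← sum_axis h F]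
    exact hE _
  have hF' := mergeAngles_sum hF hA
  have hE' : ∀ E, ∑ j, ∑ p, (X.T.edgeCount E j p : ℝ) * mergeAngles F j p = 2 := by
    intro E
    obtain ⟨x, rfl⟩ := X.T.edgeOf_surjective E
    obtain ⟨y, hy⟩ := exists_position_eq x
    rw [sum_edge_merge h hF hA hy, hE]
  -- The regions are the links of the five vertices of the bipyramid: at an equatorial vertex a
  -- quadrilateral changes its diagonal, at an apex a triangle is divided into three by a new vertex
  -- on the axis.
  let H : HybridData (BothSides R) (Fin (γ₁.len + 1) ⊕ Fin (γ₂.len + 1))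
      ((Fin 5 × Fin 5) ⊕ (R × Fin 4 × Fin 4)) (Quot (Adjacent X Y)) :=
    { γ₁.pair γ₂ with
      pat := Sum.isLeft
      flip := flip
      outer := Outer
      τ := side X Y L
      ω := fun d => (side X Y L' d : ℝ)
      f := Sum.elim (cornerFun (mergeAngles F)) (cornerFun F)
      loc := loc
      axis := Axis
      lab := label X Y
      g := g
      pat_φ := isLeft_next
      pat_α := isLeft_other
      pat_flip := isLeft_flip
      pat_corner := by rintro (d | d) <;> rfl
      τ_α := by
        rintro (d | d)
        exacts [X.θ.side_opp L d, Y.θ.side_opp L d]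
      ω_α := by
        rintro (d | d)
        exacts [(congrArg Int.cast (X.θ.side_opp L' d)).trans (Int.cast_neg _),
          (congrArg Int.cast (Y.θ.side_opp L' d)).trans (Int.cast_neg _)]
      τ_inner := fun d hd => h.side_inner L hd
      ω_inner := fun d hd => (congrArg Int.cast (h.side_inner L' hd)).trans Int.cast_zero
      loc_inner := fun d hd => h.loc_inner hd
      flip_flip := fun d hd => (match_flip hd).symm.flip_eq
      outer_flip := fun d hd => (match_flip hd).symm.outer
      α_flip := fun d hd => h.other_flip hd
      outer_α := fun d hd => h.outer_other hd
      τ_flip := fun d hd => (h.side_match L (match_flip hd)).symm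
      ω_flip := fun d hd => congrArg Int.cast (h.side_match L' (match_flip hd)).symm
      loc_flip := fun d hd => (match_flip hd).loc_eq.symm
      loc_φ_flip := fun d hd => (match_flip hd).loc_next_eq.symm
      lab_outer := fun d _ => h.label_next d
      g_outer := hg
      loc_conn := fun U hU d d' e1 e2 => (h.loc_conn hU e1 e2).1
      exists_loc := exists_loc
      axis_lab := fun d d' e1 e2 => h.label_axis e1 e2
      exists_not_axis := fun d => (exists_not_axis d).imp_right Or.inl
      inner_φ := by
        rintro (d | d) e hd
        · exact outer_next hd
        · exact absurd e (by simp)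
      lab_conn := fun U hU d d' e1 e2 e3 => (h.label_conn hU (e1.trans e2.symm) e3).1
      conn := by
        rintro v v1 v2 (d | d) (d' | d') n n' e e' hd
        · exact X.torus.twisted_conn h0 (v := fun d n => v (Sum.inl d) n)
            (fun d n => v1 (Sum.inl d) n rfl) (fun d n => v2 (Sum.inl d) n rfl) d d' n n' hd
        · exact absurd e' (by simp)
        · exact absurd e (by simp)
        · exact absurd e (by simp) }
  have sum_eq : ∀ (w₁ : DirEdge (Fin 2 ⊕ R) → ℝ) (w₂ : DirEdge (Fin 3 ⊕ R) → ℝ) (C : ℝ)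
      (hC₁ : ∀ d, ∑ d' with X.T.vertexOf d' = X.T.vertexOf d, w₁ d' = C)
      (hC₂ : ∀ d, ∑ d' with Y.T.vertexOf d' = Y.T.vertexOf d, w₂ d' = C) (d : BothSides R),
      ∑ d' with H.pat d' = H.pat d ∧ H.lab (H.loc d') = H.lab (H.loc d), Sum.elim w₁ w₂ d' = C := by
    intro w₁ w₂ C hC₁ hC₂ d
    rw [Finset.sum_filter, Fintype.sum_sum_type]
    rcases d with d | d
    · rw [← hC₁ d, Finset.sum_filter]
      have e1 : ∀ x, (H.pat (Sum.inl x) = H.pat (Sum.inl d) ∧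
          H.lab (H.loc (Sum.inl x)) = H.lab (H.loc (Sum.inl d))) ↔
          X.T.vertexOf x = X.T.vertexOf d :=
        fun x => ⟨fun e => h.label_eq_iff_inl.1 e.2, fun e => ⟨rfl, h.label_eq_iff_inl.2 e⟩⟩
      have e2 : ∀ y, ¬ (H.pat (Sum.inr y) = H.pat (Sum.inl d) ∧
          H.lab (H.loc (Sum.inr y)) = H.lab (H.loc (Sum.inl d))) :=
        fun y e => absurd e.1 (by simp [H])
      simp only [e1, e2, if_false, Finset.sum_const_zero, add_zero, Sum.elim_inl]
    · rw [← hC₂ d, Finset.sum_filter]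
      have e1 : ∀ x, (H.pat (Sum.inr x) = H.pat (Sum.inr d) ∧
          H.lab (H.loc (Sum.inr x)) = H.lab (H.loc (Sum.inr d))) ↔
          Y.T.vertexOf x = Y.T.vertexOf d :=
        fun x => ⟨fun e => h.label_eq_iff_inr.1 e.2, fun e => ⟨rfl, h.label_eq_iff_inr.2 e⟩⟩
      have e2 : ∀ y, ¬ (H.pat (Sum.inl y) = H.pat (Sum.inr d) ∧
          H.lab (H.loc (Sum.inl y)) = H.lab (H.loc (Sum.inr d))) :=
        fun y e => absurd e.1 (by simp [H])
      simp only [e1, e2, if_false, Finset.sum_const_zero, zero_add, Sum.elim_inr]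
  have dist_eq : ∀ l, ¬ H.axis l → ∑ d with H.loc d = l ∧ H.pat d = true, H.f d =
      ∑ d with H.loc d = l ∧ H.pat d = false, H.f d := by
    intro l hl
    rw [Finset.sum_filter, Fintype.sum_sum_type, Finset.sum_filter, Fintype.sum_sum_type]
    have e := sum_position_eq hF hA hl
    rw [← sum_corner_position, ← sum_corner_position, Finset.sum_filter,
      Finset.sum_filter] at e
    have e1 : ∀ x, (H.loc (Sum.inl x) = l ∧ H.pat (Sum.inl x) = true) ↔
        position bipyramidTwo (nextSide x) = l := fun x => ⟨fun e => e.1, fun e => ⟨e, rfl⟩⟩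
    have e2 : ∀ y, (H.loc (Sum.inr y) = l ∧ H.pat (Sum.inr y) = false) ↔
        position bipyramidThree (nextSide y) = l := fun x => ⟨fun e => e.1, fun e => ⟨e, rfl⟩⟩
    have e3 : ∀ x, ¬ (H.loc (Sum.inl x) = l ∧ H.pat (Sum.inl x) = false) :=
      fun x e => absurd e.2 (by simp [H])
    have e4 : ∀ y, ¬ (H.loc (Sum.inr y) = l ∧ H.pat (Sum.inr y) = true) :=
      fun y e => absurd e.2 (by simp [H])
    simp only [e1, e2, e3, e4, if_false, Finset.sum_const_zero, add_zero, zero_add]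
    exact e
  have main := H.turning_eq
    (by
      rintro (d | d)
      · exact (cornerFun_sum (mergeAngles F) d).trans (hF' _)
      · exact (cornerFun_sum F d).trans (hF _))
    dist_eq
    (sum_eq _ _ 2 (fun d => (X.torus.sum_vertexOf _ d).trans (hE' _))
      fun d => (Y.torus.sum_vertexOf F d).trans (hE _))
    (by
      have := sum_eq (fun x => (X.θ.side L' x : ℝ)) (fun y => (Y.θ.side L' y : ℝ)) 0
        (fun d => by
          have := X.θ.sum_vertex L' (fun V => if V = X.T.vertexOf d then 1 else 0)
          rw [Finset.sum_filter]
          simpa using this)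
        (fun d => by
          have := Y.θ.sum_vertex L' (fun V => if V = Y.T.vertexOf d then 1 else 0)
          rw [Finset.sum_filter]
          simpa using this)
      intro d
      rw [← this d]
      refine Finset.sum_congr rfl fun d' _ => ?_
      rcases d' with d' | d' <;> rfl)
    (by
      rintro (_ | _)
      · refine (SimpleCurve.sum_which_false γ₁ γ₂ _).trans ?_
        have := γ₂.sum_side Y.θ L'
        rw [h2'] at this
        refine Eq.trans (Finset.sum_congr rfl fun k _ => congrArg H.ω (γ₁.pair_out_inr γ₂ k)) ?_
        exact (Int.cast_sum _ _).symm.trans ((congrArg Int.cast this).trans Int.cast_one)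
      · refine (SimpleCurve.sum_which_true γ₁ γ₂ _).trans ?_
        have := γ₁.sum_side X.θ L'
        rw [h1'] at this
        refine Eq.trans (Finset.sum_congr rfl fun k _ => congrArg H.ω (γ₁.pair_out_inl γ₂ k)) ?_
        exact (Int.cast_sum _ _).symm.trans ((congrArg Int.cast this).trans Int.cast_one))
    (γ₁.exists_pair_potential γ₂ (X.θ.side L) (Y.θ.side L) ((γ₁.sum_side X.θ L).trans h1)
      ((γ₂.sum_side Y.θ L).trans h2))
  rw [← SimpleCurve.pair_turning_true γ₁ γ₂ (mergeAngles F) F,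
    ← SimpleCurve.pair_turning_false γ₁ γ₂ (mergeAngles F) F]
  exact main

end NeumannZagier

namespace NeumannZagier

/-! ### Shapes before and after the move -/

theorem crossRatio_mul {a b e : CP1} (c d : CP1) (ha : e ≠ a) (hb : e ≠ b) :
    crossRatio a b c e * crossRatio a b e d = crossRatio a b c d := by
  have h1 := bracket_ne_zero ha
  have h2 := bracket_ne_zero hb
  unfold crossRatio
  rw [div_mul_div_comm]
  rw [show bracket e a * bracket c b * (bracket d a * bracket e b) =
      bracket e a * bracket e b * (bracket d a * bracket c b) by ring,
    show bracket c a * bracket e b * (bracket e a * bracket d b) =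
      bracket e a * bracket e b * (bracket c a * bracket d b) by ring,
    mul_div_mul_left _ _ (mul_ne_zero h1 h2)]

theorem crossRatio_self {a b c : CP1} (ha : c ≠ a) (hb : c ≠ b) : crossRatio a b c c = 1 :=
  div_self (mul_ne_zero (bracket_ne_zero ha) (bracket_ne_zero hb))

variable {R : Type} {X : RegularTriangulation (Fin 2 ⊕ R)} {Y : RegularTriangulation (Fin 3 ⊕ R)}

theorem exists_three_position : ∀ (c : Fin 2) (v : Fin 4), ∃ (k : Fin 3) (v' : Fin 4),
    bipyramidTwo c v = bipyramidThree k v' := by decide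

theorem exists_common_three : ∀ p q : Fin 5, p ≠ q → ∃ (k : Fin 3) (v w : Fin 4), v ≠ w ∧
    bipyramidThree k v = p ∧ bipyramidThree k w = q := by decide

/-- The developing map sends the bipyramid to five points. Any two vertices, in particular the two
apexes, lie in a common tetrahedron after the move, so regularity of `Y` makes the points distinct.
-/
theorem StandardMove.exists_points (h : StandardMove X Y) : ∃ P : Fin 5 → CP1,
    Function.Injective P ∧ (∀ c v, X.δ.pt (Sum.inl c) v = P (bipyramidTwo c v)) ∧
      ∀ k v, Y.δ.pt (Sum.inl k) v = P (bipyramidThree k v) := by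
  have h1 : ∀ p : Fin 5, ∃ (c : Fin 2) (v : Fin 4), bipyramidTwo c v = p := by decide
  choose c v hcv using h1
  have hY : ∀ k v', Y.δ.pt (Sum.inl k) v' =
      X.δ.pt (Sum.inl (c (bipyramidThree k v'))) (v (bipyramidThree k v')) := fun k v' =>
    (h.pt_bipyramid _ _ _ _ (hcv _)).symm
  refine ⟨fun p => X.δ.pt (Sum.inl (c p)) (v p), fun p q hpq => ?_, fun c' v' => ?_, hY⟩
  · by_contra hne
    obtain ⟨k, a, b, hab, rfl, rfl⟩ := exists_common_three p q hne
    exact hab (Y.regular _ ((hY k a).trans (hpq.trans (hY k b).symm)))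
  · obtain ⟨k, w, hk⟩ := exists_three_position c' v'
    dsimp only
    rw [h.pt_bipyramid _ _ _ _ hk, hY, hk]

/-- Cross-ratios with a common pair of points multiply like dihedral angles add (`crossRatio_mul`);
around the axis the product telescopes to 1. -/
theorem StandardMove.shape_inl (h : StandardMove X Y) :
    (∀ p, X.δ.shape (Sum.inl 0) p = (![Y.δ.shape (Sum.inl 1) 1 * Y.δ.shape (Sum.inl 2) 2,
      Y.δ.shape (Sum.inl 0) 1 * Y.δ.shape (Sum.inl 1) 2,
      Y.δ.shape (Sum.inl 2) 1 * Y.δ.shape (Sum.inl 0) 2] : Fin 3 → ℂ) p) ∧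
    (∀ p, X.δ.shape (Sum.inl 1) p = (![Y.δ.shape (Sum.inl 2) 1 * Y.δ.shape (Sum.inl 1) 2,
      Y.δ.shape (Sum.inl 0) 1 * Y.δ.shape (Sum.inl 2) 2,
      Y.δ.shape (Sum.inl 1) 1 * Y.δ.shape (Sum.inl 0) 2] : Fin 3 → ℂ) p) ∧
    Y.δ.shape (Sum.inl 0) 0 * Y.δ.shape (Sum.inl 1) 0 * Y.δ.shape (Sum.inl 2) 0 = 1 := by
  obtain ⟨P, hP, hX, hY⟩ := h.exists_points
  have ne : ∀ {p q : Fin 5}, p ≠ q → P p ≠ P q := fun hpq e => hpq (hP e)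
  have m : ∀ {a b e c d : Fin 5}, e ≠ a → e ≠ b → crossRatio (P a) (P b) (P c) (P d) =
      crossRatio (P a) (P b) (P e) (P d) * crossRatio (P a) (P b) (P c) (P e) := fun ha hb => by
    rw [mul_comm, crossRatio_mul _ _ (ne ha) (ne hb)]
  refine ⟨fun p => ?_, fun p => ?_, ?_⟩
  · fin_cases p
    · simp only [DevelopingMap.shape, hX, hY]
      exact m (a := 3) (b := 0) (e := 4) (c := 1) (d := 2) (by decide) (by decide)
    · simp only [DevelopingMap.shape, hX, hY]
      exact m (a := 3) (b := 2) (e := 4) (c := 0) (d := 1) (by decide) (by decide)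
    · simp only [DevelopingMap.shape, hX, hY]
      exact m (a := 3) (b := 1) (e := 4) (c := 2) (d := 0) (by decide) (by decide)
  · have m' : ∀ {a b e c d : Fin 5}, e ≠ a → e ≠ b → crossRatio (P a) (P b) (P c) (P d) =
        crossRatio (P e) (P d) (P a) (P b) * crossRatio (P e) (P c) (P b) (P a) := by
      intro a b e c d ha hb
      rw [m ha hb, crossRatio_symm₂ (P a) (P b) (P e), crossRatio_symm₃ (P a) (P b) (P c)]
    fin_cases p
    · simp only [DevelopingMap.shape, hX, hY]
      exact m' (a := 4) (b := 0) (e := 3) (c := 2) (d := 1) (by decide) (by decide)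
    · simp only [DevelopingMap.shape, hX, hY]
      exact m' (a := 4) (b := 1) (e := 3) (c := 0) (d := 2) (by decide) (by decide)
    · simp only [DevelopingMap.shape, hX, hY]
      exact m' (a := 4) (b := 2) (e := 3) (c := 1) (d := 0) (by decide) (by decide)
  · simp only [DevelopingMap.shape, hY]
    change crossRatio (P 3) (P 4) (P 1) (P 2) * crossRatio (P 3) (P 4) (P 2) (P 0) *
      crossRatio (P 3) (P 4) (P 0) (P 1) = 1
    rw [crossRatio_mul _ _ (ne (by decide)) (ne (by decide)),
      crossRatio_mul _ _ (ne (by decide)) (ne (by decide)),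
      crossRatio_self (ne (by decide)) (ne (by decide))]

theorem StandardMove.shape_inr (h : StandardMove X Y) (r : R) (p : Fin 3) :
    X.δ.shape (Sum.inr r) p = Y.δ.shape (Sum.inr r) p := by
  unfold DevelopingMap.shape
  simp only [h.pt_rest]

/-! ### Linear forms before and after the move -/

/-- The transpose of `mergeAngles`. -/
def splitCoeff {K : Type*} [AddCommMonoid K] (c : Fin 2 ⊕ R → Fin 3 → K) : Fin 3 ⊕ R → Fin 3 → K :=
  Sum.elim (![![0, c (Sum.inl 0) 1 + c (Sum.inl 1) 1, c (Sum.inl 0) 2 + c (Sum.inl 1) 2],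
    ![0, c (Sum.inl 0) 0 + c (Sum.inl 1) 2, c (Sum.inl 0) 1 + c (Sum.inl 1) 0],
    ![0, c (Sum.inl 0) 2 + c (Sum.inl 1) 0, c (Sum.inl 0) 0 + c (Sum.inl 1) 1]] :
      Fin 3 → Fin 3 → K) fun r => c (Sum.inr r)

theorem angleSum_splitCoeff [Fintype R] {K : Type*} [CommRing K] (c : Fin 2 ⊕ R → Fin 3 → K)
    (F : Fin 3 ⊕ R → Fin 3 → K) : angleSum (splitCoeff c) F = angleSum c (mergeAngles F) := by
  unfold angleSum
  rw [Fintype.sum_sum_type, Fintype.sum_sum_type]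
  congr 1
  simp [Fin.sum_univ_three, Fin.sum_univ_two, splitCoeff, mergeAngles]
  ring

theorem cast_mergeAngles (F : Fin 3 ⊕ R → Fin 3 → ℤ) (j : Fin 2 ⊕ R) (p : Fin 3) :
    ((mergeAngles F j p : ℤ) : ℝ) = mergeAngles (fun j p => (F j p : ℝ)) j p := by
  rcases j with j | r
  · fin_cases j <;> fin_cases p <;> exact Int.cast_add _ _
  · rfl

theorem cast_splitCoeff (c : Fin 2 ⊕ R → Fin 3 → ℝ) (j : Fin 3 ⊕ R) (p : Fin 3) :
    ((splitCoeff c j p : ℝ) : ℂ) = splitCoeff (fun j p => (c j p : ℂ)) j p := by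
  rcases j with j | r
  · fin_cases j <;> fin_cases p <;> simp [splitCoeff]
  · rfl

/-- Deformations of the three tetrahedra that belong to deformations of the shapes of the two
tetrahedra. -/
noncomputable def splitShape (Y : RegularTriangulation (Fin 3 ⊕ R)) (c : Fin 2) : Fin 3 → ℂ :=
  let x := fun k => Y.δ.shape (Sum.inl k) 0
  (![(x 1 * x 2 / (1 - x 2)) • ![x 0, 1, (x 1)⁻¹], (1 - x 1)⁻¹ • ![1, x 1, x 1 * x 2]] :
    Fin 2 → Fin 3 → ℂ) c

/-- Deformations after the move that belong to deformations of single shapes before the move. -/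
noncomputable def splitDeformation [DecidableEq R] (Y : RegularTriangulation (Fin 3 ⊕ R)) (i : Fin 2 ⊕ R) :
    Fin 3 ⊕ R → ℂ :=
  Sum.elim (fun c => Sum.elim (splitShape Y c) 0) (fun r => Sum.elim 0 (Pi.single r 1)) i

/-- An infinitesimal form of the product formulas for the shapes. The vectors of `splitShape` are
normalized so that each deforms one of the two tetrahedra, at the rate given by its weights, and
leaves the other fixed. -/
theorem StandardMove.merge_splitShape (h : StandardMove X Y) (c c' : Fin 2) (p : Fin 3) :
    mergeAngles (R := R) (fun j p => Sum.elim (splitShape Y c) 0 j * Y.weight j p) (Sum.inl c') p =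
      if c' = c then X.weight (Sum.inl c) p else 0 := by
  obtain ⟨h0, h1, h2⟩ := h.shape_inl
  have hr := fun k => Y.shape_relations (Sum.inl k) 0
  have hne := fun k => Y.shape_ne_one (Sum.inl k) 0
  simp only [zero_add] at hr
  have hw : ∀ k, Y.δ.shape (Sum.inl k) 1 = (1 - Y.δ.shape (Sum.inl k) 0)⁻¹ := fun k =>
    eq_inv_of_mul_eq_one_left (hr k).2.1
  have hy : ∀ k, Y.δ.shape (Sum.inl k) 2 =
      (Y.δ.shape (Sum.inl k) 0 - 1) * (Y.δ.shape (Sum.inl k) 0)⁻¹ := fun k => by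
    rw [← (hr k).2.2, mul_comm, inv_mul_cancel_left₀ (hr k).1]
  have e0 := (hr 0).1
  have e1 := (hr 1).1
  have e2 := (hr 2).1
  have d0 : 1 - Y.δ.shape (Sum.inl 0) 0 ≠ 0 := sub_ne_zero.2 (hne 0).symm
  have d1 : 1 - Y.δ.shape (Sum.inl 1) 0 ≠ 0 := sub_ne_zero.2 (hne 1).symm
  have d2 : 1 - Y.δ.shape (Sum.inl 2) 0 ≠ 0 := sub_ne_zero.2 (hne 2).symm
  have d1' : Y.δ.shape (Sum.inl 1) 0 - 1 ≠ 0 := sub_ne_zero.2 (hne 1)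
  have d2' : Y.δ.shape (Sum.inl 2) 0 - 1 ≠ 0 := sub_ne_zero.2 (hne 2)
  have hx0 : Y.δ.shape (Sum.inl 0) 0 =
      (Y.δ.shape (Sum.inl 1) 0 * Y.δ.shape (Sum.inl 2) 0)⁻¹ :=
    eq_inv_of_mul_eq_one_left (by rw [← mul_assoc]; exact h2)
  fin_cases c <;> fin_cases c' <;> fin_cases p <;>
    simp [mergeAngles, splitShape, RegularTriangulation.weight, h0, h1, hw, hy]
  all_goals
    try rw [hx0]
    try field_simp
    try ring_nf

/-- Tangency to the axis equation x₀x₁x₂ = 1. -/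
theorem StandardMove.axis_splitShape (h : StandardMove X Y) (c : Fin 2) :
    ∑ k, splitShape Y c k * Y.weight (Sum.inl k) 0 = 0 := by
  obtain ⟨-, -, h2⟩ := h.shape_inl
  have hr := fun k => Y.shape_relations (Sum.inl k) 0
  simp only [zero_add] at hr
  have hy : ∀ k, Y.δ.shape (Sum.inl k) 2 =
      (Y.δ.shape (Sum.inl k) 0 - 1) * (Y.δ.shape (Sum.inl k) 0)⁻¹ := fun k => by
    rw [← (hr k).2.2, mul_comm, inv_mul_cancel_left₀ (hr k).1]
  have e0 := (hr 0).1
  have e1 := (hr 1).1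
  have e2 := (hr 2).1
  rw [Fin.sum_univ_three]
  fin_cases c
  · simp [splitShape, RegularTriangulation.weight, hy]
    field_simp
    linear_combination (1 - Y.δ.shape (Sum.inl 2) 0)⁻¹ * h2
  · simp [splitShape, RegularTriangulation.weight, hy]
    field_simp
    linear_combination (1 - Y.δ.shape (Sum.inl 1) 0)⁻¹ * h2

theorem StandardMove.weight_inr (h : StandardMove X Y) (r : R) (p : Fin 3) :
    X.weight (Sum.inr r) p = Y.weight (Sum.inr r) p := by
  unfold RegularTriangulation.weight
  simp only [h.shape_inr]

variable [DecidableEq R]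

theorem StandardMove.merge_splitDeformation (h : StandardMove X Y) (i j : Fin 2 ⊕ R) (p : Fin 3) :
    mergeAngles (fun j p => splitDeformation Y i j * Y.weight j p) j p =
      if j = i then X.weight i p else 0 := by
  rcases i with c | r
  · rcases j with c' | r'
    · refine (h.merge_splitShape c c' p).trans (if_congr ?_ rfl rfl)
      rw [Sum.inl.injEq]
    · simp [mergeAngles, splitDeformation]
  · rcases j with c' | r'
    · fin_cases c' <;> fin_cases p <;> simp [mergeAngles, splitDeformation]
    · by_cases hr : r' = r
      · subst hr
        simp [mergeAngles, splitDeformation, h.weight_inr]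
      · simp [mergeAngles, splitDeformation, hr]

theorem StandardMove.axis_splitDeformation (h : StandardMove X Y) (i : Fin 2 ⊕ R) :
    ∑ k, splitDeformation Y i (Sum.inl k) * Y.weight (Sum.inl k) 0 = 0 := by
  rcases i with c | r
  · exact h.axis_splitShape c
  · simp [splitDeformation]

variable [Fintype R]

theorem rowOf_dotProduct (c : Fin 3 ⊕ R → Fin 3 → ℂ) (t : Fin 3 ⊕ R → ℂ) :
    ∑ j, Y.rowOf c j * t j = angleSum c fun j p => t j * Y.weight j p := by
  refine Finset.sum_congr rfl fun j _ => ?_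
  rw [RegularTriangulation.rowOf, Finset.sum_mul]
  refine Finset.sum_congr rfl fun p _ => ?_
  ring

theorem StandardMove.angleSum_merge (h : StandardMove X Y) (c : Fin 2 ⊕ R → Fin 3 → ℂ)
    (i : Fin 2 ⊕ R) :
    angleSum c (mergeAngles fun j p => splitDeformation Y i j * Y.weight j p) = X.rowOf c i := by
  unfold angleSum
  rw [Finset.sum_eq_single i]
  · refine Finset.sum_congr rfl fun p _ => ?_
    rw [h.merge_splitDeformation, if_pos rfl]
  · intro j _ hj
    refine Finset.sum_eq_zero fun p _ => ?_
    rw [h.merge_splitDeformation, if_neg hj, mul_zero]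
  · simp

/-- Scaled weights are infinitesimal angles, with sum 0 instead of 1 on each tetrahedron, so
`sum_edge_merge` applies with `c = 0`. -/
theorem StandardMove.edgeRow_dotProduct (h : StandardMove X Y) {x : DirEdge (Fin 2 ⊕ R)}
    {y : DirEdge (Fin 3 ⊕ R)} (hxy : position bipyramidTwo x = position bipyramidThree y)
    (i : Fin 2 ⊕ R) :
    ∑ j, Y.edgeRow (Y.T.edgeOf y) j * splitDeformation Y i j = X.edgeRow (X.T.edgeOf x) i := by
  refine (rowOf_dotProduct _ _).trans ?_
  refine Eq.trans ?_ (h.angleSum_merge _ i)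
  refine (sum_edge_merge h (c := 0) (fun j => ?_) ?_ hxy).symm
  · rw [← Finset.mul_sum, Y.sum_weight, mul_zero]
  · rw [mul_zero]
    exact h.axis_splitDeformation i

theorem StandardMove.axisRow_dotProduct (h : StandardMove X Y) (i : Fin 2 ⊕ R) :
    ∑ j, Y.edgeRow (Y.T.edgeOf (axisDir R)) j * splitDeformation Y i j = 0 := by
  refine (rowOf_dotProduct _ _).trans ?_
  refine (sum_axis h _).trans ?_
  exact h.axis_splitDeformation i

theorem StandardMove.axisRow_zero (h : StandardMove X Y) :
    Y.edgeRow (Y.T.edgeOf (axisDir R)) (Sum.inl 0) = Y.δ.shape (Sum.inl 0) 2 := by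
  have h1 := rowOf_dotProduct (Y := Y)
    (fun j p => (Y.T.edgeCount (Y.T.edgeOf (axisDir R)) j p : ℂ)) (Pi.single (Sum.inl 0) 1)
  have h2 := sum_axis h fun j p => (Pi.single (Sum.inl 0) 1 : Fin 3 ⊕ R → ℂ) j * Y.weight j p
  have h3 := h1.trans h2
  simp only [Pi.single_apply, mul_ite, mul_one, mul_zero, Finset.sum_ite_eq', Finset.mem_univ,
    if_true, Sum.inl.injEq, ite_mul, one_mul, zero_mul] at h3
  exact h3

/-- The meridian before the move, written in terms of the angles after it, turns by the same amount
as the meridian after the move; duality turns this into a relation of rows. -/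
theorem StandardMove.sub_mem_span (h : StandardMove X Y) (C : Frame X) (C' : Frame Y) :
    Y.rowOf (splitCoeff fun j p => (C.μ.curveCount j p : ℂ)) - Y.curveRow C'.μ ∈
      Submodule.span ℂ (Set.range Y.edgeRow) := by
  have turn : ∀ {δ : Fin 3 ⊕ R → Fin 3 → ℝ}, (∀ j, ∑ p, δ j p = 0) →
      (∀ E, angleSum (fun j p => (Y.T.edgeCount E j p : ℝ)) δ = 0) →
      angleSum (splitCoeff fun j p => (C.μ.curveCount j p : ℝ)) (fun j p => (C'.F j p : ℝ) + δ j p) =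
        angleSum (fun j p => (C'.μ.curveCount j p : ℝ)) (fun j p => (C'.F j p : ℝ) + δ j p) := by
    intro δ h0 hE
    rw [angleSum_splitCoeff]
    exact h.turning_eq (AddMonoidHom.snd ℤ ℤ) (AddMonoidHom.fst ℤ ℤ) (γ₀ := C.lam)
      (by rw [C.lam_class]; rfl) (by rw [C.μ_class]; rfl) (by rw [C'.μ_class]; rfl)
      (by rw [C.μ_class]; rfl) (by rw [C'.μ_class]; rfl) _ (C'.isAngle h0 hE).1 (C'.isAngle h0 hE).2
  have := mem_span_of_forall
    (c := fun j p => splitCoeff (fun j p => (C.μ.curveCount j p : ℝ)) j p - C'.μ.curveCount j p)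
    (e := fun E j p => (Y.T.edgeCount E j p : ℝ)) (fun δ h0 hE => by
      have h1 := turn h0 hE
      have h2 := turn (δ := fun _ _ => 0) (by simp) (by simp [angleSum])
      rw [angleSum_add, angleSum_add] at h1
      simp only [add_zero] at h2
      have h3 : angleSum (splitCoeff fun j p => (C.μ.curveCount j p : ℝ)) δ -
          angleSum (fun j p => (C'.μ.curveCount j p : ℝ)) δ = 0 := by linarith
      rw [← h3]
      simp only [angleSum, sub_mul, Finset.sum_sub_distrib]) Y.weight Y.sum_weight
  convert this using 1
  · simp only [Complex.ofReal_intCast]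
    rfl
  · funext j
    simp only [Pi.sub_apply, RegularTriangulation.curveRow, RegularTriangulation.rowOf, sub_mul,
      Finset.sum_sub_distrib, Complex.ofReal_sub, cast_splitCoeff, Complex.ofReal_intCast]

end NeumannZagier

namespace NeumannZagier

variable {R : Type} [Fintype R] [DecidableEq R] {X : RegularTriangulation (Fin 2 ⊕ R)}
  {Y : RegularTriangulation (Fin 3 ⊕ R)}

/-! ### The torsion before and after the move -/

/-- A flattening after the move gives a flattening before the move. -/
def StandardMove.frame (h : StandardMove X Y) (C : Frame X) (C' : Frame Y) : Frame X :=
  have hF : ∀ j, ∑ p, (C'.F j p : ℝ) = 1 := fun j => by exact_mod_cast C'.F_sum j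
  have hE : ∀ E, ∑ j, ∑ p, (Y.T.edgeCount E j p : ℝ) * (C'.F j p : ℝ) = 2 := fun E => by
    exact_mod_cast C'.F_edge E
  have hA : ∑ k, (C'.F (Sum.inl k) 0 : ℝ) = 2 * 1 := by
    rw [mul_one, ← sum_axis h fun j p => (C'.F j p : ℝ)]
    exact hE _
  { C with
    F := mergeAngles C'.F
    F_sum := fun j => by
      have := mergeAngles_sum hF hA j
      simp only [← cast_mergeAngles] at this
      exact_mod_cast this
    F_edge := fun E => by
      obtain ⟨x, rfl⟩ := X.T.edgeOf_surjective E
      obtain ⟨y, hy⟩ := exists_position_eq x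
      have := sum_edge_merge h hF hA hy
      simp only [← cast_mergeAngles] at this
      rw [hE] at this
      exact_mod_cast this
    F_meridian := by
      have := h.turning_eq (AddMonoidHom.snd ℤ ℤ) (AddMonoidHom.fst ℤ ℤ) (γ₀ := C.lam)
        (γ₁ := C.μ) (γ₂ := C'.μ)
        (by rw [C.lam_class]; rfl) (by rw [C.μ_class]; rfl) (by rw [C'.μ_class]; rfl)
        (by rw [C.μ_class]; rfl) (by rw [C'.μ_class]; rfl) _ hF hE
      simp only [← cast_mergeAngles] at this
      rw [← C'.F_meridian]
      exact_mod_cast this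
    F_longitude := by
      have := h.turning_eq (AddMonoidHom.fst ℤ ℤ) (AddMonoidHom.snd ℤ ℤ) (γ₀ := C.μ)
        (γ₁ := C.lam) (γ₂ := C'.lam)
        (by rw [C.μ_class]; rfl) (by rw [C.lam_class]; rfl) (by rw [C'.lam_class]; rfl)
        (by rw [C.lam_class]; rfl) (by rw [C'.lam_class]; rfl) _ hF hE
      simp only [← cast_mergeAngles] at this
      rw [← C'.F_longitude]
      exact_mod_cast this }

/-- The tetrahedra after the move are one more than those before the move. -/
def succTetrahedra (R : Type) : Unit ⊕ (Fin 2 ⊕ R) ≃ Fin 3 ⊕ R where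
  toFun := Sum.elim (fun _ => Sum.inl 0) (Sum.elim (fun c => Sum.inl c.succ) Sum.inr)
  invFun := Sum.elim (fun k => (![Sum.inl (), Sum.inr (Sum.inl 0), Sum.inr (Sum.inl 1)] :
    Fin 3 → Unit ⊕ (Fin 2 ⊕ R)) k) fun r => Sum.inr (Sum.inr r)
  left_inv := by
    rintro (_ | c | r)
    · rfl
    · fin_cases c <;> rfl
    · rfl
  right_inv := by
    rintro (k | r)
    · fin_cases k <;> rfl
    · rfl

/-- The matrix after the move is multiplied by the matrix of split deformations, completed by a
basis vector. The axis row kills the deformations and the other rows reproduce the matrix before the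
move, so the product is block triangular. -/
theorem StandardMove.sq_det (h : StandardMove X Y) (C : Frame X) (C' : Frame Y) :
    (X.edgeMatrix C.row C.last (X.curveRow C.μ)).det ^ 2 =
      (Y.δ.shape (Sum.inl 1) 0 * Y.δ.shape (Sum.inl 2) 0 /
        ((1 - Y.δ.shape (Sum.inl 1) 0) * (1 - Y.δ.shape (Sum.inl 2) 0))) ^ 2 *
      (Y.edgeMatrix C'.row C'.last (Y.curveRow C'.μ)).det ^ 2 := by
  have : Fintype Y.T.Edge := Fintype.ofFinite _
  obtain ⟨e, he, hpos⟩ := exists_edgeEquiv h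
  let σ := succTetrahedra R
  let ε : Unit ⊕ (Fin 2 ⊕ R) ≃ Y.T.Edge :=
    ((Equiv.sumComm _ _).trans (Equiv.optionEquivSumPUnit _).symm).trans
      ((Equiv.optionCongr C.row).trans e)
  have ε_inl : ε (Sum.inl ()) = Y.T.edgeOf (axisDir R) := he
  have ε_inr : ∀ i, ε (Sum.inr i) = e (some (C.row i)) := fun i => rfl
  let l : Fin 3 ⊕ R → ℂ := Y.rowOf (splitCoeff fun j p => (C.μ.curveCount j p : ℂ))
  -- Up to sign, the rows may be numbered with the axis first, and the split form of the old
  -- meridian may stand in for the new one.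
  have hdet := sq_det_updateRow_eq Y.sum_edgeRow (σ.symm.trans ε) C'.row (σ (Sum.inr C.last))
    C'.last (h.sub_mem_span C C')
  let M : Matrix (Fin 3 ⊕ R) (Fin 3 ⊕ R) ℂ :=
    Matrix.updateRow (Matrix.of (Y.edgeRow ∘ (σ.symm.trans ε))) (σ (Sum.inr C.last)) l
  have M_inl : M (σ (Sum.inl ())) = Y.edgeRow (Y.T.edgeOf (axisDir R)) := by
    have h1 : σ (Sum.inl ()) ≠ σ (Sum.inr C.last) := fun h1 => by simpa using σ.injective h1
    funext j
    simp only [M]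
    rw [Matrix.updateRow_ne h1]
    change Y.edgeRow (ε (σ.symm (σ (Sum.inl ())))) j = _
    rw [Equiv.symm_apply_apply, ε_inl]
  let Q : Matrix (Fin 3 ⊕ R) (Unit ⊕ (Fin 2 ⊕ R)) ℂ :=
    Matrix.of fun j i => i.elim (fun _ => if j = Sum.inl 0 then 1 else 0)
      fun i => splitDeformation Y i j
  have dot : ∀ i' i, ∑ j, M (σ (Sum.inr i')) j * splitDeformation Y i j =
      X.edgeMatrix C.row C.last (X.curveRow C.μ) i' i := by
    intro i' i
    unfold RegularTriangulation.edgeMatrix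
    simp only [M]
    by_cases hi : i' = C.last
    · subst hi
      rw [Matrix.updateRow_self, Matrix.updateRow_self]
      refine (rowOf_dotProduct _ _).trans ?_
      rw [angleSum_splitCoeff, h.angleSum_merge]
      rfl
    · have h1 : σ (Sum.inr i') ≠ σ (Sum.inr C.last) := fun h1 => hi (by
        simpa using σ.injective h1)
      rw [Matrix.updateRow_ne hi, Matrix.updateRow_ne h1]
      obtain ⟨x, y, hx, hy, hxy⟩ := hpos (C.row i')
      have h2 := h.edgeRow_dotProduct hxy i
      rw [hx, hy, ← ε_inr] at h2
      refine Eq.trans (Finset.sum_congr rfl fun j _ => ?_) h2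
      change Y.edgeRow (ε (σ.symm (σ (Sum.inr i')))) j * _ = _
      rw [Equiv.symm_apply_apply]
  have hMQ : M.submatrix σ σ * Q.submatrix σ id =
      Matrix.fromBlocks (Matrix.of fun _ _ => Y.δ.shape (Sum.inl 0) 2) 0
        (Matrix.of fun i _ => M (σ (Sum.inr i)) (Sum.inl 0))
        (X.edgeMatrix C.row C.last (X.curveRow C.μ)) := by
    rw [Matrix.submatrix_mul_equiv]
    ext a b
    rw [Matrix.submatrix_apply, Matrix.mul_apply]
    rcases a with ⟨⟩ | a <;> rcases b with ⟨⟩ | b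
    · rw [M_inl]
      simp [Q, h.axisRow_zero]
    · rw [M_inl]
      simpa [Q] using h.axisRow_dotProduct b
    · simp [Q]
    · simpa [Q] using dot a b
  have hQ : (Q.submatrix σ id).det = (Matrix.of fun c c' : Fin 2 => splitShape Y c' c.succ).det := by
    have h1 : Q.submatrix σ id = Matrix.fromBlocks 1
        (Matrix.of fun _ i => splitDeformation Y i (Sum.inl 0)) 0
        (Matrix.fromBlocks (Matrix.of fun c c' : Fin 2 => splitShape Y c' c.succ) 0 0 1) := by
      ext a b
      rcases a with ⟨⟩ | c | r <;> rcases b with ⟨⟩ | c' | r'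
      · simp [Q, σ, succTetrahedra]
      · simp [Q, σ, succTetrahedra]
      · simp [Q, σ, succTetrahedra]
      · simp [Q, σ, succTetrahedra]
      · simp [Q, σ, succTetrahedra, splitDeformation]
      · simp [Q, σ, succTetrahedra, splitDeformation]
      · simp [Q, σ, succTetrahedra]
      · simp [Q, σ, succTetrahedra, splitDeformation]
      · simp [Q, σ, succTetrahedra, splitDeformation, Matrix.one_apply, Pi.single_apply]
    rw [h1, Matrix.det_fromBlocks_zero₂₁, Matrix.det_fromBlocks_zero₂₁, Matrix.det_one,
      Matrix.det_one, one_mul, mul_one]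
  have hd := congrArg Matrix.det hMQ
  rw [Matrix.det_mul, Matrix.det_submatrix_equiv_self, hQ, Matrix.det_fromBlocks_zero₁₂,
    Matrix.det_fin_two, Matrix.det_unique (n := Unit)] at hd
  rw [show (Y.edgeMatrix C'.row C'.last (Y.curveRow C'.μ)).det ^ 2 = M.det ^ 2 from hdet.symm,
    ← mul_pow]
  obtain ⟨-, -, h2⟩ := h.shape_inl
  have hr := fun k => Y.shape_relations (Sum.inl k) 0
  have hne := fun k => Y.shape_ne_one (Sum.inl k) 0
  simp only [zero_add] at hr
  have d1 : 1 - Y.δ.shape (Sum.inl 1) 0 ≠ 0 := sub_ne_zero.2 (hne 1).symm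
  have d2 : 1 - Y.δ.shape (Sum.inl 2) 0 ≠ 0 := sub_ne_zero.2 (hne 2).symm
  have hy0 : Y.δ.shape (Sum.inl 0) 2 = 1 - Y.δ.shape (Sum.inl 1) 0 * Y.δ.shape (Sum.inl 2) 0 := by
    apply mul_left_cancel₀ (hr 0).1
    rw [(hr 0).2.2]
    linear_combination h2
  have hy0' : 1 - Y.δ.shape (Sum.inl 1) 0 * Y.δ.shape (Sum.inl 2) 0 ≠ 0 := by
    rw [← hy0]
    exact Y.shape_ne_zero _ _
  -- The 2×2 determinant equals x₁x₂(x₁x₂ - 1)/((1 - x₁)(1 - x₂)). Its factor x₁x₂ - 1 is minus the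
  -- corner entry y₀ of the block matrix, so y₀ cancels and a sign remains.
  have hsq : (X.edgeMatrix C.row C.last (X.curveRow C.μ)).det =
      - (Y.δ.shape (Sum.inl 1) 0 * Y.δ.shape (Sum.inl 2) 0 /
        ((1 - Y.δ.shape (Sum.inl 1) 0) * (1 - Y.δ.shape (Sum.inl 2) 0)) * M.det) := by
    apply mul_left_cancel₀ hy0'
    rw [← hy0]
    refine hd.symm.trans ?_
    rw [hy0]
    change M.det * (Y.δ.shape (Sum.inl 1) 0 * Y.δ.shape (Sum.inl 2) 0 /
        (1 - Y.δ.shape (Sum.inl 2) 0) * 1 * ((1 - Y.δ.shape (Sum.inl 1) 0)⁻¹ *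
        (Y.δ.shape (Sum.inl 1) 0 * Y.δ.shape (Sum.inl 2) 0)) -
      (1 - Y.δ.shape (Sum.inl 1) 0)⁻¹ * Y.δ.shape (Sum.inl 1) 0 *
        (Y.δ.shape (Sum.inl 1) 0 * Y.δ.shape (Sum.inl 2) 0 / (1 - Y.δ.shape (Sum.inl 2) 0) *
          (Y.δ.shape (Sum.inl 1) 0)⁻¹)) = _
    have e1 := (hr 1).1
    field_simp
    ring
  rw [hsq, neg_sq]

/-- After eliminating x₀, w₁, w₂ and the exponents `a₀`, `a₁`, `a₂`, both sides are the same
monomial in x₁, x₂, y₀, y₁, y₂. It is applied to the squares of the shapes, for which the product on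
a tetrahedron is 1 rather than -1. -/
theorem zpow_merge {x₀ x₁ x₂ w₀ w₁ w₂ y₀ y₁ y₂ : ℂ} (hx : x₀ * x₁ * x₂ = 1)
    (h₀ : x₀ * w₀ * y₀ = 1) (h₁ : x₁ * w₁ * y₁ = 1) (h₂ : x₂ * w₂ * y₂ = 1)
    (a₀ a₁ a₂ b₀ b₁ b₂ c₀ c₁ c₂ : ℤ) (ha : a₀ + a₁ + a₂ = 2) (hs₁ : a₁ + b₁ + c₁ = 1)
    (hs₂ : a₂ + b₂ + c₂ = 1) (hs₀ : a₀ + b₀ + c₀ = 1) :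
    (w₁ * y₂) ^ (b₂ + c₀) * (w₂ * y₀) ^ (-(b₁ + c₂)) *
      ((w₂ * y₁) ^ (c₀ + b₁) * (w₁ * y₀) ^ (-(c₁ + b₂))) =
    y₁ * y₂ * (x₀ ^ c₀ * y₀ ^ (-a₀) * (x₁ ^ c₁ * y₁ ^ (-a₁)) * (x₂ ^ c₂ * y₂ ^ (-a₂))) := by
  have hx₁ : x₁ ≠ 0 := by rintro rfl; simp at hx
  have hx₂ : x₂ ≠ 0 := by rintro rfl; simp at hx
  have hy₀ : y₀ ≠ 0 := by rintro rfl; simp at h₀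
  have hy₁ : y₁ ≠ 0 := by rintro rfl; simp at h₁
  have hy₂ : y₂ ≠ 0 := by rintro rfl; simp at h₂
  obtain rfl : x₀ = (x₁ * x₂)⁻¹ := eq_inv_of_mul_eq_one_left (by rw [← mul_assoc]; exact hx)
  obtain rfl : w₁ = (x₁ * y₁)⁻¹ := eq_inv_of_mul_eq_one_left (by rw [← h₁]; ring)
  obtain rfl : w₂ = (x₂ * y₂)⁻¹ := eq_inv_of_mul_eq_one_left (by rw [← h₂]; ring)
  obtain rfl : a₀ = 2 - a₁ - a₂ := by omega
  obtain rfl : a₁ = 1 - b₁ - c₁ := by omega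
  obtain rfl : a₂ = 1 - b₂ - c₂ := by omega
  simp only [mul_zpow, inv_zpow, neg_add, neg_sub, zpow_add₀ hx₁, zpow_add₀ hx₂, zpow_add₀ hy₀,
    zpow_add₀ hy₁, zpow_add₀ hy₂, zpow_sub₀ hy₀, zpow_sub₀ hy₁, zpow_sub₀ hy₂, zpow_neg, zpow_one]
  field_simp

theorem StandardMove.sq_monomial (h : StandardMove X Y) {F : Fin 3 ⊕ R → Fin 3 → ℤ}
    (hF : ∀ j, ∑ p, F j p = 1) (hA : ∑ k, F (Sum.inl k) 0 = 2) :
    X.monomial (mergeAngles F) ^ 2 =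
      (Y.δ.shape (Sum.inl 1) 2 * Y.δ.shape (Sum.inl 2) 2) ^ 2 * Y.monomial F ^ 2 := by
  obtain ⟨h0, h1, h2⟩ := h.shape_inl
  have hp : ∀ k, Y.δ.shape (Sum.inl k) 0 ^ 2 * Y.δ.shape (Sum.inl k) 1 ^ 2 *
      Y.δ.shape (Sum.inl k) 2 ^ 2 = 1 := fun k => by
    rw [← mul_pow, ← mul_pow, Y.shape_prod]
    norm_num
  have hs : ∀ k, F (Sum.inl k) 0 + F (Sum.inl k) 1 + F (Sum.inl k) 2 = 1 := fun k => by
    rw [← Fin.sum_univ_three (F (Sum.inl k)), hF]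
  rw [Fin.sum_univ_three] at hA
  have key := zpow_merge (by rw [← mul_pow, ← mul_pow, h2, one_pow]) (hp 0) (hp 1) (hp 2) _ _ _ _ _ _
    _ _ _ hA (hs 1) (hs 2) (hs 0)
  have hsq : ∀ (z : ℂ) (n : ℤ), (z ^ n) ^ 2 = (z ^ 2) ^ n := fun z n => by
    rw [sq, sq, mul_zpow]
  unfold RegularTriangulation.monomial
  rw [Fintype.prod_sum_type, Fintype.prod_sum_type, Fin.prod_univ_two, Fin.prod_univ_three]
  have hR : ∏ r : R, X.δ.shape (Sum.inr r) 0 ^ mergeAngles F (Sum.inr r) 2 *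
      X.δ.shape (Sum.inr r) 2 ^ (-mergeAngles F (Sum.inr r) 0) =
      ∏ r : R, Y.δ.shape (Sum.inr r) 0 ^ F (Sum.inr r) 2 *
        Y.δ.shape (Sum.inr r) 2 ^ (-F (Sum.inr r) 0) :=
    Finset.prod_congr rfl fun r _ => by
      rw [h.shape_inr, h.shape_inr]
      rfl
  rw [hR]
  refine (mul_pow _ _ _).trans (Eq.trans ?_ (congrArg (_ * ·) (mul_pow _ _ _).symm))
  rw [← mul_assoc (_ ^ 2)]
  refine congrArg (· * _) ?_
  simp only [mul_pow, hsq] at key ⊢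
  rw [h0, h0, h1, h1]
  simp only [← mul_pow] at key ⊢
  exact key

/-- The torsion is invariant under a 2-3 move in standard position. -/
theorem StandardMove.torsion_sq_eq (h : StandardMove X Y) (hX : X.Glued) (C : Frame X)
    (C' : Frame Y) : C'.torsion ^ 2 = C.torsion ^ 2 := by
  rw [(h.frame C C').torsion_sq_eq hX C]
  have h1 := h.sq_det C C'
  have hA : ∑ k, C'.F (Sum.inl k) 0 = 2 := by
    have h3 := sum_axis h fun j p => (C'.F j p : ℝ)
    have h4 := C'.F_edge (Y.T.edgeOf (axisDir R))
    have h5 : ∑ j, ∑ p, (Y.T.edgeCount (Y.T.edgeOf (axisDir R)) j p : ℝ) * (C'.F j p : ℝ) = 2 := by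
      exact_mod_cast h4
    rw [h5] at h3
    exact_mod_cast h3.symm
  have h2 := h.sq_monomial C'.F_sum hA
  have hr := fun k => Y.shape_relations (Sum.inl k) 0
  have hne := fun k => Y.shape_ne_one (Sum.inl k) 0
  simp only [zero_add] at hr
  have d1 : 1 - Y.δ.shape (Sum.inl 1) 0 ≠ 0 := sub_ne_zero.2 (hne 1).symm
  have d2 : 1 - Y.δ.shape (Sum.inl 2) 0 ≠ 0 := sub_ne_zero.2 (hne 2).symm
  -- The factor from the determinants is inverse to the factor from the monomials, because xy = x -
  -- 1 on each of the tetrahedra 1 and 2.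
  have h6 : Y.δ.shape (Sum.inl 1) 0 * Y.δ.shape (Sum.inl 2) 0 /
        ((1 - Y.δ.shape (Sum.inl 1) 0) * (1 - Y.δ.shape (Sum.inl 2) 0)) *
      (Y.δ.shape (Sum.inl 1) 2 * Y.δ.shape (Sum.inl 2) 2) = 1 := by
    rw [div_mul_eq_mul_div, div_eq_one_iff_eq (mul_ne_zero d1 d2), mul_mul_mul_comm, (hr 1).2.2,
      (hr 2).2.2]
    ring
  unfold Frame.torsion
  change _ = (1 / 2 * (X.edgeMatrix C.row C.last (X.curveRow C.μ)).det *
    X.monomial (mergeAngles C'.F)) ^ 2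
  rw [mul_pow _ (X.monomial _), mul_pow (1 / 2 : ℂ) (X.edgeMatrix _ _ _).det, h1, h2]
  have h7 := congrArg (· ^ 2) h6
  simp only [one_pow, mul_pow _ (Y.δ.shape (Sum.inl 1) 2 * Y.δ.shape (Sum.inl 2) 2)] at h7
  rw [mul_pow _ (Y.monomial _), mul_pow (1 / 2 : ℂ) (Y.edgeMatrix _ _ _).det]
  linear_combination (-((1 / 2 : ℂ) ^ 2 * (Y.edgeMatrix C'.row C'.last (Y.curveRow C'.μ)).det ^ 2 *
    Y.monomial C'.F ^ 2)) * h7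

end NeumannZagier

/-! ### Arbitrary data, and moves up to isomorphism. -/

namespace NeumannZagier

variable {ι κ : Type} [Fintype ι] [DecidableEq ι] [Fintype κ] [DecidableEq κ]
  {X : RegularTriangulation ι} {Y : RegularTriangulation κ} {m : ℂ}

theorem RegularTriangulation.Isomorphic.torsion_sq_eq (h : X.Isomorphic Y)
    (D : EnhancedNZDatum X m) (D' : EnhancedNZDatum Y m) : D'.torsion ^ 2 = D.torsion ^ 2 := by
  obtain ⟨C, hC⟩ := h.exists_frame D.toFrame
  rw [D.torsion_sq, D'.torsion_sq, ← hC, C.torsion_sq_eq D'.glued D'.toFrame]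

theorem RegularTriangulation.TwoThreeMove.torsion_sq_eq (h : X.TwoThreeMove Y)
    (D : EnhancedNZDatum X m) (D' : EnhancedNZDatum Y m) : D'.torsion ^ 2 = D.torsion ^ 2 := by
  classical
  obtain ⟨R, X', Y', hX, hXY, hY⟩ := h
  have : Finite (Fin 2 ⊕ R) := X'.torus.finite
  have : Finite R := Finite.of_injective (Sum.inr : R → Fin 2 ⊕ R) Sum.inr_injective
  have : Fintype R := Fintype.ofFinite R
  obtain ⟨C, hC⟩ := hX.exists_frame D.toFrame
  -- The frame of `X` was carried forward to `X'`; that of `Y` is carried back to `Y'`, so that both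
  -- face the move in standard position.
  obtain ⟨C', hC'⟩ := hY.symm.exists_frame D'.toFrame
  rw [D.torsion_sq, D'.torsion_sq, ← hC, ← hC', hXY.torsion_sq_eq (hX.glued D.glued) C C']

end NeumannZagier

open NeumannZagier in
theorem theorem4p1 {ι : Type} [Fintype ι] [DecidableEq ι] (X : RegularTriangulation ι) (m : ℂ) :
    (∀ D D' : EnhancedNZDatum X m, D'.torsion = D.torsion ∨ D'.torsion = - D.torsion) ∧
    (∀ {κ : Type} [Fintype κ] [DecidableEq κ] (Y : RegularTriangulation κ),
      X.Isomorphic Y ∨ X.TwoThreeMove Y →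
      ∀ (D : EnhancedNZDatum X m) (D' : EnhancedNZDatum Y m),
        D'.torsion = D.torsion ∨ D'.torsion = - D.torsion) := by
  refine ⟨fun D D' => sq_eq_sq_iff_eq_or_eq_neg.1 (D.torsion_sq_eq D'), ?_⟩
  rintro κ _ _ Y (h | h) D D'
  · exact sq_eq_sq_iff_eq_or_eq_neg.1 (h.torsion_sq_eq D D')
  · exact sq_eq_sq_iff_eq_or_eq_neg.1 (h.torsion_sq_eq D D')
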